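/- Let $\Omega\subset\mathbb{R}^2=\mathbb{C}$ be a bounded domain with smooth boundary, $\boldsymbol{x}_*=(x_{*,1},\dots,x_{*,n})$ an $n$-tuple of distinct points of $\Omega$ and $\boldsymbol{d}=(d_1,\dots,d_n)\in\mathbb{Z}^n$ (some $d_j$ may be $0$). A map $u$ is called a singular harmonic map in $\Omega$ with singular set $(\boldsymbol{x},\boldsymbol{d})$ if $$u(z)=\Big(\frac{z-x_1}{|z-x_1|}\Big)^{d_1}\cdots\Big(\frac{z-x_n}{|z-x_n|}\Big)^{d_n}v(z),\qquad z\in\Omega\setminus\{x_1,\dots,x_n\},$$ where $v\in C^2(\Omega,\mathbb{S}^1)$ is a harmonic map, $-\Delta v=|\nabla v|^2v$. Let $u_*$ be a singular harmonic map with singular set $(\boldsymbol{x}_*,\boldsymbol{d})$ which is continuous on $\overline\Omega\setminus\{x_{*,1},\dots,x_{*,n}\}$ and satisfies $\int_{\Omega\setminus\bigcup_jB_\rho(x_{*,j})}|\nabla u_*|^2<\infty$ for every $\rho>0$ (as is the case when its boundary datum is smooth). Let $(u_{\boldsymbol{x}})$, for $\boldsymbol{x}$ in a neighbourhood of $\boldsymbol{x}_*$,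 be a family of singular harmonic maps with singular sets $(\boldsymbol{x},\boldsymbol{d})$, continuous on $\overline\Omega\setminus\{x_1,\dots,x_n\}$, with the same boundary values $u_{\boldsymbol{x}}|_{\partial\Omega}=u_*|_{\partial\Omega}$, with $u_{\boldsymbol{x}_*}=u_*$, and depending continuously on $\boldsymbol{x}$ in $W^{1,q}(\Omega)$ for some $q\in[1,2)$. For $p>1$, a stationary $p$-harmonic map to $\mathbb{S}^1$ is a map $u\in W^{1,p}(\Omega,\mathbb{S}^1)$ such that $-\operatorname{div}(|\nabla u|^{p-2}\nabla u)=|\nabla u|^pu$ weakly in $\Omega$ and such that $\frac{d}{dt}\big|_{t=0}\int_\Omega|\nabla(u\circ\varphi_t)|^p=0$ for every smooth family of diffeomorphisms $\varphi_t\colon\Omega\to\Omega$ with $\varphi_0=\mathrm{id}$ and $\varphi_t=\mathrm{id}$ in a neighbourhood of $\partial\Omega$. Let $p_k>1$ with $p_k\to2$ and let $u_k$ be stationary $p_k$-harmonic maps to $\mathbb{S}^1$ in $\Omega$. Assume that $u_k\to u_*$ almost everywhere in $\Omega$ and that $$\frac{\nabla u_k}{|\nabla u_k|^{p_k-2}}\to\nabla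 u_*\quad\text{in }L^2_{\mathrm{loc}}\big(\Omega\setminus\{x_{*,1},\dots,x_{*,n}\}\big)$$ (the left-hand side being $0$ where $\nabla u_k=0$). Then, for $\boldsymbol{x}$ in a neighbourhood of $\boldsymbol{x}_*$, the renormalised energy $$W(\boldsymbol{x})=\lim_{\rho\to0}\bigg(\int_{\Omega\setminus\bigcup_jB_\rho(x_j)}|\nabla u_{\boldsymbol{x}}|^2-2\pi\sum_{j=1}^nd_j^2\ln\frac1\rho\bigg)$$ exists and is finite, $W$ is differentiable at $\boldsymbol{x}_*$, and $\nabla W(\boldsymbol{x}_*)=0$. -/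

import Mathlib

open MeasureTheory Filter Topology Set
open scoped ContDiff ENNReal

/-! The plane `ℝ²` is `ℂ` with its real structure, both as the source and as the ambient space of
the circle `𝕊¹ = {w : ‖w‖ = 1}`. -/

namespace CircleMaps

/-- A bounded planar domain with smooth boundary: a nonempty connected bounded open set which near
each boundary point is a sublevel set of a smooth function with nonvanishing differential. -/
structure IsSmoothBoundedDomain (Ω : Set ℂ) : Prop where
  isOpen : IsOpen Ω
  isConnected : IsConnected Ω
  isBounded : Bornology.IsBounded Ω
  smooth_boundary : ∀ z ∈ frontier Ω, ∃ U ∈ 𝓝 z, ∃ r : ℂ → ℝ,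
    ContDiff ℝ ∞ r ∧ fderiv ℝ r z ≠ 0 ∧ ∀ w ∈ U, (w ∈ Ω ↔ r w < 0)

/-- The coordinate directions `e₁ = 1`, `e₂ = i` of `ℝ² = ℂ`. -/
def dir : Fin 2 → ℂ := ![1, Complex.I]

/-- Gradients `(∂₁u, ∂₂u)` of maps `ℝ² → ℝ² = ℂ`; the norm and the real inner product are those of
`ℝ^{2 × 2}` (Frobenius). -/
abbrev Grad : Type := EuclideanSpace ℂ (Fin 2)

/-- The classical gradient. -/
noncomputable def grad (u : ℂ → ℂ) (z : ℂ) : Grad :=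
  WithLp.toLp 2 (fun i => fderiv ℝ u z (dir i))

/-- `G` is the weak (distributional) gradient of `u` in `Ω`. -/
structure HasWeakGrad (Ω : Set ℂ) (u : ℂ → ℂ) (G : ℂ → Grad) : Prop where
  locInt : LocallyIntegrableOn u Ω volume
  locInt_grad : LocallyIntegrableOn G Ω volume
  integral_eq : ∀ η : ℂ → ℝ, ContDiff ℝ ∞ η → HasCompactSupport η → tsupport η ⊆ Ω →
    ∀ i : Fin 2, ∫ z in Ω, (fderiv ℝ η z (dir i)) • u z = - ∫ z in Ω, η z • G z i

/-- `u ∈ W^{1,p}(Ω, 𝕊¹)`, with weak gradient `G`. -/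
structure MemSobolevCircle (Ω : Set ℂ) (p : ℝ) (u : ℂ → ℂ) (G : ℂ → Grad) : Prop where
  hasWeakGrad : HasWeakGrad Ω u G
  memLp : MemLp u (ENNReal.ofReal p) (volume.restrict Ω)
  memLp_grad : MemLp G (ENNReal.ofReal p) (volume.restrict Ω)
  norm_eq_one : ∀ᵐ z ∂(volume.restrict Ω), ‖u z‖ = 1

/-- Criticality under outer variations, that is, `-div (|∇u|^{p-2} ∇u) = |∇u|^p u` weakly. -/
def IsWeaklyPHarmonic (Ω : Set ℂ) (p : ℝ) (u : ℂ → ℂ) (G : ℂ → Grad) : Prop :=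
  ∀ v : ℂ → ℂ, ContDiff ℝ ∞ v → HasCompactSupport v → tsupport v ⊆ Ω →
    ∫ z in Ω, (‖G z‖ ^ (p - 2) * inner ℝ (G z) (grad v z) - ‖G z‖ ^ p * inner ℝ (u z) (v z)) = 0

/-- Smooth families of diffeomorphisms `φ_t` of `Ω` with `φ_0 = id` and `φ_t = id` in a
neighbourhood of `∂Ω`, extended by the identity outside `Ω`. -/
structure IsInnerVariation (Ω : Set ℂ) (φ : ℝ → ℂ → ℂ) : Prop where
  smooth : ContDiff ℝ ∞ (fun q : ℝ × ℂ => φ q.1 q.2)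
  zero : ∀ z, φ 0 z = z
  diffeo : ∀ t, ∃ ψ : ℂ → ℂ,
    ContDiff ℝ ∞ ψ ∧ Function.LeftInverse ψ (φ t) ∧ Function.RightInverse ψ (φ t)
  eq_id : ∃ K : Set ℂ, IsCompact K ∧ K ⊆ Ω ∧ ∀ t, ∀ z, z ∉ K → φ t z = z

/-- Criticality under inner variations: `d/dt|_{t=0} ∫_Ω |∇(u ∘ φ_t)|^p = 0`, the gradients being
weak gradients. -/
def IsStationary (Ω : Set ℂ) (p : ℝ) (u : ℂ → ℂ) : Prop :=
  ∀ φ : ℝ → ℂ → ℂ, IsInnerVariation Ω φ →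
    ∀ H : ℝ → ℂ → Grad, (∀ t, HasWeakGrad Ω (fun z => u (φ t z)) (H t)) →
      HasDerivAt (fun t => ∫ z in Ω, ‖H t z‖ ^ p) 0 0

/-- `u` is a stationary `p`-harmonic map from `Ω` to `𝕊¹`, with weak gradient `G`. -/
structure IsStationaryPHarmonic (Ω : Set ℂ) (p : ℝ) (u : ℂ → ℂ) (G : ℂ → Grad) : Prop where
  memSobolev : MemSobolevCircle Ω p u G
  weaklyPHarmonic : IsWeaklyPHarmonic Ω p u G
  stationary : IsStationary Ω p u

/-- `v ∈ C²(Ω, 𝕊¹)` is a harmonic map: `-Δv = |∇v|² v`. -/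
structure IsHarmonicCircleMap (Ω : Set ℂ) (v : ℂ → ℂ) : Prop where
  contDiffOn : ContDiffOn ℝ 2 v Ω
  norm_eq_one : ∀ z ∈ Ω, ‖v z‖ = 1
  laplacian_eq : ∀ z ∈ Ω, Laplacian.laplacian v z = -(‖grad v z‖ ^ 2 • v z)

/-- `u` is a singular harmonic map in `Ω` with singular set `(x, d)`; it is determined
outside the points `x₁, …, xₙ` only. -/
def IsSingularHarmonicMap {n : ℕ} (Ω : Set ℂ) (x : Fin n → ℂ) (d : Fin n → ℤ) (u : ℂ → ℂ) : Prop :=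
  ∃ v : ℂ → ℂ, IsHarmonicCircleMap Ω v ∧
    ∀ z ∈ Ω \ range x, u z = (∏ j, ((z - x j) / (‖z - x j‖ : ℂ)) ^ d j) * v z

/-- The configuration space of `n` distinct points of `Ω`. -/
def Config (n : ℕ) (Ω : Set ℂ) : Set (Fin n → ℂ) :=
  {x | (∀ j, x j ∈ Ω) ∧ Function.Injective x}

/-- The perforated domain `Ω \ ⋃ⱼ B_ρ(xⱼ)`. -/
def perforated {n : ℕ} (Ω : Set ℂ) (x : Fin n → ℂ) (ρ : ℝ) : Set ℂ :=
  Ω \ ⋃ j, Metric.ball (x j) ρ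

/-- `(u_y)`, for `y` in a neighbourhood `N` of `x`, is a family of singular harmonic maps with
singular sets `(y, d)` and the same boundary values as `u`, which contains `u` as `u_x` and is
continuous in `y` in `W^{1,q}(Ω)`. -/
structure IsSingularHarmonicFamily {n : ℕ} (Ω : Set ℂ) (q : ℝ≥0∞) (x : Fin n → ℂ) (d : Fin n → ℤ)
    (u : ℂ → ℂ) (N : Set (Fin n → ℂ)) (uf : (Fin n → ℂ) → ℂ → ℂ) : Prop where
  isOpen : IsOpen N
  mem : x ∈ N
  subset : N ⊆ Config n Ω
  singularHarmonic : ∀ y ∈ N, IsSingularHarmonicMap Ω y d (uf y)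
  continuousOn : ∀ y ∈ N, ContinuousOn (uf y) (closure Ω \ range y)
  boundary : ∀ y ∈ N, EqOn (uf y) u (frontier Ω)
  base : EqOn (uf x) u (Ω \ range x)
  continuous : ∀ y ∈ N,
    Tendsto (fun y' => eLpNorm (fun z => uf y' z - uf y z) q (volume.restrict Ω)) (𝓝 y) (𝓝 0) ∧
    Tendsto (fun y' => eLpNorm (fun z => grad (uf y') z - grad (uf y) z) q (volume.restrict Ω))
      (𝓝 y) (𝓝 0)

/-- The renormalised energy of `u`, with singularities `(x, d)`, is well defined and equal to `w`:
the Dirichlet energy is finite away from the singularities, and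
`∫_{Ω \ ⋃ B_ρ(xⱼ)} |∇u|² - 2π ∑ⱼ dⱼ² ln (1/ρ) → w` as `ρ → 0`. -/
def HasRenormalisedEnergy {n : ℕ} (Ω : Set ℂ) (x : Fin n → ℂ) (d : Fin n → ℤ) (u : ℂ → ℂ)
    (w : ℝ) : Prop :=
  (∀ ρ > 0, IntegrableOn (fun z => ‖grad u z‖ ^ 2) (perforated Ω x ρ)) ∧
  Tendsto (fun ρ : ℝ => (∫ z in perforated Ω x ρ, ‖grad u z‖ ^ 2)
      - 2 * Real.pi * ∑ j, (d j : ℝ) ^ 2 * Real.log (1 / ρ)) (𝓝[>] 0) (𝓝 w)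

end CircleMaps

open CircleMaps

/-!
The renormalised energy is critical at the singularities of a limit of stationary maps because, to
first order, moving the singularities is an inner variation of the limit map, and inner variations
which are translations near the singularities are exactly those for which the criticality of the
stationary maps passes to the limit.

*Currents.* A map `u` with values in the circle is described by its *current*, the differential of a
local phase; then `|∇u|² = |current u|²`, and products of maps correspond to sums of currents. The
current of a singular harmonic map is divergence-free across the singularities
(`IsSingularWith.integral_gdot`), and its curl is `2π` times the sum of the Dirac masses of weights
`d j` (`IsSingularWith.integral_curl`).

*Criticality of the limit.* The inner variations generated by a vector field `X`
(`exists_isInnerVariation`) and the change of variables for weak gradients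
(`IsCompactDiffeo.hasWeakGrad_comp`) turn stationarity into an integral identity for the
stress-energy tensor (`IsStationaryPHarmonic.stress_identity`). In terms of `A = |G|^{2-p} G` its
density is of degree `p / (3 - p)` in `A`. If infinitely many of the exponents are at most `2`, this
degree is at most `2` along a subsequence, and if `X` is constant near each singularity the identity
passes to the limit under the `L²` convergence away from the singularities
(`stress_identity_limit`). Otherwise the exponents are eventually larger than `2`. Then the
gradients of the maps are square integrable, their distributional Jacobians vanish
(`integral_curl_eq_zero`), and so does that of the limit: all degrees are zero (`degree_eq_zero`),
and the limit is a smooth harmonic map, which is critical in any case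
(`IsHarmonicCircleMap.integral_stress`). The outcome is `integral_stress_eq_zero`.

*The phase.* Let `y` be close to the configuration `x`. A diffeomorphism `Ψ = id + ∑ j, χ j • (y j - x j)`
close to the identity translates a neighbourhood of each `x j` to one of `y j`. The quotient of
`u_y ∘ Ψ` by `u_x` has no singularity; since the boundary values agree it extends by `1` to a
continuous map of the plane to the circle (`exists_quotient`), and it has a continuous phase `ψ`
(`exists_lift`), which is a multiple of `2π` outside the domain. Different values on different
boundary components are excluded by the continuity of the family: the gradient of `ψ` tends to zero
in mean as `y → x` (`tendsto_integral_pullback_current_sub`), whereas by the smoothness of the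
boundary two different values would be taken on balls of definite size, so that the gradient would
be bounded from below in mean (`IsSmoothBoundedDomain.exists_phase_constant`). Thus `ψ` may be
chosen to vanish outside the domain (`IsPhase`, `eventually_exists_isPhase`).

*The energy difference.* In the coordinates of `x`, the energy of `u_y` is a quadratic form
`pullGdot` of `current u_x + ∇ψ`. The Euler equations of both maps, tested with truncations of `ψ`,
give `∫ |∇ψ|² ≤ C |y - x|²` (`integral_norm_fderiv_sq_le`). In the expansion of the energy
difference the terms of first order are the stress of the vector field `Ψ - id`, whose integral
vanishes by criticality, and `2 ∫ ⟨current u_x, ∇ψ⟩`, which vanishes because the current is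
divergence-free; the remainder is quadratic (`abs_integral_energy_sub_le`). Since `Ψ` is a
translation near the singularities, it maps perforated domains to perforated domains, and the
existence of `W(y)` and `|W(y) - W(x)| ≤ C |y - x|²` follow from the existence of `W(x)`
(`IsPhase.exists_hasRenormalisedEnergy`, `IsSingularWith.exists_hasRenormalisedEnergy`).
-/

namespace CircleMaps

/-! ### Diffeomorphisms close to the identity -/

/-- The inverse of a smooth bijection of a finite-dimensional space whose differentials are
injective is smooth. -/
lemma contDiff_of_leftInverse_of_rightInverse {E : Type*} [NormedAddCommGroup E] [NormedSpace ℝ E]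
    [FiniteDimensional ℝ E] {F F' : E → E} (hF : ContDiff ℝ ∞ F)
    (hl : Function.LeftInverse F' F) (hr : Function.RightInverse F' F)
    (hd : ∀ x, Function.Injective (fderiv ℝ F x)) : ContDiff ℝ ∞ F' := by
  have : CompleteSpace E := FiniteDimensional.complete ℝ E
  rw [contDiff_iff_contDiffAt]
  intro w
  set x := F' w with hx
  have hw : F x = w := hr w
  let L : E ≃L[ℝ] E :=
    (LinearEquiv.ofInjectiveEndo (fderiv ℝ F x : E →ₗ[ℝ] E) (hd x)).toContinuousLinearEquiv
  have hL : (L : E →L[ℝ] E) = fderiv ℝ F x := by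
    ext v; rfl
  have hF0 : ContDiffAt ℝ ∞ F x := hF.contDiffAt
  have hn : (∞ : WithTop ℕ∞) ≠ 0 := by simp
  have hder : HasFDerivAt F (L : E →L[ℝ] E) x := by
    rw [hL]; exact (hF.differentiable hn x).hasFDerivAt
  have h1 := hF0.to_localInverse hder hn
  have h2 := (hF0.hasStrictFDerivAt' hder hn).eventually_right_inverse
  rw [hw] at h1 h2
  refine h1.congr_of_eventuallyEq ?_
  filter_upwards [h2] with y hy
  have := congrArg F' hy
  rw [hl] at this
  exact this.symm

/-- A contractive perturbation of the identity is bijective. -/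
lemma exists_inverse_id_add {X : ℂ → ℂ} {K : NNReal} (hK : K < 1) (hX : LipschitzWith K X) :
    ∃ φ : ℂ → ℂ, Function.LeftInverse φ (fun z => z + X z) ∧
      Function.RightInverse φ (fun z => z + X z) := by
  have hinj : Function.Injective (fun z => z + X z) := by
    intro z w h
    by_contra hne
    have h1 : z - w = X w - X z := by
      have : z + X z = w + X w := h
      linear_combination this
    have h2 := hX.dist_le_mul w z
    rw [dist_eq_norm, dist_eq_norm, ← h1, norm_sub_rev w z] at h2
    have h3 : 0 < ‖z - w‖ := norm_pos_iff.2 (sub_ne_zero.2 hne)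
    have h4 : (K : ℝ) < 1 := hK
    nlinarith
  have hsurj : Function.Surjective (fun z => z + X z) := by
    intro w
    have hc : ContractingWith K (fun z => w - X z) := by
      refine ⟨hK, LipschitzWith.of_dist_le_mul fun z z' => ?_⟩
      rw [dist_sub_left]
      exact hX.dist_le_mul z z'
    refine ⟨hc.fixedPoint, ?_⟩
    have := hc.fixedPoint_isFixedPt
    have h2 : w - X hc.fixedPoint = hc.fixedPoint := this
    simp only
    linear_combination -h2
  exact ⟨Function.surjInv hsurj, Function.leftInverse_surjInv ⟨hinj, hsurj⟩,
    Function.rightInverse_surjInv hsurj⟩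

/-- The Jacobian determinant of a real-linear endomorphism of the plane, in coordinates. -/
noncomputable def jac (L : ℂ →L[ℝ] ℂ) : ℝ :=
  (L 1).re * (L Complex.I).im - (L Complex.I).re * (L 1).im

lemma det_eq_jac (L : ℂ →L[ℝ] ℂ) : L.det = jac L := by
  rw [ContinuousLinearMap.det, ← LinearMap.det_toMatrix Complex.basisOneI, Matrix.det_fin_two]
  simp [LinearMap.toMatrix_apply, jac]

/-- `ψ` is a smooth diffeomorphism of the plane, with inverse `φ` and positive Jacobian, which is
the identity outside a compact subset of `Ω`. -/
structure IsCompactDiffeo (Ω : Set ℂ) (ψ φ : ℂ → ℂ) : Prop where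
  smooth : ContDiff ℝ ∞ ψ
  smooth_inv : ContDiff ℝ ∞ φ
  left : Function.LeftInverse φ ψ
  right : Function.RightInverse φ ψ
  jac_pos : ∀ z, 0 < jac (fderiv ℝ ψ z)
  eq_id : ∃ K : Set ℂ, IsCompact K ∧ K ⊆ Ω ∧ ∀ z, z ∉ K → ψ z = z

lemma eq_re_add_im (v : ℂ) : v = v.re • (1 : ℂ) + v.im • Complex.I := by
  apply Complex.ext <;> simp

lemma clm_apply_eq {E : Type*} [NormedAddCommGroup E] [NormedSpace ℝ E] (L : ℂ →L[ℝ] E) (v : ℂ) :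
    L v = v.re • L 1 + v.im • L Complex.I := by
  conv_lhs => rw [eq_re_add_im v]
  simp only [map_add, map_smul]

lemma injective_of_jac_ne_zero {L : ℂ →L[ℝ] ℂ} (h : jac L ≠ 0) : Function.Injective L := by
  rw [injective_iff_map_eq_zero]
  intro v hv
  rw [clm_apply_eq] at hv
  have h1 := congrArg Complex.re hv
  have h2 := congrArg Complex.im hv
  simp at h1 h2
  unfold jac at h
  apply Complex.ext
  · refine (mul_eq_zero.1 (?_ : v.re * _ = 0)).resolve_right h
    linear_combination (L Complex.I).im * h1 - (L Complex.I).re * h2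
  · refine (mul_eq_zero.1 (?_ : v.im * _ = 0)).resolve_right h
    linear_combination (L 1).re * h2 - (L 1).im * h1

lemma abs_re_im_le {L : ℂ →L[ℝ] ℂ} {ε : ℝ} (h : ‖L‖ ≤ ε) :
    |(L 1).re| ≤ ε ∧ |(L 1).im| ≤ ε ∧ |(L Complex.I).re| ≤ ε ∧ |(L Complex.I).im| ≤ ε := by
  have h1 : ‖L 1‖ ≤ ε := by simpa using L.le_of_opNorm_le h 1
  have h2 : ‖L Complex.I‖ ≤ ε := by simpa using L.le_of_opNorm_le h Complex.I
  exact ⟨(Complex.abs_re_le_norm _).trans h1, (Complex.abs_im_le_norm _).trans h1,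
    (Complex.abs_re_le_norm _).trans h2, (Complex.abs_im_le_norm _).trans h2⟩

lemma jac_id_add (M : ℂ →L[ℝ] ℂ) : jac (ContinuousLinearMap.id ℝ ℂ + M) =
    (1 + (M 1).re) * (1 + (M Complex.I).im) - (M Complex.I).re * (M 1).im := by
  simp [jac]

lemma jac_id_add_ge {M : ℂ →L[ℝ] ℂ} (h : ‖M‖ ≤ 1 / 4) :
    1 / 2 ≤ jac (ContinuousLinearMap.id ℝ ℂ + M) := by
  obtain ⟨h1, h2, h3, h4⟩ := abs_re_im_le h
  rw [abs_le] at h1 h2 h3 h4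
  rw [jac_id_add]
  nlinarith

lemma fderiv_id_add {X : ℂ → ℂ} (hX : Differentiable ℝ X) (z : ℂ) :
    fderiv ℝ (fun z => z + X z) z = ContinuousLinearMap.id ℝ ℂ + fderiv ℝ X z := by
  exact ((hasFDerivAt_id z).add (hX z).hasFDerivAt).fderiv

/-- A smooth perturbation of the identity with small differential and compact support in `Ω` is a
compactly supported diffeomorphism. -/
lemma exists_isCompactDiffeo {Ω : Set ℂ} {X : ℂ → ℂ} (hX : ContDiff ℝ ∞ X)
    (hc : HasCompactSupport X) (hs : tsupport X ⊆ Ω) (hb : ∀ z, ‖fderiv ℝ X z‖ ≤ 1 / 4) :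
    ∃ φ, IsCompactDiffeo Ω (fun z => z + X z) φ := by
  have hd : Differentiable ℝ X := hX.differentiable (by simp)
  have hlip : LipschitzWith (1 / 4) X :=
    lipschitzWith_of_nnnorm_fderiv_le hd fun z => by
      rw [← NNReal.coe_le_coe]; simpa using hb z
  obtain ⟨φ, hl, hr⟩ := exists_inverse_id_add (K := 1 / 4)
    (by rw [← NNReal.coe_lt_coe]; norm_num) hlip
  have hj : ∀ z, 0 < jac (fderiv ℝ (fun z => z + X z) z) := fun z => by
    rw [fderiv_id_add hd]
    linarith [jac_id_add_ge (hb z)]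
  have hsm : ContDiff ℝ ∞ (fun z => z + X z) := contDiff_id.add hX
  refine ⟨φ, hsm, contDiff_of_leftInverse_of_rightInverse hsm hl hr
    fun z => injective_of_jac_ne_zero (hj z).ne', hl, hr, hj, tsupport X, hc, hs, fun z hz => ?_⟩
  simp [image_eq_zero_of_notMem_tsupport hz]

namespace IsCompactDiffeo

variable {Ω : Set ℂ} {ψ φ : ℂ → ℂ} (h : IsCompactDiffeo Ω ψ φ)

include h

lemma mem_iff (z : ℂ) : ψ z ∈ Ω ↔ z ∈ Ω := by
  obtain ⟨K, -, hK, hid⟩ := h.eq_id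
  have key : ∀ z, z ∈ K → ψ z ∈ K := by
    intro z hz
    by_contra hn
    have h1 := hid _ hn
    have h2 : ψ z = z := h.left.injective h1
    rw [h2] at hn
    exact hn hz
  by_cases hz : z ∈ K
  · exact ⟨fun _ => hK hz, fun _ => hK (key z hz)⟩
  · rw [hid z hz]

lemma image_eq : ψ '' Ω = Ω := by
  ext w
  constructor
  · rintro ⟨z, hz, rfl⟩
    exact (h.mem_iff z).2 hz
  · intro hw
    exact ⟨φ w, (h.mem_iff _).1 (by rwa [h.right w]), h.right w⟩

lemma symm_mem_iff (z : ℂ) : φ z ∈ Ω ↔ z ∈ Ω := by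
  rw [← h.mem_iff (φ z), h.right z]

lemma differentiable : Differentiable ℝ ψ := h.smooth.differentiable (by simp)

lemma hasFDerivAt (z : ℂ) : HasFDerivAt ψ (fderiv ℝ ψ z) z := (h.differentiable z).hasFDerivAt

lemma integral_image {E : Type*} [NormedAddCommGroup E] [NormedSpace ℝ E] {s : Set ℂ}
    (hs : MeasurableSet s) (g : ℂ → E) :
    ∫ w in ψ '' s, g w = ∫ z in s, jac (fderiv ℝ ψ z) • g (ψ z) := by
  rw [integral_image_eq_integral_abs_det_fderiv_smul volume hs
    (fun z _ => (h.hasFDerivAt z).hasFDerivWithinAt) h.left.injective.injOn]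
  simp_rw [det_eq_jac, abs_of_pos (h.jac_pos _)]

lemma integrableOn_image {E : Type*} [NormedAddCommGroup E] [NormedSpace ℝ E] {s : Set ℂ}
    (hs : MeasurableSet s) (g : ℂ → E) :
    IntegrableOn g (ψ '' s) ↔ IntegrableOn (fun z => jac (fderiv ℝ ψ z) • g (ψ z)) s := by
  rw [integrableOn_image_iff_integrableOn_abs_det_fderiv_smul volume hs
    (fun z _ => (h.hasFDerivAt z).hasFDerivWithinAt) h.left.injective.injOn]
  simp_rw [det_eq_jac, abs_of_pos (h.jac_pos _)]

lemma integral_comp {E : Type*} [NormedAddCommGroup E] [NormedSpace ℝ E]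
    (hΩ : MeasurableSet Ω) (g : ℂ → E) :
    ∫ w in Ω, g w = ∫ z in Ω, jac (fderiv ℝ ψ z) • g (ψ z) := by
  conv_lhs => rw [← h.image_eq]
  exact h.integral_image hΩ g

lemma tsupport_comp_subset {E : Type*} [Zero E] {η : ℂ → E}
    (hs : tsupport η ⊆ Ω) : tsupport (fun z => η (ψ z)) ⊆ Ω := fun z hz => by
  have : ψ z ∈ tsupport η := tsupport_comp_subset_preimage η h.smooth.continuous hz
  exact (h.mem_iff z).1 (hs this)

lemma hasCompactSupport_comp {E : Type*} [Zero E] {η : ℂ → E}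
    (hc : HasCompactSupport η) : HasCompactSupport (fun z => η (ψ z)) := by
  have hK : IsCompact (φ '' tsupport η) := hc.isCompact.image h.smooth_inv.continuous
  refine HasCompactSupport.intro hK fun z hz => ?_
  by_contra hne
  exact hz ⟨ψ z, subset_tsupport _ hne, h.left z⟩

lemma hasFDerivAt_inv (z : ℂ) : HasFDerivAt φ (fderiv ℝ φ z) z :=
  (h.smooth_inv.differentiable (by simp) z).hasFDerivAt

lemma continuous_fderiv : Continuous (fderiv ℝ ψ) := h.smooth.continuous_fderiv (by simp)

lemma symm_fderiv_comp (w : ℂ) (v : ℂ) : fderiv ℝ ψ (φ w) (fderiv ℝ φ w v) = v := by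
  have h1 : HasFDerivAt (ψ ∘ φ) ((fderiv ℝ ψ (φ w)).comp (fderiv ℝ φ w)) w :=
    (h.hasFDerivAt (φ w)).comp w (h.hasFDerivAt_inv w)
  have h2 : ψ ∘ φ = id := funext h.right
  rw [h2] at h1
  have := h1.unique (hasFDerivAt_id w)
  exact congrArg (fun L : ℂ →L[ℝ] ℂ => L v) this

lemma jac_mul_jac_inv (w : ℂ) : jac (fderiv ℝ ψ (φ w)) * jac (fderiv ℝ φ w) = 1 := by
  rw [← det_eq_jac, ← det_eq_jac, ContinuousLinearMap.det, ContinuousLinearMap.det,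
    ← LinearMap.det_comp]
  convert LinearMap.det_id (M := ℂ) (A := ℝ) using 2
  ext v
  exact h.symm_fderiv_comp w v

lemma symm : IsCompactDiffeo Ω φ ψ where
  smooth := h.smooth_inv
  smooth_inv := h.smooth
  left := h.right
  right := h.left
  jac_pos w := by
    have := h.jac_mul_jac_inv w
    have h0 := h.jac_pos (φ w)
    by_contra hn
    push Not at hn
    nlinarith
  eq_id := by
    obtain ⟨K, hc, hK, hid⟩ := h.eq_id
    refine ⟨K, hc, hK, fun z hz => ?_⟩
    have := congrArg φ (hid z hz)
    rw [h.left] at this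
    exact this.symm

end IsCompactDiffeo


/-! ### Weak gradients under changes of variables -/

lemma dir_zero : dir 0 = 1 := rfl

lemma dir_one : dir 1 = Complex.I := rfl

lemma integrable_smul_of_tsupport_subset {E : Type*} [NormedAddCommGroup E] [NormedSpace ℝ E]
    {Ω : Set ℂ} {f : ℂ → ℝ} (hf : Continuous f) (hc : HasCompactSupport f) (hs : tsupport f ⊆ Ω)
    {u : ℂ → E} (hu : LocallyIntegrableOn u Ω) : Integrable (fun z => f z • u z) := by
  have h1 : IntegrableOn u (tsupport f) := hu.integrableOn_compact_subset hs hc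
  have h2 : IntegrableOn (fun z => f z • u z) (tsupport f) :=
    h1.continuousOn_smul hf.continuousOn hc
  refine (integrableOn_iff_integrable_of_support_subset fun z hz => ?_).1 h2
  refine subset_tsupport _ fun h0 => hz ?_
  simp [h0]

/-- The cofactor matrix of `L`, acting on gradients. -/
noncomputable def cofac (L : ℂ →L[ℝ] ℂ) (g : Grad) : Grad :=
  WithLp.toLp 2 ![(L Complex.I).im • g 0 - (L 1).im • g 1, (L 1).re • g 1 - (L Complex.I).re • g 0]

/-- The transformation of gradients under composition with the inverse of a map with differential
`L`: it is the transposed inverse of `L`, written with cofactors. -/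
noncomputable def pull (L : ℂ →L[ℝ] ℂ) (g : Grad) : Grad := (jac L)⁻¹ • cofac L g

section

variable {ψ : ℂ → ℂ} {η : ℂ → ℝ}

lemma pull_zero (L : ℂ →L[ℝ] ℂ) (g : Grad) :
    pull L g 0 = (jac L)⁻¹ • ((L Complex.I).im • g 0 - (L 1).im • g 1) := rfl

lemma pull_one (L : ℂ →L[ℝ] ℂ) (g : Grad) :
    pull L g 1 = (jac L)⁻¹ • ((L 1).re • g 1 - (L Complex.I).re • g 0) := rfl

/-- The cofactors of a differential form divergence-free rows. -/
lemma fderiv_cofactor_mul (hψ : ContDiff ℝ ∞ ψ) (hη : ContDiff ℝ ∞ η) (v w : ℂ)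
    (ℓ : ℂ →L[ℝ] ℝ) (y : ℂ) :
    fderiv ℝ (fun y => ℓ (fderiv ℝ ψ y v) * η (ψ y)) y w
      - fderiv ℝ (fun y => ℓ (fderiv ℝ ψ y w) * η (ψ y)) y v
      = ℓ (fderiv ℝ ψ y v) * fderiv ℝ η (ψ y) (fderiv ℝ ψ y w)
        - ℓ (fderiv ℝ ψ y w) * fderiv ℝ η (ψ y) (fderiv ℝ ψ y v) := by
  have h2 : Differentiable ℝ (fderiv ℝ ψ) :=
    (hψ.fderiv_right (m := ∞) (by simp)).differentiable (by simp)
  have hη' : HasFDerivAt (fun y => η (ψ y)) ((fderiv ℝ η (ψ y)).comp (fderiv ℝ ψ y)) y :=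
    ((hη.differentiable (by simp)) (ψ y)).hasFDerivAt.comp y
      ((hψ.differentiable (by simp)) y).hasFDerivAt
  have key : ∀ a : ℂ, HasFDerivAt (fun y => ℓ (fderiv ℝ ψ y a) * η (ψ y))
      (ℓ (fderiv ℝ ψ y a) • ((fderiv ℝ η (ψ y)).comp (fderiv ℝ ψ y))
        + η (ψ y) • (ℓ.comp ((fderiv ℝ (fderiv ℝ ψ) y).flip a))) y := by
    intro a
    have h3 : HasFDerivAt (fun y => ℓ (fderiv ℝ ψ y a))
        (ℓ.comp ((fderiv ℝ (fderiv ℝ ψ) y).flip a)) y := by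
      have := (h2 y).hasFDerivAt.clm_apply (hasFDerivAt_const a y)
      refine (ℓ.hasFDerivAt.comp y this).congr_fderiv ?_
      ext b; simp
    exact h3.mul hη'
  rw [(key v).fderiv, (key w).fderiv]
  have hs : IsSymmSndFDerivAt ℝ ψ y := hψ.contDiffAt.isSymmSndFDerivAt (by
    rw [minSmoothness_of_isRCLikeNormedField]; exact ENat.LEInfty.out)
  have := hs v w
  simp [this]

end

lemma grad_integrableOn_iff {s : Set ℂ} {G : ℂ → Grad} :
    IntegrableOn G s ↔ ∀ i, IntegrableOn (fun z => G z i) s := by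
  constructor
  · intro h i
    exact (EuclideanSpace.proj (𝕜 := ℂ) i).integrable_comp h
  · intro h
    exact Integrable.of_eval_piLp h

namespace IsCompactDiffeo

variable {Ω : Set ℂ} {ψ φ : ℂ → ℂ} (h : IsCompactDiffeo Ω ψ φ)

include h

lemma continuous_partial (ℓ : ℂ →L[ℝ] ℝ) (v : ℂ) : Continuous (fun y => ℓ (fderiv ℝ ψ y v)) :=
  ℓ.continuous.comp (h.continuous_fderiv.clm_apply continuous_const)

lemma continuous_jac : Continuous (fun y => jac (fderiv ℝ ψ y)) := by
  unfold jac
  exact ((h.continuous_partial Complex.reCLM 1).mul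
    (h.continuous_partial Complex.imCLM Complex.I)).sub
    ((h.continuous_partial Complex.reCLM Complex.I).mul (h.continuous_partial Complex.imCLM 1))

/-- The weak equation of `u` tested with `η ∘ ψ` times the rows of the cofactors of the differential
of `ψ`. The functional `ℓ` selects the row; the derivatives of the cofactors cancel, which leaves
first derivatives of `η` only. -/
lemma integral_comp_test {u : ℂ → ℂ} {G : ℂ → Grad}
    (hu : HasWeakGrad Ω u G) {η : ℂ → ℝ} (hη : ContDiff ℝ ∞ η) (hc : HasCompactSupport η)
    (hs : tsupport η ⊆ Ω) (ℓ : ℂ →L[ℝ] ℝ) :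
    ∫ y in Ω, (ℓ (fderiv ℝ ψ y Complex.I) * fderiv ℝ η (ψ y) (fderiv ℝ ψ y 1)
        - ℓ (fderiv ℝ ψ y 1) * fderiv ℝ η (ψ y) (fderiv ℝ ψ y Complex.I)) • u y
      = - ∫ y in Ω, η (ψ y) • (ℓ (fderiv ℝ ψ y Complex.I) • G y 0
        - ℓ (fderiv ℝ ψ y 1) • G y 1) := by
  have hF : ∀ v : ℂ, ContDiff ℝ ∞ (fun y => ℓ (fderiv ℝ ψ y v) * η (ψ y)) := fun v =>
    (ℓ.contDiff.comp ((h.smooth.fderiv_right (m := ∞) (by simp)).clm_apply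
      contDiff_const)).mul (hη.comp h.smooth)
  have hFc : ∀ v : ℂ, HasCompactSupport (fun y => ℓ (fderiv ℝ ψ y v) * η (ψ y)) := fun v =>
    (h.hasCompactSupport_comp hc).mul_left
  have hFs : ∀ v : ℂ, tsupport (fun y => ℓ (fderiv ℝ ψ y v) * η (ψ y)) ⊆ Ω := fun v =>
    (tsupport_mul_subset_right (f := fun y => ℓ (fderiv ℝ ψ y v))).trans (h.tsupport_comp_subset hs)
  have hI : ∀ v w : ℂ, IntegrableOn
      (fun y => fderiv ℝ (fun y => ℓ (fderiv ℝ ψ y v) * η (ψ y)) y w • u y) Ω := fun v w =>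
    (integrable_smul_of_tsupport_subset
      (((hF v).continuous_fderiv (by simp)).clm_apply continuous_const)
      ((hFc v).fderiv_apply ℝ w)
      ((tsupport_fderiv_apply_subset ℝ w).trans (hFs v)) hu.locInt).integrableOn
  have hG : ∀ i, LocallyIntegrableOn (fun z => G z i) Ω := fun i z hz => by
    obtain ⟨t, ht, h1⟩ := hu.locInt_grad z hz
    exact ⟨t, ht, grad_integrableOn_iff.1 h1 i⟩
  have hJ : ∀ (v : ℂ) (i : Fin 2), IntegrableOn
      (fun y => (ℓ (fderiv ℝ ψ y v) * η (ψ y)) • G y i) Ω := fun v i =>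
    (integrable_smul_of_tsupport_subset (hF v).continuous (hFc v) (hFs v) (hG i)).integrableOn
  have e1 := hu.integral_eq _ (hF Complex.I) (hFc _) (hFs _) 0
  have e2 := hu.integral_eq _ (hF 1) (hFc _) (hFs _) 1
  rw [dir_zero] at e1
  rw [dir_one] at e2
  calc _ = ∫ y in Ω, (fderiv ℝ (fun y => ℓ (fderiv ℝ ψ y Complex.I) * η (ψ y)) y 1 • u y
          - fderiv ℝ (fun y => ℓ (fderiv ℝ ψ y 1) * η (ψ y)) y Complex.I • u y) := by
        refine integral_congr_ae (Eventually.of_forall fun y => ?_)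
        simp only
        rw [← sub_smul, fderiv_cofactor_mul h.smooth hη]
    _ = _ := by
        rw [integral_sub (hI _ _) (hI _ _), e1, e2, neg_sub_neg, ← integral_sub (hJ _ _) (hJ _ _),
          ← integral_neg]
        refine integral_congr_ae (Eventually.of_forall fun y => ?_)
        simp only [smul_sub, smul_smul, mul_comm (η (ψ y)), neg_sub]

/-- The chain rule for the weak gradient of a map composed with a diffeomorphism. -/
lemma hasWeakGrad_comp (hΩ : IsOpen Ω) {u : ℂ → ℂ} {G : ℂ → Grad} (hu : HasWeakGrad Ω u G) :
    HasWeakGrad Ω (fun z => u (φ z)) (fun z => pull (fderiv ℝ ψ (φ z)) (G (φ z))) := by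
  have hJ := h.continuous_jac
  have hcomp : ∀ K ⊆ Ω, IsCompact K → ∃ K', IsCompact K' ∧ K' ⊆ Ω ∧ K = ψ '' K' := by
    intro K hK hc
    refine ⟨φ '' K, hc.image h.smooth_inv.continuous, ?_, ?_⟩
    · rintro _ ⟨z, hz, rfl⟩
      exact (h.symm_mem_iff z).2 (hK hz)
    · rw [← image_comp, show ψ ∘ φ = id from funext h.right, image_id]
  have hjj : ∀ y (a : ℂ), jac (fderiv ℝ ψ y) • (jac (fderiv ℝ ψ y))⁻¹ • a = a := fun y a => by
    rw [smul_smul, mul_inv_cancel₀ (h.jac_pos y).ne', one_smul]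
  have hjt : ∀ y (t : ℝ) (a : ℂ),
      jac (fderiv ℝ ψ y) • t • (jac (fderiv ℝ ψ y))⁻¹ • a = t • a := fun y t a => by
    rw [smul_comm, hjj]
  refine ⟨?_, ?_, ?_⟩
  · rw [locallyIntegrableOn_iff hΩ.isLocallyClosed]
    intro K hK hc
    obtain ⟨K', hc', hK', rfl⟩ := hcomp K hK hc
    rw [h.integrableOn_image hc'.measurableSet]
    simp_rw [h.left _]
    exact (hu.locInt.integrableOn_compact_subset hK' hc').continuousOn_smul hJ.continuousOn hc'
  · rw [locallyIntegrableOn_iff hΩ.isLocallyClosed]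
    intro K hK hc
    obtain ⟨K', hc', hK', rfl⟩ := hcomp K hK hc
    rw [grad_integrableOn_iff]
    have hG := grad_integrableOn_iff.1 (hu.locInt_grad.integrableOn_compact_subset hK' hc')
    have hs : ∀ (ℓ : ℂ →L[ℝ] ℝ) (v : ℂ) (i : Fin 2),
        IntegrableOn (fun y => ℓ (fderiv ℝ ψ y v) • G y i) K' := fun ℓ v i =>
      (hG i).continuousOn_smul (h.continuous_partial ℓ v).continuousOn hc'
    intro i
    rw [h.integrableOn_image hc'.measurableSet]
    simp_rw [h.left _]
    fin_cases i
    · simp only [Fin.zero_eta, pull_zero, hjj]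
      exact (hs Complex.imCLM Complex.I 0).sub (hs Complex.imCLM 1 1)
    · simp only [Fin.mk_one, pull_one, hjj]
      exact (hs Complex.reCLM 1 1).sub (hs Complex.reCLM Complex.I 0)
  · intro η hη hc hs i
    rw [h.integral_comp hΩ.measurableSet (fun z => fderiv ℝ η z (dir i) • u (φ z)),
      h.integral_comp hΩ.measurableSet
        (fun z => η z • pull (fderiv ℝ ψ (φ z)) (G (φ z)) i)]
    simp_rw [h.left _]
    fin_cases i
    · have e := h.integral_comp_test hu hη hc hs Complex.imCLM
      simp only [Fin.zero_eta, pull_zero, dir_zero]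
      simp only [hjt]
      refine Eq.trans ?_ e
      refine integral_congr_ae (Eventually.of_forall fun y => ?_)
      simp only [smul_smul]
      congr 1
      rw [clm_apply_eq (fderiv ℝ η (ψ y)) (fderiv ℝ ψ y 1),
        clm_apply_eq (fderiv ℝ η (ψ y)) (fderiv ℝ ψ y Complex.I)]
      simp only [jac, smul_eq_mul, Complex.imCLM_apply]
      ring
    · have e := congrArg Neg.neg (h.integral_comp_test hu hη hc hs Complex.reCLM)
      simp only [Fin.mk_one, pull_one, dir_one]
      simp only [hjt]
      rw [← integral_neg, ← integral_neg] at e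
      rw [← integral_neg]
      refine Eq.trans ?_ (e.trans ?_)
      · refine integral_congr_ae (Eventually.of_forall fun y => ?_)
        simp only [smul_smul]
        rw [← neg_smul]
        congr 1
        rw [clm_apply_eq (fderiv ℝ η (ψ y)) (fderiv ℝ ψ y 1),
          clm_apply_eq (fderiv ℝ η (ψ y)) (fderiv ℝ ψ y Complex.I)]
        simp only [jac, smul_eq_mul, Complex.reCLM_apply]
        ring
      · rw [integral_neg, neg_neg]
        refine integral_congr_ae (Eventually.of_forall fun y => ?_)
        simp [smul_sub, Complex.reCLM_apply]

end IsCompactDiffeo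


/-! ### The first inner variation of the `p`-energy -/

/-- The trace of a real-linear endomorphism of the plane, in coordinates. -/
noncomputable def tr (M : ℂ →L[ℝ] ℂ) : ℝ := (M 1).re + (M Complex.I).im

lemma jac_id_add_smul (t : ℝ) (M : ℂ →L[ℝ] ℂ) :
    jac (ContinuousLinearMap.id ℝ ℂ + t • M) = 1 + t * tr M + t ^ 2 * jac M := by
  simp [jac, tr]; ring

lemma cofac_id_add_smul (t : ℝ) (M : ℂ →L[ℝ] ℂ) (g : Grad) :
    cofac (ContinuousLinearMap.id ℝ ℂ + t • M) g = g + t • cofac M g := by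
  ext i
  fin_cases i <;> simp [cofac] <;> ring

lemma grad_norm_sq (g : Grad) : ‖g‖ ^ 2 = ‖g 0‖ ^ 2 + ‖g 1‖ ^ 2 := by
  rw [EuclideanSpace.norm_sq_eq, Fin.sum_univ_two]

lemma norm_cofac_le {M : ℂ →L[ℝ] ℂ} {B : ℝ} (hB : ‖M‖ ≤ B) (g : Grad) :
    ‖cofac M g‖ ≤ 4 * B * ‖g‖ := by
  obtain ⟨h1, h2, h3, h4⟩ := abs_re_im_le hB
  have hB0 : 0 ≤ B := (norm_nonneg _).trans hB
  have g0 : ‖g 0‖ ≤ ‖g‖ := PiLp.norm_apply_le g 0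
  have g1 : ‖g 1‖ ≤ ‖g‖ := PiLp.norm_apply_le g 1
  have key : ∀ a b : ℝ, ∀ u v : ℂ, |a| ≤ B → |b| ≤ B → ‖u‖ ≤ ‖g‖ → ‖v‖ ≤ ‖g‖ →
      ‖a • u - b • v‖ ≤ 2 * B * ‖g‖ := by
    intro a b u v ha hb hu hv
    refine (norm_sub_le _ _).trans ?_
    rw [norm_smul, norm_smul, Real.norm_eq_abs, Real.norm_eq_abs]
    have := mul_le_mul ha hu (norm_nonneg _) hB0
    have := mul_le_mul hb hv (norm_nonneg _) hB0
    linarith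
  have k0 : ‖cofac M g 0‖ ≤ 2 * B * ‖g‖ := key _ _ _ _ h4 h2 g0 g1
  have k1 : ‖cofac M g 1‖ ≤ 2 * B * ‖g‖ := key _ _ _ _ h1 h3 g1 g0
  have hn : 0 ≤ B * ‖g‖ := by positivity
  refine abs_le_of_sq_le_sq' ?_ (by linarith) |>.2
  rw [grad_norm_sq]
  nlinarith [norm_nonneg (cofac M g 0), norm_nonneg (cofac M g 1)]

lemma continuous_cofac : Continuous (fun q : (ℂ →L[ℝ] ℂ) × Grad => cofac q.1 q.2) := by
  unfold cofac
  refine (PiLp.continuous_toLp 2 _).comp ?_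
  refine continuous_pi fun i => ?_
  fin_cases i <;> simp <;> fun_prop

lemma inner_cofac (M : ℂ →L[ℝ] ℂ) (g : Grad) : inner ℝ g (cofac M g) =
    (M Complex.I).im * ‖g 0‖ ^ 2 + (M 1).re * ‖g 1‖ ^ 2
      - ((M Complex.I).re + (M 1).im) * inner ℝ (g 0) (g 1) := by
  rw [PiLp.inner_apply, Fin.sum_univ_two]
  simp only [cofac, PiLp.toLp_apply, Matrix.cons_val_zero, Matrix.cons_val_one, inner_sub_right,
    inner_smul_right, real_inner_self_eq_norm_sq, real_inner_comm (g 0) (g 1)]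
  rw [real_inner_comm (g 1) (g 0)]
  ring

lemma contDiff_sin_scaled (δ : ℝ) : ContDiff ℝ ∞ (fun t : ℝ => δ * Real.sin (t / δ)) :=
  contDiff_const.mul (Real.contDiff_sin.comp (contDiff_id.div_const δ))

lemma hasDerivAt_sin_scaled {δ : ℝ} (hδ : 0 < δ) (t : ℝ) :
    HasDerivAt (fun t : ℝ => δ * Real.sin (t / δ)) (Real.cos (t / δ)) t := by
  have h1 := ((hasDerivAt_id t).div_const δ)
  have := ((Real.hasDerivAt_sin (t / δ)).comp t h1).const_mul δ
  refine this.congr_deriv ?_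
  field_simp

/-- A vector field generates an inner variation whose inverses are explicit: `φ_t` is the inverse of
`id + δ sin (t / δ) X`. The factor `δ sin (t / δ)` has derivative `1` at `t = 0` and is bounded by
`δ`, so that the perturbation of the identity is contractive for every `t`, not only for small
ones. -/
lemma exists_isInnerVariation {Ω : Set ℂ} {X : ℂ → ℂ} (hX : ContDiff ℝ ∞ X)
    (hc : HasCompactSupport X) (hs : tsupport X ⊆ Ω) {δ : ℝ} (hδ : 0 < δ)
    (hb : ∀ z, δ * ‖fderiv ℝ X z‖ ≤ 1 / 4) :
    ∃ φ : ℝ → ℂ → ℂ, IsInnerVariation Ω φ ∧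
      ∀ t, IsCompactDiffeo Ω (fun z => z + (δ * Real.sin (t / δ)) • X z) (φ t) := by
  set τ : ℝ → ℝ := fun t => δ * Real.sin (t / δ) with hτ
  have hτb : ∀ t, |τ t| ≤ δ := fun t => by
    simp only [hτ]
    rw [abs_mul, abs_of_pos hδ]
    exact mul_le_of_le_one_right hδ.le (Real.abs_sin_le_one _)
  have hXd : Differentiable ℝ X := hX.differentiable (by simp)
  have hsm : ∀ t z, fderiv ℝ (fun z => τ t • X z) z = τ t • fderiv ℝ X z := fun t z => by
    exact ((hXd z).hasFDerivAt.const_smul (τ t)).fderiv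
  have hbd : ∀ t z, ‖τ t • fderiv ℝ X z‖ ≤ 1 / 4 := fun t z => by
    rw [norm_smul, Real.norm_eq_abs]
    exact (mul_le_mul_of_nonneg_right (hτb t) (norm_nonneg _)).trans (hb z)
  have hts : ∀ t, tsupport (fun z => τ t • X z) ⊆ tsupport X := fun t =>
    closure_mono fun z hz h0 => hz (by simp only [h0, smul_zero])
  have hex : ∀ t, ∃ φ, IsCompactDiffeo Ω (fun z => z + τ t • X z) φ := fun t =>
    exists_isCompactDiffeo (hX.const_smul (τ t))
      (hc.smul_left (f := fun _ => τ t)) ((hts t).trans hs) (fun z => by rw [hsm]; exact hbd t z)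
  choose φ hφ using hex
  refine ⟨φ, ⟨?_, ?_, ?_, ?_⟩, hφ⟩
  -- the inverses depend smoothly on the time as well, because `(t, z) ↦ (t, φ_t z)` is the inverse
  -- of the smooth bijection `F`
  · let F : ℝ × ℂ → ℝ × ℂ := fun q => (q.1, q.2 + τ q.1 • X q.2)
    let F' : ℝ × ℂ → ℝ × ℂ := fun q => (q.1, φ q.1 q.2)
    have hF : ContDiff ℝ ∞ F := contDiff_fst.prodMk
      (contDiff_snd.add (((contDiff_sin_scaled δ).comp contDiff_fst).smul
        (hX.comp contDiff_snd)))
    have hl : Function.LeftInverse F' F := fun q => Prod.ext rfl ((hφ q.1).left q.2)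
    have hr : Function.RightInverse F' F := fun q => Prod.ext rfl ((hφ q.1).right q.2)
    have hd : ∀ q, Function.Injective (fderiv ℝ F q) := by
      intro q
      have h1 : HasFDerivAt (fun q : ℝ × ℂ => τ q.1)
          (Real.cos (q.1 / δ) • ContinuousLinearMap.fst ℝ ℝ ℂ) q :=
        (hasDerivAt_sin_scaled hδ q.1).comp_hasFDerivAt q hasFDerivAt_fst
      have h2 : HasFDerivAt (fun q : ℝ × ℂ => X q.2)
          ((fderiv ℝ X q.2).comp (ContinuousLinearMap.snd ℝ ℝ ℂ)) q :=
        (hXd q.2).hasFDerivAt.comp q hasFDerivAt_snd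
      have h3 : HasFDerivAt F _ q := hasFDerivAt_fst.prodMk (hasFDerivAt_snd.add (h1.smul h2))
      rw [h3.fderiv, injective_iff_map_eq_zero]
      rintro ⟨s, v⟩ hv
      simp only [ContinuousLinearMap.prod_apply, ContinuousLinearMap.coe_fst', Prod.mk_eq_zero,
        add_apply, ContinuousLinearMap.coe_snd', smul_apply,
        ContinuousLinearMap.comp_apply, ContinuousLinearMap.smulRight_apply] at hv
      obtain ⟨rfl, hv⟩ := hv
      simp only [smul_zero, zero_smul, add_zero] at hv
      have hj : jac (ContinuousLinearMap.id ℝ ℂ + τ q.1 • fderiv ℝ X q.2) ≠ 0 := by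
        linarith [jac_id_add_ge (hbd q.1 q.2)] |> fun h : 0 < _ => h.ne'
      have := (injective_iff_map_eq_zero _).1 (injective_of_jac_ne_zero hj) v (by simpa using hv)
      rw [this]; rfl
    exact contDiff_snd.comp (contDiff_of_leftInverse_of_rightInverse hF hl hr hd)
  · intro z
    have := (hφ 0).left z
    simpa [hτ] using this
  · intro t
    exact ⟨_, (hφ t).smooth, (hφ t).right, (hφ t).left⟩
  · refine ⟨tsupport X, hc, hs, fun t z hz => ?_⟩
    have := (hφ t).left z
    simpa [image_eq_zero_of_notMem_tsupport hz] using this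

lemma exists_norm_fderiv_le {X : ℂ → ℂ} (hX : ContDiff ℝ ∞ X) (hc : HasCompactSupport X) :
    ∃ B, 0 < B ∧ ∀ z, ‖fderiv ℝ X z‖ ≤ B := by
  obtain ⟨C, hC⟩ := (hX.continuous_fderiv (by simp)).bounded_above_of_compact_support
    (hc.fderiv (𝕜 := ℝ))
  exact ⟨max C 1, lt_max_of_lt_right one_pos, fun z => (hC z).trans (le_max_left _ _)⟩

lemma hasDerivAt_jac_rpow_mul_norm_rpow {p : ℝ} (hp : 1 < p) (M : ℂ →L[ℝ] ℂ) (g : Grad) {t : ℝ}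
    (hJ : 0 < 1 + t * tr M + t ^ 2 * jac M) :
    HasDerivAt (fun t => (1 + t * tr M + t ^ 2 * jac M) ^ (1 - p) * ‖g + t • cofac M g‖ ^ p)
      ((tr M + 2 * t * jac M) * (1 - p) * (1 + t * tr M + t ^ 2 * jac M) ^ (1 - p - 1)
          * ‖g + t • cofac M g‖ ^ p
        + (1 + t * tr M + t ^ 2 * jac M) ^ (1 - p)
          * (p * ‖g + t • cofac M g‖ ^ (p - 2) * inner ℝ (g + t • cofac M g) (cofac M g))) t := by
  have h1 : HasDerivAt (fun t => 1 + t * tr M + t ^ 2 * jac M) (tr M + 2 * t * jac M) t := by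
    have := (((hasDerivAt_id t).mul_const (tr M)).const_add 1).add
      ((hasDerivAt_pow 2 t).mul_const (jac M))
    refine this.congr_deriv ?_
    simp
  have h2 : HasDerivAt (fun t => g + t • cofac M g) (cofac M g) t := by
    have := ((hasDerivAt_id t).smul_const (cofac M g)).const_add g
    simpa using this
  have h3 := (hasFDerivAt_norm_rpow (g + t • cofac M g) hp).comp_hasDerivAt t h2
  exact (h1.rpow_const (p := 1 - p) (Or.inl hJ.ne')).mul h3

/-- The trace and the Jacobian of a small deformation. -/
lemma abs_tr_jac_le {M : ℂ →L[ℝ] ℂ} {B : ℝ} (hMB : ‖M‖ ≤ B) :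
    |tr M| ≤ 2 * B ∧ |jac M| ≤ 2 * B ^ 2 := by
  have hB : 0 ≤ B := (norm_nonneg _).trans hMB
  obtain ⟨h1, h2, h3, h4⟩ := abs_re_im_le hMB
  constructor
  · exact (abs_add_le _ _).trans (by linarith)
  · refine (abs_sub _ _).trans ?_
    rw [abs_mul, abs_mul]
    have := mul_le_mul h1 h4 (abs_nonneg _) hB
    have := mul_le_mul h3 h2 (abs_nonneg _) hB
    linarith

lemma jac_small_bounds {M : ℂ →L[ℝ] ℂ} {B t : ℝ} (hMB : ‖M‖ ≤ B) (ht : |t| * B ≤ 1 / 8) :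
    1 / 2 ≤ 1 + t * tr M + t ^ 2 * jac M ∧ 1 + t * tr M + t ^ 2 * jac M ≤ 2 := by
  have hB : 0 ≤ B := (norm_nonneg _).trans hMB
  obtain ⟨h1, h2⟩ := abs_tr_jac_le hMB
  have h3 : |t * tr M| ≤ 1 / 4 := by
    rw [abs_mul]
    have := mul_le_mul_of_nonneg_left h1 (abs_nonneg t)
    linarith
  have h4 : |t ^ 2 * jac M| ≤ 1 / 32 := by
    rw [abs_mul, abs_pow]
    have := mul_le_mul_of_nonneg_left h2 (sq_nonneg |t|)
    have h5 : (|t| * B) ^ 2 ≤ (1 / 8) ^ 2 := pow_le_pow_left₀ (by positivity) ht 2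
    nlinarith
  rw [abs_le] at h3 h4
  constructor <;> linarith

lemma rpow_le_two_rpow_abs (a : ℝ) {x : ℝ} (h1 : 1 / 2 ≤ x) (h2 : x ≤ 2) :
    x ^ a ≤ 2 ^ |a| := by
  rcases le_total 0 a with ha | ha
  · rw [abs_of_nonneg ha]
    exact Real.rpow_le_rpow (by linarith) h2 ha
  · rw [abs_of_nonpos ha]
    refine (Real.rpow_le_rpow_of_nonpos (by norm_num : (0 : ℝ) < 1 / 2) h1 ha).trans ?_
    rw [one_div, Real.inv_rpow (by norm_num), Real.rpow_neg (by norm_num)]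

lemma abs_norm_rpow_mul_inner_le {p : ℝ} (hp : 1 < p) {w g c : Grad} {B : ℝ} (hB : 0 ≤ B)
    (hw : ‖w‖ ≤ 2 * ‖g‖) (hc : ‖c‖ ≤ 4 * B * ‖g‖) :
    |‖w‖ ^ (p - 2) * inner ℝ w c| ≤ 2 ^ (p - 1) * (4 * B) * ‖g‖ ^ p := by
  rcases eq_or_ne w 0 with h0 | h0
  · rw [h0]; simp; positivity
  have hw0 : 0 < ‖w‖ := norm_pos_iff.2 h0
  have hg0 : 0 < ‖g‖ := by linarith
  rw [abs_mul, abs_of_nonneg (by positivity)]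
  have e1 : |inner ℝ w c| ≤ ‖w‖ * (4 * B * ‖g‖) :=
    (abs_real_inner_le_norm _ _).trans (mul_le_mul_of_nonneg_left hc (norm_nonneg _))
  have e2 : ‖w‖ ^ (p - 2) * ‖w‖ = ‖w‖ ^ (p - 1) := by
    rw [← Real.rpow_add_one hw0.ne']; ring_nf
  have e3 : ‖g‖ ^ (p - 1) * ‖g‖ = ‖g‖ ^ p := by
    rw [← Real.rpow_add_one hg0.ne']; ring_nf
  have e4 : ‖w‖ ^ (p - 1) ≤ 2 ^ (p - 1) * ‖g‖ ^ (p - 1) := by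
    rw [← Real.mul_rpow (by norm_num) (norm_nonneg _)]
    exact Real.rpow_le_rpow (norm_nonneg _) hw (by linarith)
  calc ‖w‖ ^ (p - 2) * |inner ℝ w c| ≤ ‖w‖ ^ (p - 2) * (‖w‖ * (4 * B * ‖g‖)) :=
        mul_le_mul_of_nonneg_left e1 (Real.rpow_nonneg (norm_nonneg _) _)
    _ = ‖w‖ ^ (p - 1) * (4 * B * ‖g‖) := by rw [← e2]; ring
    _ ≤ 2 ^ (p - 1) * ‖g‖ ^ (p - 1) * (4 * B * ‖g‖) :=
        mul_le_mul_of_nonneg_right e4 (by positivity)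
    _ = _ := by rw [← e3]; ring

/-- A bound, uniform for small `t`, for the derivative of the deformed energy density. -/
lemma norm_deriv_energy_le {p : ℝ} (hp : 1 < p) {M : ℂ →L[ℝ] ℂ} {B t : ℝ} (hMB : ‖M‖ ≤ B)
    (ht : |t| * B ≤ 1 / 8) (g : Grad) :
    ‖(tr M + 2 * t * jac M) * (1 - p) * (1 + t * tr M + t ^ 2 * jac M) ^ (1 - p - 1)
          * ‖g + t • cofac M g‖ ^ p
        + (1 + t * tr M + t ^ 2 * jac M) ^ (1 - p)
          * (p * ‖g + t • cofac M g‖ ^ (p - 2) * inner ℝ (g + t • cofac M g) (cofac M g))‖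
      ≤ (4 * B * |1 - p| * 2 ^ |1 - p - 1| * 2 ^ p
          + 2 ^ |1 - p| * (p * (2 ^ (p - 1) * (4 * B)))) * ‖g‖ ^ p := by
  have hp0 : 0 < p := by linarith
  have hB : 0 ≤ B := (norm_nonneg _).trans hMB
  obtain ⟨hJ1, hJ2⟩ := jac_small_bounds hMB ht
  have hw : ‖g + t • cofac M g‖ ≤ 2 * ‖g‖ := by
    refine (norm_add_le _ _).trans ?_
    rw [norm_smul, Real.norm_eq_abs]
    have h1 := mul_le_mul_of_nonneg_left (norm_cofac_le hMB g) (abs_nonneg t)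
    have h2 := mul_le_mul_of_nonneg_right ht (norm_nonneg g)
    nlinarith [norm_nonneg g]
  have e3 := abs_norm_rpow_mul_inner_le hp hB hw (norm_cofac_le hMB g)
  obtain ⟨he1, he2⟩ := abs_tr_jac_le hMB
  have e1 : |tr M + 2 * t * jac M| ≤ 4 * B := by
    refine (abs_add_le _ _).trans ?_
    rw [abs_mul, abs_mul, abs_two]
    have := mul_le_mul_of_nonneg_left he2 (abs_nonneg t)
    have := mul_le_mul_of_nonneg_right ht hB
    nlinarith
  generalize g + t • cofac M g = w at *
  generalize 1 + t * tr M + t ^ 2 * jac M = J at *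
  generalize tr M + 2 * t * jac M = T at *
  generalize cofac M g = c at *
  have e2 : ‖w‖ ^ p ≤ 2 ^ p * ‖g‖ ^ p := by
    rw [← Real.mul_rpow (by norm_num) (norm_nonneg _)]
    exact Real.rpow_le_rpow (norm_nonneg _) hw hp0.le
  have hJ0 : 0 ≤ J := by linarith
  rw [add_mul]
  refine (norm_add_le _ _).trans (add_le_add ?_ ?_)
  · rw [norm_mul, norm_mul, norm_mul, Real.norm_eq_abs, Real.norm_eq_abs,
      Real.norm_of_nonneg (Real.rpow_nonneg hJ0 _),
      Real.norm_of_nonneg (Real.rpow_nonneg (norm_nonneg _) _)]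
    have := mul_le_mul (mul_le_mul (mul_le_mul_of_nonneg_right e1 (abs_nonneg (1 - p)))
      (rpow_le_two_rpow_abs (1 - p - 1) hJ1 hJ2) (Real.rpow_nonneg hJ0 _) (by positivity)) e2
      (Real.rpow_nonneg (norm_nonneg _) _) (by positivity)
    linarith
  · rw [norm_mul, Real.norm_of_nonneg (Real.rpow_nonneg hJ0 _), mul_assoc p, norm_mul,
      Real.norm_of_nonneg hp0.le, Real.norm_eq_abs]
    have := mul_le_mul (rpow_le_two_rpow_abs (1 - p) hJ1 hJ2)
      (mul_le_mul_of_nonneg_left e3 hp0.le) (by positivity) (by positivity)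
    linarith

lemma aestronglyMeasurable_cofac {μ : Measure ℂ} {G : ℂ → Grad} (hG : AEStronglyMeasurable G μ)
    {M : ℂ → ℂ →L[ℝ] ℂ} (hM : Continuous M) :
    AEStronglyMeasurable (fun z => cofac (M z) (G z)) μ := by
  have h1 : AEStronglyMeasurable M μ := hM.aestronglyMeasurable
  have h2 : AEStronglyMeasurable (fun z => (M z, G z)) μ := h1.prodMk hG
  have h3 := continuous_cofac.comp_aestronglyMeasurable h2
  exact h3

/-- Differentiation under the integral sign for the `p`-energy of a deformed map. -/
lemma hasDerivAt_integral_energy {Ω : Set ℂ} {p : ℝ} (hp : 1 < p) {G : ℂ → Grad}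
    (hG : MemLp G (ENNReal.ofReal p) (volume.restrict Ω)) {M : ℂ → ℂ →L[ℝ] ℂ}
    (hM : Continuous M) {B : ℝ} (hB : 0 < B) (hMB : ∀ z, ‖M z‖ ≤ B) :
    HasDerivAt (fun t : ℝ => ∫ z in Ω, (1 + t * tr (M z) + t ^ 2 * jac (M z)) ^ (1 - p)
        * ‖G z + t • cofac (M z) (G z)‖ ^ p)
      (∫ z in Ω, ((1 - p) * tr (M z) * ‖G z‖ ^ p
        + p * ‖G z‖ ^ (p - 2) * inner ℝ (G z) (cofac (M z) (G z)))) 0 := by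
  have hp0 : 0 < p := by linarith
  have hGm := hG.aestronglyMeasurable
  have hint : Integrable (fun z => ‖G z‖ ^ p) (volume.restrict Ω) := by
    have := hG.integrable_norm_rpow (by simpa using hp0) (by simp)
    rwa [ENNReal.toReal_ofReal hp0.le] at this
  have hcm : AEStronglyMeasurable (fun z => cofac (M z) (G z)) (volume.restrict Ω) :=
    aestronglyMeasurable_cofac hGm hM
  have htr : Continuous (fun z => tr (M z)) := by unfold tr; fun_prop
  have hja : Continuous (fun z => jac (M z)) := by unfold jac; fun_prop
  set s : Set ℝ := Metric.ball 0 (1 / (8 * B)) with hs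
  have hsB : ∀ t ∈ s, |t| * B ≤ 1 / 8 := fun t ht => by
    rw [hs, mem_ball_zero_iff, Real.norm_eq_abs] at ht
    have h1 := mul_le_mul_of_nonneg_right ht.le hB.le
    have : 1 / (8 * B) * B = 1 / 8 := by field_simp
    linarith
  have hmain := hasDerivAt_integral_of_dominated_loc_of_deriv_le (μ := volume.restrict Ω)
    (x₀ := (0 : ℝ)) (s := s) (bound := fun z => (4 * B * |1 - p| * 2 ^ |1 - p - 1| * 2 ^ p
          + 2 ^ |1 - p| * (p * (2 ^ (p - 1) * (4 * B)))) * ‖G z‖ ^ p)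
    (F := fun t z => (1 + t * tr (M z) + t ^ 2 * jac (M z)) ^ (1 - p)
        * ‖G z + t • cofac (M z) (G z)‖ ^ p)
    (F' := fun t z => (tr (M z) + 2 * t * jac (M z)) * (1 - p)
          * (1 + t * tr (M z) + t ^ 2 * jac (M z)) ^ (1 - p - 1)
          * ‖G z + t • cofac (M z) (G z)‖ ^ p
        + (1 + t * tr (M z) + t ^ 2 * jac (M z)) ^ (1 - p)
          * (p * ‖G z + t • cofac (M z) (G z)‖ ^ (p - 2)
            * inner ℝ (G z + t • cofac (M z) (G z)) (cofac (M z) (G z))))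
    (Metric.ball_mem_nhds _ (by positivity)) ?_ ?_ ?_
    (Eventually.of_forall fun z t ht => norm_deriv_energy_le hp (hMB z) (hsB t ht) (G z))
    (hint.const_mul _)
    (Eventually.of_forall fun z t ht => hasDerivAt_jac_rpow_mul_norm_rpow hp (M z) (G z)
      (by linarith [(jac_small_bounds (hMB z) (hsB t ht)).1]))
  · refine hmain.2.congr_deriv ?_
    refine integral_congr_ae (Eventually.of_forall fun z => ?_)
    simp only [zero_mul, mul_zero, add_zero, ne_eq, OfNat.ofNat_ne_zero, not_false_eq_true,
      zero_pow, Real.one_rpow, mul_one, one_mul, zero_smul, mul_comm (tr (M z))]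
  · refine Eventually.of_forall fun t => ?_
    have hm : Measurable (fun z => (1 + t * tr (M z) + t ^ 2 * jac (M z)) ^ (1 - p)) :=
      Measurable.pow_const (Continuous.measurable (by fun_prop)) _
    exact hm.aestronglyMeasurable.mul
      (((hGm.add (hcm.const_smul t)).norm.aemeasurable.pow_const p).aestronglyMeasurable)
  · simpa using hint
  · simp only [zero_mul, mul_zero, add_zero, ne_eq, OfNat.ofNat_ne_zero, not_false_eq_true,
      zero_pow, Real.one_rpow, mul_one, one_mul, zero_smul]
    exact ((htr.aestronglyMeasurable.mul_const _).mul
      (hGm.norm.aemeasurable.pow_const p).aestronglyMeasurable).add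
      ((((hGm.norm.aemeasurable.pow_const (p - 2)).aestronglyMeasurable).const_mul p).mul
        (hGm.inner hcm))

/-- The stress-energy identity: stationary `p`-harmonic maps are critical with respect to inner
variations, in differentiated form. -/
lemma IsStationaryPHarmonic.stress_identity {Ω : Set ℂ} (hΩ : IsOpen Ω) {p : ℝ} (hp : 1 < p)
    {u : ℂ → ℂ} {G : ℂ → Grad} (hu : IsStationaryPHarmonic Ω p u G) {X : ℂ → ℂ}
    (hX : ContDiff ℝ ∞ X) (hc : HasCompactSupport X) (hs : tsupport X ⊆ Ω) :
    ∫ z in Ω, ((1 - p) * tr (fderiv ℝ X z) * ‖G z‖ ^ p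
        + p * ‖G z‖ ^ (p - 2) * inner ℝ (G z) (cofac (fderiv ℝ X z) (G z))) = 0 := by
  obtain ⟨B, hB, hXB⟩ := exists_norm_fderiv_le hX hc
  -- small enough for `δ X` to have differential bounded by `1 / 4`
  set δ : ℝ := 1 / (4 * B) with hδ
  have hδ0 : 0 < δ := by positivity
  have hδB : ∀ z, δ * ‖fderiv ℝ X z‖ ≤ 1 / 4 := fun z => by
    have := mul_le_mul_of_nonneg_left (hXB z) hδ0.le
    have h2 : δ * B = 1 / 4 := by rw [hδ]; field_simp
    linarith
  obtain ⟨φ, hφ, hψ⟩ := exists_isInnerVariation hX hc hs hδ0 hδB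
  have hXd : Differentiable ℝ X := hX.differentiable (by simp)
  set τ : ℝ → ℝ := fun t => δ * Real.sin (t / δ) with hτ
  have hfd : ∀ t y, fderiv ℝ (fun z => z + τ t • X z) y
      = ContinuousLinearMap.id ℝ ℂ + τ t • fderiv ℝ X y := fun t y =>
    ((hasFDerivAt_id y).add ((hXd y).hasFDerivAt.const_smul (τ t))).fderiv
  have h1 := hu.stationary φ hφ _ (fun t => (hψ t).hasWeakGrad_comp hΩ hu.memSobolev.hasWeakGrad)
  have h2 : HasDerivAt τ 1 0 := by simpa using hasDerivAt_sin_scaled hδ0 0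
  have h3 := hasDerivAt_integral_energy hp hu.memSobolev.memLp_grad
    (hX.continuous_fderiv (by simp)) hB hXB
  -- the energy depends on the time through `τ`, whose derivative at `0` is `1`
  have h4 := HasDerivAt.comp (0 : ℝ) (h₂ := fun t : ℝ => ∫ z in Ω,
    (1 + t * tr (fderiv ℝ X z) + t ^ 2 * jac (fderiv ℝ X z)) ^ (1 - p)
        * ‖G z + t • cofac (fderiv ℝ X z) (G z)‖ ^ p) (h := τ) (by simpa [hτ] using h3) h2
  rw [mul_one] at h4
  refine (h4.congr_of_eventuallyEq (Eventually.of_forall fun t => ?_)).unique h1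
  -- in the original coordinates, the energy of the deformed map is
  -- `∫ jac ^ (1 - p) * |cofac G| ^ p`
  rw [(hψ t).integral_comp hΩ.measurableSet]
  refine integral_congr_ae (Eventually.of_forall fun y => ?_)
  have hJ := (hψ t).jac_pos y
  simp only [(hψ t).left y, smul_eq_mul, pull]
  rw [hfd] at hJ ⊢
  rw [norm_smul, norm_inv, Real.norm_of_nonneg hJ.le,
    Real.mul_rpow (inv_nonneg.2 hJ.le) (norm_nonneg _), Real.inv_rpow hJ.le, cofac_id_add_smul,
    ← mul_assoc, ← Real.rpow_neg hJ.le, jac_id_add_smul]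
  rw [jac_id_add_smul] at hJ
  rw [sub_eq_add_neg, Real.rpow_add hJ, Real.rpow_one]


/-! ### Passage to the limit in the stress-energy identity -/

/-- Dominated convergence when the dominating functions are a fixed integrable function plus a
remainder converging to `0` almost everywhere and in mean. -/
lemma tendsto_integral_of_dominated_add {α : Type*} [MeasurableSpace α] {μ : Measure α}
    {f : ℕ → α → ℝ} {g D : α → ℝ} {E : ℕ → α → ℝ}
    (hf : ∀ k, AEStronglyMeasurable (f k) μ) (hD : Integrable D μ) (hE : ∀ k, Integrable (E k) μ)
    (hD0 : ∀ z, 0 ≤ D z) (hE0 : ∀ k z, 0 ≤ E k z) (hb : ∀ k, ∀ᵐ z ∂μ, |f k z| ≤ D z + E k z)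
    (hEi : Tendsto (fun k => ∫ z, E k z ∂μ) atTop (𝓝 0))
    (hEa : ∀ᵐ z ∂μ, Tendsto (fun k => E k z) atTop (𝓝 0))
    (hfa : ∀ᵐ z ∂μ, Tendsto (fun k => f k z) atTop (𝓝 (g z))) :
    Tendsto (fun k => ∫ z, f k z ∂μ) atTop (𝓝 (∫ z, g z ∂μ)) := by
  -- the truncations of `f k` between `-D` and `D` are dominated and at distance at most `E k`
  set h : ℕ → α → ℝ := fun k z => max (-D z) (min (f k z) (D z)) with hh
  have hhb : ∀ k z, |h k z| ≤ D z := fun k z => by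
    rw [abs_le]
    exact ⟨le_max_left _ _, max_le (by linarith [hD0 z]) (min_le_right _ _)⟩
  have hhm : ∀ k, AEStronglyMeasurable (h k) μ := fun k =>
    hD.aestronglyMeasurable.neg.sup ((hf k).inf hD.aestronglyMeasurable)
  have hhi : ∀ k, Integrable (h k) μ := fun k =>
    hD.mono' (hhm k) (Eventually.of_forall fun z => hhb k z)
  have hd : ∀ k, ∀ᵐ z ∂μ, |f k z - h k z| ≤ E k z := fun k => by
    filter_upwards [hb k] with z hz
    rw [abs_le] at hz ⊢
    simp only [hh]
    have h0 := hD0 z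
    have h1 := hE0 k z
    rcases le_total (f k z) (D z) with a | a
    · rw [min_eq_left a]
      rcases le_total (-D z) (f k z) with b | b
      · rw [max_eq_right b]; constructor <;> linarith
      · rw [max_eq_left b]; constructor <;> linarith
    · rw [min_eq_right a, max_eq_right (by linarith)]; constructor <;> linarith
  have hdi : ∀ k, Integrable (fun z => f k z - h k z) μ := fun k =>
    (hE k).mono' ((hf k).sub (hhm k)) (hd k)
  have hg : ∀ᵐ z ∂μ, |g z| ≤ D z := by
    filter_upwards [hEa, hfa, ae_all_iff.2 hb] with z h1 h2 h3
    have := h1.const_add (D z)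
    rw [add_zero] at this
    exact le_of_tendsto_of_tendsto' h2.abs this h3
  have l1 : Tendsto (fun k => ∫ z, h k z ∂μ) atTop (𝓝 (∫ z, g z ∂μ)) := by
    refine tendsto_integral_of_dominated_convergence D hhm hD
      (fun k => Eventually.of_forall fun z => hhb k z) ?_
    filter_upwards [hfa, hg] with z h1 h2
    rw [abs_le] at h2
    have : Tendsto (fun k => max (-D z) (min (f k z) (D z))) atTop
        (𝓝 (max (-D z) (min (g z) (D z)))) :=
      tendsto_const_nhds.max (h1.min tendsto_const_nhds)
    rwa [min_eq_left h2.2, max_eq_right h2.1] at this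
  have l2 : Tendsto (fun k => ∫ z, (f k z - h k z) ∂μ) atTop (𝓝 0) := by
    refine squeeze_zero_norm (fun k => ?_) hEi
    refine (norm_integral_le_integral_norm _).trans (integral_mono_ae (hdi k).norm (hE k) (hd k))
  have := l2.add l1
  rw [zero_add] at this
  refine this.congr fun k => ?_
  rw [← integral_add (hdi k) (hhi k)]
  simp

lemma integral_norm_sq_eq {E : Type*} [NormedAddCommGroup E] {α : Type*} [MeasurableSpace α]
    {μ : Measure α} {f : α → E} (hf : MemLp f 2 μ) :
    ∫ z, ‖f z‖ ^ 2 ∂μ = (eLpNorm f 2 μ).toReal ^ 2 := by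
  rw [hf.eLpNorm_eq_integral_rpow_norm (by simp) (by simp)]
  have h0 : 0 ≤ ∫ z, ‖f z‖ ^ 2 ∂μ := integral_nonneg fun z => by positivity
  simp only [ENNReal.toReal_ofNat, Real.rpow_ofNat]
  rw [ENNReal.toReal_ofReal (by positivity), ← Real.rpow_natCast, ← Real.rpow_mul h0]
  norm_num

/-- Convergence in `L²` gives, along a subsequence, convergence almost everywhere. -/
lemma exists_subseq_tendsto_ae {E : Type*} [NormedAddCommGroup E] {α : Type*} [MeasurableSpace α]
    {μ : Measure α} {A : ℕ → α → E} {A₀ : α → E} (hA : ∀ k, AEStronglyMeasurable (A k) μ)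
    (hA₀ : AEStronglyMeasurable A₀ μ)
    (h : Tendsto (fun k => eLpNorm (fun z => A k z - A₀ z) 2 μ) atTop (𝓝 0)) :
    ∃ ns : ℕ → ℕ, StrictMono ns ∧ (∀ k, MemLp (fun z => A (ns k) z - A₀ z) 2 μ) ∧
      (∀ᵐ z ∂μ, Tendsto (fun k => A (ns k) z) atTop (𝓝 (A₀ z))) ∧
      Tendsto (fun k => ∫ z, ‖A (ns k) z - A₀ z‖ ^ 2 ∂μ) atTop (𝓝 0) := by
  obtain ⟨N, hN⟩ := eventually_atTop.1 (h.eventually (gt_mem_nhds ENNReal.zero_lt_top))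
  have hsh : StrictMono (fun k => k + N) := fun a b hab => by simpa using hab
  have h' := h.comp hsh.tendsto_atTop
  obtain ⟨ns, hns, hae⟩ := (tendstoInMeasure_of_tendsto_eLpNorm (f := fun k => A (k + N))
    (p := 2) (by simp) (fun k => hA _) hA₀ h').exists_seq_tendsto_ae
  have hmem : ∀ k, MemLp (fun z => A (ns k + N) z - A₀ z) 2 μ := fun k =>
    ⟨(hA _).sub hA₀, hN _ (Nat.le_add_left _ _)⟩
  refine ⟨fun k => ns k + N, hsh.comp hns, hmem, hae, ?_⟩
  simp_rw [fun k => integral_norm_sq_eq (hmem k)]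
  have h2 := (ENNReal.tendsto_toReal ENNReal.zero_ne_top).comp (h'.comp hns.tendsto_atTop)
  simpa using h2.pow 2

/-- The stress-energy density of exponent `p`, written in terms of `A = |G|^{2-p} G`: then
`|G| ^ p = |A| ^ s` with `s = p / (3 - p)`. -/
lemma stress_density_eq {p : ℝ} (hp1 : 1 < p) (hp2 : p < 3) (M : ℂ →L[ℝ] ℂ) (g : Grad) :
    (1 - p) * tr M * ‖g‖ ^ p + p * ‖g‖ ^ (p - 2) * inner ℝ g (cofac M g)
      = (1 - p) * tr M * ‖(‖g‖ ^ (p - 2))⁻¹ • g‖ ^ (p / (3 - p))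
        + p * ‖(‖g‖ ^ (p - 2))⁻¹ • g‖ ^ (p / (3 - p) - 2)
          * inner ℝ ((‖g‖ ^ (p - 2))⁻¹ • g) (cofac M ((‖g‖ ^ (p - 2))⁻¹ • g)) := by
  rcases eq_or_ne g 0 with rfl | hg
  · have h1 : p ≠ 0 := by linarith
    have h2 : p / (3 - p) ≠ 0 := div_ne_zero h1 (by linarith)
    simp [Real.zero_rpow h1, Real.zero_rpow h2]
  have hn : 0 < ‖g‖ := norm_pos_iff.2 hg
  have h3 : 0 < 3 - p := by linarith
  have hc : ∀ t : ℝ, cofac M (t • g) = t • cofac M g := fun t => by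
    ext i; fin_cases i <;> simp [cofac] <;> ring
  have hA : ‖(‖g‖ ^ (p - 2))⁻¹ • g‖ = ‖g‖ ^ (3 - p) := by
    rw [norm_smul, norm_inv, Real.norm_of_nonneg (by positivity), ← Real.rpow_neg hn.le,
      ← Real.rpow_add_one hn.ne']
    ring_nf
  rw [hA, ← Real.rpow_mul hn.le, ← Real.rpow_mul hn.le, hc, inner_smul_left, inner_smul_right,
    ← Real.rpow_neg hn.le]
  have e1 : (3 - p) * (p / (3 - p)) = p := by field_simp
  have e2 : ‖g‖ ^ (p - 2)
      = ‖g‖ ^ ((3 - p) * (p / (3 - p) - 2)) * (‖g‖ ^ (-(p - 2)) * ‖g‖ ^ (-(p - 2))) := by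
    rw [← Real.rpow_add hn, ← Real.rpow_add hn]
    congr 1
    rw [mul_sub, e1]; ring
  rw [e1]
  conv_lhs => rw [e2]
  simp only [conj_trivial]
  ring

lemma abs_stress_density_le {p s : ℝ} (hp1 : 1 < p) (hp2 : p ≤ 2)
    {M : ℂ →L[ℝ] ℂ} {B : ℝ} (hB : ‖M‖ ≤ B) (a : Grad) :
    |(1 - p) * tr M * ‖a‖ ^ s + p * ‖a‖ ^ (s - 2) * inner ℝ a (cofac M a)|
      ≤ 10 * B * ‖a‖ ^ s := by
  have hB0 : 0 ≤ B := (norm_nonneg _).trans hB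
  rcases eq_or_ne a 0 with rfl | ha
  · have h0 : 0 ≤ (0 : ℝ) ^ s := Real.rpow_nonneg le_rfl _
    simp only [norm_zero, inner_zero_left, mul_zero, add_zero, abs_mul, abs_of_nonneg h0]
    have h1 : |1 - p| ≤ 1 := by rw [abs_le]; constructor <;> linarith
    have h2 := (abs_tr_jac_le hB).1
    have := mul_le_mul h1 h2 (abs_nonneg _) zero_le_one
    nlinarith
  have hn : 0 < ‖a‖ := norm_pos_iff.2 ha
  have hs : 0 ≤ ‖a‖ ^ s := by positivity
  have h1 : |1 - p| ≤ 1 := by rw [abs_le]; constructor <;> linarith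
  have h2 := (abs_tr_jac_le hB).1
  have h3 := mul_le_mul h1 h2 (abs_nonneg _) zero_le_one
  have h4 : |inner ℝ a (cofac M a)| ≤ ‖a‖ * (4 * B * ‖a‖) :=
    (abs_real_inner_le_norm _ _).trans
      (mul_le_mul_of_nonneg_left (norm_cofac_le hB a) (norm_nonneg _))
  have h5 : ‖a‖ ^ s = ‖a‖ ^ (s - 2) * (‖a‖ * ‖a‖) := by
    rw [← sq, ← Real.rpow_natCast, ← Real.rpow_add hn]
    norm_num
  have h6 : |p * ‖a‖ ^ (s - 2) * inner ℝ a (cofac M a)| ≤ 8 * B * ‖a‖ ^ s := by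
    rw [abs_mul, abs_mul, abs_of_pos (by linarith : 0 < p),
      abs_of_nonneg (Real.rpow_nonneg hn.le _), h5]
    have h7 : 0 ≤ ‖a‖ ^ (s - 2) := Real.rpow_nonneg hn.le _
    calc p * ‖a‖ ^ (s - 2) * |inner ℝ a (cofac M a)|
        ≤ 2 * ‖a‖ ^ (s - 2) * (‖a‖ * (4 * B * ‖a‖)) :=
          mul_le_mul (mul_le_mul_of_nonneg_right hp2 h7) h4 (abs_nonneg _) (by positivity)
      _ = _ := by ring
  refine (abs_add_le _ _).trans ?_
  have h8 : |(1 - p) * tr M * ‖a‖ ^ s| ≤ 2 * B * ‖a‖ ^ s := by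
    rw [abs_mul, abs_mul, abs_of_nonneg hs]
    exact mul_le_mul_of_nonneg_right (by linarith) hs
  linarith

lemma rpow_le_one_add_sq {x s : ℝ} (hx : 0 ≤ x) (hs0 : 0 ≤ s) (hs : s ≤ 2) :
    x ^ s ≤ 1 + x ^ 2 := by
  rcases le_total x 1 with h | h
  · exact (Real.rpow_le_one hx h hs0).trans (by nlinarith [sq_nonneg x])
  · have := Real.rpow_le_rpow_of_exponent_le h hs
    rw [Real.rpow_two] at this
    linarith

lemma tendsto_stress_density {p s : ℕ → ℝ} (hp1 : ∀ k, 1 < p k) (hp2 : ∀ k, p k ≤ 2)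
    (hp : Tendsto p atTop (𝓝 2)) (hs : Tendsto s atTop (𝓝 2)) (M : ℂ →L[ℝ] ℂ)
    {a : ℕ → Grad} {a₀ : Grad} (ha : Tendsto a atTop (𝓝 a₀)) :
    Tendsto (fun k => (1 - p k) * tr M * ‖a k‖ ^ s k
        + p k * ‖a k‖ ^ (s k - 2) * inner ℝ (a k) (cofac M (a k))) atTop
      (𝓝 (-tr M * ‖a₀‖ ^ 2 + 2 * inner ℝ a₀ (cofac M a₀))) := by
  have hn : Tendsto (fun k => ‖a k‖ ^ s k) atTop (𝓝 (‖a₀‖ ^ 2)) := by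
    have := ha.norm.rpow hs (Or.inr (by norm_num))
    rwa [Real.rpow_two] at this
  rcases eq_or_ne a₀ 0 with rfl | h0
  · simp only [norm_zero, ne_eq, OfNat.ofNat_ne_zero, not_false_eq_true, zero_pow, mul_zero,
      inner_zero_left, add_zero] at hn ⊢
    have hn' := hn.const_mul (10 * ‖M‖)
    rw [mul_zero] at hn'
    exact squeeze_zero_norm (fun k => abs_stress_density_le (hp1 k) (hp2 k) le_rfl (a k)) hn'
  · have hcM : Continuous (fun g : Grad => cofac M g) :=
      continuous_cofac.comp (continuous_const.prodMk continuous_id)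
    have hm : Tendsto (fun k => ‖a k‖ ^ (s k - 2)) atTop (𝓝 1) := by
      have := ha.norm.rpow (hs.sub_const 2) (Or.inl (norm_ne_zero_iff.2 h0))
      simpa using this
    have hi : Tendsto (fun k => inner ℝ (a k) (cofac M (a k))) atTop
        (𝓝 (inner ℝ a₀ (cofac M a₀))) := ha.inner ((hcM.tendsto a₀).comp ha)
    have := (((hp.const_sub 1).mul_const (tr M)).mul hn).add ((hp.mul hm).mul hi)
    convert this using 2
    ring

lemma cofac_zero (g : Grad) : cofac 0 g = 0 := by
  ext i; fin_cases i <;> simp [cofac]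

/-- The limit of the stress-energy identities, for variations whose differential is supported in a
compact set on which the rescaled gradients converge in `L²`. The restriction `p k ≤ 2` makes the
energy densities quadratically bounded in the rescaled gradients. -/
lemma stress_identity_limit {Ω : Set ℂ} (hΩ : IsOpen Ω) {p : ℕ → ℝ} (hp1 : ∀ k, 1 < p k)
    (hp2 : ∀ k, p k ≤ 2) (hp : Tendsto p atTop (𝓝 2)) {u : ℕ → ℂ → ℂ} {G : ℕ → ℂ → Grad}
    (hu : ∀ k, IsStationaryPHarmonic Ω (p k) (u k) (G k)) {D : ℂ → Grad} {K : Set ℂ}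
    (hK : IsCompact K) (hKΩ : K ⊆ Ω) (hD : ContinuousOn D K)
    (hconv : Tendsto (fun k => eLpNorm (fun z => (‖G k z‖ ^ (p k - 2))⁻¹ • G k z - D z) 2
        (volume.restrict K)) atTop (𝓝 0))
    {X : ℂ → ℂ} (hX : ContDiff ℝ ∞ X) (hc : HasCompactSupport X) (hs : tsupport X ⊆ Ω)
    (hXK : ∀ z, z ∉ K → fderiv ℝ X z = 0) :
    ∫ z in K, (-tr (fderiv ℝ X z) * ‖D z‖ ^ 2
      + 2 * inner ℝ (D z) (cofac (fderiv ℝ X z) (D z))) = 0 := by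
  obtain ⟨B, hB, hXB⟩ := exists_norm_fderiv_le hX hc
  have hM : Continuous (fderiv ℝ X) := hX.continuous_fderiv (by simp)
  have htr : Continuous (fun z => tr (fderiv ℝ X z)) := by unfold tr; fun_prop
  have hGm : ∀ k, AEStronglyMeasurable (G k) (volume.restrict K) := fun k =>
    (hu k).memSobolev.memLp_grad.aestronglyMeasurable.mono_measure
      (Measure.restrict_mono hKΩ le_rfl)
  have hDm : AEStronglyMeasurable D (volume.restrict K) :=
    hD.aestronglyMeasurable hK.measurableSet
  have hAm : ∀ k, AEStronglyMeasurable (fun z => (‖G k z‖ ^ (p k - 2))⁻¹ • G k z)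
      (volume.restrict K) := fun k =>
    ((hGm k).norm.aemeasurable.pow_const (p k - 2)).inv.aestronglyMeasurable.smul (hGm k)
  obtain ⟨ns, hns, hmem, hae, hint⟩ := exists_subseq_tendsto_ae hAm hDm hconv
  set A : ℕ → ℂ → Grad := fun k z => (‖G (ns k) z‖ ^ (p (ns k) - 2))⁻¹ • G (ns k) z with hA
  -- since `‖A‖ = ‖G‖ ^ (3 - p)`, this exponent gives `‖G‖ ^ p = ‖A‖ ^ s`; it is at most `2` if and
  -- only if `p ≤ 2`
  set s : ℕ → ℝ := fun k => p (ns k) / (3 - p (ns k)) with hsdef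
  have hpn : Tendsto (fun k => p (ns k)) atTop (𝓝 2) := hp.comp hns.tendsto_atTop
  have hsl : Tendsto s atTop (𝓝 2) := by
    have := hpn.div (hpn.const_sub 3) (by norm_num)
    rwa [show (2 : ℝ) / (3 - 2) = 2 by norm_num] at this
  have hs0 : ∀ k, 0 ≤ s k := fun k =>
    div_nonneg (by linarith [hp1 (ns k)]) (by linarith [hp2 (ns k)])
  have hs2 : ∀ k, s k ≤ 2 := fun k => by
    rw [hsdef, div_le_iff₀ (by linarith [hp2 (ns k)])]
    linarith [hp2 (ns k)]
  set f : ℕ → ℂ → ℝ := fun k z => (1 - p (ns k)) * tr (fderiv ℝ X z) * ‖A k z‖ ^ s k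
      + p (ns k) * ‖A k z‖ ^ (s k - 2) * inner ℝ (A k z) (cofac (fderiv ℝ X z) (A k z)) with hf
  have hzero : ∀ k, ∫ z in K, f k z = 0 := fun k => by
    have h1 := (hu (ns k)).stress_identity hΩ (hp1 _) hX hc hs
    rw [← h1, ← setIntegral_eq_of_subset_of_forall_sdiff_eq_zero hΩ.measurableSet hKΩ]
    · refine integral_congr_ae (Eventually.of_forall fun z => ?_)
      exact (stress_density_eq (hp1 _) (by linarith [hp2 (ns k)]) _ _).symm
    · intro z hz
      simp only [hf]
      rw [hXK z hz.2, cofac_zero]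
      simp [tr]
  have hfm : ∀ k, AEStronglyMeasurable (f k) (volume.restrict K) := fun k =>
    ((htr.aestronglyMeasurable.const_mul _).mul
      ((hAm (ns k)).norm.aemeasurable.pow_const (s k)).aestronglyMeasurable).add
      ((((hAm (ns k)).norm.aemeasurable.pow_const (s k - 2)).aestronglyMeasurable.const_mul _).mul
        ((hAm (ns k)).inner (aestronglyMeasurable_cofac (hAm (ns k)) hM)))
  have hlim := tendsto_integral_of_dominated_add (μ := volume.restrict K) (f := f)
    (g := fun z => -tr (fderiv ℝ X z) * ‖D z‖ ^ 2
      + 2 * inner ℝ (D z) (cofac (fderiv ℝ X z) (D z)))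
    (D := fun z => 10 * B * (1 + 2 * ‖D z‖ ^ 2))
    (E := fun k z => 20 * B * ‖A k z - D z‖ ^ 2) hfm ?_ ?_ (fun z => by positivity)
    (fun k z => by positivity) ?_ ?_ ?_ ?_
  · simp_rw [hzero] at hlim
    exact (tendsto_nhds_unique hlim tendsto_const_nhds)
  · exact (ContinuousOn.integrableOn_compact hK
      (continuousOn_const.mul (continuousOn_const.add (continuousOn_const.mul (hD.norm.pow 2)))))
  · intro k
    exact ((hmem k).integrable_norm_pow (by norm_num)).const_mul _
  · intro k
    refine Eventually.of_forall fun z => ?_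
    refine (abs_stress_density_le (hp1 _) (hp2 _) (hXB z) (A k z)).trans ?_
    have h1 := rpow_le_one_add_sq (norm_nonneg (A k z)) (hs0 k) (hs2 k)
    have h2 : ‖A k z‖ ≤ ‖D z‖ + ‖A k z - D z‖ := by
      have := norm_add_le (D z) (A k z - D z)
      rwa [add_sub_cancel] at this
    have h3 : ‖A k z‖ ^ 2 ≤ 2 * ‖D z‖ ^ 2 + 2 * ‖A k z - D z‖ ^ 2 := by
      have := pow_le_pow_left₀ (norm_nonneg _) h2 2
      nlinarith [sq_nonneg (‖D z‖ - ‖A k z - D z‖)]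
    nlinarith
  · have := hint.const_mul (20 * B)
    rw [mul_zero] at this
    refine this.congr fun k => ?_
    rw [integral_const_mul]
  · filter_upwards [hae] with z hz
    have := ((hz.sub_const (D z)).norm.pow 2).const_mul (20 * B)
    simpa using this
  · filter_upwards [hae] with z hz
    exact tendsto_stress_density (fun k => hp1 _) (fun k => hp2 _) hpn hsl _ hz


/-! ### Currents of circle-valued maps -/

/-- The current of a nonvanishing map `f`: the differential of a local phase of `f`, that is, the
imaginary part of the logarithmic derivative. -/
noncomputable def current (f : ℂ → ℂ) (z : ℂ) : ℂ →L[ℝ] ℝ :=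
  Complex.imCLM.comp ((f z)⁻¹ • fderiv ℝ f z)

/-- The Euclidean scalar product of two linear forms on the plane. -/
noncomputable def gdot (α β : ℂ →L[ℝ] ℝ) : ℝ := α 1 * β 1 + α Complex.I * β Complex.I

lemma gdot_add_left (α α' β : ℂ →L[ℝ] ℝ) : gdot (α + α') β = gdot α β + gdot α' β := by
  simp [gdot]; ring

lemma gdot_add_right (α β β' : ℂ →L[ℝ] ℝ) : gdot α (β + β') = gdot α β + gdot α β' := by
  simp [gdot]; ring

lemma gdot_smul_left (c : ℝ) (α β : ℂ →L[ℝ] ℝ) : gdot (c • α) β = c * gdot α β := by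
  simp [gdot]; ring

lemma gdot_smul_right (c : ℝ) (α β : ℂ →L[ℝ] ℝ) : gdot α (c • β) = c * gdot α β := by
  simp [gdot]; ring

lemma gdot_comm (α β : ℂ →L[ℝ] ℝ) : gdot α β = gdot β α := by
  simp [gdot]; ring

lemma gdot_zero_right (α : ℂ →L[ℝ] ℝ) : gdot α 0 = 0 := by simp [gdot]

lemma gdot_self_nonneg (α : ℂ →L[ℝ] ℝ) : 0 ≤ gdot α α := by
  unfold gdot; nlinarith [mul_self_nonneg (α 1), mul_self_nonneg (α Complex.I)]

lemma continuous_gdot : Continuous (fun q : (ℂ →L[ℝ] ℝ) × (ℂ →L[ℝ] ℝ) => gdot q.1 q.2) := by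
  unfold gdot; fun_prop

lemma norm_sq_le_gdot_self (α : ℂ →L[ℝ] ℝ) : ‖α‖ ^ 2 ≤ gdot α α := by
  have h : ‖α‖ ≤ √(gdot α α) := by
    refine α.opNorm_le_bound (Real.sqrt_nonneg _) fun v => ?_
    rw [clm_apply_eq α v, Complex.norm_eq_sqrt_sq_add_sq, ← Real.sqrt_mul (gdot_self_nonneg α),
      Real.norm_eq_abs, ← Real.sqrt_sq_eq_abs]
    refine Real.sqrt_le_sqrt ?_
    simp only [smul_eq_mul, gdot]
    nlinarith [sq_nonneg (v.re * α Complex.I - v.im * α 1)]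
  have := pow_le_pow_left₀ (norm_nonneg _) h 2
  rwa [Real.sq_sqrt (gdot_self_nonneg α)] at this

lemma abs_gdot_le (α β : ℂ →L[ℝ] ℝ) : |gdot α β| ≤ 2 * ‖α‖ * ‖β‖ := by
  have h : ∀ v : ℂ, ‖v‖ = 1 → |α v * β v| ≤ ‖α‖ * ‖β‖ := fun v hv => by
    have h1 : |α v| ≤ ‖α‖ := by simpa [hv] using α.le_opNorm v
    have h2 : |β v| ≤ ‖β‖ := by simpa [hv] using β.le_opNorm v
    rw [abs_mul]
    exact mul_le_mul h1 h2 (abs_nonneg _) (norm_nonneg _)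
  have := (abs_add_le _ _).trans (add_le_add (h 1 (by simp)) (h Complex.I (by simp)))
  unfold gdot; linarith

lemma current_apply (f : ℂ → ℂ) (z v : ℂ) :
    current f z v = ((f z)⁻¹ * fderiv ℝ f z v).im := rfl

lemma current_congr {f g : ℂ → ℂ} {z : ℂ} (h : f =ᶠ[𝓝 z] g) : current f z = current g z := by
  unfold current
  rw [h.fderiv_eq, h.eq_of_nhds]

lemma current_mul {f g : ℂ → ℂ} {z : ℂ} (hf : DifferentiableAt ℝ f z)
    (hg : DifferentiableAt ℝ g z) (hf0 : f z ≠ 0) (hg0 : g z ≠ 0) :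
    current (fun w => f w * g w) z = current f z + current g z := by
  ext v
  rw [add_apply, current_apply, current_apply, current_apply,
    show fderiv ℝ (fun w => f w * g w) z = _ from (hf.hasFDerivAt.mul hg.hasFDerivAt).fderiv,
    ← Complex.add_im]
  congr 1
  simp only [add_apply, smul_apply, smul_eq_mul]
  field_simp
  ring

lemma current_comp {f ψ : ℂ → ℂ} {z : ℂ} (hf : DifferentiableAt ℝ f (ψ z))
    (hψ : DifferentiableAt ℝ ψ z) :
    current (fun w => f (ψ w)) z = (current f (ψ z)).comp (fderiv ℝ ψ z) := by
  ext v
  rw [ContinuousLinearMap.comp_apply, current_apply, current_apply,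
    show fderiv ℝ (fun w => f (ψ w)) z = _ from (hf.hasFDerivAt.comp z hψ.hasFDerivAt).fderiv]
  rfl

lemma hasFDerivAt_zpow_comp {f : ℂ → ℂ} {z : ℂ} (hf : DifferentiableAt ℝ f z) (h0 : f z ≠ 0)
    (d : ℤ) : HasFDerivAt (fun w => f w ^ d) ((d * f z ^ (d - 1) : ℂ) • fderiv ℝ f z) z := by
  have h1 := ((hasDerivAt_zpow d (f z) (Or.inl h0)).hasFDerivAt.restrictScalars ℝ).comp z
    hf.hasFDerivAt
  refine h1.congr_fderiv ?_
  ext v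
  simp [mul_comm]

lemma current_zpow {f : ℂ → ℂ} {z : ℂ} (hf : DifferentiableAt ℝ f z) (h0 : f z ≠ 0) (d : ℤ) :
    current (fun w => f w ^ d) z = (d : ℝ) • current f z := by
  ext v
  rw [smul_apply, current_apply, current_apply, (hasFDerivAt_zpow_comp hf h0 d).fderiv]
  have : (f z ^ d)⁻¹ * ((d * f z ^ (d - 1) : ℂ) • fderiv ℝ f z) v
      = (d : ℝ) • ((f z)⁻¹ * fderiv ℝ f z v) := by
    have hd : f z ^ d ≠ 0 := zpow_ne_zero _ h0
    rw [zpow_sub_one₀ h0]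
    simp
    field_simp
  rw [this, Complex.smul_im]

lemma current_prod {ι : Type*} (s : Finset ι) {f : ι → ℂ → ℂ} {z : ℂ}
    (hf : ∀ i, DifferentiableAt ℝ (f i) z) (h0 : ∀ i, f i z ≠ 0) :
    current (fun w => ∏ i ∈ s, f i w) z = ∑ i ∈ s, current (f i) z := by
  classical
  suffices h : DifferentiableAt ℝ (fun w => ∏ i ∈ s, f i w) z ∧
      current (fun w => ∏ i ∈ s, f i w) z = ∑ i ∈ s, current (f i) z from h.2
  induction s using Finset.induction_on with
  | empty =>
    refine ⟨by simp, ?_⟩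
    ext v; simp [current_apply]
  | insert a s ha ih =>
    simp_rw [Finset.prod_insert ha]
    rw [Finset.sum_insert ha, ← ih.2]
    exact ⟨(hf a).mul ih.1, current_mul (hf a) ih.1 (h0 a)
      (Finset.prod_ne_zero_iff.2 fun i _ => h0 i)⟩

lemma current_conj (f : ℂ → ℂ) (z : ℂ) :
    current (fun w => (starRingEnd ℂ) (f w)) z = -current f z := by
  ext v
  have h : fderiv ℝ (fun w => (starRingEnd ℂ) (f w)) z v = (starRingEnd ℂ) (fderiv ℝ f z v) := by
    have := Complex.conjCLE.comp_fderiv (f := f) (x := z)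
    exact congrArg (fun L : ℂ →L[ℝ] ℂ => L v) this
  rw [neg_apply, current_apply, current_apply, h, ← Complex.conj_im, map_mul, map_inv₀]

lemma current_ofReal (f : ℂ → ℝ) (z : ℂ) : current (fun w => (f w : ℂ)) z = 0 := by
  ext v
  rw [current_apply]
  by_cases hf : DifferentiableAt ℝ f z
  · have : fderiv ℝ (fun w => (f w : ℂ)) z v = (fderiv ℝ f z v : ℂ) := by
      have := (Complex.ofRealCLM.hasFDerivAt.comp z hf.hasFDerivAt).fderiv
      exact congrArg (fun L : ℂ →L[ℝ] ℂ => L v) this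
    rw [this, ← Complex.ofReal_inv, ← Complex.ofReal_mul, Complex.ofReal_im]
    rfl
  · have : ¬ DifferentiableAt ℝ (fun w => (f w : ℂ)) z := fun h => hf (by
      have := Complex.reCLM.differentiableAt.comp z h
      exact this)
    rw [fderiv_zero_of_not_differentiableAt this]
    simp

lemma current_exp {ψ : ℂ → ℝ} {z : ℂ} (hψ : DifferentiableAt ℝ ψ z) :
    current (fun w => Complex.exp (ψ w * Complex.I)) z = fderiv ℝ ψ z := by
  ext v
  have h1 : HasFDerivAt (fun w => (ψ w * Complex.I : ℂ)) _ z :=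
    (Complex.ofRealCLM.hasFDerivAt.comp z hψ.hasFDerivAt).mul_const' Complex.I
  have h2 := h1.cexp
  rw [current_apply, h2.fderiv]
  simp only [smul_apply, smul_eq_mul, ContinuousLinearMap.comp_apply]
  rw [← mul_assoc, inv_mul_cancel₀ (Complex.exp_ne_zero _)]
  simp

/-- The differential of a circle-valued map is tangent to the circle. -/
lemma fderiv_eq_current_smul {f : ℂ → ℂ} {z : ℂ} (hf : DifferentiableAt ℝ f z)
    (h1 : ∀ᶠ w in 𝓝 z, ‖f w‖ = 1) (v : ℂ) :
    fderiv ℝ f z v = current f z v * (Complex.I * f z) := by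
  have hz : ‖f z‖ = 1 := h1.self_of_nhds
  have h0 : f z ≠ 0 := by rw [← norm_ne_zero_iff, hz]; norm_num
  have h2 : HasFDerivAt (fun w => ‖f w‖ ^ 2) _ z := hf.hasFDerivAt.norm_sq
  have h3 : (fun w => ‖f w‖ ^ 2) =ᶠ[𝓝 z] fun _ => (1 : ℝ) := by
    filter_upwards [h1] with w hw
    rw [hw]; norm_num
  have h4 := (h2.congr_of_eventuallyEq h3.symm).unique (hasFDerivAt_const (1 : ℝ) z)
  have h5 := congrArg (fun L : ℂ →L[ℝ] ℝ => L v) h4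
  simp [Complex.inner] at h5
  have hinv : (f z)⁻¹ = (starRingEnd ℂ) (f z) := by
    rw [Complex.inv_def, Complex.normSq_eq_norm_sq, hz]; simp
  have h6 : (f z)⁻¹ * fderiv ℝ f z v = current f z v * Complex.I := by
    apply Complex.ext
    · rw [hinv]; simp; linarith
    · rw [← current_apply]; simp
  calc fderiv ℝ f z v = f z * ((f z)⁻¹ * fderiv ℝ f z v) := by field_simp
    _ = _ := by rw [h6]; ring

lemma grad_apply_eq {f : ℂ → ℂ} {z : ℂ} (hf : DifferentiableAt ℝ f z)
    (h1 : ∀ᶠ w in 𝓝 z, ‖f w‖ = 1) (i : Fin 2) :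
    grad f z i = current f z (dir i) * (Complex.I * f z) :=
  fderiv_eq_current_smul hf h1 (dir i)

lemma inner_grad_apply {f : ℂ → ℂ} {z : ℂ} (hf : DifferentiableAt ℝ f z)
    (h1 : ∀ᶠ w in 𝓝 z, ‖f w‖ = 1) (i j : Fin 2) :
    inner ℝ (grad f z i) (grad f z j) = current f z (dir i) * current f z (dir j) := by
  have hz : ‖f z‖ = 1 := h1.self_of_nhds
  have hI : inner ℝ (Complex.I * f z) (Complex.I * f z) = (1 : ℝ) := by
    rw [real_inner_self_eq_norm_sq]; simp [hz]
  rw [grad_apply_eq hf h1, grad_apply_eq hf h1, ← Complex.real_smul, ← Complex.real_smul,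
    inner_smul_left, inner_smul_right, hI]
  simp

lemma norm_grad_sq {f : ℂ → ℂ} {z : ℂ} (hf : DifferentiableAt ℝ f z)
    (h1 : ∀ᶠ w in 𝓝 z, ‖f w‖ = 1) : ‖grad f z‖ ^ 2 = gdot (current f z) (current f z) := by
  rw [grad_norm_sq, ← real_inner_self_eq_norm_sq, ← real_inner_self_eq_norm_sq,
    inner_grad_apply hf h1, inner_grad_apply hf h1]
  rfl

/-- The differential of the angle around the point `x`. -/
noncomputable def rot (x z : ℂ) : ℂ →L[ℝ] ℝ := current (fun w => w - x) z

lemma rot_apply (x z v : ℂ) : rot x z v = ((z - x)⁻¹ * v).im := by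
  rw [rot, current_apply, show fderiv ℝ (fun w => w - x) z = ContinuousLinearMap.id ℝ ℂ from
    ((hasFDerivAt_id z).sub_const x).fderiv]
  rfl

lemma contDiffAt_unit {x z : ℂ} (h : z ≠ x) :
    ContDiffAt ℝ ∞ (fun w => (w - x) / (‖w - x‖ : ℂ)) z := by
  have h0 : z - x ≠ 0 := sub_ne_zero.2 h
  have h1 : ContDiffAt ℝ ∞ (fun w : ℂ => w - x) z := contDiffAt_id.sub contDiffAt_const
  have h2 : ContDiffAt ℝ ∞ (fun w : ℂ => ‖w - x‖) z := h1.norm ℝ h0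
  have h3 : ContDiffAt ℝ ∞ (fun w : ℂ => (‖w - x‖ : ℂ)) z :=
    Complex.ofRealCLM.contDiff.contDiffAt.comp z h2
  simp only [div_eq_mul_inv]
  exact h1.mul (h3.inv (by simpa using h0))

lemma ContDiffAt.zpow_complex {f : ℂ → ℂ} {z : ℂ} {m : WithTop ℕ∞} (hf : ContDiffAt ℝ m f z)
    (h0 : f z ≠ 0) (d : ℤ) : ContDiffAt ℝ m (fun w => f w ^ d) z := by
  cases d with
  | ofNat k => simpa using hf.pow k
  | negSucc k =>
    simp only [zpow_negSucc]
    exact (hf.pow (k + 1)).inv (pow_ne_zero _ h0)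

lemma norm_unit {x z : ℂ} (h : z ≠ x) : ‖(z - x) / (‖z - x‖ : ℂ)‖ = 1 := by
  have h0 : ‖z - x‖ ≠ 0 := norm_ne_zero_iff.2 (sub_ne_zero.2 h)
  rw [norm_div, Complex.norm_real, norm_norm, div_self h0]

lemma unit_ne_zero {x z : ℂ} (h : z ≠ x) : (z - x) / (‖z - x‖ : ℂ) ≠ 0 := by
  rw [← norm_ne_zero_iff, norm_unit h]; norm_num

lemma current_unit {x z : ℂ} (h : z ≠ x) :
    current (fun w => (w - x) / (‖w - x‖ : ℂ)) z = rot x z := by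
  have h0 : z - x ≠ 0 := sub_ne_zero.2 h
  have h1 : DifferentiableAt ℝ (fun w : ℂ => w - x) z := differentiableAt_id.sub_const x
  have h2 : DifferentiableAt ℝ (fun w : ℂ => ((‖w - x‖⁻¹ : ℝ) : ℂ)) z :=
    Complex.ofRealCLM.differentiableAt.comp z ((h1.norm ℝ h0).inv (norm_ne_zero_iff.2 h0))
  have h3 := current_mul h1 h2 h0 (by simpa using h0)
  rw [current_ofReal (fun w => ‖w - x‖⁻¹), add_zero] at h3
  rw [rot, ← h3]
  congr 1
  ext w
  simp [div_eq_mul_inv]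


/-! ### The angular form around a point -/

lemma integrableOn_polar {g : ℝ × ℝ → ℝ} (hg : Continuous g) {R : ℝ}
    (h0 : ∀ p : ℝ × ℝ, R < p.1 → g p = 0) :
    IntegrableOn g (Ioi 0 ×ˢ Ioo (-Real.pi) Real.pi) (volume.prod volume) := by
  have h1 : IntegrableOn g (Icc 0 R ×ˢ Icc (-Real.pi) Real.pi) (volume.prod volume) :=
    hg.continuousOn.integrableOn_compact (isCompact_Icc.prod isCompact_Icc)
  refine h1.of_forall_sdiff_eq_zero (measurableSet_Ioi.prod measurableSet_Ioo) ?_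
  rintro ⟨r, θ⟩ ⟨⟨hr, hθ⟩, hn⟩
  refine h0 _ ?_
  by_contra hle
  exact hn ⟨⟨le_of_lt hr, not_lt.1 hle⟩, Ioo_subset_Icc_self hθ⟩

/-- The point of the unit circle of angle `θ`. -/
noncomputable def circ (θ : ℝ) : ℂ := Real.cos θ + Real.sin θ * Complex.I

lemma norm_circ (θ : ℝ) : ‖circ θ‖ = 1 := by
  rw [circ, Complex.norm_add_mul_I]; simp

lemma continuous_circ : Continuous circ := by unfold circ; fun_prop

lemma circ_re (θ : ℝ) : (circ θ).re = Real.cos θ := by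
  simp only [circ, Complex.add_re, Complex.mul_re, Complex.ofReal_re, Complex.ofReal_im,
    Complex.I_re, Complex.I_im]
  ring

lemma circ_im (θ : ℝ) : (circ θ).im = Real.sin θ := by
  simp only [circ, Complex.add_im, Complex.mul_im, Complex.ofReal_re, Complex.ofReal_im,
    Complex.I_re, Complex.I_im]
  ring

lemma hasDerivAt_circ (θ : ℝ) : HasDerivAt circ (Complex.I * circ θ) θ := by
  have h1 := (Real.hasDerivAt_cos θ).ofReal_comp
  have h2 := ((Real.hasDerivAt_sin θ).ofReal_comp).mul_const Complex.I
  refine (h1.add h2).congr_deriv ?_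
  apply Complex.ext <;> simp [circ]

lemma inv_circ (θ : ℝ) : (circ θ)⁻¹ = Real.cos θ - Real.sin θ * Complex.I := by
  have : circ θ * (Real.cos θ - Real.sin θ * Complex.I) = 1 := by
    apply Complex.ext
    · simp only [Complex.mul_re, circ_re, circ_im, Complex.sub_re, Complex.sub_im,
        Complex.ofReal_re, Complex.ofReal_im, Complex.mul_im, Complex.I_re, Complex.I_im,
        Complex.one_re]
      nlinarith [Real.sin_sq_add_cos_sq θ]
    · simp only [Complex.mul_re, circ_re, circ_im, Complex.sub_re, Complex.sub_im,
        Complex.ofReal_re, Complex.ofReal_im, Complex.mul_im, Complex.I_re, Complex.I_im,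
        Complex.one_im]
      ring
  exact inv_eq_of_mul_eq_one_right this

lemma rot_circ (x : ℂ) {r : ℝ} (θ : ℝ) : rot x (x + r * circ θ) 1 = -r⁻¹ * Real.sin θ ∧
    rot x (x + r * circ θ) Complex.I = r⁻¹ * Real.cos θ := by
  have e : (x + r * circ θ - x)⁻¹ = (r⁻¹ : ℝ) * (Real.cos θ - Real.sin θ * Complex.I) := by
    rw [add_sub_cancel_left, mul_inv, inv_circ, Complex.ofReal_inv]
  constructor <;> rw [rot_apply, e] <;>
    simp only [Complex.mul_im, Complex.mul_re, Complex.sub_re, Complex.sub_im, Complex.ofReal_re,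
      Complex.ofReal_im, Complex.I_re, Complex.I_im, Complex.one_re, Complex.one_im] <;> ring

lemma exists_radius {η : ℂ → ℝ} (hc : HasCompactSupport η) (x : ℂ) :
    ∃ R, 0 ≤ R ∧ ∀ z, R < ‖z - x‖ → η z = 0 ∧ fderiv ℝ η z = 0 := by
  obtain ⟨R, hR⟩ := hc.isCompact.isBounded.subset_closedBall x
  refine ⟨max R 0, le_max_right _ _, fun z hz => ?_⟩
  have hn : z ∉ tsupport η := fun h => by
    have := hR h
    rw [Metric.mem_closedBall, dist_eq_norm] at this
    exact absurd hz (not_lt.2 (this.trans (le_max_left _ _)))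
  exact ⟨image_eq_zero_of_notMem_tsupport hn,
    Function.notMem_support.1 fun h => hn (support_fderiv_subset ℝ h)⟩

lemma integral_polar_translate (x : ℂ) (f : ℂ → ℝ) :
    ∫ z, f z = ∫ p in Ioi (0 : ℝ) ×ˢ Ioo (-Real.pi) Real.pi,
      p.1 * f (x + p.1 * circ p.2) := by
  rw [← integral_add_left_eq_self f x, ← Complex.integral_comp_polarCoord_symm,
    polarCoord_target]
  simp_rw [Complex.polarCoord_symm_apply]
  rfl

/-- The angular form is divergence-free in the sense of distributions, including at its centre. -/
lemma integral_gdot_rot {η : ℂ → ℝ} (hη : ContDiff ℝ 1 η) (hc : HasCompactSupport η) (x : ℂ) :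
    ∫ z, gdot (rot x z) (fderiv ℝ η z) = 0 := by
  obtain ⟨R, hR0, hR⟩ := exists_radius hc x
  have hcont : Continuous (fderiv ℝ η) := hη.continuous_fderiv (by simp)
  have hg : Continuous (fun p : ℝ × ℝ =>
      fderiv ℝ η (x + p.1 * circ p.2) (Complex.I * circ p.2)) := by
    have := continuous_circ
    fun_prop
  -- in polar coordinates the integrand is the angular derivative of `η` divided by the radius,
  -- which integrates to zero over each circle
  rw [integral_polar_translate x]
  rw [setIntegral_congr_fun (g := fun p : ℝ × ℝ =>
      fderiv ℝ η (x + p.1 * circ p.2) (Complex.I * circ p.2))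
      (measurableSet_Ioi.prod measurableSet_Ioo)]
  · rw [Measure.volume_eq_prod, setIntegral_prod _ (integrableOn_polar hg (R := R) ?_)]
    · refine setIntegral_eq_zero_of_forall_eq_zero fun r hr => ?_
      rw [mem_Ioi] at hr
      rw [← integral_Ioc_eq_integral_Ioo, ← intervalIntegral.integral_of_le (by
        linarith [Real.pi_pos])]
      have hd : ∀ θ : ℝ, HasDerivAt (fun θ => r⁻¹ * η (x + r * circ θ))
          (fderiv ℝ η (x + r * circ θ) (Complex.I * circ θ)) θ := fun θ => by
        have h1 : HasDerivAt (fun θ => x + r * circ θ) (r * (Complex.I * circ θ)) θ :=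
          ((hasDerivAt_circ θ).const_mul (r : ℂ)).const_add x
        have h2 := ((hη.differentiable (by simp)) (x + r * circ θ)).hasFDerivAt.comp_hasDerivAt
          θ h1
        refine (h2.const_mul r⁻¹).congr_deriv ?_
        rw [← Complex.real_smul (x := r) (z := Complex.I * circ θ), map_smul, smul_eq_mul,
          ← mul_assoc, inv_mul_cancel₀ hr.ne',
          one_mul]
      rw [intervalIntegral.integral_eq_sub_of_hasDerivAt (fun θ _ => hd θ)]
      · simp [circ]
      · refine Continuous.intervalIntegrable ?_ _ _
        exact hg.comp (continuous_const.prodMk continuous_id)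
    · rintro ⟨r, θ⟩ hr
      have : fderiv ℝ η (x + r * circ θ) = 0 := (hR _ (by
        simp only at hr
        rw [add_sub_cancel_left, norm_mul, norm_circ, mul_one, Complex.norm_real,
          Real.norm_of_nonneg (by linarith)]
        exact hr)).2
      simp [this]
  · rintro ⟨r, θ⟩ ⟨hr, -⟩
    simp only [mem_Ioi] at hr
    obtain ⟨e1, e2⟩ := rot_circ x (r := r) θ
    simp only [gdot, e1, e2]
    rw [clm_apply_eq _ (Complex.I * circ θ)]
    simp only [smul_eq_mul]
    have i1 : (Complex.I * circ θ).re = -Real.sin θ := by simp [circ_im]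
    have i2 : (Complex.I * circ θ).im = Real.cos θ := by simp [circ_re]
    rw [i1, i2]
    field_simp

/-- The curl of the angular form is a Dirac mass at its centre. -/
lemma integral_curl_rot {η : ℂ → ℝ} (hη : ContDiff ℝ 1 η) (hc : HasCompactSupport η) (x : ℂ) :
    ∫ z, (rot x z 1 * fderiv ℝ η z Complex.I
    - rot x z Complex.I * fderiv ℝ η z 1) = 2 * Real.pi * η x := by
  obtain ⟨R, hR0, hR⟩ := exists_radius hc x
  have hcont : Continuous (fderiv ℝ η) := hη.continuous_fderiv (by simp)
  have hg : Continuous (fun p : ℝ × ℝ => -fderiv ℝ η (x + p.1 * circ p.2) (circ p.2)) := by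
    have := continuous_circ
    fun_prop
  have hvan : ∀ r θ : ℝ, R < r → η (x + r * circ θ) = 0 ∧ fderiv ℝ η (x + r * circ θ) = 0 :=
    fun r θ hr => hR _ (by
      rw [add_sub_cancel_left, norm_mul, norm_circ, mul_one, Complex.norm_real,
        Real.norm_of_nonneg (by linarith)]
      exact hr)
  -- in polar coordinates the integrand is minus the radial derivative of `η`, whose integral over
  -- each ray is `η x`
  rw [integral_polar_translate x]
  rw [setIntegral_congr_fun (g := fun p : ℝ × ℝ => -fderiv ℝ η (x + p.1 * circ p.2) (circ p.2))
      (measurableSet_Ioi.prod measurableSet_Ioo)]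
  · have hint := integrableOn_polar hg (R := R) (fun p hp => by simp [(hvan p.1 p.2 hp).2])
    rw [Measure.volume_eq_prod]
    have hint' := hint
    rw [IntegrableOn, ← Measure.prod_restrict] at hint'
    rw [← Measure.prod_restrict, integral_prod_symm _ hint']
    have hinner : ∀ θ : ℝ, ∫ r in Ioi (0 : ℝ), -fderiv ℝ η (x + r * circ θ) (circ θ) = η x :=
      fun θ => by
        have hd : ∀ r : ℝ, HasDerivAt (fun r : ℝ => -η (x + r * circ θ))
            (-fderiv ℝ η (x + r * circ θ) (circ θ)) r := fun r => by
          have h1 : HasDerivAt (fun r : ℝ => x + r * circ θ) (circ θ) r := by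
            have := (((hasDerivAt_id r).ofReal_comp).mul_const (circ θ)).const_add x
            simpa using this
          exact (((hη.differentiable (by simp)) (x + r * circ θ)).hasFDerivAt.comp_hasDerivAt
            r h1).neg
        have hcr : Continuous (fun r : ℝ => -fderiv ℝ η (x + r * circ θ) (circ θ)) :=
          hg.comp (continuous_id.prodMk continuous_const)
        rw [integral_Ioi_of_hasDerivAt_of_tendsto (m := 0)
          (hd 0).continuousAt.continuousWithinAt (fun r _ => hd r)]
        · simp
        · have h1 : IntegrableOn (fun r : ℝ => -fderiv ℝ η (x + r * circ θ) (circ θ)) (Icc 0 R) :=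
            hcr.continuousOn.integrableOn_compact isCompact_Icc
          refine h1.of_forall_sdiff_eq_zero measurableSet_Ioi fun r hr => ?_
          rw [(hvan r θ ?_).2]
          · simp
          · by_contra hle
            exact hr.2 ⟨le_of_lt hr.1, not_lt.1 hle⟩
        · refine tendsto_const_nhds.congr' ?_
          filter_upwards [eventually_gt_atTop R] with r hr
          rw [(hvan r θ hr).1, neg_zero]
    simp_rw [hinner]
    rw [setIntegral_const, measureReal_def, Real.volume_Ioo, ENNReal.toReal_ofReal (by
      linarith [Real.pi_pos]), smul_eq_mul]
    ring
  · rintro ⟨r, θ⟩ ⟨hr, -⟩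
    simp only [mem_Ioi] at hr
    obtain ⟨e1, e2⟩ := rot_circ x (r := r) θ
    simp only [e1, e2]
    rw [clm_apply_eq _ (circ θ)]
    simp only [smul_eq_mul]
    rw [circ_re, circ_im]
    field_simp
    ring

lemma gdot_rot_self {x z : ℂ} : gdot (rot x z) (rot x z) = (‖z - x‖ ^ 2)⁻¹ := by
  rw [gdot, rot_apply, rot_apply]
  have h : ((z - x)⁻¹ * 1).im * ((z - x)⁻¹ * 1).im
      + ((z - x)⁻¹ * Complex.I).im * ((z - x)⁻¹ * Complex.I).im = ‖(z - x)⁻¹‖ ^ 2 := by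
    rw [← Complex.normSq_eq_norm_sq, Complex.normSq_apply]
    simp; ring
  rw [h, norm_inv, inv_pow]

lemma norm_rot_le (x z : ℂ) : ‖rot x z‖ ≤ ‖z - x‖⁻¹ := by
  have h := norm_sq_le_gdot_self (rot x z)
  rw [gdot_rot_self, ← inv_pow] at h
  exact abs_le_of_sq_le_sq' h (by positivity) |>.2

lemma measurable_rot (x : ℂ) : Measurable (rot x) := by
  have : rot x = fun z => Complex.imCLM.comp
      ((z - x)⁻¹ • (ContinuousLinearMap.id ℝ ℂ)) := by
    ext z v
    rw [rot_apply]
    rfl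
  rw [this]
  have h1 : Measurable (fun z : ℂ => (z - x)⁻¹) := by fun_prop
  have h2 : Continuous (fun c : ℂ => Complex.imCLM.comp (c • (ContinuousLinearMap.id ℝ ℂ))) := by
    fun_prop
  exact h2.measurable.comp h1

lemma integrableOn_inv_norm (x : ℂ) (R : ℝ) :
    IntegrableOn (fun z => ‖z - x‖⁻¹) (Metric.ball x R) := by
  have h : Integrable (fun z : ℂ => (Iio R).indicator (fun y : ℝ => y⁻¹) ‖z‖) := by
    rw [integrable_fun_norm_addHaar volume (f := (Iio R).indicator (fun y : ℝ => y⁻¹)),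
      Complex.finrank_real_complex]
    have h1 : IntegrableOn ((Iio R).indicator fun _ : ℝ => (1 : ℝ)) (Ioi 0) := by
      rw [IntegrableOn, integrable_indicator_iff measurableSet_Iio, IntegrableOn,
        Measure.restrict_restrict measurableSet_Iio]
      have : Iio R ∩ Ioi 0 = Ioo 0 R := by rw [inter_comm, Ioi_inter_Iio]
      rw [this]
      exact integrable_const _
    refine h1.congr_fun (fun y hy => ?_) measurableSet_Ioi
    have hy0 : y ≠ 0 := (mem_Ioi.1 hy).ne'
    by_cases hR : y ∈ Iio R
    · simp [indicator_of_mem hR, hy0]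
    · simp [indicator_of_notMem hR]
  have h2 := h.comp_sub_right x
  refine h2.integrableOn.congr_fun (fun z hz => ?_) measurableSet_ball
  rw [Metric.mem_ball, dist_eq_norm] at hz
  exact indicator_of_mem (by exact hz) _

/-- The energy of the angular form on an annulus. -/
lemma integral_annulus (x : ℂ) {ρ R : ℝ} (hρ : 0 < ρ) (hR : ρ ≤ R) :
    ∫ z in Metric.ball x R \ Metric.ball x ρ, (‖z - x‖ ^ 2)⁻¹
      = 2 * Real.pi * (Real.log R - Real.log ρ) := by
  set f : ℝ → ℝ := (Ico ρ R).indicator (fun y => (y ^ 2)⁻¹) with hf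
  have e1 : ∫ z in Metric.ball x R \ Metric.ball x ρ, (‖z - x‖ ^ 2)⁻¹ = ∫ z : ℂ, f ‖z - x‖ := by
    rw [← integral_indicator (measurableSet_ball.diff measurableSet_ball)]
    congr 1
    ext z
    by_cases hz : ‖z - x‖ ∈ Ico ρ R
    · rw [hf, indicator_of_mem hz, indicator_of_mem]
      simpa [dist_eq_norm, and_comm] using hz
    · rw [hf, indicator_of_notMem hz, indicator_of_notMem]
      simpa [dist_eq_norm, and_comm] using hz
  rw [e1, integral_sub_right_eq_self (fun z : ℂ => f ‖z‖) x, integral_fun_norm_addHaar volume f,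
    Complex.finrank_real_complex]
  have e2 : ∫ y in Ioi (0 : ℝ), y ^ (2 - 1) • f y = Real.log R - Real.log ρ := by
    have : ∀ y ∈ Ioi (0 : ℝ), y ^ (2 - 1) • f y = (Ico ρ R).indicator (fun y => y⁻¹) y := by
      intro y hy
      have hy0 : y ≠ 0 := (mem_Ioi.1 hy).ne'
      by_cases hz : y ∈ Ico ρ R
      · rw [hf, indicator_of_mem hz, indicator_of_mem hz, smul_eq_mul]
        field_simp
        ring
      · rw [hf, indicator_of_notMem hz, indicator_of_notMem hz, smul_zero]
    rw [setIntegral_congr_fun measurableSet_Ioi this, setIntegral_indicator measurableSet_Ico,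
      show Ioi 0 ∩ Ico ρ R = Ico ρ R from inter_eq_right.2 fun y hy => lt_of_lt_of_le hρ hy.1,
      integral_Ico_eq_integral_Ioc, ← intervalIntegral.integral_of_le hR,
      integral_inv_of_pos hρ (by linarith), Real.log_div (by linarith) hρ.ne']
  have e3 : (volume : Measure ℂ).real (Metric.ball 0 1) = Real.pi := by
    rw [measureReal_def, Complex.volume_ball]
    simp
  rw [e2, e3]
  simp
  ring


/-! ### Conservation laws of harmonic and singular harmonic maps -/

lemma integrable_mul_of_tsupport_subset {Ω : Set ℂ} (hΩ : IsOpen Ω) {f g : ℂ → ℝ}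
    (hg : ContinuousOn g Ω) (hf : Continuous f) (hc : HasCompactSupport f) (hs : tsupport f ⊆ Ω) :
    Integrable (fun z => g z * f z) := by
  have := integrable_smul_of_tsupport_subset hf hc hs (hg.locallyIntegrableOn hΩ.measurableSet
    (μ := volume))
  simpa [mul_comm] using this

lemma integrable_fderiv_mul_add {Ω : Set ℂ} (hΩ : IsOpen Ω) {g η : ℂ → ℝ}
    (hg : ContDiffOn ℝ 1 g Ω) (hη : ContDiff ℝ 1 η) (hc : HasCompactSupport η)
    (hs : tsupport η ⊆ Ω) (w : ℂ) :
    Integrable (fun z => g z * fderiv ℝ η z w + fderiv ℝ g z w * η z) :=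
  (integrable_mul_of_tsupport_subset hΩ hg.continuousOn
    ((hη.continuous_fderiv (by simp)).clm_apply continuous_const) (hc.fderiv_apply ℝ w)
    ((tsupport_fderiv_apply_subset ℝ w).trans hs)).add
  (integrable_mul_of_tsupport_subset hΩ
    ((hg.continuousOn_fderiv_of_isOpen hΩ le_rfl).clm_apply continuousOn_const)
    hη.continuous hc hs)

lemma integral_fderiv_mul_add {Ω : Set ℂ} (hΩ : IsOpen Ω) {g η : ℂ → ℝ}
    (hg : ContDiffOn ℝ 1 g Ω) (hη : ContDiff ℝ 1 η) (hc : HasCompactSupport η)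
    (hs : tsupport η ⊆ Ω) (w : ℂ) :
    ∫ z, (g z * fderiv ℝ η z w + fderiv ℝ g z w * η z) = 0 := by
  have i1 := integrable_mul_of_tsupport_subset hΩ hg.continuousOn
    ((hη.continuous_fderiv (by simp)).clm_apply (continuous_const (y := w))) (hc.fderiv_apply ℝ w)
    ((tsupport_fderiv_apply_subset ℝ w).trans hs)
  have i2 := integrable_mul_of_tsupport_subset hΩ
    ((hg.continuousOn_fderiv_of_isOpen hΩ le_rfl).clm_apply (continuousOn_const (c := w)))
    hη.continuous hc hs
  have i3 := integrable_mul_of_tsupport_subset hΩ hg.continuousOn hη.continuous hc hs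
  rw [integral_add i1 i2, integral_mul_fderiv_eq_neg_fderiv_mul_of_integrable i2 i1 i3]
  · simp
  · exact fun z hz => (hg.differentiableOn (by simp)).differentiableAt (hΩ.mem_nhds (hs hz))
  · exact fun z _ => hη.differentiable (by simp) z

lemma fderiv_current_apply {v : ℂ → ℂ} {z : ℂ} (hv : ContDiffAt ℝ 2 v z) (h0 : v z ≠ 0)
    (w a : ℂ) : fderiv ℝ (fun z => current v z w) z a
      = (-((v z)⁻¹ * fderiv ℝ v z a) * ((v z)⁻¹ * fderiv ℝ v z w)
        + (v z)⁻¹ * fderiv ℝ (fderiv ℝ v) z a w).im := by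
  have h1 : HasFDerivAt v (fderiv ℝ v z) z := (hv.differentiableAt (by simp)).hasFDerivAt
  have h2 : HasFDerivAt (fderiv ℝ v) (fderiv ℝ (fderiv ℝ v) z) z :=
    ((hv.fderiv_right (m := 1) (by norm_num)).differentiableAt (by simp)).hasFDerivAt
  have h3 : HasFDerivAt (fun z => fderiv ℝ v z w) ((fderiv ℝ (fderiv ℝ v) z).flip w) z := by
    refine (h2.clm_apply (hasFDerivAt_const w z)).congr_fderiv ?_
    ext b; simp
  have h4 : HasFDerivAt (fun z => (v z)⁻¹) ((-(v z ^ 2)⁻¹ : ℂ) • fderiv ℝ v z) z := by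
    have := ((hasDerivAt_inv h0).hasFDerivAt.restrictScalars ℝ).comp z h1
    refine this.congr_fderiv ?_
    ext b; simp [mul_comm]
  have h5 : HasFDerivAt (Complex.imCLM ∘ fun z => (v z)⁻¹ * fderiv ℝ v z w) _ z :=
    Complex.imCLM.hasFDerivAt.comp z (h4.mul h3)
  have h6 : (fun z => current v z w) = Complex.imCLM ∘ fun z => (v z)⁻¹ * fderiv ℝ v z w := rfl
  rw [h6, h5.fderiv]
  simp only [ContinuousLinearMap.comp_apply, add_apply, smul_apply, smul_eq_mul,
    ContinuousLinearMap.flip_apply, Complex.imCLM_apply]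
  congr 1
  field_simp
  ring

namespace IsHarmonicCircleMap

variable {Ω : Set ℂ} {v : ℂ → ℂ} (hv : IsHarmonicCircleMap Ω v) (hΩ : IsOpen Ω)

include hv

lemma ne_zero {z : ℂ} (hz : z ∈ Ω) : v z ≠ 0 := by
  rw [← norm_ne_zero_iff, hv.norm_eq_one z hz]; norm_num

include hΩ

lemma contDiffAt {z : ℂ} (hz : z ∈ Ω) : ContDiffAt ℝ 2 v z :=
  hv.contDiffOn.contDiffAt (hΩ.mem_nhds hz)

lemma eventually_norm {z : ℂ} (hz : z ∈ Ω) : ∀ᶠ w in 𝓝 z, ‖v w‖ = 1 := by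
  filter_upwards [hΩ.mem_nhds hz] with w hw using hv.norm_eq_one w hw

lemma contDiffOn_current (w : ℂ) : ContDiffOn ℝ 1 (fun z => current v z w) Ω := by
  have h1 : ContDiffOn ℝ 1 (fun z => fderiv ℝ v z w) Ω :=
    (hv.contDiffOn.fderiv_of_isOpen hΩ (m := 1) (by norm_num)).clm_apply contDiffOn_const
  have h2 : ContDiffOn ℝ 1 (fun z => (v z)⁻¹) Ω :=
    (hv.contDiffOn.of_le (by norm_num)).inv fun z hz => hv.ne_zero hz
  exact Complex.imCLM.contDiff.comp_contDiffOn (h2.mul h1)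

lemma fderiv_eq {z : ℂ} (hz : z ∈ Ω) (a : ℂ) :
    (v z)⁻¹ * fderiv ℝ v z a = current v z a * Complex.I := by
  rw [fderiv_eq_current_smul ((hv.contDiffAt hΩ hz).differentiableAt (by simp))
    (hv.eventually_norm hΩ hz)]
  have := hv.ne_zero hz
  field_simp

lemma div_current {z : ℂ} (hz : z ∈ Ω) :
    fderiv ℝ (fun z => current v z 1) z 1
      + fderiv ℝ (fun z => current v z Complex.I) z Complex.I = 0 := by
  have h0 := hv.ne_zero hz
  rw [fderiv_current_apply (hv.contDiffAt hΩ hz) h0, fderiv_current_apply (hv.contDiffAt hΩ hz) h0,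
    hv.fderiv_eq hΩ hz, hv.fderiv_eq hΩ hz]
  have hL := hv.laplacian_eq z hz
  rw [InnerProductSpace.laplacian_eq_iteratedFDeriv_complexPlane] at hL
  simp only [iteratedFDeriv_two_apply, Matrix.cons_val_zero, Matrix.cons_val_one] at hL
  have h1 : (v z)⁻¹ * fderiv ℝ (fderiv ℝ v) z 1 1
      + (v z)⁻¹ * fderiv ℝ (fderiv ℝ v) z Complex.I Complex.I = -((‖grad v z‖ ^ 2 : ℝ) : ℂ) := by
    rw [← mul_add, hL, Complex.real_smul]
    field_simp
  have h2 := congrArg Complex.im h1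
  simp only [Complex.add_im, Complex.neg_im, Complex.ofReal_im, neg_zero] at h2
  simp only [Complex.add_im]
  have h3 : ∀ t : ℝ, (-(t * Complex.I : ℂ) * (t * Complex.I)).im = 0 := fun t => by simp
  rw [h3, h3]
  linarith

lemma curl_current {z : ℂ} (hz : z ∈ Ω) :
    fderiv ℝ (fun z => current v z Complex.I) z 1
      = fderiv ℝ (fun z => current v z 1) z Complex.I := by
  have h0 := hv.ne_zero hz
  rw [fderiv_current_apply (hv.contDiffAt hΩ hz) h0, fderiv_current_apply (hv.contDiffAt hΩ hz) h0]
  have hs : IsSymmSndFDerivAt ℝ v z := (hv.contDiffAt hΩ hz).isSymmSndFDerivAt (by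
    rw [minSmoothness_of_isRCLikeNormedField])
  rw [hs 1 Complex.I]
  ring_nf

/-- The current of a harmonic map is divergence-free. -/
lemma integral_gdot {η : ℂ → ℝ} (hη : ContDiff ℝ 1 η) (hc : HasCompactSupport η)
    (hs : tsupport η ⊆ Ω) : ∫ z, gdot (current v z) (fderiv ℝ η z) = 0 := by
  have h1 := hv.contDiffOn_current hΩ 1
  have h2 := hv.contDiffOn_current hΩ Complex.I
  have e : ∀ z, gdot (current v z) (fderiv ℝ η z)
      = (current v z 1 * fderiv ℝ η z 1 + fderiv ℝ (fun z => current v z 1) z 1 * η z)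
      + (current v z Complex.I * fderiv ℝ η z Complex.I
        + fderiv ℝ (fun z => current v z Complex.I) z Complex.I * η z) := fun z => by
    by_cases hz : z ∈ Ω
    · have := hv.div_current hΩ hz
      rw [gdot]
      linear_combination (-η z) * this
    · rw [gdot, image_eq_zero_of_notMem_tsupport fun h => hz (hs h)]
      ring
  simp_rw [e]
  rw [integral_add (integrable_fderiv_mul_add hΩ h1 hη hc hs 1)
    (integrable_fderiv_mul_add hΩ h2 hη hc hs Complex.I),
    integral_fderiv_mul_add hΩ h1 hη hc hs, integral_fderiv_mul_add hΩ h2 hη hc hs, add_zero]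

/-- The current of a harmonic map is curl-free. -/
lemma integral_curl {η : ℂ → ℝ} (hη : ContDiff ℝ 1 η) (hc : HasCompactSupport η)
    (hs : tsupport η ⊆ Ω) : ∫ z, (current v z 1 * fderiv ℝ η z Complex.I
      - current v z Complex.I * fderiv ℝ η z 1) = 0 := by
  have h1 := hv.contDiffOn_current hΩ 1
  have h2 := hv.contDiffOn_current hΩ Complex.I
  have e : ∀ z, current v z 1 * fderiv ℝ η z Complex.I - current v z Complex.I * fderiv ℝ η z 1
      = (current v z 1 * fderiv ℝ η z Complex.I
          + fderiv ℝ (fun z => current v z 1) z Complex.I * η z)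
      - (current v z Complex.I * fderiv ℝ η z 1
        + fderiv ℝ (fun z => current v z Complex.I) z 1 * η z) := fun z => by
    by_cases hz : z ∈ Ω
    · have := hv.curl_current hΩ hz
      linear_combination (η z) * this
    · rw [image_eq_zero_of_notMem_tsupport fun h => hz (hs h)]
      ring
  simp_rw [e]
  rw [integral_sub (integrable_fderiv_mul_add hΩ h1 hη hc hs Complex.I)
    (integrable_fderiv_mul_add hΩ h2 hη hc hs 1),
    integral_fderiv_mul_add hΩ h1 hη hc hs, integral_fderiv_mul_add hΩ h2 hη hc hs, sub_zero]

end IsHarmonicCircleMap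

/-- The first inner variation of the Dirichlet energy density `|α|²` of a field of linear forms, in
the direction of a vector field with differential `M`. -/
noncomputable def stress (M : ℂ →L[ℝ] ℂ) (α : ℂ →L[ℝ] ℝ) : ℝ :=
  ((M Complex.I).im - (M 1).re) * (α 1 ^ 2 - α Complex.I ^ 2)
    - 2 * ((M Complex.I).re + (M 1).im) * (α 1 * α Complex.I)

lemma stress_eq {f : ℂ → ℂ} {z : ℂ} (hf : DifferentiableAt ℝ f z)
    (h1 : ∀ᶠ w in 𝓝 z, ‖f w‖ = 1) (M : ℂ →L[ℝ] ℂ) :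
    -tr M * ‖grad f z‖ ^ 2 + 2 * inner ℝ (grad f z) (cofac M (grad f z))
      = stress M (current f z) := by
  rw [inner_cofac, norm_grad_sq hf h1, ← real_inner_self_eq_norm_sq, ← real_inner_self_eq_norm_sq,
    inner_grad_apply hf h1, inner_grad_apply hf h1, inner_grad_apply hf h1, dir_zero, dir_one,
    gdot, stress, tr]
  ring

lemma hasFDerivAt_re_im {X : ℂ → ℂ} (hX : Differentiable ℝ X) (z a : ℂ) :
    fderiv ℝ (fun z => (X z).re) z a = (fderiv ℝ X z a).re ∧
    fderiv ℝ (fun z => (X z).im) z a = (fderiv ℝ X z a).im := by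
  constructor
  · rw [show fderiv ℝ (fun z => (X z).re) z = _ from
      (Complex.reCLM.hasFDerivAt.comp z (hX z).hasFDerivAt).fderiv]
    rfl
  · rw [show fderiv ℝ (fun z => (X z).im) z = _ from
      (Complex.imCLM.hasFDerivAt.comp z (hX z).hasFDerivAt).fderiv]
    rfl

/-- A harmonic map without singularities is critical under inner variations. -/
lemma IsHarmonicCircleMap.integral_stress {Ω : Set ℂ} {v : ℂ → ℂ} (hv : IsHarmonicCircleMap Ω v)
    (hΩ : IsOpen Ω) {X : ℂ → ℂ} (hX : ContDiff ℝ ∞ X) (hc : HasCompactSupport X)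
    (hs : tsupport X ⊆ Ω) : ∫ z, stress (fderiv ℝ X z) (current v z) = 0 := by
  have h1 := hv.contDiffOn_current hΩ 1
  have h2 := hv.contDiffOn_current hΩ Complex.I
  have hA : ContDiffOn ℝ 1 (fun z => current v z 1 ^ 2 - current v z Complex.I ^ 2) Ω :=
    (h1.pow 2).sub (h2.pow 2)
  have hB : ContDiffOn ℝ 1 (fun z => current v z 1 * current v z Complex.I) Ω := h1.mul h2
  have hX1 : ContDiff ℝ 1 (fun z => (X z).re) :=
    Complex.reCLM.contDiff.comp (hX.of_le (by exact_mod_cast le_top))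
  have hX2 : ContDiff ℝ 1 (fun z => (X z).im) :=
    Complex.imCLM.contDiff.comp (hX.of_le (by exact_mod_cast le_top))
  have hc1 : HasCompactSupport (fun z => (X z).re) := hc.comp_left (g := Complex.re) rfl
  have hc2 : HasCompactSupport (fun z => (X z).im) := hc.comp_left (g := Complex.im) rfl
  have hs1 : tsupport (fun z => (X z).re) ⊆ Ω :=
    (closure_mono (Function.support_comp_subset (g := Complex.re) rfl X)).trans hs
  have hs2 : tsupport (fun z => (X z).im) ⊆ Ω :=
    (closure_mono (Function.support_comp_subset (g := Complex.im) rfl X)).trans hs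
  have hXd : Differentiable ℝ X := hX.differentiable (by simp)
  set A : ℂ → ℝ := fun z => current v z 1 ^ 2 - current v z Complex.I ^ 2 with hAdef
  set B : ℂ → ℝ := fun z => current v z 1 * current v z Complex.I with hBdef
  have e : ∀ z, stress (fderiv ℝ X z) (current v z)
      = ((A z * fderiv ℝ (fun z => (X z).im) z Complex.I + fderiv ℝ A z Complex.I * (X z).im)
        - (A z * fderiv ℝ (fun z => (X z).re) z 1 + fderiv ℝ A z 1 * (X z).re))
      - 2 * ((B z * fderiv ℝ (fun z => (X z).re) z Complex.I
          + fderiv ℝ B z Complex.I * (X z).re)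
        + (B z * fderiv ℝ (fun z => (X z).im) z 1 + fderiv ℝ B z 1 * (X z).im)) := fun z => by
    rw [(hasFDerivAt_re_im hXd z 1).1, (hasFDerivAt_re_im hXd z 1).2,
      (hasFDerivAt_re_im hXd z Complex.I).1, (hasFDerivAt_re_im hXd z Complex.I).2]
    by_cases hz : z ∈ Ω
    · have k1 := ((h1.differentiableOn (by simp)).differentiableAt
        (hΩ.mem_nhds hz)).hasFDerivAt
      have k2 := ((h2.differentiableOn (by simp)).differentiableAt
        (hΩ.mem_nhds hz)).hasFDerivAt
      have kA : HasFDerivAt A _ z := (k1.pow 2).sub (k2.pow 2)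
      have kB : HasFDerivAt B _ z := k1.mul k2
      have hd := hv.div_current hΩ hz
      have hcurl := hv.curl_current hΩ hz
      rw [kA.fderiv, kB.fderiv]
      simp only [sub_apply, add_apply, smul_apply, smul_eq_mul, stress, hAdef, hBdef]
      rw [hcurl]
      have hd' : fderiv ℝ (fun z => current v z Complex.I) z Complex.I
        = -fderiv ℝ (fun z => current v z 1) z 1 := by linarith
      rw [hd']
      simp
      ring
    · rw [image_eq_zero_of_notMem_tsupport fun h => hz (hs h)]
      simp only [stress, hAdef, hBdef, Complex.zero_re, Complex.zero_im]
      ring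
  simp_rw [e]
  have I1 := integrable_fderiv_mul_add hΩ hA hX2 hc2 hs2 Complex.I
  have I2 := integrable_fderiv_mul_add hΩ hA hX1 hc1 hs1 1
  have I3 := integrable_fderiv_mul_add hΩ hB hX1 hc1 hs1 Complex.I
  have I4 := integrable_fderiv_mul_add hΩ hB hX2 hc2 hs2 1
  have I34 := (I3.add I4).const_mul 2
  have I12 := I1.sub I2
  simp only [Pi.add_apply] at I34
  rw [show (fun z => A z * fderiv ℝ (fun z => (X z).im) z Complex.I
      + fderiv ℝ A z Complex.I * (X z).im) - (fun z => A z * fderiv ℝ (fun z => (X z).re) z 1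
      + fderiv ℝ A z 1 * (X z).re) = fun z => (A z * fderiv ℝ (fun z => (X z).im) z Complex.I
      + fderiv ℝ A z Complex.I * (X z).im) - (A z * fderiv ℝ (fun z => (X z).re) z 1
      + fderiv ℝ A z 1 * (X z).re) from rfl] at I12
  rw [integral_sub I12 I34, integral_const_mul, integral_add I3 I4, integral_sub I1 I2,
    integral_fderiv_mul_add hΩ hA hX2 hc2 hs2, integral_fderiv_mul_add hΩ hA hX1 hc1 hs1,
    integral_fderiv_mul_add hΩ hB hX1 hc1 hs1, integral_fderiv_mul_add hΩ hB hX2 hc2 hs2]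
  simp

/-- `u` is the singular harmonic map with singular set `(x, d)` and regular part `v`. -/
structure IsSingularWith {n : ℕ} (Ω : Set ℂ) (x : Fin n → ℂ) (d : Fin n → ℤ) (u v : ℂ → ℂ) :
    Prop where
  harmonic : IsHarmonicCircleMap Ω v
  eq_mul : ∀ z ∈ Ω \ range x, u z = (∏ j, ((z - x j) / (‖z - x j‖ : ℂ)) ^ d j) * v z

lemma integrableOn_rot (x : ℂ) (R : ℝ) : IntegrableOn (rot x) (Metric.ball x R) :=
  (integrableOn_inv_norm x R).mono' (measurable_rot x).aestronglyMeasurable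
    (Eventually.of_forall fun z => norm_rot_le x z)

lemma locallyIntegrable_rot (x : ℂ) : LocallyIntegrable (rot x) := fun z =>
  ⟨Metric.ball x (‖z - x‖ + 1), Metric.isOpen_ball.mem_nhds (by
    rw [Metric.mem_ball, dist_eq_norm]; linarith), integrableOn_rot x _⟩

/-- The product of an integrable field of linear forms by a continuous compactly supported
function. -/
lemma integrable_clm_mul {F : ℂ → ℂ →L[ℝ] ℝ} (hF : LocallyIntegrable F) {f : ℂ → ℝ}
    (hf : Continuous f) (hc : HasCompactSupport f) (w : ℂ) :
    Integrable (fun z => F z w * f z) := by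
  have h1 := hF.integrable_smul_left_of_hasCompactSupport hf hc
  have h2 := (ContinuousLinearMap.apply ℝ ℝ w).integrable_comp h1
  refine h2.congr (Eventually.of_forall fun z => ?_)
  simp [mul_comm]

namespace IsSingularWith

variable {n : ℕ} {Ω : Set ℂ} {x : Fin n → ℂ} {d : Fin n → ℤ} {u v : ℂ → ℂ}
  (h : IsSingularWith Ω x d u v) (hΩ : IsOpen Ω)

omit h in
lemma ne_of_notMem_range {z : ℂ} (hz : z ∉ range x) (j : Fin n) : z ≠ x j := fun he =>
  hz ⟨j, he.symm⟩

include hΩ in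
omit h in
lemma isOpen_diff : IsOpen (Ω \ range x) := hΩ.sdiff (finite_range x).isClosed

include h hΩ

lemma eventuallyEq {z : ℂ} (hz : z ∈ Ω \ range x) :
    u =ᶠ[𝓝 z] fun z => (∏ j, ((z - x j) / (‖z - x j‖ : ℂ)) ^ d j) * v z := by
  filter_upwards [(isOpen_diff hΩ).mem_nhds hz] with w hw using h.eq_mul w hw

omit hΩ in
lemma norm_eq_one {z : ℂ} (hz : z ∈ Ω \ range x) : ‖u z‖ = 1 := by
  rw [h.eq_mul z hz, norm_mul, h.harmonic.norm_eq_one z hz.1, norm_prod]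
  simp_rw [norm_zpow]
  rw [Finset.prod_eq_one fun j _ => ?_, one_mul]
  rw [norm_unit (ne_of_notMem_range hz.2 j), one_zpow]

lemma eventually_norm {z : ℂ} (hz : z ∈ Ω \ range x) : ∀ᶠ w in 𝓝 z, ‖u w‖ = 1 := by
  filter_upwards [(isOpen_diff hΩ).mem_nhds hz] with w hw using h.norm_eq_one hw

lemma contDiffAt {z : ℂ} (hz : z ∈ Ω \ range x) : ContDiffAt ℝ 2 u z := by
  refine ContDiffAt.congr_of_eventuallyEq ?_ (h.eventuallyEq hΩ hz)
  refine ContDiffAt.mul ?_ (h.harmonic.contDiffAt hΩ hz.1)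
  refine contDiffAt_prod fun j _ => ?_
  exact (ContDiffAt.zpow_complex (contDiffAt_unit (ne_of_notMem_range hz.2 j))
    (unit_ne_zero (ne_of_notMem_range hz.2 j)) (d j)).of_le (by
      exact ENat.LEInfty.out)

lemma differentiableAt {z : ℂ} (hz : z ∈ Ω \ range x) : DifferentiableAt ℝ u z :=
  (h.contDiffAt hΩ hz).differentiableAt (by simp)

lemma current_eq {z : ℂ} (hz : z ∈ Ω \ range x) :
    current u z = ∑ j, (d j : ℝ) • rot (x j) z + current v z := by
  have hne := ne_of_notMem_range hz.2
  have hd : ∀ j, DifferentiableAt ℝ (fun w => ((w - x j) / (‖w - x j‖ : ℂ)) ^ d j) z := fun j =>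
    (ContDiffAt.zpow_complex (contDiffAt_unit (hne j)) (unit_ne_zero (hne j))
      (d j)).differentiableAt (by simp)
  have h0 : ∀ j, ((z - x j) / (‖z - x j‖ : ℂ)) ^ d j ≠ 0 := fun j =>
    zpow_ne_zero _ (unit_ne_zero (hne j))
  rw [current_congr (h.eventuallyEq hΩ hz), current_mul ?_
    ((h.harmonic.contDiffAt hΩ hz.1).differentiableAt (by simp))
    (Finset.prod_ne_zero_iff.2 fun j _ => h0 j) (h.harmonic.ne_zero hz.1), current_prod _ hd h0]
  · congr 1
    refine Finset.sum_congr rfl fun j _ => ?_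
    rw [current_zpow ((contDiffAt_unit (hne j)).differentiableAt (by simp))
      (unit_ne_zero (hne j)), current_unit (hne j)]
  · exact (contDiffAt_prod fun j _ => ContDiffAt.zpow_complex (contDiffAt_unit (hne j))
      (unit_ne_zero (hne j)) (d j)).differentiableAt (by simp)

omit h hΩ in
lemma ae_notMem_range : ∀ᵐ z : ℂ, z ∉ range x :=
  (finite_range x).measure_zero volume |> compl_mem_ae_iff.2

lemma continuousOn_current : ContinuousOn (current u) (Ω \ range x) := fun z hz => by
  have h1 := h.contDiffAt hΩ hz
  have h2 : ContinuousAt (fderiv ℝ u) z :=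
    (h1.fderiv_right (m := 1) (by norm_num)).continuousAt
  have h3 : ContinuousAt (fun z => (u z)⁻¹) z := h1.continuousAt.inv₀ (by
    rw [← norm_ne_zero_iff, h.norm_eq_one hz]; norm_num)
  have h4 : ContinuousAt (fun z => (u z)⁻¹ • fderiv ℝ u z) z := h3.smul h2
  exact ((ContinuousLinearMap.compL ℝ ℂ ℂ ℝ Complex.imCLM).continuous.continuousAt.comp
    h4).continuousWithinAt

/-- The current of a singular harmonic map is divergence-free in the sense of distributions,
including at the singularities. -/
lemma integral_gdot {η : ℂ → ℝ} (hη : ContDiff ℝ 1 η) (hc : HasCompactSupport η)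
    (hs : tsupport η ⊆ Ω) : ∫ z, gdot (current u z) (fderiv ℝ η z) = 0 := by
  have hcf : ∀ w, Continuous (fun z => fderiv ℝ η z w) := fun w =>
    (hη.continuous_fderiv (by simp)).clm_apply continuous_const
  have hi : ∀ j, Integrable (fun z => (d j : ℝ) * gdot (rot (x j) z) (fderiv ℝ η z)) := fun j =>
    ((integrable_clm_mul (locallyIntegrable_rot (x j)) (hcf 1) (hc.fderiv_apply ℝ 1) 1).add
      (integrable_clm_mul (locallyIntegrable_rot (x j)) (hcf Complex.I)
        (hc.fderiv_apply ℝ Complex.I) Complex.I)).const_mul _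
  have hv : Integrable (fun z => gdot (current v z) (fderiv ℝ η z)) :=
    (integrable_mul_of_tsupport_subset hΩ (h.harmonic.contDiffOn_current hΩ 1).continuousOn
      (hcf 1) (hc.fderiv_apply ℝ 1) ((tsupport_fderiv_apply_subset ℝ 1).trans hs)).add
    (integrable_mul_of_tsupport_subset hΩ
      (h.harmonic.contDiffOn_current hΩ Complex.I).continuousOn
      (hcf Complex.I) (hc.fderiv_apply ℝ Complex.I)
      ((tsupport_fderiv_apply_subset ℝ Complex.I).trans hs))
  have e : ∀ᵐ z, gdot (current u z) (fderiv ℝ η z)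
      = ∑ j, (d j : ℝ) * gdot (rot (x j) z) (fderiv ℝ η z)
        + gdot (current v z) (fderiv ℝ η z) := by
    filter_upwards [ae_notMem_range (x := x)] with z hz
    by_cases hzΩ : z ∈ Ω
    · rw [h.current_eq hΩ ⟨hzΩ, hz⟩, gdot_add_left]
      congr 1
      simp only [gdot, sum_apply, smul_apply, smul_eq_mul, Finset.sum_mul,
        ← Finset.sum_add_distrib]
      exact Finset.sum_congr rfl fun j _ => by ring
    · have : fderiv ℝ η z = 0 := Function.notMem_support.1 fun hz' =>
        hzΩ (hs (support_fderiv_subset ℝ hz'))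
      simp [this, gdot_zero_right]
  rw [integral_congr_ae e, integral_add (integrable_finsetSum _ fun j _ => hi j) hv,
    integral_finsetSum _ fun j _ => hi j, h.harmonic.integral_gdot hΩ hη hc hs]
  simp_rw [integral_const_mul, integral_gdot_rot hη hc]
  simp

/-- The curl of the current of a singular harmonic map counts its singularities. -/
lemma integral_curl {η : ℂ → ℝ} (hη : ContDiff ℝ 1 η) (hc : HasCompactSupport η)
    (hs : tsupport η ⊆ Ω) : ∫ z, (current u z 1 * fderiv ℝ η z Complex.I
      - current u z Complex.I * fderiv ℝ η z 1) = 2 * Real.pi * ∑ j, d j * η (x j) := by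
  have hcf : ∀ w, Continuous (fun z => fderiv ℝ η z w) := fun w =>
    (hη.continuous_fderiv (by simp)).clm_apply continuous_const
  have hi : ∀ j, Integrable (fun z => (d j : ℝ) * (rot (x j) z 1 * fderiv ℝ η z Complex.I
      - rot (x j) z Complex.I * fderiv ℝ η z 1)) := fun j =>
    ((integrable_clm_mul (locallyIntegrable_rot (x j)) (hcf Complex.I)
        (hc.fderiv_apply ℝ Complex.I) 1).sub
      (integrable_clm_mul (locallyIntegrable_rot (x j)) (hcf 1)
        (hc.fderiv_apply ℝ 1) Complex.I)).const_mul _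
  have hv : Integrable (fun z => current v z 1 * fderiv ℝ η z Complex.I
      - current v z Complex.I * fderiv ℝ η z 1) :=
    (integrable_mul_of_tsupport_subset hΩ (h.harmonic.contDiffOn_current hΩ 1).continuousOn
      (hcf Complex.I) (hc.fderiv_apply ℝ Complex.I)
      ((tsupport_fderiv_apply_subset ℝ Complex.I).trans hs)).sub
    (integrable_mul_of_tsupport_subset hΩ
      (h.harmonic.contDiffOn_current hΩ Complex.I).continuousOn
      (hcf 1) (hc.fderiv_apply ℝ 1) ((tsupport_fderiv_apply_subset ℝ 1).trans hs))
  have e : ∀ᵐ z, current u z 1 * fderiv ℝ η z Complex.I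
      - current u z Complex.I * fderiv ℝ η z 1
      = ∑ j, (d j : ℝ) * (rot (x j) z 1 * fderiv ℝ η z Complex.I
          - rot (x j) z Complex.I * fderiv ℝ η z 1)
        + (current v z 1 * fderiv ℝ η z Complex.I
          - current v z Complex.I * fderiv ℝ η z 1) := by
    filter_upwards [ae_notMem_range (x := x)] with z hz
    by_cases hzΩ : z ∈ Ω
    · rw [h.current_eq hΩ ⟨hzΩ, hz⟩]
      simp only [add_apply, sum_apply, smul_apply, smul_eq_mul, mul_sub,
        Finset.sum_sub_distrib, add_mul, Finset.sum_mul, mul_assoc]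
      ring
    · have : fderiv ℝ η z = 0 := Function.notMem_support.1 fun hz' =>
        hzΩ (hs (support_fderiv_subset ℝ hz'))
      simp [this]
  rw [integral_congr_ae e, integral_add (integrable_finsetSum _ fun j _ => hi j) hv,
    integral_finsetSum _ fun j _ => hi j, h.harmonic.integral_curl hΩ hη hc hs, add_zero,
    Finset.mul_sum]
  refine Finset.sum_congr rfl fun j _ => ?_
  rw [integral_const_mul, integral_curl_rot hη hc]
  ring

end IsSingularWith


/-! ### Mollification -/

/-- A sequence of bumps at the origin of radius `1 / (k + 1)`. -/
noncomputable def bump (k : ℕ) : ContDiffBump (0 : ℂ) where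
  rIn := 1 / (2 * (k + 1))
  rOut := 1 / (k + 1)
  rIn_pos := by positivity
  rIn_lt_rOut := by
    apply one_div_lt_one_div_of_lt <;> linarith [(Nat.cast_nonneg k : (0 : ℝ) ≤ k)]

/-- The mollification of `h` at scale `1 / (k + 1)`. -/
noncomputable def moll {F : Type*} [NormedAddCommGroup F] [NormedSpace ℝ F] (k : ℕ) (h : ℂ → F) :
    ℂ → F :=
  convolution ((bump k).normed volume) h (ContinuousLinearMap.lsmul ℝ ℝ) volume

section

variable {F : Type*} [NormedAddCommGroup F] [NormedSpace ℝ F] {h : ℂ → F}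

lemma moll_apply (k : ℕ) (h : ℂ → F) (z : ℂ) :
    moll k h z = ∫ t, (bump k).normed volume t • h (z - t) := rfl

lemma integrable_moll_apply (hh : LocallyIntegrable h) (k : ℕ) (z : ℂ) :
    Integrable (fun t => (bump k).normed volume t • h (z - t)) :=
  HasCompactSupport.convolutionExists_left (ContinuousLinearMap.lsmul ℝ ℝ)
    (bump k).hasCompactSupport_normed (bump k).continuous_normed hh z

lemma contDiff_moll (hh : LocallyIntegrable h) (k : ℕ) [CompleteSpace F] :
    ContDiff ℝ ∞ (moll k h) :=
  HasCompactSupport.contDiff_convolution_left _ (bump k).hasCompactSupport_normed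
    (bump k).contDiff_normed hh

lemma ae_tendsto_moll [CompleteSpace F] (hh : LocallyIntegrable h) :
    ∀ᵐ z, Tendsto (fun k => moll k h z) atTop (𝓝 (h z)) := by
  refine ContDiffBump.ae_convolution_tendsto_right_of_locallyIntegrable (K := 2)
    tendsto_one_div_add_atTop_nhds_zero_nat (Eventually.of_forall fun k => ?_) hh
  change 1 / ((k : ℝ) + 1) ≤ 2 * (1 / (2 * (k + 1)))
  apply le_of_eq
  field_simp

end

lemma norm_sq_moll_le {h : ℂ → ℂ} (hh : MemLp h 2) (k : ℕ) (z : ℂ) :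
    ‖moll k h z‖ ^ 2 ≤ moll k (fun z => ‖h z‖ ^ 2) z := by
  have i1 := integrable_moll_apply (hh.locallyIntegrable (by norm_num)) k z
  have i2 := integrable_moll_apply (hh.integrable_norm_pow (by norm_num)).locallyIntegrable k z
  have i3 : Integrable ((bump k).normed volume) := (bump k).integrable_normed
  set c := moll k h z with hc
  -- the variance of `h` with respect to the probability density of the bump is nonnegative
  have h0 : 0 ≤ ∫ t, ((bump k).normed volume t • ‖h (z - t)‖ ^ 2
      - 2 * inner ℝ c ((bump k).normed volume t • h (z - t))
      + ‖c‖ ^ 2 * (bump k).normed volume t) := by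
    refine integral_nonneg fun t => ?_
    have e : (bump k).normed volume t • ‖h (z - t)‖ ^ 2
        - 2 * inner ℝ c ((bump k).normed volume t • h (z - t))
        + ‖c‖ ^ 2 * (bump k).normed volume t
        = (bump k).normed volume t * ‖h (z - t) - c‖ ^ 2 := by
      rw [norm_sub_sq_real, real_inner_smul_right, real_inner_comm, smul_eq_mul]
      ring
    show 0 ≤ _
    rw [e]
    exact mul_nonneg ((bump k).nonneg_normed t) (by positivity)
  have i4 : Integrable (fun t => inner ℝ c ((bump k).normed volume t • h (z - t))) :=
    (innerSL ℝ c).integrable_comp i1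
  have e4 : ∫ t, inner ℝ c ((bump k).normed volume t • h (z - t)) = ‖c‖ ^ 2 := by
    rw [integral_inner i1, ← moll_apply, ← hc, real_inner_self_eq_norm_sq]
  have i5 : Integrable (fun t => (bump k).normed volume t • ‖h (z - t)‖ ^ 2
      - 2 * inner ℝ c ((bump k).normed volume t • h (z - t))) := i2.sub (i4.const_mul 2)
  rw [integral_add i5 (i3.const_mul _), integral_sub i2 (i4.const_mul 2), integral_const_mul,
    integral_const_mul, e4, (bump k).integral_normed] at h0
  rw [moll_apply]
  linarith

lemma integrable_moll {g : ℂ → ℝ} (hg : Integrable g) (k : ℕ) : Integrable (moll k g) :=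
  (bump k).integrable_normed.integrable_convolution _ hg

/-- Convergence almost everywhere of nonnegative functions of constant integral is convergence in
mean. -/
lemma tendsto_integral_abs_sub_of_integral_eq {α : Type*} [MeasurableSpace α] {μ : Measure α}
    {f : ℕ → α → ℝ} {g : α → ℝ} (hf : ∀ k, Integrable (f k) μ) (hg : Integrable g μ)
    (hf0 : ∀ k z, 0 ≤ f k z) (hg0 : ∀ z, 0 ≤ g z) (he : ∀ k, ∫ z, f k z ∂μ = ∫ z, g z ∂μ)
    (hae : ∀ᵐ z ∂μ, Tendsto (fun k => f k z) atTop (𝓝 (g z))) :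
    Tendsto (fun k => ∫ z, |f k z - g z| ∂μ) atTop (𝓝 0) := by
  have l : Tendsto (fun k => ∫ z, max (g z - f k z) 0 ∂μ) atTop (𝓝 (∫ _, (0 : ℝ) ∂μ)) := by
    refine tendsto_integral_of_dominated_convergence g (fun k => ?_) hg (fun k => ?_) ?_
    · exact (hg.sub (hf k)).aestronglyMeasurable.sup aestronglyMeasurable_const
    · refine Eventually.of_forall fun z => ?_
      rw [Real.norm_eq_abs, abs_of_nonneg (le_max_right _ _)]
      exact max_le (by linarith [hf0 k z]) (hg0 z)
    · filter_upwards [hae] with z hz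
      have := ((tendsto_const_nhds (x := g z)).sub hz).max (tendsto_const_nhds (x := (0 : ℝ)))
      simpa using this
  rw [integral_zero] at l
  have l2 := l.const_mul 2
  rw [mul_zero] at l2
  refine l2.congr fun k => ?_
  have i2 : Integrable (fun z => max (g z - f k z) 0) μ := (hg.sub (hf k)).pos_part
  have e : ∀ z, |f k z - g z| = (f k z - g z) + 2 * max (g z - f k z) 0 := by
    intro z
    rcases le_total (f k z) (g z) with h | h
    · rw [abs_of_nonpos (by linarith), max_eq_left (by linarith)]; ring
    · rw [abs_of_nonneg (by linarith), max_eq_right (by linarith)]; ring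
  simp_rw [e]
  have i3 : Integrable (fun z => f k z - g z) μ := (hf k).sub hg
  rw [integral_add i3 (i2.const_mul 2), integral_sub (hf k) hg, he, integral_const_mul]
  ring

lemma tendsto_integral_abs_moll_sub {g : ℂ → ℝ} (hg : Integrable g) (h0 : ∀ z, 0 ≤ g z) :
    Tendsto (fun k => ∫ z, |moll k g z - g z|) atTop (𝓝 0) := by
  refine tendsto_integral_abs_sub_of_integral_eq (fun k => integrable_moll hg k) hg
    (fun k z => ?_) h0 (fun k => ?_) (ae_tendsto_moll hg.locallyIntegrable)
  · rw [moll_apply]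
    exact integral_nonneg fun t => mul_nonneg ((bump k).nonneg_normed t) (h0 _)
  · have := integral_convolution (ContinuousLinearMap.lsmul ℝ ℝ) (μ := (volume : Measure ℂ))
      (ν := (volume : Measure ℂ)) (f := (bump k).normed volume) (bump k).integrable_normed hg
    rw [(bump k).integral_normed] at this
    simpa [moll] using this

lemma abs_inner_moll_le {h g : ℂ → ℂ} (hh : MemLp h 2) (k : ℕ) (z : ℂ) :
    |inner ℝ (moll k h z) (g z)| ≤ (‖h z‖ ^ 2 + ‖g z‖ ^ 2)
      + |moll k (fun z => ‖h z‖ ^ 2) z - ‖h z‖ ^ 2| := by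
  have h1 := abs_real_inner_le_norm (moll k h z) (g z)
  have h3 := norm_sq_moll_le hh k z
  have h4 := le_abs_self (moll k (fun z => ‖h z‖ ^ 2) z - ‖h z‖ ^ 2)
  have h5 : ‖moll k h z‖ * ‖g z‖ ≤ ‖moll k h z‖ ^ 2 + ‖g z‖ ^ 2 := by
    nlinarith [sq_nonneg (‖moll k h z‖ - ‖g z‖), sq_nonneg (‖moll k h z‖), sq_nonneg ‖g z‖]
  linarith

lemma aestronglyMeasurable_inner_moll {h g : ℂ → ℂ} (hh : MemLp h 2) (hg : MemLp g 2) (k : ℕ) :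
    AEStronglyMeasurable (fun z => inner ℝ (moll k h z) (g z)) := by
  have hm : AEStronglyMeasurable (moll k h) :=
    (contDiff_moll (hh.locallyIntegrable (by norm_num)) k).continuous.aestronglyMeasurable
  exact hm.inner hg.aestronglyMeasurable

lemma integrable_inner_moll {h g : ℂ → ℂ} (hh : MemLp h 2) (hg : MemLp g 2) (k : ℕ) :
    Integrable (fun z => inner ℝ (moll k h z) (g z)) := by
  have h2 : Integrable (fun z => ‖h z‖ ^ 2) := hh.integrable_norm_pow (by norm_num)
  have g2 : Integrable (fun z => ‖g z‖ ^ 2) := hg.integrable_norm_pow (by norm_num)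
  have hE : Integrable (fun z => |moll k (fun z => ‖h z‖ ^ 2) z - ‖h z‖ ^ 2|) :=
    ((integrable_moll h2 k).sub h2).abs
  have hD : Integrable (fun z => (‖h z‖ ^ 2 + ‖g z‖ ^ 2)
      + |moll k (fun z => ‖h z‖ ^ 2) z - ‖h z‖ ^ 2|) := (h2.add g2).add hE
  exact hD.mono' (aestronglyMeasurable_inner_moll hh hg k)
    (Eventually.of_forall fun z => abs_inner_moll_le hh k z)

/-- Mollification converges weakly in `L²`. -/
lemma tendsto_integral_inner_moll {h g : ℂ → ℂ} (hh : MemLp h 2) (hg : MemLp g 2) :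
    Tendsto (fun k => ∫ z, inner ℝ (moll k h z) (g z)) atTop (𝓝 (∫ z, inner ℝ (h z) (g z))) := by
  have hl := hh.locallyIntegrable (by norm_num)
  have h2 : Integrable (fun z => ‖h z‖ ^ 2) := hh.integrable_norm_pow (by norm_num)
  have g2 : Integrable (fun z => ‖g z‖ ^ 2) := hg.integrable_norm_pow (by norm_num)
  have hE : ∀ k, Integrable (fun z => |moll k (fun z => ‖h z‖ ^ 2) z - ‖h z‖ ^ 2|) := fun k =>
    ((integrable_moll h2 k).sub h2).abs
  have hEa : ∀ᵐ z, Tendsto (fun k => |moll k (fun z => ‖h z‖ ^ 2) z - ‖h z‖ ^ 2|) atTop (𝓝 0) := by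
    filter_upwards [ae_tendsto_moll h2.locallyIntegrable] with z hz
    have h0 : |‖h z‖ ^ 2 - ‖h z‖ ^ 2| = 0 := by rw [sub_self, abs_zero]
    rw [← h0]
    exact (Tendsto.sub_const hz (‖h z‖ ^ 2)).abs
  have hfa : ∀ᵐ z, Tendsto (fun k => inner ℝ (moll k h z) (g z)) atTop
      (𝓝 (inner ℝ (h z) (g z))) := by
    filter_upwards [ae_tendsto_moll hl] with z hz
    exact hz.inner tendsto_const_nhds
  have hDi : Integrable (fun z => ‖h z‖ ^ 2 + ‖g z‖ ^ 2) := h2.add g2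
  exact tendsto_integral_of_dominated_add (f := fun k z => inner ℝ (moll k h z) (g z))
    (g := fun z => inner ℝ (h z) (g z)) (D := fun z => ‖h z‖ ^ 2 + ‖g z‖ ^ 2)
    (E := fun k z => |moll k (fun z => ‖h z‖ ^ 2) z - ‖h z‖ ^ 2|)
    (aestronglyMeasurable_inner_moll hh hg) hDi hE
    (fun z => by positivity) (fun k z => abs_nonneg _)
    (fun k => Eventually.of_forall (abs_inner_moll_le hh k))
    (tendsto_integral_abs_moll_sub h2 fun z => by positivity) hEa hfa

/-- Away from the boundary, mollification commutes with weak derivatives. -/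
lemma fderiv_moll {Ω : Set ℂ} (hΩ : MeasurableSet Ω) {u : ℂ → ℂ} {G : ℂ → Grad}
    (hu : HasWeakGrad Ω u G) (hl : LocallyIntegrable (Ω.indicator u)) {k : ℕ} {z : ℂ}
    (hz : Metric.closedBall z (1 / (k + 1)) ⊆ Ω) (i : Fin 2) :
    fderiv ℝ (moll k (Ω.indicator u)) z (dir i) = moll k (Ω.indicator fun z => G z i) z := by
  set φ := (bump k).normed volume with hφ
  have hφd : ContDiff ℝ ∞ φ := (bump k).contDiff_normed
  have hφc : HasCompactSupport φ := (bump k).hasCompactSupport_normed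
  have h1 := hφc.hasFDerivAt_convolution_left (ContinuousLinearMap.lsmul ℝ ℝ) (μ := volume)
    (hφd.of_le (by exact ENat.LEInfty.out)) hl z
  have h2 : fderiv ℝ (moll k (Ω.indicator u)) z (dir i)
      = ∫ t, fderiv ℝ φ t (dir i) • Ω.indicator u (z - t) := by
    rw [show fderiv ℝ (moll k (Ω.indicator u)) z = _ from h1.fderiv, convolution,
      ContinuousLinearMap.integral_apply]
    · rfl
    · exact HasCompactSupport.convolutionExists_left _ (hφc.fderiv ℝ)
        (hφd.continuous_fderiv (by simp)) hl z
  have hdη : ∀ t, fderiv ℝ (fun t => φ (z - t)) t (dir i) = -fderiv ℝ φ (z - t) (dir i) :=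
    fun t => by
    have := (hφd.differentiable (by simp) (z - t)).hasFDerivAt.comp t
      ((hasFDerivAt_id t).const_sub z)
    rw [show fderiv ℝ (fun t => φ (z - t)) t = _ from this.fderiv]
    simp
  have hsupp : tsupport (fun t => φ (z - t)) ⊆ Ω := by
    refine Subset.trans ?_ hz
    refine closure_minimal (fun t ht => ?_) Metric.isClosed_closedBall
    have : z - t ∈ Function.support φ := ht
    rw [hφ, (bump k).support_normed_eq, Metric.mem_ball, dist_zero_right] at this
    rw [Metric.mem_closedBall, dist_comm, dist_eq_norm]
    exact this.le
  have hcη : HasCompactSupport (fun t => φ (z - t)) := by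
    refine HasCompactSupport.of_support_subset_isCompact (isCompact_closedBall z (1 / (k + 1)))
      fun t ht => ?_
    have : z - t ∈ Function.support φ := ht
    rw [hφ, (bump k).support_normed_eq, Metric.mem_ball, dist_zero_right] at this
    rw [Metric.mem_closedBall, dist_comm, dist_eq_norm]
    exact this.le
  have h3 := hu.integral_eq (fun t => φ (z - t)) (hφd.comp (contDiff_const.sub contDiff_id)) hcη
    hsupp i
  simp_rw [hdη, neg_smul] at h3
  rw [integral_neg, neg_inj] at h3
  rw [h2, moll_apply, ← integral_sub_left_eq_self _ volume z,
    ← integral_sub_left_eq_self (fun t => φ t • _) volume z]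
  simp only [sub_sub_cancel]
  rw [← integral_indicator hΩ, ← integral_indicator hΩ] at h3
  refine Eq.trans ?_ (h3.trans ?_)
  · refine integral_congr_ae (Eventually.of_forall fun t => ?_)
    by_cases h : t ∈ Ω <;> simp [h]
  · refine integral_congr_ae (Eventually.of_forall fun t => ?_)
    by_cases h : t ∈ Ω <;> simp [h]


/-! ### The distributional Jacobian of circle valued Sobolev maps -/

/-- Integration by parts against smooth complex valued test functions. -/
lemma HasWeakGrad.integral_inner {Ω : Set ℂ} {u : ℂ → ℂ} {G : ℂ → Grad}
    (hu : HasWeakGrad Ω u G) {ζ : ℂ → ℂ} (hζ : ContDiff ℝ ∞ ζ) (hc : HasCompactSupport ζ)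
    (hs : tsupport ζ ⊆ Ω) (i : Fin 2) :
    ∫ z in Ω, inner ℝ (fderiv ℝ ζ z (dir i)) (u z) = - ∫ z in Ω, inner ℝ (ζ z) (G z i) := by
  have hd : Differentiable ℝ ζ := hζ.differentiable (by simp)
  have hGi : LocallyIntegrableOn (fun z => G z i) Ω :=
    fun z hz => by
      obtain ⟨s, hs, hi⟩ := hu.locInt_grad z hz
      exact ⟨s, hs, (EuclideanSpace.proj (𝕜 := ℂ) i).integrable_comp hi⟩
  -- the two real components
  have key : ∀ P : ℂ →L[ℝ] ℝ,
      Integrable (fun z => P (fderiv ℝ ζ z (dir i)) • u z) (volume.restrict Ω) ∧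
      Integrable (fun z => P (ζ z) • G z i) (volume.restrict Ω) ∧
      ∫ z in Ω, P (fderiv ℝ ζ z (dir i)) • u z = - ∫ z in Ω, P (ζ z) • G z i := fun P => by
    have hη : ContDiff ℝ ∞ (fun z => P (ζ z)) := P.contDiff.comp hζ
    have hcη : HasCompactSupport (fun z => P (ζ z)) := hc.comp_left (map_zero P)
    have hsη : tsupport (fun z => P (ζ z)) ⊆ Ω := (tsupport_comp_subset (map_zero P) ζ).trans hs
    have he : ∀ z, fderiv ℝ (fun z => P (ζ z)) z (dir i) = P (fderiv ℝ ζ z (dir i)) := fun z => by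
      rw [show fderiv ℝ (fun z => P (ζ z)) z = _ from
        (P.hasFDerivAt.comp z (hd z).hasFDerivAt).fderiv]
      rfl
    refine ⟨?_, ?_, ?_⟩
    · simp_rw [← he]
      exact (integrable_smul_of_tsupport_subset
        ((hη.continuous_fderiv (by simp)).clm_apply continuous_const)
        (hcη.fderiv_apply ℝ _) ((tsupport_fderiv_apply_subset ℝ _).trans hsη)
        hu.locInt).integrableOn
    · exact (integrable_smul_of_tsupport_subset hη.continuous hcη hsη hGi).integrableOn
    · simp_rw [← he]
      exact hu.integral_eq _ hη hcη hsη i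
  have e : ∀ a b : ℂ, inner ℝ a b = Complex.reCLM (Complex.reCLM a • b)
      + Complex.imCLM (Complex.imCLM a • b) := fun a b => by
    rw [Complex.inner]; simp; ring
  obtain ⟨a1, a2, a3⟩ := key Complex.reCLM
  obtain ⟨b1, b2, b3⟩ := key Complex.imCLM
  simp_rw [e]
  rw [integral_add (Complex.reCLM.integrable_comp a1) (Complex.imCLM.integrable_comp b1),
    integral_add (Complex.reCLM.integrable_comp a2) (Complex.imCLM.integrable_comp b2),
    Complex.reCLM.integral_comp_comm a1, Complex.reCLM.integral_comp_comm a2,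
    Complex.imCLM.integral_comp_comm b1, Complex.imCLM.integral_comp_comm b2, a3, b3, map_neg,
    map_neg]
  ring

/-- Weak gradients are curl-free. -/
lemma HasWeakGrad.integral_curl {Ω : Set ℂ} {u : ℂ → ℂ} {G : ℂ → Grad}
    (hu : HasWeakGrad Ω u G) {ζ : ℂ → ℂ} (hζ : ContDiff ℝ ∞ ζ) (hc : HasCompactSupport ζ)
    (hs : tsupport ζ ⊆ Ω) :
    ∫ z in Ω, inner ℝ (fderiv ℝ ζ z 1) (G z 1)
      = ∫ z in Ω, inner ℝ (fderiv ℝ ζ z Complex.I) (G z 0) := by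
  have hD : ∀ w, ContDiff ℝ ∞ (fun z => fderiv ℝ ζ z w) := fun w =>
    (hζ.fderiv_right (m := ∞) (by simp)).clm_apply contDiff_const
  have h2 : ∀ z v w, fderiv ℝ (fun z => fderiv ℝ ζ z w) z v = fderiv ℝ (fderiv ℝ ζ) z v w :=
    fun z v w => by
    have h := (((hζ.fderiv_right (m := ∞) (by simp)).differentiable (by simp)) z).hasFDerivAt
    rw [show fderiv ℝ (fun z => fderiv ℝ ζ z w) z = _ from
      (h.clm_apply (hasFDerivAt_const w z)).fderiv]
    simp
  have hsymm : ∀ z v w, fderiv ℝ (fderiv ℝ ζ) z v w = fderiv ℝ (fderiv ℝ ζ) z w v := fun z v w =>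
    (hζ.contDiffAt.isSymmSndFDerivAt (by simp; exact ENat.LEInfty.out)) v w
  have a := hu.integral_inner (hD 1) (hc.fderiv_apply ℝ 1)
    ((tsupport_fderiv_apply_subset ℝ 1).trans hs) 1
  have b := hu.integral_inner (hD Complex.I) (hc.fderiv_apply ℝ Complex.I)
    ((tsupport_fderiv_apply_subset ℝ Complex.I).trans hs) 0
  simp_rw [h2, dir_one] at a
  simp_rw [h2, dir_zero] at b
  simp_rw [hsymm _ Complex.I 1] at a
  rw [a] at b
  exact neg_injective b

lemma integrable_inner_of_memLp {α : Type*} [MeasurableSpace α] {μ : Measure α} {h g : α → ℂ}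
    (hh : MemLp h 2 μ) (hg : MemLp g 2 μ) : Integrable (fun z => inner ℝ (h z) (g z)) μ := by
  have h2 : Integrable (fun z => ‖h z‖ ^ 2) μ := hh.integrable_norm_pow (by norm_num)
  have g2 : Integrable (fun z => ‖g z‖ ^ 2) μ := hg.integrable_norm_pow (by norm_num)
  have hD : Integrable (fun z => ‖h z‖ ^ 2 + ‖g z‖ ^ 2) μ := h2.add g2
  refine hD.mono' (hh.aestronglyMeasurable.inner hg.aestronglyMeasurable)
    (Eventually.of_forall fun z => (abs_real_inner_le_norm (h z) (g z)).trans ?_)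
  nlinarith [sq_nonneg (‖h z‖ - ‖g z‖), sq_nonneg (‖h z‖), sq_nonneg ‖g z‖]

/-- A square integrable function times a bounded continuous one, extended by zero. -/
lemma memLp_indicator_smul {Ω : Set ℂ} (hΩ : MeasurableSet Ω) {g : ℂ → ℂ}
    (hg : MemLp g 2 (volume.restrict Ω)) {η : ℂ → ℝ} (hη : Continuous η)
    (hc : HasCompactSupport η) : MemLp (fun z => η z • Ω.indicator g z) 2 := by
  obtain ⟨B, hB⟩ := hη.bounded_above_of_compact_support hc
  have hg' : MemLp (Ω.indicator g) 2 := (memLp_indicator_iff_restrict hΩ).2 hg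
  have hm : AEStronglyMeasurable (fun z => η z • Ω.indicator g z) :=
    hη.aestronglyMeasurable.smul hg'.aestronglyMeasurable
  refine MemLp.of_le_mul (c := B) hg' hm (Eventually.of_forall fun z => ?_)
  rw [norm_smul]
  exact mul_le_mul_of_nonneg_right (hB z) (norm_nonneg _)


section

variable {Ω : Set ℂ} {u : ℂ → ℂ} {G : ℂ → Grad}

/-- On the support of a test function, mollification commutes with weak derivatives at small
scales. -/
lemma eventually_fderiv_moll (hΩ : IsOpen Ω) (hu : HasWeakGrad Ω u G)
    (hl : LocallyIntegrable (Ω.indicator u)) {K : Set ℂ} (hK : IsCompact K) (hKΩ : K ⊆ Ω) :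
    ∀ᶠ k : ℕ in atTop, ∀ z ∈ K, ∀ i : Fin 2,
      fderiv ℝ (moll k (Ω.indicator u)) z (dir i) = moll k (Ω.indicator fun z => G z i) z := by
  obtain ⟨δ, hδ, hδΩ⟩ := hK.exists_cthickening_subset_open hΩ hKΩ
  filter_upwards [tendsto_one_div_add_atTop_nhds_zero_nat.eventually (gt_mem_nhds hδ)]
    with k hk z hz i
  refine fderiv_moll hΩ.measurableSet hu hl (Subset.trans ?_ hδΩ) i
  exact (Metric.closedBall_subset_closedBall hk.le).trans
    (Metric.closedBall_subset_cthickening hz δ)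

lemma smul_fderiv_eq_zero {η : ℂ → ℝ} {z : ℂ} (hz : z ∉ tsupport η) (w : ℂ) :
    η z = 0 ∧ fderiv ℝ η z w = 0 := by
  refine ⟨image_eq_zero_of_notMem_tsupport hz, ?_⟩
  rw [Function.notMem_support.1 fun h => hz (support_fderiv_subset ℝ h)]
  simp

/-- The product rule for a test function times a mollification, rotated by `c`. -/
lemma fderiv_smul_mul {η : ℂ → ℝ} {w : ℂ → ℂ} {z : ℂ} (hη : DifferentiableAt ℝ η z)
    (hw : DifferentiableAt ℝ w z) (c e : ℂ) :
    fderiv ℝ (fun z => η z • (c * w z)) z e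
      = fderiv ℝ η z e • (c * w z) + η z • (c * fderiv ℝ w z e) := by
  have h := hη.hasFDerivAt.smul (hw.hasFDerivAt.const_mul c)
  rw [show fderiv ℝ (fun z => η z • (c * w z)) z = _ from h.fderiv]
  simp [add_comm]

lemma inner_smul_mul (t : ℝ) (c a b : ℂ) :
    inner ℝ (t • (c * a)) b = inner ℝ a (t • (starRingEnd ℂ c * b)) := by
  simp only [Complex.inner, Complex.real_smul, Complex.mul_re, Complex.mul_im, map_mul,
    Complex.conj_re, Complex.conj_im, Complex.ofReal_re, Complex.ofReal_im]
  ring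

variable (hΩ : IsOpen Ω) (hu : HasWeakGrad Ω u G) (hu2 : MemLp u 2 (volume.restrict Ω))
  (hG2 : MemLp G 2 (volume.restrict Ω)) {η : ℂ → ℝ} (hη : ContDiff ℝ ∞ η)
  (hc : HasCompactSupport η) (hs : tsupport η ⊆ Ω)

include hG2 in
lemma memLp_grad_apply (i : Fin 2) : MemLp (fun z => G z i) 2 (volume.restrict Ω) :=
  (EuclideanSpace.proj (𝕜 := ℂ) i).comp_memLp' hG2

include hΩ hu hu2 hG2 hη hc hs

/-- Integration of the derivative of a mollified circle valued map against a square integrable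
function, in the limit. -/
lemma tendsto_integral_fderiv_moll {g : ℂ → ℂ} (hg : MemLp g 2 (volume.restrict Ω)) (c : ℂ)
    (i : Fin 2) :
    Tendsto (fun k => ∫ z in Ω, inner ℝ (fderiv ℝ (fun z => η z •
        (c * moll k (Ω.indicator u) z)) z (dir i)) (g z)) atTop
      (𝓝 (∫ z in Ω, inner ℝ (fderiv ℝ η z (dir i) • (c * u z) + η z • (c * G z i)) (g z))) := by
  have hUl : MemLp (Ω.indicator u) 2 := (memLp_indicator_iff_restrict hΩ.measurableSet).2 hu2
  have hHl : MemLp (Ω.indicator fun z => G z i) 2 :=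
    (memLp_indicator_iff_restrict hΩ.measurableSet).2 (memLp_grad_apply hG2 i)
  have hl := hUl.locallyIntegrable (by norm_num)
  have hcg : MemLp (fun z => starRingEnd ℂ c * g z) 2 (volume.restrict Ω) := hg.const_mul _
  have g1 := memLp_indicator_smul hΩ.measurableSet hcg
    ((hη.continuous_fderiv (by simp)).clm_apply (continuous_const (y := dir i)))
    (hc.fderiv_apply ℝ (dir i))
  have g2 := memLp_indicator_smul hΩ.measurableSet hcg hη.continuous hc
  have l := (tendsto_integral_inner_moll hUl g1).add (tendsto_integral_inner_moll hHl g2)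
  have e2 : ∫ z in Ω, inner ℝ (fderiv ℝ η z (dir i) • (c * u z) + η z • (c * G z i)) (g z)
      = (∫ z, inner ℝ (Ω.indicator u z)
          (fderiv ℝ η z (dir i) • Ω.indicator (fun z => starRingEnd ℂ c * g z) z))
        + ∫ z, inner ℝ (Ω.indicator (fun z => G z i) z)
          (η z • Ω.indicator (fun z => starRingEnd ℂ c * g z) z) := by
    rw [← integral_add (integrable_inner_of_memLp hUl g1) (integrable_inner_of_memLp hHl g2),
      ← integral_indicator hΩ.measurableSet]
    refine integral_congr_ae (Eventually.of_forall fun z => ?_)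
    by_cases hz : z ∈ Ω
    · simp only [indicator_of_mem hz]
      rw [inner_add_left, inner_smul_mul, inner_smul_mul]
    · simp [hz]
  rw [e2]
  refine l.congr' ?_
  filter_upwards [eventually_fderiv_moll hΩ hu hl hc.isCompact hs] with k hk
  rw [← integral_add (integrable_inner_moll hUl g1 k) (integrable_inner_moll hHl g2 k),
    ← integral_indicator hΩ.measurableSet]
  refine integral_congr_ae (Eventually.of_forall fun z => ?_)
  have hw := (contDiff_moll hl k).differentiable (by simp) z
  by_cases hz : z ∈ Ω
  · simp only [indicator_of_mem hz]
    rw [fderiv_smul_mul (hη.differentiable (by simp) z) hw, inner_add_left, inner_smul_mul,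
      inner_smul_mul]
    congr 1
    by_cases hzη : z ∈ tsupport η
    · rw [hk z hzη]
    · rw [(smul_fderiv_eq_zero hzη 0).1]; simp
  · simp [hz]

/-- The product rule for weak gradients. -/
lemma integral_inner_add_inner_eq_zero (i : Fin 2) :
    (∫ z in Ω, inner ℝ (fderiv ℝ η z (dir i) • u z + η z • G z i) (u z))
      + ∫ z in Ω, inner ℝ (η z • u z) (G z i) = 0 := by
  have hUl : MemLp (Ω.indicator u) 2 := (memLp_indicator_iff_restrict hΩ.measurableSet).2 hu2
  have hl := hUl.locallyIntegrable (by norm_num)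
  have l1 := tendsto_integral_fderiv_moll hΩ hu hu2 hG2 hη hc hs hu2 1 i
  have g1 := memLp_indicator_smul hΩ.measurableSet (memLp_grad_apply hG2 i) hη.continuous hc
  have l2 := tendsto_integral_inner_moll hUl g1
  have e2 : ∫ z, inner ℝ (Ω.indicator u z) (η z • Ω.indicator (fun z => G z i) z)
      = ∫ z in Ω, inner ℝ (η z • u z) (G z i) := by
    rw [← integral_indicator hΩ.measurableSet]
    refine integral_congr_ae (Eventually.of_forall fun z => ?_)
    by_cases hz : z ∈ Ω
    · simp only [indicator_of_mem hz, inner_smul_left, inner_smul_right]; simp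
    · simp [hz]
  rw [e2] at l2
  simp only [one_mul] at l1
  refine tendsto_nhds_unique (l1.add l2) (tendsto_const_nhds.congr fun k => ?_)
  have hw := contDiff_moll hl k
  rw [hu.integral_inner (ζ := fun z => η z • moll k (Ω.indicator u) z) (hη.smul hw) hc.smul_right
    ((closure_mono (Function.support_smul_subset_left _ _)).trans hs) i, neg_add_eq_sub, eq_comm,
    sub_eq_zero, ← integral_indicator hΩ.measurableSet]
  refine integral_congr_ae (Eventually.of_forall fun z => ?_)
  by_cases hz : z ∈ Ω
  · simp only [indicator_of_mem hz, inner_smul_left, inner_smul_right]; simp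
  · simp [hz]

omit hη hc hs in
/-- The weak gradient of a circle valued map is tangential. -/
lemma inner_weakGrad_eq_zero (h1 : ∀ᵐ z ∂(volume.restrict Ω), ‖u z‖ = 1) (i : Fin 2) :
    ∀ᵐ z ∂(volume.restrict Ω), inner ℝ (u z) (G z i) = 0 := by
  have hGi := memLp_grad_apply hG2 i
  have hint : IntegrableOn (fun z => inner ℝ (u z) (G z i)) Ω := integrable_inner_of_memLp hu2 hGi
  rw [ae_restrict_iff' hΩ.measurableSet]
  refine hΩ.ae_eq_zero_of_integral_contDiff_smul_eq_zero hint.locallyIntegrableOn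
    fun η hη hc hs => ?_
  have h := integral_inner_add_inner_eq_zero hΩ hu hu2 hG2 hη hc hs i
  have i1 : Integrable (fun z => η z • inner ℝ (u z) (G z i)) (volume.restrict Ω) :=
    (integrable_smul_of_tsupport_subset hη.continuous hc hs hint.locallyIntegrableOn).integrableOn
  have hcont : Continuous (fun z => fderiv ℝ η z (dir i)) :=
    (hη.continuous_fderiv (by simp)).clm_apply continuous_const
  have i2 : Integrable (fun z => fderiv ℝ η z (dir i)) :=
    hcont.integrable_of_hasCompactSupport (hc.fderiv_apply ℝ (dir i))
  have e1 : ∫ z in Ω, inner ℝ (fderiv ℝ η z (dir i) • u z + η z • G z i) (u z)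
      = ∫ z in Ω, (fderiv ℝ η z (dir i) + η z • inner ℝ (u z) (G z i)) := by
    refine integral_congr_ae ?_
    filter_upwards [h1] with z hz
    rw [inner_add_left, real_inner_smul_left, real_inner_smul_left, real_inner_self_eq_norm_sq, hz,
      real_inner_comm, smul_eq_mul]
    ring
  have e2 : ∫ z in Ω, fderiv ℝ η z (dir i) = 0 := by
    rw [setIntegral_eq_integral_of_forall_compl_eq_zero fun z hz =>
      (smul_fderiv_eq_zero (fun h => hz (hs h)) (dir i)).2]
    have := integral_fderiv_mul_add (isOpen_univ) (g := fun _ => (1 : ℝ)) (η := η)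
      contDiffOn_const (hη.of_le (by exact ENat.LEInfty.out)) hc (subset_univ _) (dir i)
    simpa using this
  have e3 : ∫ z, η z • inner ℝ (u z) (G z i) = ∫ z in Ω, η z • inner ℝ (u z) (G z i) :=
    (setIntegral_eq_integral_of_forall_compl_eq_zero fun z hz => by
      rw [image_eq_zero_of_notMem_tsupport fun h => hz (hs h), zero_smul]).symm
  rw [e1, integral_add i2.integrableOn i1, e2] at h
  simp_rw [real_inner_smul_left] at h
  rw [e3]
  simp only [smul_eq_mul] at h ⊢
  linarith

/-- The distributional Jacobian of a circle valued map with square integrable weak gradient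
vanishes. -/
lemma integral_curl_eq_zero (h1 : ∀ᵐ z ∂(volume.restrict Ω), ‖u z‖ = 1) :
    ∫ z in Ω, (inner ℝ (Complex.I * u z) (G z 1) * fderiv ℝ η z 1
      - inner ℝ (Complex.I * u z) (G z 0) * fderiv ℝ η z Complex.I) = 0 := by
  have hUl : MemLp (Ω.indicator u) 2 := (memLp_indicator_iff_restrict hΩ.measurableSet).2 hu2
  have hl := hUl.locallyIntegrable (by norm_num)
  have l1 := tendsto_integral_fderiv_moll hΩ hu hu2 hG2 hη hc hs (memLp_grad_apply hG2 1)
    Complex.I 0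
  have l2 := tendsto_integral_fderiv_moll hΩ hu hu2 hG2 hη hc hs (memLp_grad_apply hG2 0)
    Complex.I 1
  simp only [dir_zero, dir_one] at l1 l2
  have h := tendsto_nhds_unique l1 (l2.congr fun k => (hu.integral_curl
    (ζ := fun z => η z • (Complex.I * moll k (Ω.indicator u) z)) (hη.smul
    (contDiff_const.mul (contDiff_moll hl k))) hc.smul_right
    ((closure_mono (Function.support_smul_subset_left _ _)).trans hs)).symm)
  -- tangential vectors are parallel, so the quadratic terms drop out
  have ht : ∀ᵐ z ∂(volume.restrict Ω), inner ℝ (Complex.I * G z 0) (G z 1) = 0 ∧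
      inner ℝ (Complex.I * G z 1) (G z 0) = 0 := by
    filter_upwards [h1, inner_weakGrad_eq_zero hΩ hu hu2 hG2 h1 0,
      inner_weakGrad_eq_zero hΩ hu hu2 hG2 h1 1] with z hz a b
    have hz2 : (u z).re ^ 2 + (u z).im ^ 2 = 1 := by
      rw [← Complex.normSq_add_mul_I, Complex.re_add_im, Complex.normSq_eq_norm_sq, hz]; norm_num
    simp only [Complex.inner, map_mul, Complex.mul_re, Complex.mul_im, Complex.conj_re,
      Complex.conj_im, Complex.conj_I, Complex.neg_re, Complex.neg_im, Complex.I_re,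
      Complex.I_im] at a b ⊢
    have key : (G z 0).re * (G z 1).im - (G z 0).im * (G z 1).re = 0 := by
      linear_combination ((G z 0).re * (G z 1).im - (G z 0).im * (G z 1).re) * (-hz2)
        + ((G z 1).im * (u z).re - (G z 1).re * (u z).im) * a
        + (-(G z 0).im * (u z).re + (G z 0).re * (u z).im) * b
    constructor <;> linarith
  have i : ∀ (j : Fin 2) (w : ℂ), Integrable (fun z => inner ℝ (Complex.I * u z) (G z j)
      * fderiv ℝ η z w) (volume.restrict Ω) := fun j w => by
    have hi : IntegrableOn (fun z => inner ℝ (Complex.I * u z) (G z j)) Ω :=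
      integrable_inner_of_memLp (hu2.const_mul Complex.I) (memLp_grad_apply hG2 j)
    have := (integrable_smul_of_tsupport_subset
      ((hη.continuous_fderiv (by simp)).clm_apply continuous_const)
      (hc.fderiv_apply ℝ w) ((tsupport_fderiv_apply_subset ℝ w).trans hs)
      hi.locallyIntegrableOn).integrableOn (s := Ω)
    refine Integrable.congr this (Eventually.of_forall fun z => ?_)
    simp [mul_comm]
  rw [integral_sub (i 1 1) (i 0 Complex.I), sub_eq_zero]
  refine Eq.trans (integral_congr_ae ?_) (h.trans (integral_congr_ae ?_))
  · filter_upwards [ht] with z hz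
    rw [inner_add_left, real_inner_smul_left, real_inner_smul_left, hz.1]; ring
  · filter_upwards [ht] with z hz
    rw [inner_add_left, real_inner_smul_left, real_inner_smul_left, hz.2]; ring

end


/-! ### Criticality of the limit -/

/-- Cut-off functions `χ j` in `Ω`, equal to `1` on the ball of radius `r` around `x j` and to `0`
on the balls of radius `r` around the other points. -/
structure IsCutoffFamily {n : ℕ} (Ω : Set ℂ) (x : Fin n → ℂ) (r : ℝ) (χ : Fin n → ℂ → ℝ) :
    Prop where
  pos : 0 < r
  contDiff : ∀ j, ContDiff ℝ ∞ (χ j)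
  hasCompactSupport : ∀ j, HasCompactSupport (χ j)
  tsupport_subset : ∀ j, tsupport (χ j) ⊆ Ω
  eq_ite : ∀ j l, ∀ z ∈ Metric.ball (x l) r, χ j z = if j = l then 1 else 0

lemma exists_isCutoffFamily {n : ℕ} {Ω : Set ℂ} (hΩ : IsOpen Ω) {x : Fin n → ℂ}
    (hx : x ∈ Config n Ω) : ∃ r χ, IsCutoffFamily Ω x r χ := by
  have h1 : ∀ j, ∀ᶠ r in 𝓝[>] (0 : ℝ), Metric.closedBall (x j) (2 * r) ⊆ Ω := fun j => by
    obtain ⟨ε, hε, hb⟩ := Metric.isOpen_iff.1 hΩ (x j) (hx.1 j)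
    filter_upwards [Ioo_mem_nhdsGT (show (0 : ℝ) < ε / 2 by linarith)] with r hr
    exact (Metric.closedBall_subset_ball (by linarith [hr.2])).trans hb
  have h2 : ∀ j l, ∀ᶠ r in 𝓝[>] (0 : ℝ), j ≠ l → 3 * r < dist (x l) (x j) := fun j l => by
    by_cases hjl : j = l
    · exact Eventually.of_forall fun r h => (h hjl).elim
    · have hd : 0 < dist (x l) (x j) := dist_pos.2 fun h => hjl (hx.2 h).symm
      filter_upwards [Ioo_mem_nhdsGT (show (0 : ℝ) < dist (x l) (x j) / 3 by linarith)] with r hr _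
      linarith [hr.2]
  obtain ⟨r, ⟨hr1, hr2⟩, hr0⟩ := (((eventually_all.2 h1).and (eventually_all.2 fun j =>
    eventually_all.2 (h2 j))).and self_mem_nhdsWithin).exists
  have hr0 : 0 < r := hr0
  let f : ∀ j, ContDiffBump (x j) := fun j =>
    { rIn := r, rOut := 2 * r, rIn_pos := hr0, rIn_lt_rOut := by linarith }
  refine ⟨r, fun j => f j, hr0, fun j => (f j).contDiff, fun j => (f j).hasCompactSupport,
    fun j => ?_, fun j l z hz => ?_⟩
  · rw [(f j).tsupport_eq]
    exact hr1 j
  · split_ifs with h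
    · subst h
      exact (f j).one_of_mem_closedBall (Metric.ball_subset_closedBall hz)
    · refine (f j).zero_of_le_dist ?_
      change 2 * r ≤ dist z (x j)
      have h3 := hr2 j l h
      have h4 := dist_triangle (x l) z (x j)
      rw [Metric.mem_ball, dist_comm] at hz
      linarith

lemma fderiv_eq_zero_of_eqOn_ball {F : Type*} [NormedAddCommGroup F] [NormedSpace ℝ F] {X : ℂ → F}
    {x z : ℂ} {a : F} {r : ℝ} (h : ∀ z ∈ Metric.ball x r, X z = a) (hz : z ∈ Metric.ball x r) :
    fderiv ℝ X z = 0 := by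
  have : X =ᶠ[𝓝 z] fun _ => a := by
    filter_upwards [Metric.isOpen_ball.mem_nhds hz] with w hw using h w hw
  rw [this.fderiv_eq]
  simp

/-- Undoing the rescaling of the gradients. -/
lemma rpow_smul_rescaled {p : ℝ} (hp : p < 3) (g : Grad) :
    ‖(‖g‖ ^ (p - 2))⁻¹ • g‖ ^ ((p - 2) / (3 - p)) • ((‖g‖ ^ (p - 2))⁻¹ • g) = g := by
  rcases eq_or_ne g 0 with rfl | hg
  · simp
  have hn : 0 < ‖g‖ := norm_pos_iff.2 hg
  have h3 : 0 < 3 - p := by linarith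
  rw [norm_smul, norm_inv, Real.norm_of_nonneg (by positivity), ← Real.rpow_neg hn.le]
  nth_rewrite 2 [← Real.rpow_one ‖g‖]
  rw [← Real.rpow_add hn, ← Real.rpow_mul hn.le, smul_smul, ← Real.rpow_add hn]
  have : (-(p - 2) + 1) * ((p - 2) / (3 - p)) + -(p - 2) = 0 := by field_simp; ring
  rw [this, Real.rpow_zero, one_smul]

lemma tendsto_rpow_smul {A : ℕ → Grad} {D : Grad} {s : ℕ → ℝ} (hA : Tendsto A atTop (𝓝 D))
    (hs : Tendsto s atTop (𝓝 0)) (hs0 : ∀ k, 0 ≤ s k) :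
    Tendsto (fun k => ‖A k‖ ^ s k • A k) atTop (𝓝 D) := by
  rcases eq_or_ne D 0 with rfl | hD
  · refine squeeze_zero_norm' ?_ (hA.norm.trans (by simp))
    filter_upwards [hA.norm.eventually (gt_mem_nhds (show ‖(0 : Grad)‖ < 1 by simp))] with k hk
    rw [norm_smul, Real.norm_of_nonneg (by positivity)]
    exact mul_le_of_le_one_left (norm_nonneg _) (Real.rpow_le_one (norm_nonneg _) hk.le (hs0 k))
  · have := (hA.norm.rpow hs (Or.inl (norm_ne_zero_iff.2 hD))).smul hA
    simpa using this

lemma norm_rpow_smul_le {s : ℝ} (hs0 : 0 ≤ s) (hs1 : s ≤ 1) (A D : Grad) :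
    ‖‖A‖ ^ s • A‖ ≤ 1 + 2 * ‖D‖ ^ 2 + 2 * ‖A - D‖ ^ 2 := by
  rw [norm_smul, Real.norm_of_nonneg (by positivity)]
  have h1 : ‖A‖ ^ s * ‖A‖ = ‖A‖ ^ (s + 1) := by
    rw [Real.rpow_add_one' (norm_nonneg _) (by linarith)]
  rw [h1]
  have h2 := rpow_le_one_add_sq (norm_nonneg A) (s := s + 1) (by linarith) (by linarith)
  have h3 : ‖A‖ ≤ ‖D‖ + ‖A - D‖ := by
    have := norm_add_le D (A - D)
    rwa [add_sub_cancel] at this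
  have h4 := pow_le_pow_left₀ (norm_nonneg _) h3 2
  nlinarith [sq_nonneg (‖D‖ - ‖A - D‖)]

lemma inner_grad_eq_current {f : ℂ → ℂ} {z : ℂ} (hf : DifferentiableAt ℝ f z)
    (h1 : ∀ᶠ w in 𝓝 z, ‖f w‖ = 1) (i : Fin 2) :
    inner ℝ (Complex.I * f z) (grad f z i) = current f z (dir i) := by
  have hz : ‖f z‖ = 1 := h1.self_of_nhds
  have hI : inner ℝ (Complex.I * f z) (Complex.I * f z) = (1 : ℝ) := by
    rw [real_inner_self_eq_norm_sq]; simp [hz]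
  rw [grad_apply_eq hf h1, ← Complex.real_smul, real_inner_smul_right, hI, mul_one]

lemma norm_apply_le (g : Grad) (i : Fin 2) : ‖g i‖ ≤ ‖g‖ := PiLp.norm_apply_le g i

/-- A limit of maps without distributional Jacobian has no singularity of nonzero degree; here the
exponents are larger than `2`, so that the maps themselves have square integrable gradients. -/
lemma degree_eq_zero {Ω : Set ℂ} (hΩ : IsOpen Ω) (hΩb : Bornology.IsBounded Ω) {n : ℕ}
    {xs : Fin n → ℂ} (hxs : xs ∈ Config n Ω) {d : Fin n → ℤ} {us v : ℂ → ℂ}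
    (hus : IsSingularWith Ω xs d us v) {p : ℕ → ℝ} (hp2 : ∀ k, 2 < p k) (hp3 : ∀ k, p k ≤ 5 / 2)
    (hp : Tendsto p atTop (𝓝 2)) {u : ℕ → ℂ → ℂ} {G : ℕ → ℂ → Grad}
    (hu : ∀ k, MemSobolevCircle Ω (p k) (u k) (G k))
    (hae : ∀ᵐ z ∂(volume.restrict Ω), Tendsto (fun k => u k z) atTop (𝓝 (us z)))
    (hconv : ∀ K : Set ℂ, IsCompact K → K ⊆ Ω \ range xs →
      Tendsto (fun k => eLpNorm (fun z => (‖G k z‖ ^ (p k - 2))⁻¹ • G k z - grad us z) 2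
        (volume.restrict K)) atTop (𝓝 0)) (j : Fin n) : d j = 0 := by
  obtain ⟨r, χ, hr, hχ, hχc, hχs, hχ1⟩ := exists_isCutoffFamily hΩ hxs
  have : IsFiniteMeasure (volume.restrict Ω) := isFiniteMeasure_restrict.2 hΩb.measure_lt_top.ne
  set η := χ j with hη
  -- the differential of `η` is supported in `K`, away from the singularities
  set K : Set ℂ := tsupport η \ ⋃ l, Metric.ball (xs l) r with hKdef
  have hK : IsCompact K := (hχc j).isCompact.diff (isOpen_iUnion fun l => Metric.isOpen_ball)
  have hKΩ : K ⊆ Ω \ range xs := fun z hz => ⟨hχs j hz.1, by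
    rintro ⟨l, rfl⟩
    exact hz.2 (mem_iUnion.2 ⟨l, Metric.mem_ball_self hr⟩)⟩
  have hηK : ∀ z, z ∉ K → fderiv ℝ η z = 0 := fun z hz => by
    by_cases h : z ∈ tsupport η
    · obtain ⟨l, hl⟩ := mem_iUnion.1 (not_not.1 fun h' => hz ⟨h, h'⟩)
      exact fderiv_eq_zero_of_eqOn_ball (hχ1 j l) hl
    · exact Function.notMem_support.1 fun h' => h (support_fderiv_subset ℝ h')
  have hcf : ∀ w, Continuous (fun z => fderiv ℝ η z w) := fun w =>
    ((hχ j).continuous_fderiv (by simp)).clm_apply continuous_const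
  have hgc : ContinuousOn (grad us) K := by
    refine (PiLp.continuous_toLp 2 _).comp_continuousOn (continuousOn_pi.2 fun i => ?_)
    intro z hz
    have h2 : ContinuousAt (fderiv ℝ us) z :=
      ((hus.contDiffAt hΩ (hKΩ hz)).fderiv_right (m := 1) (by norm_num)).continuousAt
    exact (h2.clm_apply continuousAt_const).continuousWithinAt
  have hmK : volume.restrict K ≤ volume.restrict Ω :=
    Measure.restrict_mono (hKΩ.trans sdiff_subset) le_rfl
  have hGm : ∀ k, AEStronglyMeasurable (G k) (volume.restrict K) := fun k =>
    (hu k).memLp_grad.aestronglyMeasurable.mono_measure hmK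
  have hum : ∀ k, AEStronglyMeasurable (u k) (volume.restrict K) := fun k =>
    (hu k).memLp.aestronglyMeasurable.mono_measure hmK
  have hAm : ∀ k, AEStronglyMeasurable (fun z => (‖G k z‖ ^ (p k - 2))⁻¹ • G k z)
      (volume.restrict K) := fun k =>
    ((hGm k).norm.aemeasurable.pow_const (p k - 2)).inv.aestronglyMeasurable.smul (hGm k)
  obtain ⟨ns, hns, hmem, haeA, hint⟩ := exists_subseq_tendsto_ae hAm
    (hgc.aestronglyMeasurable hK.measurableSet) (hconv K hK hKΩ)
  set A : ℕ → ℂ → Grad := fun k z => (‖G (ns k) z‖ ^ (p (ns k) - 2))⁻¹ • G (ns k) z with hA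
  -- this exponent undoes the rescaling: `G = ‖A‖ ^ s • A`
  set s : ℕ → ℝ := fun k => (p (ns k) - 2) / (3 - p (ns k)) with hsdef
  have hs0 : ∀ k, 0 ≤ s k := fun k =>
    div_nonneg (by linarith [hp2 (ns k)]) (by linarith [hp3 (ns k)])
  have hs1 : ∀ k, s k ≤ 1 := fun k => by
    rw [hsdef, div_le_iff₀ (by linarith [hp3 (ns k)])]
    linarith [hp3 (ns k)]
  have hsl : Tendsto s atTop (𝓝 0) := by
    have hpn := hp.comp hns.tendsto_atTop
    have := (hpn.sub_const 2).div (hpn.const_sub 3) (by norm_num)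
    rwa [show ((2 : ℝ) - 2) / (3 - 2) = 0 by norm_num] at this
  have hGA : ∀ k z, G (ns k) z = ‖A k z‖ ^ s k • A k z := fun k z =>
    (rpow_smul_rescaled (by linarith [hp3 (ns k)]) _).symm
  obtain ⟨B, hB⟩ := ((hχ j).continuous_fderiv (by simp)).bounded_above_of_compact_support
    ((hχc j).fderiv ℝ)
  have hB0 : 0 ≤ B := (norm_nonneg _).trans (hB 0)
  have hBw : ∀ z (w : ℂ), ‖w‖ = 1 → |fderiv ℝ η z w| ≤ B := fun z w hw => by
    have := (fderiv ℝ η z).le_of_opNorm_le (hB z) w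
    rwa [hw, mul_one] at this
  set f : ℕ → ℂ → ℝ := fun k z => inner ℝ (Complex.I * u (ns k) z) (G (ns k) z 1) * fderiv ℝ η z 1
      - inner ℝ (Complex.I * u (ns k) z) (G (ns k) z 0) * fderiv ℝ η z Complex.I with hf
  -- the distributional Jacobians of the maps vanish, as their gradients are square integrable
  have hzero : ∀ k, ∫ z in K, f k z = 0 := fun k => by
    have h2 : ENNReal.ofReal 2 ≤ ENNReal.ofReal (p (ns k)) :=
      ENNReal.ofReal_le_ofReal (hp2 _).le
    rw [ENNReal.ofReal_ofNat] at h2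
    rw [← integral_curl_eq_zero hΩ (hu (ns k)).hasWeakGrad ((hu (ns k)).memLp.mono_exponent h2)
      ((hu (ns k)).memLp_grad.mono_exponent h2) (hχ j) (hχc j) (hχs j) (hu (ns k)).norm_eq_one]
    refine (setIntegral_eq_of_subset_of_forall_sdiff_eq_zero hΩ.measurableSet
      (hKΩ.trans sdiff_subset) fun z hz => ?_).symm
    simp only [hf, hηK z hz.2]; simp
  have hGi : ∀ k i, AEStronglyMeasurable (fun z => G k z i) (volume.restrict K) := fun k i =>
    (EuclideanSpace.proj (𝕜 := ℂ) i).continuous.comp_aestronglyMeasurable (hGm k)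
  have hfm : ∀ k, AEStronglyMeasurable (f k) (volume.restrict K) := fun k =>
    ((((hum _).const_mul _).inner (hGi _ 1)).mul (hcf 1).aestronglyMeasurable).sub
      ((((hum _).const_mul _).inner (hGi _ 0)).mul (hcf Complex.I).aestronglyMeasurable)
  have hfb : ∀ k, ∀ᵐ z ∂(volume.restrict K), |f k z| ≤ 2 * B * (1 + 2 * ‖grad us z‖ ^ 2)
      + 4 * B * ‖A k z - grad us z‖ ^ 2 := fun k => by
    filter_upwards [ae_mono hmK (hu (ns k)).norm_eq_one] with z hz
    have hi : ∀ i, |inner ℝ (Complex.I * u (ns k) z) (G (ns k) z i)| ≤ ‖G (ns k) z‖ := fun i => by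
      refine (abs_real_inner_le_norm _ _).trans ?_
      rw [norm_mul, Complex.norm_I, hz, one_mul, one_mul]
      exact norm_apply_le _ i
    have h1 : |f k z| ≤ ‖G (ns k) z‖ * B + ‖G (ns k) z‖ * B := by
      refine (abs_sub _ _).trans ?_
      rw [abs_mul, abs_mul]
      exact add_le_add (mul_le_mul (hi 1) (hBw z 1 (by simp)) (abs_nonneg _) (norm_nonneg _))
        (mul_le_mul (hi 0) (hBw z Complex.I (by simp)) (abs_nonneg _) (norm_nonneg _))
    have h2 := norm_rpow_smul_le (hs0 k) (hs1 k) (A k z) (grad us z)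
    rw [← hGA] at h2
    nlinarith
  have hlim := tendsto_integral_of_dominated_add (μ := volume.restrict K) (f := f)
    (g := fun z => inner ℝ (Complex.I * us z) (grad us z 1) * fderiv ℝ η z 1
      - inner ℝ (Complex.I * us z) (grad us z 0) * fderiv ℝ η z Complex.I)
    (D := fun z => 2 * B * (1 + 2 * ‖grad us z‖ ^ 2))
    (E := fun k z => 4 * B * ‖A k z - grad us z‖ ^ 2) hfm
    (ContinuousOn.integrableOn_compact hK
      (continuousOn_const.mul (continuousOn_const.add (continuousOn_const.mul (hgc.norm.pow 2)))))
    (fun k => ((hmem k).integrable_norm_pow (by norm_num)).const_mul _)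
    (fun z => by positivity) (fun k z => by positivity) hfb ?_ ?_ ?_
  · simp_rw [hzero] at hlim
    have h0 := tendsto_nhds_unique hlim tendsto_const_nhds
    -- in the limit, the Jacobian is `2π` times the sum of the Dirac masses of weights `d l`
    have hcurl := hus.integral_curl hΩ ((hχ j).of_le (by exact ENat.LEInfty.out)) (hχc j) (hχs j)
    have hsum : ∑ l, (d l : ℝ) * η (xs l) = d j := by
      rw [Finset.sum_eq_single j]
      · rw [hη, hχ1 j j _ (Metric.mem_ball_self hr)]; simp
      · intro l _ hl
        rw [hη, hχ1 j l _ (Metric.mem_ball_self hr), if_neg hl.symm, mul_zero]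
      · simp
    rw [hsum, ← setIntegral_eq_integral_of_forall_compl_eq_zero (s := K) fun z hz => by
      rw [hηK z hz]; simp] at hcurl
    have e : ∫ z in K, (current us z 1 * fderiv ℝ η z Complex.I
        - current us z Complex.I * fderiv ℝ η z 1) = 0 := by
      rw [← neg_eq_zero, ← h0, ← integral_neg]
      refine setIntegral_congr_fun hK.measurableSet fun z hz => ?_
      rw [inner_grad_eq_current (hus.differentiableAt hΩ (hKΩ hz))
        (hus.eventually_norm hΩ (hKΩ hz)), inner_grad_eq_current
        (hus.differentiableAt hΩ (hKΩ hz)) (hus.eventually_norm hΩ (hKΩ hz)), dir_zero, dir_one]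
      ring
    rw [e] at hcurl
    have hpi := Real.pi_pos
    have : (d j : ℝ) = 0 := by
      rcases mul_eq_zero.1 hcurl.symm with h | h
      · exfalso; linarith
      · exact h
    exact_mod_cast this
  · have := hint.const_mul (4 * B)
    rw [mul_zero] at this
    refine this.congr fun k => ?_
    rw [integral_const_mul]
  · filter_upwards [haeA] with z hz
    have := ((hz.sub_const (grad us z)).norm.pow 2).const_mul (4 * B)
    simpa using this
  · filter_upwards [haeA, ae_mono hmK hae] with z hz1 hz2
    have hg := tendsto_rpow_smul hz1 hsl hs0
    have hg' : Tendsto (fun k => G (ns k) z) atTop (𝓝 (grad us z)) :=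
      hg.congr fun k => (hGA k z).symm
    have hgi : ∀ i : Fin 2, Tendsto (fun k => G (ns k) z i) atTop (𝓝 (grad us z i)) := fun i =>
      ((EuclideanSpace.proj (𝕜 := ℂ) i).continuous.tendsto _).comp hg'
    have hui := (hz2.comp hns.tendsto_atTop).const_mul Complex.I
    exact ((hui.inner (hgi 1)).mul_const _).sub ((hui.inner (hgi 0)).mul_const _)

lemma stress_zero (α : ℂ →L[ℝ] ℝ) : stress 0 α = 0 := by simp [stress]

/-- The limit of stationary maps is critical under the inner variations which are translations near
the singularities. -/
lemma integral_stress_eq_zero {Ω : Set ℂ} (hΩ : IsOpen Ω) (hΩb : Bornology.IsBounded Ω) {n : ℕ}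
    {xs : Fin n → ℂ} (hxs : xs ∈ Config n Ω) {d : Fin n → ℤ} {us v : ℂ → ℂ}
    (hus : IsSingularWith Ω xs d us v) {p : ℕ → ℝ} (hp1 : ∀ k, 1 < p k)
    (hp : Tendsto p atTop (𝓝 2)) {u : ℕ → ℂ → ℂ} {G : ℕ → ℂ → Grad}
    (hu : ∀ k, IsStationaryPHarmonic Ω (p k) (u k) (G k))
    (hae : ∀ᵐ z ∂(volume.restrict Ω), Tendsto (fun k => u k z) atTop (𝓝 (us z)))
    (hconv : ∀ K : Set ℂ, IsCompact K → K ⊆ Ω \ range xs →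
      Tendsto (fun k => eLpNorm (fun z => (‖G k z‖ ^ (p k - 2))⁻¹ • G k z - grad us z) 2
        (volume.restrict K)) atTop (𝓝 0))
    {X : ℂ → ℂ} (hX : ContDiff ℝ ∞ X) (hc : HasCompactSupport X) (hs : tsupport X ⊆ Ω)
    {r : ℝ} (hr : 0 < r) (hXr : ∀ l, ∀ z ∈ Metric.ball (xs l) r, fderiv ℝ X z = 0) :
    ∫ z, stress (fderiv ℝ X z) (current us z) = 0 := by
  by_cases hfreq : ∃ᶠ k in atTop, p k ≤ 2
  -- infinitely many exponents are at most `2`: pass to the limit in the stress-energy identity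
  · obtain ⟨ns, hns, hp2⟩ := extraction_of_frequently_atTop hfreq
    set K : Set ℂ := tsupport X \ ⋃ l, Metric.ball (xs l) r with hKdef
    have hK : IsCompact K := hc.isCompact.diff (isOpen_iUnion fun l => Metric.isOpen_ball)
    have hKΩ : K ⊆ Ω \ range xs := fun z hz => ⟨hs hz.1, by
      rintro ⟨l, rfl⟩
      exact hz.2 (mem_iUnion.2 ⟨l, Metric.mem_ball_self hr⟩)⟩
    have hXK : ∀ z, z ∉ K → fderiv ℝ X z = 0 := fun z hz => by
      by_cases h : z ∈ tsupport X
      · obtain ⟨l, hl⟩ := mem_iUnion.1 (not_not.1 fun h' => hz ⟨h, h'⟩)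
        exact hXr l z hl
      · exact Function.notMem_support.1 fun h' => h (support_fderiv_subset ℝ h')
    have hgc : ContinuousOn (grad us) K := by
      refine (PiLp.continuous_toLp 2 _).comp_continuousOn (continuousOn_pi.2 fun i => ?_)
      intro z hz
      have h2 : ContinuousAt (fderiv ℝ us) z :=
        ((hus.contDiffAt hΩ (hKΩ hz)).fderiv_right (m := 1) (by norm_num)).continuousAt
      exact (h2.clm_apply continuousAt_const).continuousWithinAt
    have h := stress_identity_limit hΩ (p := fun k => p (ns k)) (fun k => hp1 _) hp2
      (hp.comp hns.tendsto_atTop) (u := fun k => u (ns k)) (G := fun k => G (ns k))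
      (fun k => hu _) hK (hKΩ.trans sdiff_subset) hgc
      ((hconv K hK hKΩ).comp hns.tendsto_atTop) hX hc hs hXK
    rw [← setIntegral_eq_integral_of_forall_compl_eq_zero (s := K) fun z hz => by
      rw [hXK z hz, stress_zero], ← h]
    exact setIntegral_congr_fun hK.measurableSet fun z hz => (stress_eq
      (hus.differentiableAt hΩ (hKΩ hz)) (hus.eventually_norm hΩ (hKΩ hz)) _).symm
  · -- all exponents are eventually larger than `2`, and the limit has no singularities
    rw [not_frequently] at hfreq
    obtain ⟨k₀, hk₀⟩ := eventually_atTop.1 (hfreq.and (hp.eventually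
      (ge_mem_nhds (show (2 : ℝ) < 5 / 2 by norm_num))))
    have hd := degree_eq_zero hΩ hΩb hxs hus (p := fun k => p (k + k₀))
      (fun k => not_le.1 (hk₀ _ (by lia)).1) (fun k => (hk₀ _ (by lia)).2)
      (hp.comp (tendsto_add_atTop_nat k₀)) (u := fun k => u (k + k₀)) (G := fun k => G (k + k₀))
      (fun k => (hu _).memSobolev) (hae.mono fun z hz => hz.comp (tendsto_add_atTop_nat k₀))
      (fun K hK hKΩ => (hconv K hK hKΩ).comp (tendsto_add_atTop_nat k₀))
    rw [← hus.harmonic.integral_stress hΩ hX hc hs]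
    refine integral_congr_ae ?_
    filter_upwards [IsSingularWith.ae_notMem_range (x := xs)] with z hz
    by_cases hzΩ : z ∈ Ω
    · rw [hus.current_eq hΩ ⟨hzΩ, hz⟩]
      simp [hd]
    · rw [Function.notMem_support.1 fun h' => hzΩ (hs (support_fderiv_subset ℝ h')), stress_zero,
        stress_zero]


/-! ### Displacing the singularities -/

/-- The vector field which is equal to `a j` near the `j`-th point of a configuration. -/
noncomputable def shift {n : ℕ} (χ : Fin n → ℂ → ℝ) (a : Fin n → ℂ) (z : ℂ) : ℂ :=
  ∑ j, χ j z • a j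

namespace IsCutoffFamily

variable {n : ℕ} {Ω : Set ℂ} {x : Fin n → ℂ} {r : ℝ} {χ : Fin n → ℂ → ℝ}
  (h : IsCutoffFamily Ω x r χ)

include h

lemma contDiff_shift (a : Fin n → ℂ) : ContDiff ℝ ∞ (shift χ a) :=
  ContDiff.sum fun j _ => (h.contDiff j).smul contDiff_const

omit h in
lemma shift_eq_zero (a : Fin n → ℂ) {z : ℂ} (hz : z ∉ ⋃ j, tsupport (χ j)) : shift χ a z = 0 := by
  refine Finset.sum_eq_zero fun j _ => ?_
  rw [image_eq_zero_of_notMem_tsupport fun h' => hz (mem_iUnion.2 ⟨j, h'⟩), zero_smul]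

lemma isCompact_iUnion : IsCompact (⋃ j, tsupport (χ j)) :=
  _root_.isCompact_iUnion fun j => (h.hasCompactSupport j).isCompact

lemma hasCompactSupport_shift (a : Fin n → ℂ) : HasCompactSupport (shift χ a) :=
  HasCompactSupport.intro h.isCompact_iUnion fun _ hz => shift_eq_zero a hz

lemma tsupport_shift_subset (a : Fin n → ℂ) : tsupport (shift χ a) ⊆ Ω := by
  refine (closure_minimal (fun z hz => ?_) h.isCompact_iUnion.isClosed).trans
    (iUnion_subset h.tsupport_subset)
  by_contra h'
  exact hz (shift_eq_zero a h')

lemma shift_eq (a : Fin n → ℂ) {l : Fin n} {z : ℂ} (hz : z ∈ Metric.ball (x l) r) :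
    shift χ a z = a l := by
  rw [shift, Finset.sum_eq_single l]
  · rw [h.eq_ite l l z hz, if_pos rfl, one_smul]
  · intro j _ hj
    rw [h.eq_ite j l z hz, if_neg hj, zero_smul]
  · simp

lemma fderiv_shift_eq_zero (a : Fin n → ℂ) {l : Fin n} {z : ℂ} (hz : z ∈ Metric.ball (x l) r) :
    fderiv ℝ (shift χ a) z = 0 :=
  fderiv_eq_zero_of_eqOn_ball (fun _ hz => h.shift_eq a hz) hz

lemma fderiv_shift (a : Fin n → ℂ) (z : ℂ) :
    fderiv ℝ (shift χ a) z = ∑ j, (fderiv ℝ (χ j) z).smulRight (a j) := by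
  have : HasFDerivAt (shift χ a) (∑ j, (fderiv ℝ (χ j) z).smulRight (a j)) z := by
    unfold shift
    exact HasFDerivAt.fun_sum fun j _ =>
      (((h.contDiff j).differentiable (by simp)) z).hasFDerivAt.smul_const (a j)
  exact this.fderiv

lemma exists_norm_fderiv_shift_le :
    ∃ B > 0, ∀ a z, ‖fderiv ℝ (shift χ a) z‖ ≤ B * ‖a‖ := by
  choose C hC using fun j => ((h.contDiff j).continuous_fderiv
    (by simp)).bounded_above_of_compact_support ((h.hasCompactSupport j).fderiv (𝕜 := ℝ))
  have hC0 : ∀ j, 0 ≤ C j := fun j => (norm_nonneg _).trans (hC j 0)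
  refine ⟨∑ j, C j + 1, by have := Finset.sum_nonneg fun j (_ : j ∈ Finset.univ) => hC0 j; linarith,
    fun a z => ?_⟩
  rw [h.fderiv_shift]
  calc ‖∑ j, (fderiv ℝ (χ j) z).smulRight (a j)‖ ≤ ∑ j, C j * ‖a‖ := by
        refine (norm_sum_le _ _).trans (Finset.sum_le_sum fun j _ => ?_)
        rw [ContinuousLinearMap.norm_smulRight_apply]
        exact mul_le_mul (hC j z) (norm_le_pi_norm a j) (norm_nonneg _) (hC0 j)
    _ ≤ (∑ j, C j + 1) * ‖a‖ := by
        rw [← Finset.sum_mul]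
        nlinarith [norm_nonneg a]

/-- Points close to each other are exchanged by a diffeomorphism close to the identity, which is a
translation near each of them. -/
lemma eventually_isCompactDiffeo :
    ∀ᶠ y in 𝓝 x, (∀ z, ‖fderiv ℝ (shift χ (y - x)) z‖ ≤ 1 / 4) ∧
      ∃ φ, IsCompactDiffeo Ω (fun z => z + shift χ (y - x) z) φ := by
  obtain ⟨B, hB, hb⟩ := h.exists_norm_fderiv_shift_le
  have : ∀ᶠ y in 𝓝 x, ‖y - x‖ < 1 / (4 * B) := by
    have hc : Continuous fun y : Fin n → ℂ => ‖y - x‖ := by fun_prop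
    exact hc.tendsto' x 0 (by simp) |>.eventually (gt_mem_nhds (by positivity))
  filter_upwards [this] with y hy
  have hy' : ∀ z, ‖fderiv ℝ (shift χ (y - x)) z‖ ≤ 1 / 4 := fun z => (hb _ z).trans (by
    rw [lt_div_iff₀ (by positivity)] at hy
    linarith)
  exact ⟨hy', exists_isCompactDiffeo (h.contDiff_shift _) (h.hasCompactSupport_shift _)
    (h.tsupport_shift_subset _) hy'⟩

omit h in
lemma tendsto_shift {y : ℕ → Fin n → ℂ} (hy : Tendsto y atTop (𝓝 x)) (z : ℂ) :
    Tendsto (fun k => z + shift χ (y k - x) z) atTop (𝓝 z) := by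
  have hc : Continuous fun a : Fin n → ℂ => z + shift χ (a - x) z := by
    unfold shift
    simp only [Pi.sub_apply]
    fun_prop
  have e : z = z + shift χ (x - x) z := by simp [shift]
  have := (hc.tendsto x).comp hy
  rwa [← e] at this

lemma tendsto_fderiv_shift {y : ℕ → Fin n → ℂ} (hy : Tendsto y atTop (𝓝 x)) (z : ℂ) :
    Tendsto (fun k => fderiv ℝ (shift χ (y k - x)) z) atTop (𝓝 0) := by
  obtain ⟨B, hB, hb⟩ := h.exists_norm_fderiv_shift_le
  refine squeeze_zero_norm (fun k => hb _ z) ?_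
  have := (hy.sub_const x).norm.const_mul B
  simpa using this

variable {y : Fin n → ℂ} {φ : ℂ → ℂ}

omit h in
lemma mem_of_ball_eq {ρ : ℝ} (hρ : ρ ≤ r) {l : Fin n} {z : ℂ} (hz : z ∈ Metric.ball (x l) ρ) :
    z ∈ Metric.ball (x l) r := Metric.ball_subset_ball hρ hz

lemma add_shift_eq {l : Fin n} {z : ℂ} (hz : z ∈ Metric.ball (x l) r) :
    z + shift χ (y - x) z = z + (y l - x l) := by rw [h.shift_eq _ hz]; rfl

variable (hD : IsCompactDiffeo Ω (fun z => z + shift χ (y - x) z) φ)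

include hD

lemma add_shift_mem_ball_iff {ρ : ℝ} (hρ : ρ ≤ r) (l : Fin n) (z : ℂ) :
    z + shift χ (y - x) z ∈ Metric.ball (y l) ρ ↔ z ∈ Metric.ball (x l) ρ := by
  constructor
  · intro hz
    set w := z + shift χ (y - x) z - (y l - x l) with hw
    have hwb : w ∈ Metric.ball (x l) ρ := by
      rw [Metric.mem_ball, dist_eq_norm] at hz ⊢
      convert hz using 2
      rw [hw]; ring
    have h1 := h.add_shift_eq (y := y) (mem_of_ball_eq hρ hwb)
    have h2 : w = z := hD.left.injective (by
      show w + shift χ (y - x) w = z + shift χ (y - x) z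
      rw [h1, hw]; ring)
    rwa [← h2]
  · intro hz
    rw [h.add_shift_eq (mem_of_ball_eq hρ hz)]
    rw [Metric.mem_ball, dist_eq_norm] at hz ⊢
    convert hz using 2
    ring

lemma add_shift_eq_iff (l : Fin n) (z : ℂ) : z + shift χ (y - x) z = y l ↔ z = x l := by
  have e : x l + shift χ (y - x) (x l) = y l := by
    rw [h.add_shift_eq (Metric.mem_ball_self h.pos)]; ring
  constructor
  · intro hz
    exact hD.left.injective (show z + shift χ (y - x) z = x l + shift χ (y - x) (x l) by rw [hz, e])
  · rintro rfl
    exact e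

lemma add_shift_mem_range_iff (z : ℂ) : z + shift χ (y - x) z ∈ range y ↔ z ∈ range x := by
  simp only [mem_range]
  exact exists_congr fun l => by
    rw [eq_comm, h.add_shift_eq_iff hD l z, eq_comm]

lemma add_shift_mem_diff_iff (z : ℂ) :
    z + shift χ (y - x) z ∈ Ω \ range y ↔ z ∈ Ω \ range x := by
  rw [Set.mem_sdiff, Set.mem_sdiff, h.add_shift_mem_range_iff hD]
  exact and_congr (hD.mem_iff z) Iff.rfl

lemma image_perforated {ρ : ℝ} (hρ : ρ ≤ r) :
    (fun z => z + shift χ (y - x) z) '' perforated Ω x ρ = perforated Ω y ρ := by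
  have key : ∀ z, z + shift χ (y - x) z ∈ perforated Ω y ρ ↔ z ∈ perforated Ω x ρ := fun z => by
    rw [perforated, perforated, Set.mem_sdiff, Set.mem_sdiff, mem_iUnion, mem_iUnion]
    refine and_congr (hD.mem_iff z) (not_congr (exists_congr fun j => ?_))
    exact h.add_shift_mem_ball_iff hD hρ j z
  ext w
  constructor
  · rintro ⟨z, hz, rfl⟩
    exact (key z).2 hz
  · intro hw
    refine ⟨φ w, ?_, hD.right w⟩
    have := (key (φ w)).1
    rw [show φ w + shift χ (y - x) (φ w) = w from hD.right w] at this
    exact this hw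

end IsCutoffFamily

lemma isMeasurable_perforated {n : ℕ} {Ω : Set ℂ} (hΩ : IsOpen Ω) (x : Fin n → ℂ) (ρ : ℝ) :
    MeasurableSet (perforated Ω x ρ) :=
  hΩ.measurableSet.diff (MeasurableSet.iUnion fun _ => measurableSet_ball)


/-! ### Continuity of the currents in mean -/

lemma norm_clm_le_of_basis {E : Type*} [NormedAddCommGroup E] [NormedSpace ℝ E] (L : ℂ →L[ℝ] E) :
    ‖L‖ ≤ ‖L 1‖ + ‖L Complex.I‖ := by
  refine L.opNorm_le_bound (by positivity) fun v => ?_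
  rw [clm_apply_eq]
  refine (norm_add_le _ _).trans ?_
  rw [norm_smul, norm_smul, add_mul]
  have h1 : ‖v.re‖ ≤ ‖v‖ := Complex.abs_re_le_norm v
  have h2 : ‖v.im‖ ≤ ‖v‖ := Complex.abs_im_le_norm v
  nlinarith [norm_nonneg (L 1), norm_nonneg (L Complex.I)]

/-- Comparison of the currents of two circle valued maps. -/
lemma norm_current_sub_le {f g : ℂ → ℂ} {z : ℂ} (hf1 : ‖f z‖ = 1)
    (hg : DifferentiableAt ℝ g z) (hg1 : ∀ᶠ w in 𝓝 z, ‖g w‖ = 1) :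
    ‖current f z - current g z‖ ≤ 2 * ‖grad f z - grad g z‖ + ‖f z - g z‖ * ‖current g z‖ := by
  have hgz : ‖g z‖ = 1 := hg1.self_of_nhds
  have hinv : ∀ w : ℂ, ‖w‖ = 1 → w⁻¹ = (starRingEnd ℂ) w := fun w hw => by
    rw [Complex.inv_def, Complex.normSq_eq_norm_sq, hw]; simp
  have h1 : ‖fderiv ℝ f z - fderiv ℝ g z‖ ≤ 2 * ‖grad f z - grad g z‖ := by
    refine (norm_clm_le_of_basis _).trans ?_
    have a := norm_apply_le (grad f z - grad g z) 0
    have b := norm_apply_le (grad f z - grad g z) 1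
    simp only [grad, PiLp.sub_apply, dir_zero, dir_one] at a b
    simp only [grad, sub_apply]
    linarith
  refine ContinuousLinearMap.opNorm_le_bound _ (by positivity) fun w => ?_
  have e : current f z w - current g z w = ((f z)⁻¹ * (fderiv ℝ f z w - fderiv ℝ g z w)
      + ((f z)⁻¹ - (g z)⁻¹) * fderiv ℝ g z w).im := by
    rw [current_apply, current_apply, ← Complex.sub_im]
    congr 1; ring
  rw [sub_apply, e]
  refine (Complex.abs_im_le_norm _).trans ((norm_add_le _ _).trans ?_)
  have e2 : ‖fderiv ℝ g z w‖ = ‖current g z w‖ := by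
    rw [fderiv_eq_current_smul hg hg1, norm_mul, norm_mul, Complex.norm_I, hgz,
      Complex.norm_real, one_mul, mul_one]
  rw [norm_mul, norm_mul, norm_inv, hf1, inv_one, one_mul, hinv _ hf1, hinv _ hgz, ← map_sub,
    RCLike.norm_conj, e2, add_mul, mul_assoc ‖f z - g z‖]
  refine add_le_add ?_ (mul_le_mul_of_nonneg_left ((current g z).le_opNorm w) (norm_nonneg _))
  rw [← sub_apply]
  exact (ContinuousLinearMap.le_opNorm _ w).trans (mul_le_mul_of_nonneg_right h1 (norm_nonneg _))

lemma ae_mem_diff {n : ℕ} {Ω : Set ℂ} (hΩ : MeasurableSet Ω) (x : Fin n → ℂ) :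
    ∀ᵐ z ∂(volume.restrict Ω), z ∈ Ω \ range x := by
  filter_upwards [ae_restrict_mem hΩ,
    ae_restrict_of_ae (IsSingularWith.ae_notMem_range (x := x))] with z h1 h2 using ⟨h1, h2⟩

/-- Maps which are continuous off finitely many points are measurable. -/
lemma aestronglyMeasurable_of_continuousOn_diff {E : Type*} [NormedAddCommGroup E]
    {n : ℕ} {Ω : Set ℂ} (hΩ : IsOpen Ω) {x : Fin n → ℂ} {f : ℂ → E}
    [SecondCountableTopologyEither ℂ E] (hf : ContinuousOn f (Ω \ range x)) :
    AEStronglyMeasurable f (volume.restrict Ω) := by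
  have h1 := hf.aestronglyMeasurable (μ := volume) (IsSingularWith.isOpen_diff hΩ).measurableSet
  rwa [Measure.restrict_congr_set (sdiff_null_ae_eq_self
    ((finite_range x).measure_zero volume))] at h1

namespace IsSingularWith

variable {n : ℕ} {Ω : Set ℂ} {x : Fin n → ℂ} {d : Fin n → ℤ} {u v : ℂ → ℂ}
  (h : IsSingularWith Ω x d u v) (hΩ : IsOpen Ω)

include h hΩ

lemma aestronglyMeasurable_current :
    AEStronglyMeasurable (current u) (volume.restrict Ω) :=
  aestronglyMeasurable_of_continuousOn_diff hΩ (h.continuousOn_current hΩ)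

lemma continuousOn : ContinuousOn u (Ω \ range x) := fun _ hz =>
  (h.contDiffAt hΩ hz).continuousAt.continuousWithinAt

lemma continuousOn_grad : ContinuousOn (grad u) (Ω \ range x) := by
  refine (PiLp.continuous_toLp 2 _).comp_continuousOn (continuousOn_pi.2 fun i => ?_)
  intro z hz
  have h2 : ContinuousAt (fderiv ℝ u) z :=
    ((h.contDiffAt hΩ hz).fderiv_right (m := 1) (by norm_num)).continuousAt
  exact (h2.clm_apply continuousAt_const).continuousWithinAt

lemma norm_current_sq_le {z : ℂ} (hz : z ∈ Ω \ range x) : ‖current u z‖ ^ 2 ≤ ‖grad u z‖ ^ 2 := by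
  rw [norm_grad_sq (h.differentiableAt hΩ hz) (h.eventually_norm hΩ hz)]
  exact norm_sq_le_gdot_self _

/-- The current is square integrable away from the singularities. -/
lemma memLp_current {ρ : ℝ} (hfin : IntegrableOn (fun z => ‖grad u z‖ ^ 2) (perforated Ω x ρ)) :
    MemLp (current u) 2 (volume.restrict (perforated Ω x ρ)) := by
  have hm : AEStronglyMeasurable (current u) (volume.restrict (perforated Ω x ρ)) :=
    (h.aestronglyMeasurable_current hΩ).mono_measure (Measure.restrict_mono sdiff_subset le_rfl)
  rw [memLp_two_iff_integrable_sq_norm hm]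
  refine hfin.mono' (hm.norm.pow 2) ?_
  filter_upwards [ae_restrict_of_ae_restrict_of_subset (sdiff_subset : perforated Ω x ρ ⊆ Ω)
    (ae_mem_diff hΩ.measurableSet x)] with z hz
  rw [Real.norm_of_nonneg (by positivity)]
  exact h.norm_current_sq_le hΩ hz

omit h in
/-- Near a singularity, the current differs from an integrable field by a bounded one. -/
lemma integrableOn_current_ball (h : IsSingularWith Ω x d u v) (j : Fin n) {ρ : ℝ}
    (hρ : Metric.closedBall (x j) ρ ⊆ Ω) : IntegrableOn (current u) (Metric.ball (x j) ρ) := by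
  have hsub : Metric.ball (x j) ρ ⊆ Ω := Metric.ball_subset_closedBall.trans hρ
  have h1 : ∀ l, IntegrableOn (fun z => (d l : ℝ) • rot (x l) z) (Metric.ball (x j) ρ) := fun l =>
    ((integrableOn_rot (x l) (ρ + dist (x l) (x j))).mono_set (Metric.ball_subset_ball' (by
      rw [dist_comm]))).smul (d l : ℝ)
  have h2 : IntegrableOn (current v) (Metric.ball (x j) ρ) := by
    have hcv : ContinuousOn (current v) Ω := fun z hz => by
      have h3 := h.harmonic.contDiffAt hΩ hz
      have h4 : ContinuousAt (fun z => (v z)⁻¹ • fderiv ℝ v z) z :=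
        (h3.continuousAt.inv₀ (h.harmonic.ne_zero hz)).smul
          (h3.fderiv_right (m := 1) (by norm_num)).continuousAt
      exact ((ContinuousLinearMap.compL ℝ ℂ ℂ ℝ Complex.imCLM).continuous.continuousAt.comp
        h4).continuousWithinAt
    exact ((hcv.mono hρ).integrableOn_compact (isCompact_closedBall _ _)).mono_set
      Metric.ball_subset_closedBall
  have h5 : IntegrableOn (fun z => ∑ l, (d l : ℝ) • rot (x l) z + current v z)
      (Metric.ball (x j) ρ) :=
    (integrable_finsetSum (μ := volume.restrict (Metric.ball (x j) ρ))
      (f := fun l z => (d l : ℝ) • rot (x l) z) _ fun l _ => (h1 l).integrable).add h2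
  refine h5.congr ?_
  filter_upwards [ae_restrict_of_ae_restrict_of_subset hsub (ae_mem_diff hΩ.measurableSet x)]
    with z hz
  exact (h.current_eq hΩ hz).symm

lemma integrableOn_current (hΩb : Bornology.IsBounded Ω) (hx : ∀ j, x j ∈ Ω)
    (hfin : ∀ ρ > 0, IntegrableOn (fun z => ‖grad u z‖ ^ 2) (perforated Ω x ρ)) :
    IntegrableOn (current u) Ω := by
  have h1 : ∀ j, ∀ᶠ r in 𝓝[>] (0 : ℝ), Metric.closedBall (x j) r ⊆ Ω := fun j => by
    obtain ⟨ε, hε, hb⟩ := Metric.isOpen_iff.1 hΩ (x j) (hx j)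
    filter_upwards [Ioo_mem_nhdsGT hε] with r hr
    exact (Metric.closedBall_subset_ball hr.2).trans hb
  obtain ⟨ρ, hρ, hρ0⟩ := ((eventually_all.2 h1).and self_mem_nhdsWithin).exists
  have hfm : IsFiniteMeasure (volume.restrict (perforated Ω x ρ)) :=
    isFiniteMeasure_restrict.2 (hΩb.subset sdiff_subset).measure_lt_top.ne
  have h2 : IntegrableOn (current u) (perforated Ω x ρ) :=
    (h.memLp_current hΩ (hfin ρ hρ0)).integrable (by norm_num)
  have h3 : IntegrableOn (current u) (⋃ j, Metric.ball (x j) ρ) :=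
    integrableOn_finite_iUnion.2 fun j => integrableOn_current_ball hΩ h j (hρ j)
  refine (h2.union h3).mono_set fun z hz => ?_
  by_cases hz' : z ∈ ⋃ j, Metric.ball (x j) ρ
  · exact Or.inr hz'
  · exact Or.inl ⟨hz, hz'⟩

end IsSingularWith


lemma tendsto_integral_norm_of_eLpNorm {E α : Type*} [NormedAddCommGroup E] [MeasurableSpace α]
    {μ : Measure α} [IsFiniteMeasure μ] {q : ℝ≥0∞} (hq : 1 ≤ q) {f : ℕ → α → E}
    (hf : ∀ k, MemLp (f k) q μ) (h : Tendsto (fun k => eLpNorm (f k) q μ) atTop (𝓝 0)) :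
    Tendsto (fun k => ∫ z, ‖f k z‖ ∂μ) atTop (𝓝 0) := by
  set c : ℝ≥0∞ := μ univ ^ (1 / (1 : ℝ≥0∞).toReal - 1 / q.toReal) with hc
  have hcfin : c ≠ ⊤ := by
    refine ENNReal.rpow_ne_top_of_nonneg ?_ (measure_ne_top μ _)
    rcases eq_or_ne q ⊤ with rfl | hqt
    · simp
    · have : 1 ≤ q.toReal := by
        rw [← ENNReal.toReal_one]; exact ENNReal.toReal_mono hqt hq
      rw [ENNReal.toReal_one, sub_nonneg]
      exact one_div_le_one_div_of_le one_pos this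
  have h1 : Tendsto (fun k => eLpNorm (f k) 1 μ) atTop (𝓝 0) := by
    have h2 : Tendsto (fun k => eLpNorm (f k) q μ * c) atTop (𝓝 (0 * c)) :=
      ENNReal.Tendsto.mul_const h (Or.inr hcfin)
    rw [zero_mul] at h2
    exact tendsto_of_tendsto_of_tendsto_of_le_of_le tendsto_const_nhds h2 (fun _ => zero_le)
      fun k => eLpNorm_le_eLpNorm_mul_rpow_measure_univ hq (hf k).aestronglyMeasurable
  have h3 := (ENNReal.tendsto_toReal ENNReal.zero_ne_top).comp h1
  rw [ENNReal.toReal_zero] at h3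
  refine h3.congr fun k => ?_
  rw [integral_norm_eq_lintegral_enorm (hf k).aestronglyMeasurable, Function.comp_apply,
    eLpNorm_one_eq_lintegral_enorm]

/-- Products of a fixed integrable function with bounded functions converging to zero in `L^q`. -/
lemma tendsto_integral_mul_of_eLpNorm {α : Type*} [MeasurableSpace α]
    {μ : Measure α} {q : ℝ≥0∞} (hq : 1 ≤ q) {f : ℕ → α → ℂ}
    (hf : ∀ k, MemLp (f k) q μ) (h : Tendsto (fun k => eLpNorm (f k) q μ) atTop (𝓝 0))
    {C : ℝ} (hb : ∀ k, ∀ᵐ z ∂μ, ‖f k z‖ ≤ C) {g : α → ℝ} (hg : Integrable g μ) :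
    Tendsto (fun k => ∫ z, ‖f k z‖ * g z ∂μ) atTop (𝓝 0) := by
  refine tendsto_of_subseq_tendsto fun ns hns => ?_
  have h' : Tendsto (fun k => eLpNorm (fun z => f (ns k) z - (0 : ℂ)) q μ) atTop (𝓝 0) := by
    simp only [sub_zero]
    exact h.comp hns
  obtain ⟨ms, hms, hae⟩ := (tendstoInMeasure_of_tendsto_eLpNorm (f := fun k => f (ns k))
    (g := fun _ => (0 : ℂ)) (p := q)
    (by rintro rfl; simp at hq) (fun k => (hf _).aestronglyMeasurable) aestronglyMeasurable_const
    h').exists_seq_tendsto_ae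
  refine ⟨ms, ?_⟩
  have := tendsto_integral_of_dominated_convergence (μ := μ)
    (F := fun k z => ‖f (ns (ms k)) z‖ * g z) (f := fun _ => (0 : ℝ)) (fun z => C * |g z|)
    (fun k => (hf _).aestronglyMeasurable.norm.mul hg.aestronglyMeasurable)
    (hg.abs.const_mul C) (fun k => ?_) ?_
  · simpa using this
  · filter_upwards [hb (ns (ms k))] with z hz
    rw [norm_mul, norm_norm]
    exact mul_le_mul_of_nonneg_right hz (abs_nonneg _)
  · filter_upwards [hae] with z hz
    have := hz.norm.mul_const (g z)
    simpa using this

section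

variable {n : ℕ} {Ω : Set ℂ} {x : Fin n → ℂ} {d : Fin n → ℤ} {u v : ℂ → ℂ}
  (h : IsSingularWith Ω x d u v) (hΩ : IsOpen Ω) (ha : IntegrableOn (current u) Ω)
  {q : ℝ≥0∞} (hq : 1 ≤ q) [IsFiniteMeasure (volume.restrict Ω)]
  {y : ℕ → Fin n → ℂ} {U V : ℕ → ℂ → ℂ} (hU : ∀ k, IsSingularWith Ω (y k) d (U k) (V k))
  (h0 : ∀ k, MemLp (fun z => U k z - u z) q (volume.restrict Ω))
  (h1 : ∀ k, MemLp (fun z => grad (U k) z - grad u z) q (volume.restrict Ω))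
  (hl0 : Tendsto (fun k => eLpNorm (fun z => U k z - u z) q (volume.restrict Ω)) atTop (𝓝 0))
  (hl1 : Tendsto (fun k => eLpNorm (fun z => grad (U k) z - grad u z) q (volume.restrict Ω))
    atTop (𝓝 0))

include h hΩ ha hq hU h0 h1 hl0 hl1

/-- Convergence in `W^{1,q}` implies the convergence of the currents in mean. -/
lemma tendsto_integral_current_sub :
    (∀ k, IntegrableOn (fun z => current (U k) z - current u z) Ω) ∧
    Tendsto (fun k => ∫ z in Ω, ‖current (U k) z - current u z‖) atTop (𝓝 0) := by
  have hb : ∀ k, ∀ᵐ z ∂(volume.restrict Ω), ‖current (U k) z - current u z‖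
      ≤ 2 * ‖grad (U k) z - grad u z‖ + ‖U k z - u z‖ * ‖current u z‖ := fun k => by
    filter_upwards [ae_mem_diff hΩ.measurableSet x, ae_mem_diff hΩ.measurableSet (y k)]
      with z hz hz'
    exact norm_current_sub_le ((hU k).norm_eq_one hz')
      (h.differentiableAt hΩ hz) (h.eventually_norm hΩ hz)
  have h2 : ∀ k, ∀ᵐ z ∂(volume.restrict Ω), ‖U k z - u z‖ ≤ 2 := fun k => by
    filter_upwards [ae_mem_diff hΩ.measurableSet x, ae_mem_diff hΩ.measurableSet (y k)]
      with z hz hz'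
    refine (norm_sub_le _ _).trans ?_
    rw [h.norm_eq_one hz, (hU k).norm_eq_one hz']
    norm_num
  have i1 : ∀ k, Integrable (fun z => 2 * ‖grad (U k) z - grad u z‖) (volume.restrict Ω) :=
    fun k => ((h1 k).integrable hq).norm.const_mul 2
  have i2 : ∀ k, Integrable (fun z => ‖U k z - u z‖ * ‖current u z‖) (volume.restrict Ω) :=
    fun k => by
    refine (ha.norm.const_mul 2).mono'
      ((h0 k).aestronglyMeasurable.norm.mul ha.aestronglyMeasurable.norm) ?_
    filter_upwards [h2 k] with z hz
    rw [norm_mul, norm_norm, norm_norm]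
    exact mul_le_mul_of_nonneg_right hz (norm_nonneg _)
  have i3 : ∀ k, IntegrableOn (fun z => current (U k) z - current u z) Ω := fun k =>
    ((i1 k).add (i2 k)).mono' (((hU k).aestronglyMeasurable_current hΩ).sub
      ha.aestronglyMeasurable) (hb k)
  refine ⟨i3, ?_⟩
  have l1 := (tendsto_integral_norm_of_eLpNorm hq h1 hl1).const_mul 2
  have l2 := tendsto_integral_mul_of_eLpNorm hq h0 hl0 h2 ha.norm
  have l3 := l1.add l2
  rw [mul_zero, add_zero] at l3
  refine squeeze_zero (fun k => integral_nonneg fun z => norm_nonneg _) (fun k => ?_) l3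
  rw [← integral_const_mul, ← integral_add (i1 k) (i2 k)]
  exact integral_mono_ae (i3 k).norm ((i1 k).add (i2 k)) (hb k)

/-- The currents, pulled back by diffeomorphisms converging to the identity, converge in mean. -/
lemma tendsto_integral_pullback_current_sub {r : ℝ} {χ : Fin n → ℂ → ℝ}
    (hχ : IsCutoffFamily Ω x r χ) (hy : Tendsto y atTop (𝓝 x))
    (hy4 : ∀ k z, ‖fderiv ℝ (shift χ (y k - x)) z‖ ≤ 1 / 4) {φ : ℕ → ℂ → ℂ}
    (hD : ∀ k, IsCompactDiffeo Ω (fun z => z + shift χ (y k - x) z) (φ k)) :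
    (∀ k, IntegrableOn (fun z => (current (U k) (z + shift χ (y k - x) z)).comp
      (fderiv ℝ (fun z => z + shift χ (y k - x) z) z) - current u z) Ω) ∧
    Tendsto (fun k => ∫ z in Ω, ‖(current (U k) (z + shift χ (y k - x) z)).comp
      (fderiv ℝ (fun z => z + shift χ (y k - x) z) z) - current u z‖) atTop (𝓝 0) := by
  obtain ⟨i0, l0⟩ := tendsto_integral_current_sub h hΩ ha hq hU h0 h1 hl0 hl1
  set Ψ : ℕ → ℂ → ℂ := fun k z => z + shift χ (y k - x) z with hΨ
  have hL : ∀ k z, fderiv ℝ (Ψ k) z = ContinuousLinearMap.id ℝ ℂ + fderiv ℝ (shift χ (y k - x)) z :=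
    fun k z => fderiv_id_add ((hχ.contDiff_shift _).differentiable (by simp)) z
  have hJ : ∀ k z, 1 / 2 ≤ jac (fderiv ℝ (Ψ k) z) := fun k z => by
    rw [hL]; exact jac_id_add_ge (hy4 k z)
  have hL2 : ∀ k z, ‖fderiv ℝ (Ψ k) z‖ ≤ 2 := fun k z => by
    rw [hL]
    refine (norm_add_le _ _).trans ?_
    have := ContinuousLinearMap.norm_id_le (𝕜 := ℝ) (E := ℂ)
    linarith [hy4 k z]
  -- the currents of `u` transported along the diffeomorphisms converge, by Scheffé's lemma
  set f : ℕ → ℂ → ℝ := fun k z => jac (fderiv ℝ (Ψ k) z) • ‖current u (Ψ k z)‖ with hf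
  have hfi : ∀ k, Integrable (f k) (volume.restrict Ω) := fun k => by
    have := ((hD k).integrableOn_image hΩ.measurableSet (fun z => ‖current u z‖)).1 (by
      rw [(hD k).image_eq]; exact ha.norm)
    exact this
  have hae : ∀ᵐ z ∂(volume.restrict Ω), Tendsto (fun k => current u (Ψ k z)) atTop
      (𝓝 (current u z)) := by
    filter_upwards [ae_mem_diff hΩ.measurableSet x] with z hz
    have hc := (h.continuousOn_current hΩ).continuousAt
      ((IsSingularWith.isOpen_diff hΩ).mem_nhds hz)
    exact hc.tendsto.comp (IsCutoffFamily.tendsto_shift hy z)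
  have hfd : ∀ z, Tendsto (fun k => fderiv ℝ (Ψ k) z) atTop (𝓝 (ContinuousLinearMap.id ℝ ℂ)) :=
    fun z => by
    simp_rw [hL]
    simpa using (hχ.tendsto_fderiv_shift hy z).const_add (ContinuousLinearMap.id ℝ ℂ)
  have hjc : Continuous jac := by unfold jac; fun_prop
  have hj1 : jac (ContinuousLinearMap.id ℝ ℂ) = 1 := by simp [jac]
  have l1 := tendsto_integral_abs_sub_of_integral_eq (μ := volume.restrict Ω) hfi ha.norm
    (fun k z => mul_nonneg (by linarith [hJ k z]) (norm_nonneg _)) (fun z => norm_nonneg _)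
    (fun k => ((hD k).integral_comp hΩ.measurableSet (fun z => ‖current u z‖)).symm) (by
      filter_upwards [hae] with z hz
      have := ((hjc.tendsto _).comp (hfd z)).mul hz.norm
      rwa [hj1, one_mul] at this)
  have hm1 : ∀ k, AEStronglyMeasurable (fun z => (current u (Ψ k z)).comp (fderiv ℝ (Ψ k) z)
      - current u z) (volume.restrict Ω) := fun k => by
    have hm : ContinuousOn (fun z => (current u (Ψ k z)).comp (fderiv ℝ (Ψ k) z))
        (Ω \ range (φ k ∘ x)) := by
      refine ((h.continuousOn_current hΩ).comp (hD k).smooth.continuous.continuousOn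
        fun z hz => ⟨((hD k).mem_iff z).2 hz.1, ?_⟩).clm_comp (hD k).continuous_fderiv.continuousOn
      rintro ⟨l, hl⟩
      refine hz.2 ⟨l, ?_⟩
      rw [Function.comp_apply, hl]
      exact (hD k).left z
    exact (aestronglyMeasurable_of_continuousOn_diff hΩ hm).sub ha.aestronglyMeasurable
  have hm2 : ∀ k, AEStronglyMeasurable (fun z => (current (U k) (Ψ k z)).comp (fderiv ℝ (Ψ k) z)
      - current u z) (volume.restrict Ω) := fun k => by
    have hm : ContinuousOn (fun z => (current (U k) (Ψ k z)).comp (fderiv ℝ (Ψ k) z))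
        (Ω \ range x) :=
      (((hU k).continuousOn_current hΩ).comp (hD k).smooth.continuous.continuousOn
        fun z hz => (hχ.add_shift_mem_diff_iff (hD k) z).2 hz).clm_comp
        (hD k).continuous_fderiv.continuousOn
    exact (aestronglyMeasurable_of_continuousOn_diff hΩ hm).sub ha.aestronglyMeasurable
  have hL4 : ∀ k z (α : ℂ →L[ℝ] ℝ), ‖α.comp (fderiv ℝ (Ψ k) z)‖
      ≤ 4 * (jac (fderiv ℝ (Ψ k) z) • ‖α‖) := fun k z α => by
    refine (α.opNorm_comp_le _).trans ?_
    rw [smul_eq_mul]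
    nlinarith [norm_nonneg α, hL2 k z, hJ k z, mul_nonneg (norm_nonneg α)
      (sub_nonneg.2 (hL2 k z)), mul_nonneg (norm_nonneg α) (sub_nonneg.2 (hJ k z))]
  have hE : ∀ k, Integrable (fun z => 4 * |f k z - ‖current u z‖|) (volume.restrict Ω) :=
    fun k => ((hfi k).sub ha.norm).abs.const_mul 4
  have hb1 : ∀ k z, ‖(current u (Ψ k z)).comp (fderiv ℝ (Ψ k) z) - current u z‖
      ≤ 5 * ‖current u z‖ + 4 * |f k z - ‖current u z‖| := fun k z => by
    have e1 := norm_sub_le ((current u (Ψ k z)).comp (fderiv ℝ (Ψ k) z)) (current u z)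
    have e2 := hL4 k z (current u (Ψ k z))
    have e3 := le_abs_self (f k z - ‖current u z‖)
    simp only [hf] at e3 ⊢
    linarith
  have i1 : ∀ k, Integrable (fun z => ‖(current u (Ψ k z)).comp (fderiv ℝ (Ψ k) z)
      - current u z‖) (volume.restrict Ω) := fun k =>
    ((ha.norm.const_mul 5).add (hE k)).mono' (hm1 k).norm
      (Eventually.of_forall fun z => by rw [norm_norm]; exact hb1 k z)
  -- first the pullbacks of the current of `u` itself: they converge almost everywhere and are
  -- dominated by the densities `f k`, which converge in mean
  have l2 : Tendsto (fun k => ∫ z in Ω, ‖(current u (Ψ k z)).comp (fderiv ℝ (Ψ k) z)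
      - current u z‖) atTop (𝓝 (∫ _ in Ω, (0 : ℝ))) := by
    refine tendsto_integral_of_dominated_add (D := fun z => 5 * ‖current u z‖)
      (E := fun k z => 4 * |f k z - ‖current u z‖|) (fun k => (hm1 k).norm) (ha.norm.const_mul 5)
      hE (fun z => by positivity) (fun k z => by positivity)
      (fun k => Eventually.of_forall fun z => by rw [abs_norm]; exact hb1 k z) ?_ ?_ ?_
    · have := l1.const_mul 4
      rw [mul_zero] at this
      refine this.congr fun k => ?_
      rw [integral_const_mul]
    · filter_upwards [hae] with z hz
      have := ((hjc.tendsto _).comp (hfd z)).mul hz.norm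
      rw [hj1, one_mul] at this
      have h4 := ((this.sub_const ‖current u z‖).abs).const_mul 4
      rw [sub_self, abs_zero, mul_zero] at h4
      exact h4
    · filter_upwards [hae] with z hz
      have h3 := ((ContinuousLinearMap.compL ℝ ℂ ℂ ℝ).continuous₂.tendsto
        (current u z, ContinuousLinearMap.id ℝ ℂ)).comp (hz.prodMk_nhds (hfd z))
      have h4 : Tendsto (fun k => ‖(current u (Ψ k z)).comp (fderiv ℝ (Ψ k) z) - current u z‖) atTop
          (𝓝 ‖(current u z).comp (ContinuousLinearMap.id ℝ ℂ) - current u z‖) :=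
        (h3.sub_const (current u z)).norm
      rwa [ContinuousLinearMap.comp_id, sub_self, norm_zero] at h4
  rw [integral_zero] at l2
  -- then the difference between the pullbacks of the currents of `U k` and of `u`, whose integral
  -- is controlled, after the change of variables, by that of the difference of the currents
  have i2 : ∀ k, Integrable (fun z => jac (fderiv ℝ (Ψ k) z)
      • ‖current (U k) (Ψ k z) - current u (Ψ k z)‖) (volume.restrict Ω) := fun k => by
    have := ((hD k).integrableOn_image hΩ.measurableSet
      (fun z => ‖current (U k) z - current u z‖)).1 (by
      rw [(hD k).image_eq]; exact (i0 k).norm)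
    exact this
  have hb2 : ∀ k z, ‖(current (U k) (Ψ k z)).comp (fderiv ℝ (Ψ k) z) - current u z‖
      ≤ 4 * (jac (fderiv ℝ (Ψ k) z) • ‖current (U k) (Ψ k z) - current u (Ψ k z)‖)
        + ‖(current u (Ψ k z)).comp (fderiv ℝ (Ψ k) z) - current u z‖ := fun k z => by
    refine le_trans ?_ (add_le_add_left (hL4 k z _) _)
    rw [ContinuousLinearMap.sub_comp]
    refine le_trans (le_of_eq ?_) (norm_add_le _ _)
    congr 1
    abel
  have i3 : ∀ k, IntegrableOn (fun z => (current (U k) (Ψ k z)).comp (fderiv ℝ (Ψ k) z)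
      - current u z) Ω := fun k =>
    (((i2 k).const_mul 4).add (i1 k)).mono' (hm2 k) (Eventually.of_forall fun z => hb2 k z)
  refine ⟨i3, ?_⟩
  have l3 := (l0.const_mul 4).add l2
  rw [mul_zero, add_zero] at l3
  refine squeeze_zero (fun k => integral_nonneg fun z => norm_nonneg _) (fun k => ?_) l3
  rw [(hD k).integral_comp hΩ.measurableSet (fun z => ‖current (U k) z - current u z‖),
    ← integral_const_mul, ← integral_add ((i2 k).const_mul 4) (i1 k)]
  exact integral_mono (i3 k).norm (((i2 k).const_mul 4).add (i1 k)) fun z => hb2 k z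

end


/-! ### The phase between two singular harmonic maps -/

lemma mul_conj_eq_one {w : ℂ} (hw : ‖w‖ = 1) : w * starRingEnd ℂ w = 1 := by
  rw [Complex.mul_conj, Complex.normSq_eq_norm_sq, hw]; norm_num

lemma norm_unit_zpow {w c : ℂ} (h : w ≠ c) (m : ℤ) :
    ‖((w - c) / (‖w - c‖ : ℂ)) ^ m‖ = 1 := by
  rw [norm_zpow, norm_unit h, one_zpow]

lemma ContDiffAt.conj {f : ℂ → ℂ} {z : ℂ} {m : WithTop ℕ∞} (hf : ContDiffAt ℝ m f z) :
    ContDiffAt ℝ m (fun z => starRingEnd ℂ (f z)) z :=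
  Complex.conjCLE.contDiff.contDiffAt.comp z hf

section

variable {n : ℕ} {Ω : Set ℂ} {x y : Fin n → ℂ} {d : Fin n → ℤ} {r : ℝ} {χ : Fin n → ℂ → ℝ}
  {φ : ℂ → ℂ}

/-- The quotient of the singular factors of two singular harmonic maps, the first one being
transported by the diffeomorphism which displaces the singularities, has no singularity. -/
lemma exists_quotient_singular (hχ : IsCutoffFamily Ω x r χ)
    (hD : IsCompactDiffeo Ω (fun z => z + shift χ (y - x) z) φ) (l : Fin n) (m : ℤ) :
    ∃ E : ℂ → ℂ, (∀ z, ContDiffAt ℝ 2 E z) ∧ (∀ z, ‖E z‖ = 1) ∧ ∀ z, z ≠ x l →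
      E z = ((z + shift χ (y - x) z - y l) / (‖z + shift χ (y - x) z - y l‖ : ℂ)) ^ m *
        starRingEnd ℂ (((z - x l) / (‖z - x l‖ : ℂ)) ^ m) := by
  classical
  -- near `x l` the diffeomorphism is the translation by `y l - x l`, hence `Q = 1` off `x l`
  set Q : ℂ → ℂ := fun z =>
    ((z + shift χ (y - x) z - y l) / (‖z + shift χ (y - x) z - y l‖ : ℂ)) ^ m *
        starRingEnd ℂ (((z - x l) / (‖z - x l‖ : ℂ)) ^ m) with hQ
  set E : ℂ → ℂ := fun z => if z ∈ Metric.ball (x l) r then 1 else Q z with hE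
  have hEQ : ∀ z, z ≠ x l → E z = Q z := fun z hz => by
    simp only [hE]
    split_ifs with hb
    · simp only [hQ]
      rw [hχ.add_shift_eq hb, show z + (y l - x l) - y l = z - x l by ring,
        mul_conj_eq_one (norm_unit_zpow hz m)]
    · rfl
  refine ⟨E, fun z => ?_, fun z => ?_, hEQ⟩
  · by_cases hz : z = x l
    · have hzb : z ∈ Metric.ball (x l) r := by rw [hz]; exact Metric.mem_ball_self hχ.pos
      have : E =ᶠ[𝓝 z] fun _ => 1 := by
        filter_upwards [Metric.isOpen_ball.mem_nhds hzb] with w hw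
        simp only [hE, if_pos hw]
      exact contDiffAt_const.congr_of_eventuallyEq this
    · have : E =ᶠ[𝓝 z] Q := by
        filter_upwards [isOpen_compl_singleton.mem_nhds hz] with w hw using hEQ w hw
      refine ContDiffAt.congr_of_eventuallyEq ?_ this
      have hz' : z + shift χ (y - x) z ≠ y l := fun h => hz ((hχ.add_shift_eq_iff hD l z).1 h)
      have h1 := (contDiffAt_unit hz').comp z hD.smooth.contDiffAt
      have h2 := ContDiffAt.zpow_complex h1 (unit_ne_zero hz') m
      have h3 := ContDiffAt.conj (ContDiffAt.zpow_complex (contDiffAt_unit hz) (unit_ne_zero hz) m)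
      exact (h2.mul h3).of_le (by exact ENat.LEInfty.out)
  · by_cases hz : z ∈ Metric.ball (x l) r
    · simp only [hE, if_pos hz, norm_one]
    · have hz1 : z ≠ x l := fun h => hz (h ▸ Metric.mem_ball_self hχ.pos)
      have hz' : z + shift χ (y - x) z ≠ y l := fun h => hz1 ((hχ.add_shift_eq_iff hD l z).1 h)
      rw [hEQ z hz1]
      simp only [hQ]
      rw [norm_mul, RCLike.norm_conj, norm_unit_zpow hz', norm_unit_zpow hz1, one_mul]

/-- The quotient of two singular harmonic maps with the same degrees and the same boundary values,
the first one being transported by the diffeomorphism which displaces the singularities, extends to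
a continuous circle valued map on the plane. -/
lemma exists_quotient (hΩ : IsOpen Ω) {u v U V : ℂ → ℂ} (h : IsSingularWith Ω x d u v)
    (hU : IsSingularWith Ω y d U V) (hχ : IsCutoffFamily Ω x r χ)
    (hD : IsCompactDiffeo Ω (fun z => z + shift χ (y - x) z) φ)
    (hx : ∀ j, x j ∈ Ω) (huc : ContinuousOn u (closure Ω \ range x))
    (hUc : ContinuousOn U (closure Ω \ range y)) (hbd : EqOn U u (frontier Ω)) :
    ∃ F : ℂ → ℂ, Continuous F ∧ (∀ z, ‖F z‖ = 1) ∧ (∀ z ∈ Ω, ContDiffAt ℝ 2 F z) ∧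
      (∀ z, z ∉ Ω → F z = 1) ∧
      ∀ z ∈ Ω \ range x, F z = U (z + shift χ (y - x) z) * starRingEnd ℂ (u z) := by
  classical
  choose E hE1 hE2 hE3 using fun l => exists_quotient_singular hχ hD l (d l)
  set Ψ : ℂ → ℂ := fun z => z + shift χ (y - x) z with hΨ
  set f : ℂ → ℂ := fun z => (∏ l, E l z) * V (Ψ z) * starRingEnd ℂ (v z) with hf
  set F : ℂ → ℂ := fun z => if z ∈ Ω then f z else 1 with hF
  have hFf : ∀ z ∈ Ω, F =ᶠ[𝓝 z] f := fun z hz => by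
    filter_upwards [hΩ.mem_nhds hz] with w hw
    simp only [hF, if_pos hw]
  have hsm : ∀ z ∈ Ω, ContDiffAt ℝ 2 F z := fun z hz => by
    refine ContDiffAt.congr_of_eventuallyEq ?_ (hFf z hz)
    have hV : ContDiffAt ℝ 2 (fun z => V (Ψ z)) z :=
      (hU.harmonic.contDiffAt hΩ ((hD.mem_iff z).2 hz)).comp z
        (hD.smooth.contDiffAt.of_le (by exact ENat.LEInfty.out))
    exact ((contDiffAt_prod fun l _ => hE1 l z).mul hV).mul
      (ContDiffAt.conj (h.harmonic.contDiffAt hΩ hz))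
  have hFu : ∀ z ∈ Ω \ range x, F z = U (Ψ z) * starRingEnd ℂ (u z) := fun z hz => by
    have hne := IsSingularWith.ne_of_notMem_range hz.2
    simp only [hF, if_pos hz.1, hf]
    rw [hU.eq_mul _ ((hχ.add_shift_mem_diff_iff hD z).2 hz), h.eq_mul z hz, map_mul, map_prod]
    rw [Finset.prod_congr rfl fun l _ => hE3 l z (hne l), Finset.prod_mul_distrib]
    ring
  have hnorm : ∀ z, ‖F z‖ = 1 := fun z => by
    simp only [hF]
    split_ifs with hz
    · simp only [hf]
      rw [norm_mul, norm_mul, norm_prod, Finset.prod_eq_one fun l _ => hE2 l z, RCLike.norm_conj,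
        hU.harmonic.norm_eq_one _ ((hD.mem_iff z).2 hz), h.harmonic.norm_eq_one _ hz]
      norm_num
    · simp
  refine ⟨F, ?_, hnorm, hsm, fun z hz => by simp only [hF, if_neg hz], hFu⟩
  rw [continuous_iff_continuousAt]
  intro z
  by_cases hz : z ∈ Ω
  · exact (hsm z hz).continuousAt
  by_cases hzc : z ∈ closure Ω
  swap
  · have : F =ᶠ[𝓝 z] fun _ => 1 := by
      filter_upwards [isClosed_closure.isOpen_compl.mem_nhds hzc] with w hw
      simp only [hF, if_neg fun h => hw (subset_closure h)]
    exact continuousAt_const.congr this.symm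
  -- the boundary values agree
  have hzf : z ∈ frontier Ω := by rw [hΩ.frontier_eq]; exact ⟨hzc, hz⟩
  have hzx : z ∉ range x := by rintro ⟨l, rfl⟩; exact hz (hx l)
  have hK : z ∉ ⋃ j, tsupport (χ j) := fun h' => hz (iUnion_subset hχ.tsupport_subset h')
  have hev : ∀ᶠ w in 𝓝 z, w ∉ range x ∧ Ψ w = w := by
    filter_upwards [(finite_range x).isClosed.isOpen_compl.mem_nhds hzx,
      hχ.isCompact_iUnion.isClosed.isOpen_compl.mem_nhds hK] with w h1 h2
    exact ⟨h1, by simp only [hΨ]; rw [IsCutoffFamily.shift_eq_zero _ h2, add_zero]⟩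
  have hzy : z ∉ range y := fun h' => hzx ((hχ.add_shift_mem_range_iff hD z).1 (by
    have := hev.self_of_nhds.2
    simp only [hΨ] at this
    rwa [this]))
  have hne : (𝓝[Ω] z).NeBot := mem_closure_iff_nhdsWithin_neBot.1 hzc
  have huw : Tendsto u (𝓝[Ω] z) (𝓝 (u z)) := by
    have h1 := huc z ⟨hzc, hzx⟩
    refine (h1.tendsto).mono_left (nhdsWithin_le_iff.2 ?_)
    filter_upwards [self_mem_nhdsWithin, mem_nhdsWithin_of_mem_nhds hev] with w h2 h3
    exact ⟨subset_closure h2, h3.1⟩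
  have hUw : Tendsto U (𝓝[Ω] z) (𝓝 (U z)) := by
    have h1 := hUc z ⟨hzc, hzy⟩
    refine (h1.tendsto).mono_left (nhdsWithin_le_iff.2 ?_)
    filter_upwards [self_mem_nhdsWithin, mem_nhdsWithin_of_mem_nhds
      ((finite_range y).isClosed.isOpen_compl.mem_nhds hzy)] with w h2 h3
    exact ⟨subset_closure h2, h3⟩
  have hu1 : ‖u z‖ = 1 := by
    refine tendsto_nhds_unique huw.norm (tendsto_const_nhds.congr' ?_)
    filter_upwards [self_mem_nhdsWithin, mem_nhdsWithin_of_mem_nhds hev] with w h2 h3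
    exact (h.norm_eq_one ⟨h2, h3.1⟩).symm
  have hFz : F z = 1 := by simp only [hF, if_neg hz]
  rw [ContinuousAt, hFz, nhds_eq_nhdsWithin_sup_nhdsWithin z (union_compl_self Ω).symm]
  refine Tendsto.sup ?_ ?_
  · have hl := hUw.mul ((Complex.continuous_conj.tendsto _).comp huw)
    rw [hbd hzf, mul_conj_eq_one hu1] at hl
    refine hl.congr' ?_
    filter_upwards [self_mem_nhdsWithin, mem_nhdsWithin_of_mem_nhds hev] with w h2 h3
    rw [hFu w ⟨h2, h3.1⟩, h3.2]; rfl
  · refine tendsto_const_nhds.congr' ?_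
    filter_upwards [self_mem_nhdsWithin] with w hw
    simp only [hF, if_neg hw]

end

/-- Continuous lifting of circle valued maps on the plane, with the regularity of the map. -/
lemma exists_lift {F : ℂ → ℂ} (hF : Continuous F) (h1 : ∀ z, ‖F z‖ = 1) :
    ∃ ψ : ℂ → ℝ, Continuous ψ ∧ (∀ z, F z = Complex.exp (ψ z * Complex.I)) ∧
      ∀ z (m : WithTop ℕ∞), ContDiffAt ℝ m F z → ContDiffAt ℝ m ψ z := by
  have h0 : ∀ z, F z ≠ 0 := fun z => by rw [← norm_ne_zero_iff, h1]; norm_num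
  have hsc : IsSimplyConnected (univ : Set ℂ) := by
    have := convex_univ.contractibleSpace (univ_nonempty (α := ℂ))
    exact SimplyConnectedSpace.ofContractible _
  obtain ⟨g, hg, hge⟩ := Complex.exists_continuousOn_eqOn_exp_comp (U := (univ : Set ℂ))
    hsc isOpen_univ
    hF.continuousOn (by rintro ⟨z, -, hz⟩; exact h0 z hz)
  have hgF : ∀ z, Complex.exp (g z) = F z := fun z => hge (mem_univ z)
  have hre : ∀ z, (g z).re = 0 := fun z => by
    have := h1 z
    rw [← hgF, Complex.norm_exp] at this
    exact Real.exp_eq_one_iff _ |>.1 this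
  have hc : Continuous fun z => (g z).im :=
    Complex.continuous_im.comp (continuousOn_univ.1 hg)
  have he : ∀ z, F z = Complex.exp ((g z).im * Complex.I) := fun z => by
    rw [← hgF]
    congr 1
    apply Complex.ext <;> simp [hre]
  refine ⟨fun z => (g z).im, hc, he, fun z m hm => ?_⟩
  -- near `z`, the lift is a branch of the argument of `F / F z`
  have hev : (fun w => (g w).im) =ᶠ[𝓝 z] fun w => (g z).im + (Complex.log (F w * (F z)⁻¹)).im := by
    have hn : ∀ᶠ w in 𝓝 z, (g w).im - (g z).im ∈ Ioo (-Real.pi) Real.pi := by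
      refine (hc.sub continuous_const).continuousAt.eventually_mem (isOpen_Ioo.mem_nhds ?_)
      simp [Real.pi_pos]
    filter_upwards [hn] with w hw
    have : F w * (F z)⁻¹ = Complex.exp (((g w).im - (g z).im : ℝ) * Complex.I) := by
      rw [he w, he z, ← Complex.exp_neg, ← Complex.exp_add]
      congr 1
      push_cast; ring
    rw [this, Complex.log_exp (by simpa using hw.1) (by simpa using hw.2.le)]
    simp
  refine ContDiffAt.congr_of_eventuallyEq ?_ hev
  have hl : ContDiffAt ℝ m Complex.log (F z * (F z)⁻¹) := by
    rw [mul_inv_cancel₀ (h0 z)]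
    exact (Complex.contDiffAt_log (by simp)).restrict_scalars ℝ
  have h2 : ContDiffAt ℝ m (fun w => F w * (F z)⁻¹) z := hm.mul contDiffAt_const
  have h3 : ContDiffAt ℝ m (fun w => Complex.log (F w * (F z)⁻¹)) z :=
    ContDiffAt.comp (g := Complex.log) z hl h2
  have h4 : ContDiffAt ℝ m (fun w => (Complex.log (F w * (F z)⁻¹)).im) z :=
    Complex.imCLM.contDiff.contDiffAt.comp z h3
  exact contDiffAt_const.add h4


/-! ### Constancy of the phase on the boundary -/

/-- Along a connected set, a continuous function with values in `2πℤ` is constant. -/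
lemma eq_of_isPreconnected {S : Set ℂ} (hS : IsPreconnected S) {ψ : ℂ → ℝ} (hψ : ContinuousOn ψ S)
    (hz : ∀ z ∈ S, ∃ m : ℤ, ψ z = 2 * Real.pi * m) {a b : ℂ} (ha : a ∈ S) (hb : b ∈ S) :
    ψ a = ψ b := by
  have key : ∀ a ∈ S, ∀ b ∈ S, ¬ ψ a < ψ b := fun a ha b hb hab => by
    obtain ⟨m, hm⟩ := hz a ha
    obtain ⟨m', hm'⟩ := hz b hb
    have hpi := Real.pi_pos
    have hlt : (m : ℝ) < m' := by
      rw [hm, hm'] at hab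
      exact lt_of_mul_lt_mul_left hab (by positivity)
    have hle : (m : ℝ) + 1 ≤ m' := by exact_mod_cast hlt
    have hmem : 2 * Real.pi * m + Real.pi ∈ Icc (ψ a) (ψ b) := by
      rw [hm, hm']
      constructor <;> nlinarith
    obtain ⟨z, hzS, hzm⟩ := hS.intermediate_value ha hb hψ hmem
    obtain ⟨k, hk⟩ := hz z hzS
    have h1 : Real.pi * (2 * (k : ℝ)) = Real.pi * (2 * m + 1) := by linarith
    have h2 := mul_left_cancel₀ hpi.ne' h1
    have h3 : 2 * k = 2 * m + 1 := by exact_mod_cast h2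
    lia
  exact le_antisymm (not_lt.1 (key b hb a ha)) (not_lt.1 (key a ha b hb))

lemma exists_abs_deriv_smoothTransition_le :
    ∃ C > 0, ∀ s, |deriv Real.smoothTransition s| ≤ C := by
  have hc : HasCompactSupport (deriv Real.smoothTransition) := by
    refine HasCompactSupport.intro (isCompact_Icc (a := (0 : ℝ)) (b := 1)) fun s hs => ?_
    rcases lt_or_ge s 0 with h | h
    · have : Real.smoothTransition =ᶠ[𝓝 s] fun _ => 0 := by
        filter_upwards [Iio_mem_nhds h] with w hw
        exact Real.smoothTransition.zero_of_nonpos (le_of_lt hw)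
      rw [this.deriv_eq, deriv_const]
    · have h1 : 1 < s := not_le.1 fun h' => hs ⟨h, h'⟩
      have : Real.smoothTransition =ᶠ[𝓝 s] fun _ => 1 := by
        filter_upwards [Ioi_mem_nhds h1] with w hw
        exact Real.smoothTransition.one_of_one_le (le_of_lt hw)
      rw [this.deriv_eq, deriv_const]
  obtain ⟨C, hC⟩ := (Real.smoothTransition.contDiff (n := 1)).continuous_deriv (by simp)
    |>.bounded_above_of_compact_support hc
  exact ⟨max C 1, lt_max_of_lt_right one_pos, fun s => (hC s).trans (le_max_left _ _)⟩

/-- The oscillation of a function along the segments parallel to `e` which start from a ball is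
controlled by the integral of its gradient. -/
lemma volume_ball_le_of_segments {τ : ℂ → ℝ} (hτ : ContDiff ℝ 1 τ) {c e : ℂ} {s : ℝ}
    (h : ∀ a ∈ Metric.ball c s, 1 ≤ |τ (a + e) - τ a|) :
    volume (Metric.ball c s) ≤ (∫⁻ z, ‖fderiv ℝ τ z‖ₑ) * ‖e‖ₑ := by
  have hcf : Continuous (fderiv ℝ τ) := hτ.continuous_fderiv (by simp)
  have hpt : ∀ a ∈ Metric.ball c s,
      1 ≤ ∫⁻ t in Ioc (0 : ℝ) 1, ‖fderiv ℝ τ (a + t * e)‖ₑ * ‖e‖ₑ := fun a ha => by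
    have hd : ∀ t : ℝ, HasDerivAt (fun t : ℝ => τ (a + t * e)) (fderiv ℝ τ (a + t * e) e) t :=
      fun t => by
      have h1 : HasDerivAt (fun t : ℝ => a + t * e) e t := by
        simpa using ((hasDerivAt_id t).ofReal_comp.mul_const e).const_add a
      exact ((hτ.differentiable (by simp)) _).hasFDerivAt.comp_hasDerivAt t h1
    have hcd : Continuous fun t : ℝ => fderiv ℝ τ (a + t * e) e :=
      (hcf.comp (by fun_prop)).clm_apply continuous_const
    have h2 := intervalIntegral.integral_eq_sub_of_hasDerivAt (a := 0) (b := 1) (fun t _ => hd t)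
      (hcd.intervalIntegrable _ _)
    have h3 : (1 : ℝ≥0∞) ≤ ‖∫ t in (0 : ℝ)..1, fderiv ℝ τ (a + t * e) e‖ₑ := by
      rw [h2]
      simp only [Complex.ofReal_one, one_mul, Complex.ofReal_zero, zero_mul, add_zero]
      rw [← ofReal_norm, Real.norm_eq_abs, ← ENNReal.ofReal_one]
      exact ENNReal.ofReal_le_ofReal (h a ha)
    refine h3.trans ?_
    rw [intervalIntegral.integral_of_le zero_le_one]
    refine (enorm_integral_le_lintegral_enorm _).trans (lintegral_mono fun t => ?_)
    exact ContinuousLinearMap.le_opENorm _ _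
  have hm : AEMeasurable (Function.uncurry fun (a : ℂ) (t : ℝ) => ‖fderiv ℝ τ (a + t * e)‖ₑ * ‖e‖ₑ)
      ((volume.restrict (Metric.ball c s)).prod (volume.restrict (Ioc (0 : ℝ) 1))) := by
    have : Continuous (fun p : ℂ × ℝ => fderiv ℝ τ (p.1 + p.2 * e)) := hcf.comp (by fun_prop)
    exact (this.enorm.measurable.mul_const _).aemeasurable
  calc volume (Metric.ball c s) = ∫⁻ _ in Metric.ball c s, 1 := by simp
    _ ≤ ∫⁻ a in Metric.ball c s, ∫⁻ t in Ioc (0 : ℝ) 1, ‖fderiv ℝ τ (a + t * e)‖ₑ * ‖e‖ₑ :=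
        setLIntegral_mono' measurableSet_ball hpt
    _ = ∫⁻ t in Ioc (0 : ℝ) 1, ∫⁻ a in Metric.ball c s, ‖fderiv ℝ τ (a + t * e)‖ₑ * ‖e‖ₑ :=
        lintegral_lintegral_swap hm
    _ ≤ ∫⁻ _ in Ioc (0 : ℝ) 1, (∫⁻ z, ‖fderiv ℝ τ z‖ₑ) * ‖e‖ₑ := by
        refine lintegral_mono fun t => ?_
        refine (setLIntegral_le_lintegral _ _).trans ?_
        have hct : Continuous fun a : ℂ => fderiv ℝ τ (a + t * e) := hcf.comp (by fun_prop)
        rw [lintegral_mul_const _ hct.enorm.measurable,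
          lintegral_add_right_eq_self (fun z => ‖fderiv ℝ τ z‖ₑ)]
    _ = (∫⁻ z, ‖fderiv ℝ τ z‖ₑ) * ‖e‖ₑ := by simp

/-- A phase which takes different values on two balls has a gradient of definite size. -/
lemma exists_volume_ball_le : ∃ C > 0, ∀ {Ω : Set ℂ} {ψ : ℂ → ℝ} {c c' : ℂ} {s : ℝ} {m m' : ℤ},
    IsOpen Ω → Continuous ψ → (∀ z ∈ Ω, ContDiffAt ℝ 1 ψ z) →
    (∀ z ∉ Ω, ∃ m : ℤ, ψ z = 2 * Real.pi * m) → IntegrableOn (fderiv ℝ ψ) Ω →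
    (∀ z ∈ Metric.ball c s, ψ z = 2 * Real.pi * m) →
    (∀ z ∈ Metric.ball c' s, ψ z = 2 * Real.pi * m') → m < m' →
    volume (Metric.ball c s) ≤ ENNReal.ofReal (C * ‖c' - c‖ * ∫ z in Ω, ‖fderiv ℝ ψ z‖) := by
  obtain ⟨C, hC, hb⟩ := exists_abs_deriv_smoothTransition_le
  refine ⟨C, hC, ?_⟩
  intro Ω ψ c c' s m m' hΩ hψ hsm hint hi hm hm' hlt
  have hpi := Real.pi_gt_three
  -- a truncation of the phase which is locally constant outside `Ω`
  set T : ℝ → ℝ := fun t => Real.smoothTransition (t - (2 * Real.pi * m + 1)) with hT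
  have hT0 : ∀ k : ℤ, k ≤ m → ∀ t < 2 * Real.pi * k + 1, T t = 0 := fun k hk t ht => by
    have : (k : ℝ) ≤ m := by exact_mod_cast hk
    exact Real.smoothTransition.zero_of_nonpos (by nlinarith)
  have hT1 : ∀ k : ℤ, m < k → ∀ t > 2 * Real.pi * k - 1, T t = 1 := fun k hk t ht => by
    have : (m : ℝ) + 1 ≤ k := by exact_mod_cast hk
    exact Real.smoothTransition.one_of_one_le (by nlinarith)
  have hTd : ∀ t, HasDerivAt T (deriv Real.smoothTransition (t - (2 * Real.pi * m + 1))) t :=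
    fun t => by
    have h1 := ((Real.smoothTransition.contDiff (n := 1)).differentiable (by simp)
      (t - (2 * Real.pi * m + 1))).hasDerivAt
    exact h1.comp_sub_const t _
  have hTs : ContDiff ℝ 1 T := Real.smoothTransition.contDiff.comp (contDiff_id.sub contDiff_const)
  have hconst : ∀ z ∉ Ω, ∃ a : ℝ, (fun z => T (ψ z)) =ᶠ[𝓝 z] fun _ => a := fun z hz => by
    obtain ⟨k, hk⟩ := hint z hz
    rcases le_or_gt k m with h | h
    · refine ⟨0, ?_⟩
      filter_upwards [hψ.continuousAt.eventually (gt_mem_nhds (show ψ z < 2 * Real.pi * k + 1 by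
        linarith))] with w hw using hT0 k h _ hw
    · refine ⟨1, ?_⟩
      filter_upwards [hψ.continuousAt.eventually (lt_mem_nhds (show 2 * Real.pi * k - 1 < ψ z by
        linarith))] with w hw using hT1 k h _ hw
  have hτ : ContDiff ℝ 1 (fun z => T (ψ z)) := contDiff_iff_contDiffAt.2 fun z => by
    by_cases hz : z ∈ Ω
    · exact hTs.contDiffAt.comp z (hsm z hz)
    · obtain ⟨a, ha⟩ := hconst z hz
      exact contDiffAt_const.congr_of_eventuallyEq ha
  have hseg := volume_ball_le_of_segments hτ (c := c) (e := c' - c) (s := s) fun a ha => by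
    have ha' : a + (c' - c) ∈ Metric.ball c' s := by
      rw [Metric.mem_ball, dist_eq_norm] at ha ⊢
      convert ha using 2
      ring
    rw [hm a ha, hm' _ ha', hT1 m' hlt _ (by linarith), hT0 m le_rfl _ (by linarith)]
    norm_num
  have hfd : ∀ z, ‖fderiv ℝ (fun z => T (ψ z)) z‖ₑ
      ≤ Ω.indicator (fun z => ENNReal.ofReal (C * ‖fderiv ℝ ψ z‖)) z := fun z => by
    by_cases hz : z ∈ Ω
    · have h1 := (hTd (ψ z)).comp_hasFDerivAt z ((hsm z hz).differentiableAt (by simp)).hasFDerivAt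
      rw [show fderiv ℝ (fun z => T (ψ z)) z = _ from h1.fderiv, indicator_of_mem hz,
        ← ofReal_norm, norm_smul]
      exact ENNReal.ofReal_le_ofReal (mul_le_mul_of_nonneg_right (hb _) (norm_nonneg _))
    · obtain ⟨a, ha⟩ := hconst z hz
      have h0 : fderiv ℝ (fun _ : ℂ => a) z = 0 := by simp
      rw [ha.fderiv_eq, h0, ← ofReal_norm, norm_zero, ENNReal.ofReal_zero]
      exact zero_le
  calc volume (Metric.ball c s) ≤ _ := hseg
    _ ≤ (∫⁻ z in Ω, ENNReal.ofReal (C * ‖fderiv ℝ ψ z‖)) * ‖c' - c‖ₑ := by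
        refine mul_le_mul_left ?_ _
        rw [← lintegral_indicator hΩ.measurableSet]
        exact lintegral_mono hfd
    _ = _ := by
        rw [← ofReal_integral_eq_lintegral_ofReal (hi.norm.const_mul C)
          (Eventually.of_forall fun z => by positivity), integral_const_mul,
          ← ofReal_norm, ← ENNReal.ofReal_mul (by positivity)]
        congr 1
        ring

/-- Near a smooth boundary point, the points outside the domain are joined outside the domain to an
exterior ball. -/
lemma IsSmoothBoundedDomain.exists_exterior_ball {Ω : Set ℂ} (hΩ : IsSmoothBoundedDomain Ω)
    {z₀ : ℂ} (hz₀ : z₀ ∈ frontier Ω) : ∃ c : ℂ, ∃ s > 0, ∃ ρ > 0, Metric.ball c s ⊆ Ωᶜ ∧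
      ∀ w ∈ Metric.ball z₀ ρ, w ∉ Ω → ∃ w' ∈ Metric.ball c s, segment ℝ w w' ⊆ Ωᶜ := by
  obtain ⟨U, hU, g, hg, hg0, hgU⟩ := hΩ.smooth_boundary z₀ hz₀
  -- the defining function `g` increases in the direction `e`, so that translation by `t • e` leads
  -- from the complement of `Ω` to its exterior
  obtain ⟨e, he⟩ : ∃ e, 0 < fderiv ℝ g z₀ e := by
    by_contra! hcon
    refine hg0 (ContinuousLinearMap.ext fun v => le_antisymm (hcon v) ?_)
    have := hcon (-v)
    rw [map_neg] at this
    simpa using this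
  have hz₀Ω : z₀ ∉ Ω := by
    rw [hΩ.isOpen.frontier_eq] at hz₀; exact hz₀.2
  have hcf : Continuous fun w => fderiv ℝ g w e :=
    (hg.continuous_fderiv (by simp)).clm_apply continuous_const
  obtain ⟨R, hR, hRU⟩ := Metric.mem_nhds_iff.1 (Filter.inter_mem hU
    (hcf.continuousAt.eventually (lt_mem_nhds he)))
  have he0 : e ≠ 0 := by rintro rfl; simp at he
  have hen : 0 < ‖e‖ := norm_pos_iff.2 he0
  -- half a radius for the starting point and a quarter for the translation stay in the ball where
  -- `g` is increasing in the direction `e`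
  set t₀ : ℝ := R / (4 * ‖e‖) with ht₀
  have ht₀p : 0 < t₀ := by positivity
  have ht₀e : t₀ * ‖e‖ = R / 4 := by rw [ht₀]; field_simp
  have hmemR : ∀ w ∈ Metric.ball z₀ (R / 2), ∀ t ∈ Icc 0 t₀, w + t • e ∈ Metric.ball z₀ R := by
    intro w hw t ht
    rw [Metric.mem_ball, dist_eq_norm] at hw ⊢
    have h1 : ‖t • e‖ ≤ R / 4 := by
      rw [norm_smul, Real.norm_of_nonneg ht.1, ← ht₀e]
      exact mul_le_mul_of_nonneg_right ht.2 hen.le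
    have h2 := norm_add_le (w - z₀) (t • e)
    rw [show w + t • e - z₀ = w - z₀ + t • e by ring]
    linarith
  have hmono : ∀ w ∈ Metric.ball z₀ (R / 2), StrictMonoOn (fun t : ℝ => g (w + t • e)) (Icc 0 t₀) :=
    fun w hw => by
    have hd : ∀ t : ℝ, HasDerivAt (fun t : ℝ => g (w + t • e)) (fderiv ℝ g (w + t • e) e) t :=
      fun t => by
      have h1 : HasDerivAt (fun t : ℝ => w + t • e) e t := by
        simpa using ((hasDerivAt_id t).smul_const e).const_add w
      exact ((hg.differentiable (by simp)) _).hasFDerivAt.comp_hasDerivAt t h1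
    refine strictMonoOn_of_deriv_pos (convex_Icc _ _)
      (fun t _ => (hd t).continuousAt.continuousWithinAt) fun t ht => ?_
    rw [interior_Icc] at ht
    rw [(hd t).deriv]
    exact (hRU (hmemR w hw t ⟨ht.1.le, ht.2.le⟩)).2
  have hg_nonneg : ∀ w ∈ Metric.ball z₀ R, w ∉ Ω → 0 ≤ g w := fun w hw hwΩ =>
    not_lt.1 fun h => hwΩ ((hgU w (hRU hw).1).2 h)
  set c := z₀ + t₀ • e with hc
  have hzb : z₀ ∈ Metric.ball z₀ (R / 2) := Metric.mem_ball_self (by positivity)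
  have hgc : 0 < g c := by
    have h1 := hmono z₀ hzb ⟨le_rfl, ht₀p.le⟩ ⟨ht₀p.le, le_rfl⟩ ht₀p
    simp only [zero_smul, add_zero] at h1
    exact (hg_nonneg z₀ (Metric.mem_ball_self hR) hz₀Ω).trans_lt h1
  obtain ⟨s, hs, hsc⟩ := Metric.mem_nhds_iff.1 (Filter.inter_mem
    (Metric.isOpen_ball.mem_nhds (hmemR z₀ hzb t₀ ⟨ht₀p.le, le_rfl⟩))
    (hg.continuous.continuousAt.eventually (lt_mem_nhds hgc)))
  refine ⟨c, s, hs, min (R / 2) s, lt_min (by positivity) hs, fun w hw hwΩ => ?_,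
    fun w hw hwΩ => ⟨w + t₀ • e, ?_, ?_⟩⟩
  · have h1 := (hgU w (hRU (hsc hw).1).1).1 hwΩ
    have h2 : 0 < g w := (hsc hw).2
    linarith
  · rw [Metric.mem_ball, dist_eq_norm] at hw ⊢
    rw [hc, show w + t₀ • e - (z₀ + t₀ • e) = w - z₀ by ring]
    exact hw.trans_le (min_le_right _ _)
  · have hwR : w ∈ Metric.ball z₀ (R / 2) := Metric.ball_subset_ball (min_le_left _ _) hw
    rw [segment_eq_image']
    rintro _ ⟨θ, hθ, rfl⟩
    have ht : θ * t₀ ∈ Icc 0 t₀ :=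
      ⟨mul_nonneg hθ.1 ht₀p.le, mul_le_of_le_one_left ht₀p.le hθ.2⟩
    have e1 : w + θ • (w + t₀ • e - w) = w + (θ * t₀) • e := by
      rw [add_sub_cancel_left, smul_smul]
    intro hmem
    simp only [e1] at hmem
    have h1 := (hgU _ (hRU (hmemR w hwR _ ht)).1).1 hmem
    have h2 := (hmono w hwR).monotoneOn ⟨le_rfl, ht₀p.le⟩ ht ht.1
    simp only [zero_smul, add_zero] at h2
    have h3 := hg_nonneg w (Metric.ball_subset_ball (by linarith) hwR) hwΩ
    linarith

/-- A phase with small gradient in mean is constant on the boundary. -/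
lemma IsSmoothBoundedDomain.exists_phase_constant {Ω : Set ℂ} (hΩ : IsSmoothBoundedDomain Ω) :
    ∃ ε > 0, ∀ ψ : ℂ → ℝ, Continuous ψ → (∀ z ∈ Ω, ContDiffAt ℝ 1 ψ z) →
      (∀ z ∉ Ω, ∃ m : ℤ, ψ z = 2 * Real.pi * m) → IntegrableOn (fderiv ℝ ψ) Ω →
      ∫ z in Ω, ‖fderiv ℝ ψ z‖ < ε → ∃ m : ℤ, ∀ z ∈ frontier Ω, ψ z = 2 * Real.pi * m := by
  obtain ⟨C, hC, hball⟩ := exists_volume_ball_le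
  have hcomp : IsCompact (frontier Ω) :=
    Metric.isCompact_of_isClosed_isBounded isClosed_frontier
      (hΩ.isBounded.closure.subset frontier_subset_closure)
  choose! c s hs ρ hρ hcs hseg using fun z₀ (hz₀ : z₀ ∈ frontier Ω) => hΩ.exists_exterior_ball hz₀
  -- finitely many exterior balls reach the whole boundary; a small integral of the gradient forces
  -- the values of the phase on all of them to agree
  obtain ⟨t, ht, hcover⟩ := hcomp.elim_nhds_subcover (fun z => Metric.ball z (ρ z))
    fun z hz => Metric.ball_mem_nhds z (hρ z hz)
  have hev : ∀ z ∈ t, ∀ z' ∈ t, ∀ᶠ ε in 𝓝[>] (0 : ℝ),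
      ENNReal.ofReal (C * ‖c z' - c z‖ * ε) < volume (Metric.ball (c z) (min (s z) (s z'))) := by
    intro z hz z' hz'
    have hpos : 0 < volume (Metric.ball (c z) (min (s z) (s z'))) :=
      Metric.measure_ball_pos _ _ (lt_min (hs z (ht z hz)) (hs z' (ht z' hz')))
    have hcont : Continuous fun ε : ℝ => ENNReal.ofReal (C * ‖c z' - c z‖ * ε) :=
      ENNReal.continuous_ofReal.comp (by fun_prop)
    exact (hcont.tendsto' 0 0 (by simp)).mono_left nhdsWithin_le_nhds |>.eventually
      (gt_mem_nhds hpos)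
  obtain ⟨ε, hε, hε0⟩ := (((Finset.eventually_all t).2 fun z hz => (Finset.eventually_all t).2
    (hev z hz)).and self_mem_nhdsWithin).exists
  refine ⟨ε, hε0, fun ψ hψ hsm hout hint hlt => ?_⟩
  have hval : ∀ z ∈ t, ∃ m : ℤ, ∀ w ∈ Metric.ball (c z) (s z), ψ w = 2 * Real.pi * m :=
    fun z hz => by
    have hsub := hcs z (ht z hz)
    have hc0 := Metric.mem_ball_self (x := c z) (hs z (ht z hz))
    obtain ⟨m, hm⟩ := hout (c z) (hsub hc0)
    refine ⟨m, fun w hw => ?_⟩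
    rw [← hm]
    exact eq_of_isPreconnected (convex_ball _ _).isPreconnected hψ.continuousOn
      (fun z hz => hout z (hsub hz)) hw hc0
  choose! m hm using hval
  have hnot : ∀ z ∈ t, ∀ z' ∈ t, ¬ m z < m z' := fun z hz z' hz' hmm => by
    have h1 := hball (s := min (s z) (s z')) hΩ.isOpen hψ hsm hout hint
      (fun w hw => hm z hz w (Metric.ball_subset_ball (min_le_left _ _) hw))
      (fun w hw => hm z' hz' w (Metric.ball_subset_ball (min_le_right _ _) hw)) hmm
    have h2 := hε z hz z' hz'
    refine absurd (h1.trans (ENNReal.ofReal_le_ofReal ?_)) (not_le.2 h2)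
    exact mul_le_mul_of_nonneg_left hlt.le (by positivity)
  have hfr : ∀ w ∈ frontier Ω, ∃ z ∈ t, ψ w = 2 * Real.pi * m z := fun w hw => by
    obtain ⟨z, hz, hwz⟩ := mem_iUnion₂.1 (hcover hw)
    have hwΩ : w ∉ Ω := by rw [hΩ.isOpen.frontier_eq] at hw; exact hw.2
    obtain ⟨w', hw', hsub⟩ := hseg z (ht z hz) w hwz hwΩ
    refine ⟨z, hz, ?_⟩
    rw [← hm z hz w' hw']
    exact eq_of_isPreconnected (convex_segment w w').isPreconnected hψ.continuousOn
      (fun z hz => hout z (hsub hz)) (left_mem_segment ℝ w w') (right_mem_segment ℝ w w')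
  rcases t.eq_empty_or_nonempty with rfl | ⟨z₁, hz₁⟩
  · exact ⟨0, fun w hw => by obtain ⟨z, hz, -⟩ := hfr w hw; simp at hz⟩
  · refine ⟨m z₁, fun w hw => ?_⟩
    obtain ⟨z, hz, he⟩ := hfr w hw
    rw [he, le_antisymm (not_lt.1 (hnot z₁ hz₁ z hz)) (not_lt.1 (hnot z hz z₁ hz₁))]


/-- `ψ` is the phase by which the singular harmonic map `U`, transported by the diffeomorphism which
moves the singularities `x` to `y`, differs from `u`; it vanishes outside the domain. -/
structure IsPhase {n : ℕ} (Ω : Set ℂ) (x y : Fin n → ℂ) (χ : Fin n → ℂ → ℝ) (u U : ℂ → ℂ)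
    (ψ : ℂ → ℝ) : Prop where
  continuous : Continuous ψ
  eq_zero : ∀ z ∉ Ω, ψ z = 0
  contDiffAt : ∀ z ∈ Ω, ContDiffAt ℝ 1 ψ z
  current_comp_eq : ∀ z ∈ Ω \ range x, (current U (z + shift χ (y - x) z)).comp
    (fderiv ℝ (fun z => z + shift χ (y - x) z) z) = current u z + fderiv ℝ ψ z

section

variable {n : ℕ} {Ω : Set ℂ} {x : Fin n → ℂ} {d : Fin n → ℤ} {r : ℝ} {χ : Fin n → ℂ → ℝ}

/-- The phase exists if the currents are close to each other in mean. -/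
lemma exists_isPhase (hΩ : IsOpen Ω) {ε : ℝ}
    (hε : ∀ ψ : ℂ → ℝ, Continuous ψ → (∀ z ∈ Ω, ContDiffAt ℝ 1 ψ z) →
      (∀ z ∉ Ω, ∃ m : ℤ, ψ z = 2 * Real.pi * m) → IntegrableOn (fderiv ℝ ψ) Ω →
      ∫ z in Ω, ‖fderiv ℝ ψ z‖ < ε → ∃ m : ℤ, ∀ z ∈ frontier Ω, ψ z = 2 * Real.pi * m)
    {y : Fin n → ℂ} {φ : ℂ → ℂ} {u v U V : ℂ → ℂ} (h : IsSingularWith Ω x d u v)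
    (hU : IsSingularWith Ω y d U V) (hχ : IsCutoffFamily Ω x r χ)
    (hD : IsCompactDiffeo Ω (fun z => z + shift χ (y - x) z) φ)
    (hx : ∀ j, x j ∈ Ω) (huc : ContinuousOn u (closure Ω \ range x))
    (hUc : ContinuousOn U (closure Ω \ range y)) (hbd : EqOn U u (frontier Ω))
    (hint : IntegrableOn (fun z => (current U (z + shift χ (y - x) z)).comp
      (fderiv ℝ (fun z => z + shift χ (y - x) z) z) - current u z) Ω)
    (hlt : ∫ z in Ω, ‖(current U (z + shift χ (y - x) z)).comp
      (fderiv ℝ (fun z => z + shift χ (y - x) z) z) - current u z‖ < ε) :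
    ∃ ψ, IsPhase Ω x y χ u U ψ := by
  obtain ⟨F, hFc, hF1, hFd, hFo, hFu⟩ := exists_quotient hΩ h hU hχ hD hx huc hUc hbd
  obtain ⟨ψ, hψ, hψF, hψd⟩ := exists_lift hFc hF1
  have hψ1 : ∀ z ∈ Ω, ContDiffAt ℝ 1 ψ z := fun z hz => (hψd z 2 (hFd z hz)).of_le (by norm_num)
  have hout : ∀ z ∉ Ω, ∃ m : ℤ, ψ z = 2 * Real.pi * m := fun z hz => by
    have h1 := hψF z
    rw [hFo z hz, eq_comm, Complex.exp_eq_one_iff] at h1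
    obtain ⟨m, hm⟩ := h1
    refine ⟨m, ?_⟩
    have := congrArg Complex.im hm
    simp at this
    linarith
  have hfd : ∀ z ∈ Ω \ range x, fderiv ℝ ψ z = (current U (z + shift χ (y - x) z)).comp
      (fderiv ℝ (fun z => z + shift χ (y - x) z) z) - current u z := fun z hz => by
    have hz' := (hχ.add_shift_mem_diff_iff hD z).2 hz
    have hdU := hU.differentiableAt hΩ hz'
    have hne : ∀ {w : ℂ}, ‖w‖ = 1 → w ≠ 0 := fun hw => by
      rw [← norm_ne_zero_iff, hw]; norm_num
    have hdc : DifferentiableAt ℝ (fun z => starRingEnd ℂ (u z)) z :=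
      (ContDiffAt.conj (h.contDiffAt hΩ hz)).differentiableAt (by simp)
    have e1 : current F z = fderiv ℝ ψ z := by
      rw [show F = fun z => Complex.exp (ψ z * Complex.I) from funext hψF]
      exact current_exp ((hψ1 z hz.1).differentiableAt (by simp))
    have e2 : F =ᶠ[𝓝 z] fun z => U (z + shift χ (y - x) z) * starRingEnd ℂ (u z) := by
      filter_upwards [(IsSingularWith.isOpen_diff hΩ).mem_nhds hz] with w hw using hFu w hw
    rw [← e1, current_congr e2, current_mul (f := fun z => U (z + shift χ (y - x) z))
      (DifferentiableAt.comp z (g := U) hdU (hD.differentiable z)) hdc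
      (hne (hU.norm_eq_one hz')) (by
        rw [← norm_ne_zero_iff, RCLike.norm_conj, h.norm_eq_one hz]; norm_num),
      current_conj, ← sub_eq_add_neg]
    exact congrArg (· - current u z) (current_comp (f := U)
      (ψ := fun z => z + shift χ (y - x) z) hdU (hD.differentiable z))
  have hae : ∀ᵐ z ∂(volume.restrict Ω), fderiv ℝ ψ z = (current U (z + shift χ (y - x) z)).comp
      (fderiv ℝ (fun z => z + shift χ (y - x) z) z) - current u z := by
    filter_upwards [ae_mem_diff hΩ.measurableSet x] with z hz using hfd z hz
  obtain ⟨m, hm⟩ := hε ψ hψ hψ1 hout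
    (hint.congr (by filter_upwards [hae] with z hz using hz.symm))
    (by rwa [integral_congr_ae (hae.mono fun z hz => congrArg norm hz)])
  set c : ℝ := 2 * Real.pi * m with hc
  have hloc : ∀ z ∈ Ω, Ω.indicator (fun z => ψ z - c) =ᶠ[𝓝 z] fun z => ψ z - c := fun z hz => by
    filter_upwards [hΩ.mem_nhds hz] with w hw using indicator_of_mem hw _
  -- outside `Ω` the lift may take other multiples of `2π`, away from the boundary; it is replaced
  -- by `0` there
  refine ⟨Ω.indicator fun z => ψ z - c, ?_, fun z hz => indicator_of_notMem hz _,
    fun z hz => ((hψ1 z hz).sub contDiffAt_const).congr_of_eventuallyEq (hloc z hz),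
    fun z hz => ?_⟩
  · refine continuous_indicator (fun z hz => ?_) (hψ.sub continuous_const).continuousOn
    rw [hm z hz, sub_self]
  · rw [(hloc z hz.1).fderiv_eq, fderiv_sub_const, hfd z hz]
    abel

/-- The phases exist for all configurations which are close to the given one. -/
lemma eventually_exists_isPhase (hΩ : IsSmoothBoundedDomain Ω) (hx : x ∈ Config n Ω) {u v : ℂ → ℂ}
    (h : IsSingularWith Ω x d u v) (huc : ContinuousOn u (closure Ω \ range x))
    (hfin : ∀ ρ > 0, IntegrableOn (fun z => ‖grad u z‖ ^ 2) (perforated Ω x ρ))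
    {q : ℝ≥0∞} (hq : 1 ≤ q) {N : Set (Fin n → ℂ)} {uf : (Fin n → ℂ) → ℂ → ℂ}
    (huf : IsSingularHarmonicFamily Ω q x d u N uf) (hχ : IsCutoffFamily Ω x r χ) :
    ∀ᶠ y in 𝓝 x, ∃ ψ, IsPhase Ω x y χ u (uf y) ψ := by
  obtain ⟨ε, hε0, hε⟩ := hΩ.exists_phase_constant
  have hΩo := hΩ.isOpen
  have hfm : IsFiniteMeasure (volume.restrict Ω) :=
    isFiniteMeasure_restrict.2 hΩ.isBounded.measure_lt_top.ne
  have ha := h.integrableOn_current hΩo hΩ.isBounded hx.1 hfin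
  have hsing : ∀ y ∈ N, ∃ V, IsSingularWith Ω y d (uf y) V := fun y hy => by
    obtain ⟨V, h1, h2⟩ := huf.singularHarmonic y hy
    exact ⟨V, h1, h2⟩
  choose! V hV using hsing
  have hgb : EqOn (grad (uf x)) (grad u) (Ω \ range x) := fun z hz => by
    have : uf x =ᶠ[𝓝 z] u := by
      filter_upwards [(IsSingularWith.isOpen_diff hΩo).mem_nhds hz] with w hw using huf.base hw
    simp only [grad, this.fderiv_eq]
  obtain ⟨l0, l1⟩ := huf.continuous x huf.mem
  have e0 : ∀ y, eLpNorm (fun z => uf y z - uf x z) q (volume.restrict Ω)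
      = eLpNorm (fun z => uf y z - u z) q (volume.restrict Ω) := fun y => by
    refine eLpNorm_congr_ae ?_
    filter_upwards [ae_mem_diff hΩo.measurableSet x] with z hz
    rw [huf.base hz]
  have e1 : ∀ y, eLpNorm (fun z => grad (uf y) z - grad (uf x) z) q (volume.restrict Ω)
      = eLpNorm (fun z => grad (uf y) z - grad u z) q (volume.restrict Ω) := fun y => by
    refine eLpNorm_congr_ae ?_
    filter_upwards [ae_mem_diff hΩo.measurableSet x] with z hz
    rw [hgb hz]
  simp_rw [e0] at l0
  simp_rw [e1] at l1
  -- configurations for which the hypotheses of the convergence lemmas hold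
  set P : (Fin n → ℂ) → Prop := fun y => y ∈ N ∧ ((∀ z, ‖fderiv ℝ (shift χ (y - x)) z‖ ≤ 1 / 4) ∧
      ∃ φ, IsCompactDiffeo Ω (fun z => z + shift χ (y - x) z) φ) ∧
      eLpNorm (fun z => uf y z - u z) q (volume.restrict Ω) < ⊤ ∧
      eLpNorm (fun z => grad (uf y) z - grad u z) q (volume.restrict Ω) < ⊤ with hP
  have hPev : ∀ᶠ y in 𝓝 x, P y := by
    filter_upwards [huf.isOpen.mem_nhds huf.mem, hχ.eventually_isCompactDiffeo,
      l0.eventually (gt_mem_nhds ENNReal.zero_lt_top),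
      l1.eventually (gt_mem_nhds ENNReal.zero_lt_top)] with y a1 a2 a3 a4 using ⟨a1, a2, a3, a4⟩
  have hsmall : ∀ᶠ y in 𝓝 x, IntegrableOn (fun z => (current (uf y) (z + shift χ (y - x) z)).comp
      (fderiv ℝ (fun z => z + shift χ (y - x) z) z) - current u z) Ω ∧
      ∫ z in Ω, ‖(current (uf y) (z + shift χ (y - x) z)).comp
      (fderiv ℝ (fun z => z + shift χ (y - x) z) z) - current u z‖ < ε := by
    rw [eventually_iff_seq_eventually]
    intro y hy
    obtain ⟨k₀, hk₀⟩ := eventually_atTop.1 (hy.eventually hPev)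
    have hshift := tendsto_add_atTop_nat k₀
    choose φ hφ using fun k => (hk₀ (k + k₀) (by lia)).2.1.2
    have hVk := fun k => hV _ (hk₀ (k + k₀) (by lia)).1
    have hm0 : ∀ k, MemLp (fun z => uf (y (k + k₀)) z - u z) q (volume.restrict Ω) := fun k =>
      ⟨(aestronglyMeasurable_of_continuousOn_diff hΩo ((hVk k).continuousOn hΩo)).sub
        (aestronglyMeasurable_of_continuousOn_diff hΩo (h.continuousOn hΩo)),
        (hk₀ (k + k₀) (by lia)).2.2.1⟩
    have hm1 : ∀ k, MemLp (fun z => grad (uf (y (k + k₀))) z - grad u z) q (volume.restrict Ω) :=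
      fun k => ⟨(aestronglyMeasurable_of_continuousOn_diff hΩo ((hVk k).continuousOn_grad hΩo)).sub
        (aestronglyMeasurable_of_continuousOn_diff hΩo (h.continuousOn_grad hΩo)),
        (hk₀ (k + k₀) (by lia)).2.2.2⟩
    obtain ⟨i, l⟩ := tendsto_integral_pullback_current_sub h hΩo ha hq hVk hm0 hm1
      (l0.comp (hy.comp hshift)) (l1.comp (hy.comp hshift)) hχ (hy.comp hshift)
      (fun k => (hk₀ (k + k₀) (by lia)).2.1.1) hφ
    have hev := l.eventually (gt_mem_nhds hε0)
    obtain ⟨k₁, hk₁⟩ := eventually_atTop.1 hev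
    filter_upwards [eventually_ge_atTop (k₁ + k₀)] with k hk
    have hkk : k - k₀ + k₀ = k := by lia
    have a1 := i (k - k₀)
    have a2 := hk₁ (k - k₀) (by lia)
    simp only [hkk] at a1 a2
    exact ⟨a1, a2⟩
  filter_upwards [hPev, hsmall] with y hy hys
  obtain ⟨φ, hφ⟩ := hy.2.1.2
  exact exists_isPhase hΩo hε h (hV y hy.1) hχ hφ hx.1 huc (huf.continuousOn y hy.1)
    (huf.boundary y hy.1) hys.1 hys.2

end


/-! ### The Dirichlet form in moved coordinates -/

/-- The Dirichlet form transported by a linear change of variables `L`: the scalar product of linear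
forms in the target, times the Jacobian, as a bilinear form in the pullbacks. -/
noncomputable def pullGdot (L : ℂ →L[ℝ] ℂ) (α β : ℂ →L[ℝ] ℝ) : ℝ :=
  (jac L)⁻¹ * (((L Complex.I).im * α 1 - (L 1).im * α Complex.I)
      * ((L Complex.I).im * β 1 - (L 1).im * β Complex.I)
    + ((L 1).re * α Complex.I - (L Complex.I).re * α 1)
      * ((L 1).re * β Complex.I - (L Complex.I).re * β 1))

lemma pullGdot_comp {L : ℂ →L[ℝ] ℂ} (hL : jac L ≠ 0) (α β : ℂ →L[ℝ] ℝ) :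
    pullGdot L (α.comp L) (β.comp L) = jac L * gdot α β := by
  have h : ∀ (γ : ℂ →L[ℝ] ℝ) (v : ℂ), γ v = v.re * γ 1 + v.im * γ Complex.I := fun γ v => by
    rw [clm_apply_eq γ v]; rfl
  rw [pullGdot, gdot, ContinuousLinearMap.comp_apply, ContinuousLinearMap.comp_apply,
    ContinuousLinearMap.comp_apply, ContinuousLinearMap.comp_apply, h α (L 1), h α (L Complex.I),
    h β (L 1), h β (L Complex.I), inv_mul_eq_iff_eq_mul₀ hL]
  unfold jac
  ring

lemma pullGdot_add_left (L : ℂ →L[ℝ] ℂ) (α α' β : ℂ →L[ℝ] ℝ) :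
    pullGdot L (α + α') β = pullGdot L α β + pullGdot L α' β := by
  simp only [pullGdot, add_apply]; ring

lemma pullGdot_add_right (L : ℂ →L[ℝ] ℂ) (α β β' : ℂ →L[ℝ] ℝ) :
    pullGdot L α (β + β') = pullGdot L α β + pullGdot L α β' := by
  simp only [pullGdot, add_apply]; ring

lemma pullGdot_smul_right (L : ℂ →L[ℝ] ℂ) (c : ℝ) (α β : ℂ →L[ℝ] ℝ) :
    pullGdot L α (c • β) = c * pullGdot L α β := by
  simp only [pullGdot, smul_apply, smul_eq_mul]; ring

lemma pullGdot_comm (L : ℂ →L[ℝ] ℂ) (α β : ℂ →L[ℝ] ℝ) : pullGdot L α β = pullGdot L β α := by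
  simp only [pullGdot]; ring

lemma abs_apply_one_le (α : ℂ →L[ℝ] ℝ) : |α 1| ≤ ‖α‖ := by simpa using α.le_opNorm 1

lemma abs_apply_I_le (α : ℂ →L[ℝ] ℝ) : |α Complex.I| ≤ ‖α‖ := by simpa using α.le_opNorm Complex.I

lemma abs_bilinear_le {k₁ k₂ k₃ k₄ K₁ K₂ K₃ K₄ : ℝ} (h₁ : |k₁| ≤ K₁) (h₂ : |k₂| ≤ K₂)
    (h₃ : |k₃| ≤ K₃) (h₄ : |k₄| ≤ K₄) (α β : ℂ →L[ℝ] ℝ) :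
    |k₁ * (α 1 * β 1) + k₂ * (α Complex.I * β Complex.I) + k₃ * (α 1 * β Complex.I)
      + k₄ * (α Complex.I * β 1)| ≤ (K₁ + K₂ + K₃ + K₄) * (‖α‖ * ‖β‖) := by
  have key : ∀ {k K s t S T : ℝ}, |k| ≤ K → |s| ≤ S → |t| ≤ T →
      |k * (s * t)| ≤ K * (S * T) := fun {k K s t S T} hk hs ht => by
    rw [abs_mul, abs_mul]
    have := (abs_nonneg s).trans hs
    have := (abs_nonneg k).trans hk
    gcongr
  have a1 := abs_apply_one_le α
  have a2 := abs_apply_I_le α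
  have b1 := abs_apply_one_le β
  have b2 := abs_apply_I_le β
  refine (abs_add_le _ _).trans ?_
  have e1 := abs_add_le (k₁ * (α 1 * β 1) + k₂ * (α Complex.I * β Complex.I))
    (k₃ * (α 1 * β Complex.I))
  have e2 := abs_add_le (k₁ * (α 1 * β 1)) (k₂ * (α Complex.I * β Complex.I))
  have f1 := key h₁ a1 b1
  have f2 := key h₂ a2 b2
  have f3 := key h₃ a1 b2
  have f4 := key h₄ a2 b1
  linarith

lemma abs_mul_le_of_le {s t m : ℝ} (hs : |s| ≤ m) (ht : |t| ≤ m) : |s * t| ≤ m ^ 2 := by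
  rw [abs_mul, sq]
  exact mul_le_mul hs ht (abs_nonneg _) ((abs_nonneg _).trans hs)

/-- The change of variables by `id + M` modifies the Dirichlet form by terms of first order in `M`. -/
lemma abs_pullGdot_sub_gdot_le {M : ℂ →L[ℝ] ℂ} {m : ℝ} (hM : ‖M‖ ≤ m) (hm : m ≤ 1 / 4)
    (α β : ℂ →L[ℝ] ℝ) :
    |pullGdot (ContinuousLinearMap.id ℝ ℂ + M) α β - gdot α β| ≤ 22 * m * (‖α‖ * ‖β‖) := by
  have hJ := jac_id_add_ge (hM.trans hm)
  have hJe := jac_id_add M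
  obtain ⟨h1, h2, h3, h4⟩ := abs_re_im_le hM
  have hm0 : 0 ≤ m := (norm_nonneg _).trans hM
  set J := jac (ContinuousLinearMap.id ℝ ℂ + M) with hJd
  set a := (M 1).re
  set b := (M 1).im
  set c := (M Complex.I).re
  set e := (M Complex.I).im
  have hJ0 : J ≠ 0 := by linarith
  have key : pullGdot (ContinuousLinearMap.id ℝ ℂ + M) α β - gdot α β
      = J⁻¹ * ((e - a + e * e + c * c - a * e + b * c) * (α 1 * β 1)
        + (a - e + b * b + a * a - a * e + b * c) * (α Complex.I * β Complex.I)
        + (-b - c - b * e - c * a) * (α 1 * β Complex.I)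
        + (-b - c - b * e - c * a) * (α Complex.I * β 1)) := by
    have e1 : ((ContinuousLinearMap.id ℝ ℂ + M) 1).re = 1 + a := by simp [a]
    have e2 : ((ContinuousLinearMap.id ℝ ℂ + M) 1).im = b := by simp [b]
    have e3 : ((ContinuousLinearMap.id ℝ ℂ + M) Complex.I).re = c := by simp [c]
    have e4 : ((ContinuousLinearMap.id ℝ ℂ + M) Complex.I).im = 1 + e := by simp [e]
    rw [pullGdot, ← hJd, e1, e2, e3, e4, sub_eq_iff_eq_add, ← sub_eq_iff_eq_add', ← mul_sub,
      inv_mul_eq_iff_eq_mul₀ hJ0, gdot, hJe]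
    ring
  have p := fun {s t : ℝ} (hs : |s| ≤ m) (ht : |t| ≤ m) => abs_le.1 (abs_mul_le_of_le hs ht)
  have hmm : m ^ 2 ≤ m / 4 := by nlinarith
  have q1 := p h4 h4
  have q2 := p h3 h3
  have q3 := p h1 h4
  have q4 := p h2 h3
  have q5 := p h2 h2
  have q6 := p h1 h1
  have q7 := p h2 h4
  have q8 := p h3 h1
  rw [abs_le] at h1 h2 h3 h4
  rw [key, abs_mul, abs_inv, abs_of_pos (by linarith : 0 < J)]
  have hJi : J⁻¹ ≤ 2 := by
    rw [inv_le_comm₀ (by linarith) (by norm_num)]; linarith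
  calc J⁻¹ * _ ≤ 2 * ((3 * m + 3 * m + 5 / 2 * m + 5 / 2 * m) * (‖α‖ * ‖β‖)) := by
        refine mul_le_mul hJi (abs_bilinear_le ?_ ?_ ?_ ?_ α β) (abs_nonneg _) (by norm_num) <;>
        · rw [abs_le]; constructor <;> linarith
    _ = _ := by ring

/-- To first order, the change of variables contributes the stress. -/
lemma abs_pullGdot_sub_stress_le {M : ℂ →L[ℝ] ℂ} {m : ℝ} (hM : ‖M‖ ≤ m) (hm : m ≤ 1 / 4)
    (α : ℂ →L[ℝ] ℝ) :
    |pullGdot (ContinuousLinearMap.id ℝ ℂ + M) α α - gdot α α - stress M α|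
      ≤ 64 * m ^ 2 * ‖α‖ ^ 2 := by
  have hJ := jac_id_add_ge (hM.trans hm)
  have hJe := jac_id_add M
  obtain ⟨h1, h2, h3, h4⟩ := abs_re_im_le hM
  have hm0 : 0 ≤ m := (norm_nonneg _).trans hM
  set J := jac (ContinuousLinearMap.id ℝ ℂ + M) with hJd
  set a := (M 1).re with ha
  set b := (M 1).im with hb
  set c := (M Complex.I).re with hc
  set e := (M Complex.I).im with he
  have hJ0 : J ≠ 0 := by linarith
  set t := a + e + a * e - b * c with ht
  have key : pullGdot (ContinuousLinearMap.id ℝ ℂ + M) α α - gdot α α - stress M α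
      = J⁻¹ * ((e * e + c * c - a * e + b * c - t * (e - a)) * (α 1 * α 1)
        + (b * b + a * a - a * e + b * c + t * (e - a)) * (α Complex.I * α Complex.I)
        + (-(b * e) - c * a + t * (b + c)) * (α 1 * α Complex.I)
        + (-(b * e) - c * a + t * (b + c)) * (α Complex.I * α 1)) := by
    have e1 : ((ContinuousLinearMap.id ℝ ℂ + M) 1).re = 1 + a := by simp [a]
    have e2 : ((ContinuousLinearMap.id ℝ ℂ + M) 1).im = b := by simp [b]
    have e3 : ((ContinuousLinearMap.id ℝ ℂ + M) Complex.I).re = c := by simp [c]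
    have e4 : ((ContinuousLinearMap.id ℝ ℂ + M) Complex.I).im = 1 + e := by simp [e]
    rw [pullGdot, ← hJd, e1, e2, e3, e4, sub_sub, sub_eq_iff_eq_add, ← sub_eq_iff_eq_add',
      ← mul_sub, inv_mul_eq_iff_eq_mul₀ hJ0, gdot, stress, ← ha, ← hb, ← hc, ← he, hJe, ht]
    ring
  have p := fun {s t : ℝ} (hs : |s| ≤ m) (ht : |t| ≤ m) => abs_le.1 (abs_mul_le_of_le hs ht)
  have hmm : m ^ 2 ≤ m / 4 := by nlinarith
  have q1 := p h4 h4
  have q2 := p h3 h3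
  have q3 := p h1 h4
  have q4 := p h2 h3
  have q5 := p h2 h2
  have q6 := p h1 h1
  have q7 := p h2 h4
  have q8 := p h3 h1
  rw [abs_le] at h1 h2 h3 h4
  have htm : |t| ≤ 5 / 2 * m := by rw [abs_le]; constructor <;> linarith
  have hle : ∀ s, |s| ≤ 2 * m → |t * s| ≤ 5 * m ^ 2 := fun s hs => by
    rw [abs_mul]
    calc |t| * |s| ≤ 5 / 2 * m * (2 * m) :=
          mul_le_mul htm hs (abs_nonneg _) (by positivity)
      _ = _ := by ring
  have r1 := abs_le.1 (hle (e - a) (by rw [abs_le]; constructor <;> linarith))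
  have r2 := abs_le.1 (hle (b + c) (by rw [abs_le]; constructor <;> linarith))
  rw [key, abs_mul, abs_inv, abs_of_pos (by linarith : 0 < J)]
  have hJi : J⁻¹ ≤ 2 := by
    rw [inv_le_comm₀ (by linarith) (by norm_num)]; linarith
  calc J⁻¹ * _ ≤ 2 * ((9 * m ^ 2 + 9 * m ^ 2 + 7 * m ^ 2 + 7 * m ^ 2) * (‖α‖ * ‖α‖)) := by
        refine mul_le_mul hJi (abs_bilinear_le ?_ ?_ ?_ ?_ α α) (abs_nonneg _) (by norm_num) <;>
        · rw [abs_le]; constructor <;> linarith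
    _ = _ := by ring

lemma pullGdot_eq_gdot {M : ℂ →L[ℝ] ℂ} (hM : M = 0) (α β : ℂ →L[ℝ] ℝ) :
    pullGdot (ContinuousLinearMap.id ℝ ℂ + M) α β = gdot α β := by
  have := abs_pullGdot_sub_gdot_le (M := M) (m := 0) (by simp [hM]) (by norm_num) α β
  rw [mul_zero, zero_mul, abs_nonpos_iff, sub_eq_zero] at this
  exact this

lemma continuousOn_pullGdot {M : ℂ → ℂ →L[ℝ] ℂ} (hM : Continuous M) (hM' : ∀ z, ‖M z‖ ≤ 1 / 4)
    {s : Set ℂ} {α β : ℂ → ℂ →L[ℝ] ℝ} (hα : ContinuousOn α s) (hβ : ContinuousOn β s) :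
    ContinuousOn (fun z => pullGdot (ContinuousLinearMap.id ℝ ℂ + M z) (α z) (β z)) s := by
  have hL : Continuous fun z => ContinuousLinearMap.id ℝ ℂ + M z := continuous_const.add hM
  have hj : Continuous fun z => jac (ContinuousLinearMap.id ℝ ℂ + M z) := by
    unfold jac; fun_prop
  have hji := hj.inv₀ fun z => (by linarith [jac_id_add_ge (hM' z)] :
    jac (ContinuousLinearMap.id ℝ ℂ + M z) ≠ 0)
  have e1 : ∀ v : ℂ, Continuous fun z => ((ContinuousLinearMap.id ℝ ℂ + M z) v).re := fun v =>
    Complex.continuous_re.comp (hL.clm_apply continuous_const)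
  have e2 : ∀ v : ℂ, Continuous fun z => ((ContinuousLinearMap.id ℝ ℂ + M z) v).im := fun v =>
    Complex.continuous_im.comp (hL.clm_apply continuous_const)
  have c1 : ∀ v : ℂ, ContinuousOn (fun z => α z v) s := fun v => hα.clm_apply continuousOn_const
  have c2 : ∀ v : ℂ, ContinuousOn (fun z => β z v) s := fun v => hβ.clm_apply continuousOn_const
  unfold pullGdot
  exact hji.continuousOn.mul (((((e2 _).continuousOn.mul (c1 _)).sub
    ((e2 _).continuousOn.mul (c1 _))).mul (((e2 _).continuousOn.mul (c2 _)).sub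
    ((e2 _).continuousOn.mul (c2 _)))).add ((((e1 _).continuousOn.mul (c1 _)).sub
    ((e1 _).continuousOn.mul (c1 _))).mul (((e1 _).continuousOn.mul (c2 _)).sub
    ((e1 _).continuousOn.mul (c2 _)))))


/-! ### Truncations of functions vanishing outside the domain -/

/-- A continuous approximation of the indicator function of `ℝ \ {0}`, which vanishes near `0`. -/
noncomputable def cut (k : ℕ) (t : ℝ) : ℝ := min 1 (max 0 (k * |t| - 1))

lemma continuous_cut (k : ℕ) : Continuous (cut k) := by unfold cut; fun_prop

lemma cut_nonneg (k : ℕ) (t : ℝ) : 0 ≤ cut k t := le_min zero_le_one (le_max_left _ _)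

lemma cut_le_one (k : ℕ) (t : ℝ) : cut k t ≤ 1 := min_le_left _ _

lemma cut_eq_zero {k : ℕ} {t : ℝ} (h : k * |t| ≤ 1) : cut k t = 0 := by
  rw [cut, max_eq_left (by linarith), min_eq_right zero_le_one]

lemma tendsto_cut {t : ℝ} (ht : t ≠ 0) : Tendsto (fun k => cut k t) atTop (𝓝 1) := by
  have h1 : Tendsto (fun k : ℕ => (k : ℝ) * |t|) atTop atTop :=
    tendsto_natCast_atTop_atTop.atTop_mul_const (abs_pos.2 ht)
  refine tendsto_const_nhds.congr' ?_
  filter_upwards [h1.eventually_ge_atTop 2] with k hk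
  rw [cut, min_eq_left]
  exact le_max_of_le_right (by linarith)

/-- The primitive of the truncation, an odd function which vanishes near `0`. -/
noncomputable def cutPrim (k : ℕ) (t : ℝ) : ℝ := ∫ s in (0 : ℝ)..t, cut k s

lemma hasDerivAt_cutPrim (k : ℕ) (t : ℝ) : HasDerivAt (cutPrim k) (cut k t) t :=
  intervalIntegral.integral_hasDerivAt_right ((continuous_cut k).intervalIntegrable _ _)
    ((continuous_cut k).stronglyMeasurableAtFilter _ _) (continuous_cut k).continuousAt

lemma contDiff_cutPrim (k : ℕ) : ContDiff ℝ 1 (cutPrim k) := by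
  rw [contDiff_one_iff_deriv]
  refine ⟨fun t => (hasDerivAt_cutPrim k t).differentiableAt, ?_⟩
  rw [show deriv (cutPrim k) = cut k from funext fun t => (hasDerivAt_cutPrim k t).deriv]
  exact continuous_cut k

lemma cutPrim_eq_zero {k : ℕ} {t : ℝ} (h : k * |t| ≤ 1) : cutPrim k t = 0 := by
  rw [cutPrim, intervalIntegral.integral_congr (g := fun _ => 0), intervalIntegral.integral_zero]
  intro s hs
  refine cut_eq_zero (le_trans ?_ h)
  have : |s| ≤ |t| := by
    have := abs_sub_left_of_mem_uIcc hs
    simpa using this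
  gcongr

section

variable {Ω : Set ℂ} {ψ : ℂ → ℝ} (hψc : Continuous ψ) (hψ0 : ∀ z ∉ Ω, ψ z = 0)

include hψc in
lemma isClosed_le_mul_abs (k : ℕ) : IsClosed {z | 1 ≤ k * |ψ z|} :=
  isClosed_le continuous_const (continuous_const.mul hψc.abs)

include hψ0 in
lemma setOf_le_mul_abs_subset (k : ℕ) : {z | 1 ≤ k * |ψ z|} ⊆ Ω := fun z hz => by
  by_contra h
  rw [mem_ofPred_eq, hψ0 z h, abs_zero, mul_zero] at hz
  linarith

include hψc hψ0 in
lemma eventually_mul_abs_le (k : ℕ) {z : ℂ} (hz : z ∉ Ω) : ∀ᶠ w in 𝓝 z, k * |ψ w| ≤ 1 := by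
  have h : Continuous fun w => k * |ψ w| := continuous_const.mul hψc.abs
  have hlt : (k : ℝ) * |ψ z| < 1 := by rw [hψ0 z hz]; simp
  filter_upwards [h.continuousAt.eventually (gt_mem_nhds hlt)] with w hw using hw.le

include hψc hψ0 in
/-- The functions which vanish where `k * |ψ| ≤ 1` are compactly supported in the domain, because
`ψ` is continuous and vanishes outside. -/
lemma hasCompactSupport_of_mul_abs (hΩb : Bornology.IsBounded Ω) (k : ℕ) {f : ℂ → ℝ}
    (hf : ∀ z, k * |ψ z| ≤ 1 → f z = 0) : HasCompactSupport f ∧ tsupport f ⊆ Ω := by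
  have hs : tsupport f ⊆ {z | 1 ≤ k * |ψ z|} := by
    refine closure_minimal (fun z hz => ?_) (isClosed_le_mul_abs hψc k)
    by_contra h
    exact hz (hf z (not_le.1 h).le)
  have hsΩ := hs.trans (setOf_le_mul_abs_subset hψ0 k)
  exact ⟨Metric.isCompact_of_isClosed_isBounded (isClosed_tsupport f) (hΩb.subset hsΩ), hsΩ⟩

include hψc hψ0 in
/-- Truncation makes functions which are continuous in the domain continuous in the plane. -/
lemma continuous_cut_mul (hΩ : IsOpen Ω) (k : ℕ) {f : ℂ → ℝ} (hf : ContinuousOn f Ω) :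
    Continuous fun z => cut k (ψ z) * f z := continuous_iff_continuousAt.2 fun z => by
  by_cases hz : z ∈ Ω
  · exact ((continuous_cut k).comp hψc).continuousAt.mul (hf.continuousAt (hΩ.mem_nhds hz))
  · refine (continuousAt_const (y := (0 : ℝ))).congr ?_
    filter_upwards [eventually_mul_abs_le hψc hψ0 k hz] with w hw
    rw [cut_eq_zero hw, zero_mul]

include hψc hψ0 in
lemma integrable_cut_mul (hΩ : IsOpen Ω) (hΩb : Bornology.IsBounded Ω) (k : ℕ) {f : ℂ → ℝ}
    (hf : ContinuousOn f Ω) : Integrable fun z => cut k (ψ z) * f z :=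
  (continuous_cut_mul hψc hψ0 hΩ k hf).integrable_of_hasCompactSupport
    (hasCompactSupport_of_mul_abs hψc hψ0 hΩb k fun z hz => by
      rw [cut_eq_zero hz, zero_mul]).1

variable (hψd : ∀ z ∈ Ω, ContDiffAt ℝ 1 ψ z)

include hψd in
lemma continuousOn_fderiv_of_contDiffAt : ContinuousOn (fderiv ℝ ψ) Ω := fun z hz =>
  ((hψd z hz).fderiv_right (m := 0) (by norm_num)).continuousAt.continuousWithinAt

include hψc hψ0 hψd in
lemma contDiff_cutPrim_comp (k : ℕ) : ContDiff ℝ 1 fun z => cutPrim k (ψ z) :=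
  contDiff_iff_contDiffAt.2 fun z => by
    by_cases hz : z ∈ Ω
    · exact (contDiff_cutPrim k).contDiffAt.comp z (hψd z hz)
    · refine (contDiffAt_const (c := (0 : ℝ))).congr_of_eventuallyEq ?_
      filter_upwards [eventually_mul_abs_le hψc hψ0 k hz] with w hw using cutPrim_eq_zero hw

include hψd in
lemma fderiv_cutPrim_comp (k : ℕ) {z : ℂ} (hz : z ∈ Ω) :
    fderiv ℝ (fun z => cutPrim k (ψ z)) z = cut k (ψ z) • fderiv ℝ ψ z :=
  ((hasDerivAt_cutPrim k (ψ z)).comp_hasFDerivAt z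
    ((hψd z hz).differentiableAt (by simp)).hasFDerivAt).fderiv

include hψd in
/-- The gradient of a function vanishes almost everywhere on its zero set. -/
lemma ae_fderiv_eq_zero (hΩ : IsOpen Ω) (hψc : Continuous ψ) :
    ∀ᵐ z ∂(volume.restrict Ω), ψ z = 0 → fderiv ℝ ψ z = 0 := by
  set s : Set ℂ := Ω ∩ {z | ψ z = 0} with hs
  have hsm : MeasurableSet {z | ψ z = 0} := (isClosed_eq hψc continuous_const).measurableSet
  have hd : ∀ z ∈ Ω, HasFDerivAt (fun z => (ψ z : ℂ)) (Complex.ofRealCLM.comp (fderiv ℝ ψ z)) z :=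
    fun z hz => Complex.ofRealCLM.hasFDerivAt.comp z
      ((hψd z hz).differentiableAt (by simp)).hasFDerivAt
  have hA : ApproximatesLinearOn (fun z => (ψ z : ℂ)) (0 : ℂ →L[ℝ] ℂ) s 0 := by
    intro z hz w hw
    simp [(show ψ z = 0 from hz.2), (show ψ w = 0 from hw.2)]
  have key := hA.norm_fderiv_sub_le volume (hΩ.measurableSet.inter hsm)
    (fun z => Complex.ofRealCLM.comp (fderiv ℝ ψ z)) fun z hz => (hd z hz.1).hasFDerivWithinAt
  rw [hs, inter_comm, ← Measure.restrict_restrict hsm, ae_restrict_iff' hsm] at key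
  filter_upwards [key] with z hz h0
  have h1 := hz h0
  rw [sub_zero] at h1
  have h2 : Complex.ofRealCLM.comp (fderiv ℝ ψ z) = 0 := by
    rw [← norm_le_zero_iff]; exact_mod_cast h1
  ext v
  have h3 := congrArg (fun L : ℂ →L[ℝ] ℂ => (L v).re) h2
  simpa using h3

include hψd in
lemma ae_tendsto_cut_mul (hΩ : IsOpen Ω) (hψc : Continuous ψ) {f : ℂ → ℝ}
    (hf : ∀ z, fderiv ℝ ψ z = 0 → f z = 0) :
    ∀ᵐ z ∂(volume.restrict Ω), Tendsto (fun k => cut k (ψ z) * f z) atTop (𝓝 (f z)) := by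
  filter_upwards [ae_fderiv_eq_zero hψd hΩ hψc] with z hz
  by_cases h : ψ z = 0
  · rw [hf z (hz h)]; simp
  · simpa using (tendsto_cut h).mul_const (f z)

end


/-! ### The energy difference is of second order -/

/-- Fatou's lemma for nonnegative integrable functions with bounded integrals. -/
lemma integrable_of_tendsto_of_integral_le {α : Type*} [MeasurableSpace α] {μ : Measure α}
    {f : ℕ → α → ℝ} {g : α → ℝ} {A : ℝ} (hi : ∀ k, Integrable (f k) μ) (h0 : ∀ k z, 0 ≤ f k z)
    (hA : ∀ k, ∫ z, f k z ∂μ ≤ A)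
    (ht : ∀ᵐ z ∂μ, Tendsto (fun k => f k z) atTop (𝓝 (g z))) :
    Integrable g μ ∧ ∫ z, g z ∂μ ≤ A := by
  have hA0 : 0 ≤ A := (integral_nonneg (h0 0)).trans (hA 0)
  have h1 : ∫⁻ z, ‖g z‖ₑ ∂μ ≤ ENNReal.ofReal A := by
    rw [lintegral_congr_ae (g := fun z => liminf (fun k => ‖f k z‖ₑ) atTop)
      (by filter_upwards [ht] with z hz using hz.enorm.liminf_eq.symm)]
    refine (lintegral_liminf_le' fun k => (hi k).aestronglyMeasurable.enorm).trans ?_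
    refine liminf_le_of_le (by isBoundedDefault) fun b hb => ?_
    obtain ⟨k, hk⟩ := hb.exists
    refine hk.trans ?_
    rw [← ofReal_integral_norm_eq_lintegral_enorm (hi k)]
    refine ENNReal.ofReal_le_ofReal ((le_of_eq ?_).trans (hA k))
    exact integral_congr_ae (Eventually.of_forall fun z => Real.norm_of_nonneg (h0 k z))
  have hg : Integrable g μ :=
    ⟨aestronglyMeasurable_of_tendsto_ae atTop (fun k => (hi k).aestronglyMeasurable) ht,
      h1.trans_lt ENNReal.ofReal_lt_top⟩
  refine ⟨hg, (integral_mono hg hg.norm fun z => Real.le_norm_self _).trans ?_⟩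
  rw [← ofReal_integral_norm_eq_lintegral_enorm hg] at h1
  exact (ENNReal.ofReal_le_ofReal_iff hA0).1 h1

lemma abs_pullGdot_le {M : ℂ →L[ℝ] ℂ} {m : ℝ} (hM : ‖M‖ ≤ m) (hm : m ≤ 1 / 44)
    (α β : ℂ →L[ℝ] ℝ) :
    |pullGdot (ContinuousLinearMap.id ℝ ℂ + M) α β| ≤ 3 * (‖α‖ * ‖β‖) := by
  have h1 := abs_pullGdot_sub_gdot_le hM (by linarith) α β
  have h2 := abs_gdot_le α β
  have h3 : 22 * m * (‖α‖ * ‖β‖) ≤ 1 / 2 * (‖α‖ * ‖β‖) := by gcongr; linarith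
  have h4 := abs_sub_abs_le_abs_sub (pullGdot (ContinuousLinearMap.id ℝ ℂ + M) α β) (gdot α β)
  nlinarith [mul_nonneg (norm_nonneg α) (norm_nonneg β)]

lemma half_norm_sq_le_pullGdot {M : ℂ →L[ℝ] ℂ} {m : ℝ} (hM : ‖M‖ ≤ m) (hm : m ≤ 1 / 44)
    (α : ℂ →L[ℝ] ℝ) :
    ‖α‖ ^ 2 / 2 ≤ pullGdot (ContinuousLinearMap.id ℝ ℂ + M) α α := by
  have h1 := (abs_le.1 (abs_pullGdot_sub_gdot_le hM (by linarith) α α)).1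
  have h2 := norm_sq_le_gdot_self α
  have h3 : 22 * m * (‖α‖ * ‖α‖) ≤ 1 / 2 * (‖α‖ * ‖α‖) := by gcongr; linarith
  nlinarith

section

variable {n : ℕ} {Ω : Set ℂ} {x : Fin n → ℂ} {r m : ℝ} {a : ℂ → ℂ →L[ℝ] ℝ} {M : ℂ → ℂ →L[ℝ] ℂ}
  {ψ : ℂ → ℝ} (hΩ : IsOpen Ω) (hΩb : Bornology.IsBounded Ω) (hMc : Continuous M)
  (hMm : ∀ z, ‖M z‖ ≤ m) (hm : m ≤ 1 / 44)
  (hMr : ∀ l, ∀ z ∈ Metric.ball (x l) r, M z = 0) (hac : ContinuousOn a (Ω \ range x))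
  (hai : IntegrableOn a Ω) (hψc : Continuous ψ) (hψ0 : ∀ z ∉ Ω, ψ z = 0)
  (hψd : ∀ z ∈ Ω, ContDiffAt ℝ 1 ψ z)

include hMr in
lemma eq_zero_of_notMem_perforated {z : ℂ} (hz : z ∈ Ω) (hzP : z ∉ perforated Ω x r) :
    M z = 0 := by
  rw [perforated, Set.mem_sdiff, not_and_not_right, mem_iUnion] at hzP
  obtain ⟨l, hl⟩ := hzP hz
  exact hMr l z hl

include hMm hm hMr in
/-- The interaction terms are of first order in the change of variables, and supported away from the
singularities. -/
lemma abs_pullGdot_sub_gdot_le_indicator {z : ℂ} (hz : z ∈ Ω) (α : ℂ →L[ℝ] ℝ) :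
    |pullGdot (ContinuousLinearMap.id ℝ ℂ + M z) (a z) α - gdot (a z) α|
      ≤ 484 * m ^ 2 * (perforated Ω x r).indicator (fun z => ‖a z‖ ^ 2) z + ‖α‖ ^ 2 / 4 := by
  by_cases hzP : z ∈ perforated Ω x r
  · rw [indicator_of_mem hzP]
    refine (abs_pullGdot_sub_gdot_le (hMm z) (by linarith) (a z) α).trans ?_
    nlinarith [sq_nonneg (22 * m * ‖a z‖ - ‖α‖ / 2)]
  · rw [indicator_of_notMem hzP, pullGdot_eq_gdot (eq_zero_of_notMem_perforated hMr hz hzP),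
      sub_self, abs_zero]
    positivity

include hψc hψ0 hψd hΩ hΩb hai in
lemma integrableOn_cut_mul_of_abs_le (k : ℕ) {b : ℂ → ℝ}
    (hb : AEStronglyMeasurable b (volume.restrict Ω))
    (hbd : ∀ z, |b z| ≤ 3 * (‖a z‖ * ‖fderiv ℝ ψ z‖)) :
    IntegrableOn (fun z => cut k (ψ z) * b z) Ω := by
  have hd := (continuousOn_fderiv_of_contDiffAt hψd).norm
  obtain ⟨C, hC⟩ := (continuous_cut_mul hψc hψ0 hΩ k hd).bounded_above_of_compact_support
    (hasCompactSupport_of_mul_abs hψc hψ0 hΩb k fun z hz => by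
      rw [cut_eq_zero hz, zero_mul]).1
  refine (hai.norm.const_mul (3 * C)).mono'
    (((continuous_cut k).comp hψc).aestronglyMeasurable.mul hb) (Eventually.of_forall fun z => ?_)
  have h1 := (Real.le_norm_self _).trans (hC z)
  have h0 := cut_nonneg k (ψ z)
  rw [Real.norm_eq_abs, abs_mul, abs_of_nonneg h0]
  calc cut k (ψ z) * |b z| ≤ cut k (ψ z) * (3 * (‖a z‖ * ‖fderiv ℝ ψ z‖)) :=
        mul_le_mul_of_nonneg_left (hbd z) h0
    _ = 3 * ‖a z‖ * (cut k (ψ z) * ‖fderiv ℝ ψ z‖) := by ring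
    _ ≤ 3 * ‖a z‖ * C := mul_le_mul_of_nonneg_left h1 (by positivity)
    _ = _ := by ring

include hMc hMm hm in
lemma aestronglyMeasurable_pullGdot (hΩ : IsOpen Ω) {α β : ℂ → ℂ →L[ℝ] ℝ}
    (hα : ContinuousOn α (Ω \ range x)) (hβ : ContinuousOn β (Ω \ range x)) :
    AEStronglyMeasurable (fun z => pullGdot (ContinuousLinearMap.id ℝ ℂ + M z) (α z) (β z))
      (volume.restrict Ω) :=
  aestronglyMeasurable_of_continuousOn_diff hΩ
    (continuousOn_pullGdot hMc (fun z => (hMm z).trans (by linarith)) hα hβ)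

omit hψ0 in
lemma aestronglyMeasurable_gdot (hΩ : IsOpen Ω) {α β : ℂ → ℂ →L[ℝ] ℝ}
    (hα : ContinuousOn α (Ω \ range x)) (hβ : ContinuousOn β (Ω \ range x)) :
    AEStronglyMeasurable (fun z => gdot (α z) (β z)) (volume.restrict Ω) :=
  aestronglyMeasurable_of_continuousOn_diff hΩ (continuous_gdot.comp_continuousOn (hα.prodMk hβ))

variable (haP : IntegrableOn (fun z => ‖a z‖ ^ 2) (perforated Ω x r))

include haP in
lemma integrableOn_indicator_perforated (hΩ : IsOpen Ω) :
    IntegrableOn ((perforated Ω x r).indicator fun z => ‖a z‖ ^ 2) Ω ∧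
    ∫ z in Ω, (perforated Ω x r).indicator (fun z => ‖a z‖ ^ 2) z
      = ∫ z in perforated Ω x r, ‖a z‖ ^ 2 := by
  have hP := isMeasurable_perforated hΩ x r
  refine ⟨((integrable_indicator_iff hP).2 haP).integrableOn, ?_⟩
  have hsub : perforated Ω x r ⊆ Ω := sdiff_subset
  rw [setIntegral_indicator hP, inter_eq_right.2 hsub]

variable (ha0 : ∀ η : ℂ → ℝ, ContDiff ℝ 1 η → HasCompactSupport η → tsupport η ⊆ Ω →
    ∫ z in Ω, gdot (a z) (fderiv ℝ η z) = 0)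
  (hb0 : ∀ η : ℂ → ℝ, ContDiff ℝ 1 η → HasCompactSupport η → tsupport η ⊆ Ω →
    ∫ z in Ω, pullGdot (ContinuousLinearMap.id ℝ ℂ + M z) (a z + fderiv ℝ ψ z) (fderiv ℝ η z) = 0)

include hΩ hΩb hψc hψ0 hψd ha0 in
/-- The Euler equation of the current, tested with the truncation `cutPrim k ∘ ψ` of the phase. -/
lemma integral_cut_mul_gdot (k : ℕ) :
    ∫ z in Ω, cut k (ψ z) * gdot (a z) (fderiv ℝ ψ z) = 0 := by
  obtain ⟨hc, hs⟩ := hasCompactSupport_of_mul_abs hψc hψ0 hΩb k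
    (f := fun z => cutPrim k (ψ z)) fun z hz => cutPrim_eq_zero hz
  rw [← ha0 _ (contDiff_cutPrim_comp hψc hψ0 hψd k) hc hs]
  refine setIntegral_congr_fun hΩ.measurableSet fun z hz => ?_
  simp only [fderiv_cutPrim_comp hψd k hz, gdot_smul_right]

include hΩ hΩb hMc hMm hm hMr hac hai hψc hψ0 hψd haP ha0 hb0 in
/-- The difference of the Euler equations, tested with truncations of the phase itself. -/
lemma integral_cut_mul_norm_sq_le (k : ℕ) :
    ∫ z in Ω, cut k (ψ z) * ‖fderiv ℝ ψ z‖ ^ 2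
      ≤ 1936 * m ^ 2 * ∫ z in perforated Ω x r, ‖a z‖ ^ 2 := by
  have hdc := continuousOn_fderiv_of_contDiffAt hψd
  have hdc' := hdc.mono (sdiff_subset : Ω \ range x ⊆ Ω)
  have hdm : ∀ z, ‖M z‖ ≤ 1 / 4 := fun z => (hMm z).trans (by linarith)
  have i0 : IntegrableOn (fun z => cut k (ψ z) * gdot (a z) (fderiv ℝ ψ z)) Ω :=
    integrableOn_cut_mul_of_abs_le hΩ hΩb hai hψc hψ0 hψd k
      (aestronglyMeasurable_gdot hΩ hac hdc') fun z => (abs_gdot_le _ _).trans (by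
        nlinarith [mul_nonneg (norm_nonneg (a z)) (norm_nonneg (fderiv ℝ ψ z))])
  have i1 : IntegrableOn (fun z => cut k (ψ z) *
      pullGdot (ContinuousLinearMap.id ℝ ℂ + M z) (a z) (fderiv ℝ ψ z)) Ω :=
    integrableOn_cut_mul_of_abs_le hΩ hΩb hai hψc hψ0 hψd k
      (aestronglyMeasurable_pullGdot hMc hMm hm hΩ hac hdc') fun z => abs_pullGdot_le (hMm z) hm _ _
  have i2 : IntegrableOn (fun z => cut k (ψ z) *
      pullGdot (ContinuousLinearMap.id ℝ ℂ + M z) (fderiv ℝ ψ z) (fderiv ℝ ψ z)) Ω :=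
    (integrable_cut_mul hψc hψ0 hΩ hΩb k (continuousOn_pullGdot hMc hdm hdc hdc)).integrableOn
  have i3 : IntegrableOn (fun z => cut k (ψ z) * ‖fderiv ℝ ψ z‖ ^ 2) Ω :=
    (integrable_cut_mul hψc hψ0 hΩ hΩb k (hdc.norm.pow 2)).integrableOn
  obtain ⟨i4, e4⟩ := integrableOn_indicator_perforated haP hΩ
  obtain ⟨hc, hs⟩ := hasCompactSupport_of_mul_abs hψc hψ0 hΩb k
    (f := fun z => cutPrim k (ψ z)) fun z hz => cutPrim_eq_zero hz
  have h2 : ∫ z in Ω, (cut k (ψ z) *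
      pullGdot (ContinuousLinearMap.id ℝ ℂ + M z) (a z) (fderiv ℝ ψ z) + cut k (ψ z) *
      pullGdot (ContinuousLinearMap.id ℝ ℂ + M z) (fderiv ℝ ψ z) (fderiv ℝ ψ z)) = 0 := by
    rw [← hb0 _ (contDiff_cutPrim_comp hψc hψ0 hψd k) hc hs]
    refine setIntegral_congr_fun hΩ.measurableSet fun z hz => ?_
    simp only [fderiv_cutPrim_comp hψd k hz, pullGdot_smul_right, pullGdot_add_left]
    ring
  have h3 := integral_sub (i1.add i2) i0
  simp only [Pi.add_apply] at h3
  rw [h2, integral_cut_mul_gdot hΩ hΩb hψc hψ0 hψd ha0, sub_zero] at h3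
  -- pointwise, up to the truncation, `‖∇ψ‖² / 4` is bounded by the quadratic form of `∇ψ` plus the
  -- interaction term, up to an error of order `m² ‖a‖²`
  have hle : ∫ z in Ω, (cut k (ψ z) * ‖fderiv ℝ ψ z‖ ^ 2 - 1936 * m ^ 2 *
      (perforated Ω x r).indicator (fun z => ‖a z‖ ^ 2) z) ≤ ∫ z in Ω, 4 * (cut k (ψ z) *
      pullGdot (ContinuousLinearMap.id ℝ ℂ + M z) (a z) (fderiv ℝ ψ z) + cut k (ψ z) *
      pullGdot (ContinuousLinearMap.id ℝ ℂ + M z) (fderiv ℝ ψ z) (fderiv ℝ ψ z)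
      - cut k (ψ z) * gdot (a z) (fderiv ℝ ψ z)) := by
    refine setIntegral_mono_on (i3.sub (i4.const_mul _)) (((i1.add i2).sub i0).const_mul _)
      hΩ.measurableSet fun z hz => ?_
    have q1 := (abs_le.1 (abs_pullGdot_sub_gdot_le_indicator (a := a) hMm hm hMr hz
      (fderiv ℝ ψ z))).1
    have q2 := half_norm_sq_le_pullGdot (hMm z) hm (fderiv ℝ ψ z)
    have q3 := cut_nonneg k (ψ z)
    have q4 := cut_le_one k (ψ z)
    have q5 : 0 ≤ (perforated Ω x r).indicator (fun z => ‖a z‖ ^ 2) z :=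
      indicator_nonneg (fun z _ => by positivity) z
    have q6 : 0 ≤ m ^ 2 * (perforated Ω x r).indicator (fun z => ‖a z‖ ^ 2) z := by positivity
    have q7 : cut k (ψ z) * (‖fderiv ℝ ψ z‖ ^ 2
        - 1936 * (m ^ 2 * (perforated Ω x r).indicator (fun z => ‖a z‖ ^ 2) z))
        ≤ cut k (ψ z) * (4 * (pullGdot (ContinuousLinearMap.id ℝ ℂ + M z) (a z) (fderiv ℝ ψ z)
          + pullGdot (ContinuousLinearMap.id ℝ ℂ + M z) (fderiv ℝ ψ z) (fderiv ℝ ψ z)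
          - gdot (a z) (fderiv ℝ ψ z))) := mul_le_mul_of_nonneg_left (by linarith) q3
    nlinarith
  rw [integral_const_mul, h3, mul_zero, integral_sub i3 (i4.const_mul _), integral_const_mul,
    e4] at hle
  linarith

include hΩ hΩb hMc hMm hm hMr hac hai hψc hψ0 hψd haP ha0 hb0 in
/-- The phase is of first order in the energy norm. -/
lemma integral_norm_fderiv_sq_le : IntegrableOn (fun z => ‖fderiv ℝ ψ z‖ ^ 2) Ω ∧
    ∫ z in Ω, ‖fderiv ℝ ψ z‖ ^ 2 ≤ 1936 * m ^ 2 * ∫ z in perforated Ω x r, ‖a z‖ ^ 2 := by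
  refine integrable_of_tendsto_of_integral_le (f := fun k z => cut k (ψ z) * ‖fderiv ℝ ψ z‖ ^ 2)
    (fun k => (integrable_cut_mul (f := fun z => ‖fderiv ℝ ψ z‖ ^ 2) hψc hψ0 hΩ hΩb k
      ((continuousOn_fderiv_of_contDiffAt hψd).norm.pow 2)).integrableOn)
    (fun k z => mul_nonneg (cut_nonneg _ _) (by positivity))
    (integral_cut_mul_norm_sq_le hΩ hΩb hMc hMm hm hMr hac hai hψc hψ0 hψd haP ha0 hb0)
    (ae_tendsto_cut_mul hψd hΩ hψc (f := fun z => ‖fderiv ℝ ψ z‖ ^ 2) fun z hz => by simp [hz])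

end


section

variable {n : ℕ} {Ω : Set ℂ} {x : Fin n → ℂ} {r m : ℝ} {a : ℂ → ℂ →L[ℝ] ℝ} {M : ℂ → ℂ →L[ℝ] ℂ}
  {ψ : ℂ → ℝ} (hΩ : IsOpen Ω) (hΩb : Bornology.IsBounded Ω) (hMc : Continuous M)
  (hMm : ∀ z, ‖M z‖ ≤ m) (hm : m ≤ 1 / 44)
  (hMr : ∀ l, ∀ z ∈ Metric.ball (x l) r, M z = 0) (hac : ContinuousOn a (Ω \ range x))
  (hai : IntegrableOn a Ω) (hψc : Continuous ψ) (hψ0 : ∀ z ∉ Ω, ψ z = 0)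
  (hψd : ∀ z ∈ Ω, ContDiffAt ℝ 1 ψ z)
  (hx : ∀ j, x j ∈ Ω)
  (haρ : ∀ ρ > 0, IntegrableOn (fun z => ‖a z‖ ^ 2) (perforated Ω x ρ))
  (hψ2 : IntegrableOn (fun z => ‖fderiv ℝ ψ z‖ ^ 2) Ω)

include hΩ hac hai hψd hx haρ hψ2 in
/-- Near the singularities the gradient of the phase is bounded, and away from them both factors are
square integrable. -/
lemma integrableOn_norm_mul_norm_fderiv : IntegrableOn (fun z => ‖a z‖ * ‖fderiv ℝ ψ z‖) Ω := by
  have hdc := continuousOn_fderiv_of_contDiffAt hψd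
  -- `ρ` is such that the closed balls of radius `ρ` around the singularities lie in `Ω`, where the
  -- gradient of the phase is continuous
  have h1 : ∀ j, ∀ᶠ ρ in 𝓝[>] (0 : ℝ), Metric.closedBall (x j) ρ ⊆ Ω := fun j => by
    obtain ⟨ε, hε, hb⟩ := Metric.isOpen_iff.1 hΩ (x j) (hx j)
    filter_upwards [Ioo_mem_nhdsGT hε] with ρ hρ
    exact (Metric.closedBall_subset_ball hρ.2).trans hb
  obtain ⟨ρ, hρ, hρ0⟩ := ((eventually_all.2 h1).and self_mem_nhdsWithin).exists
  have hρ0 : 0 < ρ := hρ0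
  have hK : IsCompact (⋃ j, Metric.closedBall (x j) ρ) :=
    isCompact_iUnion fun j => isCompact_closedBall _ _
  obtain ⟨C, hC⟩ := hK.exists_bound_of_continuousOn (hdc.mono (iUnion_subset hρ))
  have hm : AEStronglyMeasurable (fun z => ‖a z‖ * ‖fderiv ℝ ψ z‖) (volume.restrict Ω) :=
    aestronglyMeasurable_of_continuousOn_diff hΩ
      (hac.norm.mul (hdc.mono (sdiff_subset : Ω \ range x ⊆ Ω)).norm)
  obtain ⟨i1, -⟩ := integrableOn_indicator_perforated (haρ ρ hρ0) hΩ
  refine ((hai.norm.const_mul |C|).add (i1.add hψ2)).mono' hm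
    ((ae_restrict_iff' hΩ.measurableSet).2 (Eventually.of_forall fun z hz => ?_))
  rw [Real.norm_of_nonneg (by positivity)]
  simp only [Pi.add_apply]
  by_cases hzP : z ∈ perforated Ω x ρ
  · rw [indicator_of_mem hzP]
    have : 0 ≤ |C| * ‖a z‖ := by positivity
    nlinarith [sq_nonneg (‖a z‖ - ‖fderiv ℝ ψ z‖), sq_nonneg ‖a z‖, sq_nonneg ‖fderiv ℝ ψ z‖]
  · rw [indicator_of_notMem hzP]
    rw [perforated, Set.mem_sdiff, not_and_not_right] at hzP
    have h2 := hC z (iUnion_mono (fun j => Metric.ball_subset_closedBall) (hzP hz))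
    have h3 : ‖a z‖ * ‖fderiv ℝ ψ z‖ ≤ ‖a z‖ * |C| :=
      mul_le_mul_of_nonneg_left (h2.trans (le_abs_self C)) (norm_nonneg _)
    nlinarith [sq_nonneg ‖fderiv ℝ ψ z‖]

variable (ha0 : ∀ η : ℂ → ℝ, ContDiff ℝ 1 η → HasCompactSupport η → tsupport η ⊆ Ω →
    ∫ z in Ω, gdot (a z) (fderiv ℝ η z) = 0)

include hΩ hΩb hac hai hψc hψ0 hψd hx haρ hψ2 ha0 in
/-- The current is orthogonal to the gradient of the phase. The phase itself is not an admissible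
test function, being neither compactly supported in `Ω` nor smooth at the boundary, and is replaced
by its truncations. -/
lemma integral_gdot_fderiv_phase : IntegrableOn (fun z => gdot (a z) (fderiv ℝ ψ z)) Ω ∧
    ∫ z in Ω, gdot (a z) (fderiv ℝ ψ z) = 0 := by
  have hdc := (continuousOn_fderiv_of_contDiffAt hψd).mono (sdiff_subset : Ω \ range x ⊆ Ω)
  have i1 := (integrableOn_norm_mul_norm_fderiv hΩ hac hai hψd hx haρ hψ2).const_mul 2
  have hgm := aestronglyMeasurable_gdot hΩ hac hdc
  have hb : ∀ z, ‖gdot (a z) (fderiv ℝ ψ z)‖ ≤ 2 * (‖a z‖ * ‖fderiv ℝ ψ z‖) := fun z => by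
    rw [Real.norm_eq_abs, ← mul_assoc]
    exact abs_gdot_le _ _
  refine ⟨i1.mono' hgm (Eventually.of_forall hb), ?_⟩
  refine tendsto_nhds_unique (tendsto_integral_of_dominated_convergence _
    (F := fun k z => cut k (ψ z) * gdot (a z) (fderiv ℝ ψ z))
    (fun k => ((continuous_cut k).comp hψc).aestronglyMeasurable.mul hgm) i1
    (fun k => Eventually.of_forall fun z => ?_)
    (ae_tendsto_cut_mul hψd hΩ hψc (f := fun z => gdot (a z) (fderiv ℝ ψ z)) fun z hz => by
      simp only [hz, gdot_zero_right])) ?_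
  · rw [norm_mul, Real.norm_of_nonneg (cut_nonneg _ _)]
    exact (mul_le_of_le_one_left (norm_nonneg _) (cut_le_one _ _)).trans (hb z)
  · simp_rw [integral_cut_mul_gdot hΩ hΩb hψc hψ0 hψd ha0]
    exact tendsto_const_nhds

variable (hr : 0 < r) (hb0 : ∀ η : ℂ → ℝ, ContDiff ℝ 1 η → HasCompactSupport η → tsupport η ⊆ Ω →
    ∫ z in Ω, pullGdot (ContinuousLinearMap.id ℝ ℂ + M z) (a z + fderiv ℝ ψ z) (fderiv ℝ η z) = 0)
  (hs0 : ∫ z in Ω, stress (M z) (a z) = 0)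

lemma continuousOn_stress {s : Set ℂ} (hMc : Continuous M) (hac : ContinuousOn a s) :
    ContinuousOn (fun z => stress (M z) (a z)) s := by
  have e1 : ∀ v : ℂ, Continuous fun z => (M z v).re := fun v =>
    Complex.continuous_re.comp (hMc.clm_apply continuous_const)
  have e2 : ∀ v : ℂ, Continuous fun z => (M z v).im := fun v =>
    Complex.continuous_im.comp (hMc.clm_apply continuous_const)
  have c1 : ∀ v : ℂ, ContinuousOn (fun z => a z v) s := fun v => hac.clm_apply continuousOn_const
  unfold stress
  exact (((e2 _).sub (e1 _)).continuousOn.mul (((c1 _).pow 2).sub ((c1 _).pow 2))).sub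
    ((continuous_const.mul ((e1 _).add (e2 _))).continuousOn.mul ((c1 _).mul (c1 _)))

include hΩ hMc hMm hm hMr hac haρ hr in
lemma integrableOn_stress : IntegrableOn (fun z => stress (M z) (a z)) Ω := by
  obtain ⟨i1, -⟩ := integrableOn_indicator_perforated (haρ r hr) hΩ
  refine (i1.const_mul (22 * m + 64 * m ^ 2)).mono'
    (aestronglyMeasurable_of_continuousOn_diff hΩ (continuousOn_stress hMc hac))
    ((ae_restrict_iff' hΩ.measurableSet).2 (Eventually.of_forall fun z hz => ?_))
  rw [Real.norm_eq_abs]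
  by_cases hzP : z ∈ perforated Ω x r
  · rw [indicator_of_mem hzP]
    have h1 := abs_pullGdot_sub_stress_le (hMm z) (by linarith) (a z)
    have h2 := abs_pullGdot_sub_gdot_le (hMm z) (by linarith) (a z) (a z)
    rw [abs_le] at h1 h2 ⊢
    constructor <;> nlinarith
  · rw [indicator_of_notMem hzP, eq_zero_of_notMem_perforated hMr hz hzP, stress_zero]
    simp

include hΩ hΩb hMc hMm hm hMr hac hai hψc hψ0 hψd hx haρ ha0 hr hb0 hs0 in
/-- The difference of the energy densities is integrable, and its integral is of second order: the
terms of first order are the stress and the product of the current with the gradient of the phase,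
whose integrals vanish. -/
lemma abs_integral_energy_sub_le :
    IntegrableOn (fun z => pullGdot (ContinuousLinearMap.id ℝ ℂ + M z) (a z + fderiv ℝ ψ z)
      (a z + fderiv ℝ ψ z) - gdot (a z) (a z)) Ω ∧
    |∫ z in Ω, (pullGdot (ContinuousLinearMap.id ℝ ℂ + M z) (a z + fderiv ℝ ψ z)
      (a z + fderiv ℝ ψ z) - gdot (a z) (a z))|
      ≤ 50000 * m ^ 2 * ∫ z in perforated Ω x r, ‖a z‖ ^ 2 := by
  obtain ⟨hψ2, hψ3⟩ := integral_norm_fderiv_sq_le hΩ hΩb hMc hMm hm hMr hac hai hψc hψ0 hψd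
    (haρ r hr) ha0 hb0
  obtain ⟨ig, eg⟩ := integral_gdot_fderiv_phase hΩ hΩb hac hai hψc hψ0 hψd hx haρ hψ2 ha0
  have is := integrableOn_stress hΩ hMc hMm hm hMr hac haρ hr
  obtain ⟨i1, e1⟩ := integrableOn_indicator_perforated (haρ r hr) hΩ
  have hdc := (continuousOn_fderiv_of_contDiffAt hψd).mono (sdiff_subset : Ω \ range x ⊆ Ω)
  set L : ℂ → ℂ →L[ℝ] ℂ := fun z => ContinuousLinearMap.id ℝ ℂ + M z with hL
  set F : ℂ → ℝ := fun z => pullGdot (L z) (a z + fderiv ℝ ψ z) (a z + fderiv ℝ ψ z)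
    - gdot (a z) (a z) with hF
  -- `R` is what remains of the energy difference without its first order terms
  set R : ℂ → ℝ := fun z => F z - stress (M z) (a z) - 2 * gdot (a z) (fderiv ℝ ψ z) with hR
  set B : ℂ → ℝ := fun z => 1100 * m ^ 2 * (perforated Ω x r).indicator (fun z => ‖a z‖ ^ 2) z
    + 4 * ‖fderiv ℝ ψ z‖ ^ 2 with hB
  have hFm : AEStronglyMeasurable F (volume.restrict Ω) :=
    (aestronglyMeasurable_pullGdot hMc hMm hm hΩ (hac.add hdc) (hac.add hdc)).sub
      (aestronglyMeasurable_gdot hΩ hac hac)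
  have hRm : AEStronglyMeasurable R (volume.restrict Ω) :=
    (hFm.sub is.aestronglyMeasurable).sub (ig.aestronglyMeasurable.const_mul 2)
  have hBi : IntegrableOn B Ω := (i1.const_mul _).add (hψ2.const_mul 4)
  have hRB : ∀ z ∈ Ω, |R z| ≤ B z := fun z hz => by
    have q1 := abs_pullGdot_sub_gdot_le_indicator (a := a) hMm hm hMr hz (fderiv ℝ ψ z)
    have q2 := abs_pullGdot_le (hMm z) hm (fderiv ℝ ψ z) (fderiv ℝ ψ z)
    have q3 : |pullGdot (L z) (a z) (a z) - gdot (a z) (a z) - stress (M z) (a z)|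
        ≤ 64 * m ^ 2 * (perforated Ω x r).indicator (fun z => ‖a z‖ ^ 2) z := by
      by_cases hzP : z ∈ perforated Ω x r
      · rw [indicator_of_mem hzP]
        exact abs_pullGdot_sub_stress_le (hMm z) (by linarith) (a z)
      · have h0 := eq_zero_of_notMem_perforated hMr hz hzP
        rw [indicator_of_notMem hzP, hL, pullGdot_eq_gdot h0, h0, stress_zero]
        simp
    have e : R z = (pullGdot (L z) (a z) (a z) - gdot (a z) (a z) - stress (M z) (a z))
        + 2 * (pullGdot (L z) (a z) (fderiv ℝ ψ z) - gdot (a z) (fderiv ℝ ψ z))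
        + pullGdot (L z) (fderiv ℝ ψ z) (fderiv ℝ ψ z) := by
      simp only [hR, hF, pullGdot_add_left, pullGdot_add_right,
        pullGdot_comm (L z) (fderiv ℝ ψ z) (a z)]
      ring
    have q5 : 0 ≤ (perforated Ω x r).indicator (fun z => ‖a z‖ ^ 2) z :=
      indicator_nonneg (fun z _ => by positivity) z
    have q6 : 0 ≤ m ^ 2 * (perforated Ω x r).indicator (fun z => ‖a z‖ ^ 2) z := by positivity
    rw [e]
    simp only [hB]
    rw [abs_le] at q1 q2 q3 ⊢
    constructor <;> nlinarith [sq_nonneg ‖fderiv ℝ ψ z‖]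
  have hRB' : ∀ᵐ z ∂(volume.restrict Ω), ‖R z‖ ≤ B z :=
    (ae_restrict_iff' hΩ.measurableSet).2 (Eventually.of_forall hRB)
  have iR : IntegrableOn R Ω := hBi.mono' hRm hRB'
  have eF : F = fun z => R z + stress (M z) (a z) + 2 * gdot (a z) (fderiv ℝ ψ z) := by
    funext z; simp only [hR]; ring
  have iF : IntegrableOn F Ω := by
    rw [eF]
    exact (iR.add is).add (ig.const_mul 2)
  refine ⟨iF, ?_⟩
  have eI : ∫ z in Ω, F z = ∫ z in Ω, R z := by
    rw [eF, integral_add (f := fun z => R z + stress (M z) (a z)) (iR.add is) (ig.const_mul 2),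
      integral_add iR is, integral_const_mul, eg, hs0]
    ring
  rw [eI, ← Real.norm_eq_abs]
  refine (norm_integral_le_of_norm_le hBi hRB').trans ?_
  simp only [hB]
  rw [integral_add (i1.const_mul _) (hψ2.const_mul 4), integral_const_mul, integral_const_mul, e1]
  have hA : 0 ≤ m ^ 2 * ∫ z in perforated Ω x r, ‖a z‖ ^ 2 :=
    mul_nonneg (sq_nonneg _) (integral_nonneg fun z => by positivity)
  nlinarith

end


/-! ### The renormalised energy of the limit map -/

lemma eventually_mem_perforated {n : ℕ} {Ω : Set ℂ} {x : Fin n → ℂ} {z : ℂ} (hz : z ∈ Ω \ range x) :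
    ∀ᶠ ρ in 𝓝[>] (0 : ℝ), z ∈ perforated Ω x ρ := by
  have h : ∀ j, ∀ᶠ ρ in 𝓝[>] (0 : ℝ), z ∉ Metric.ball (x j) ρ := fun j => by
    have hd : 0 < dist z (x j) := dist_pos.2 (IsSingularWith.ne_of_notMem_range hz.2 j)
    filter_upwards [Ioo_mem_nhdsGT hd] with ρ hρ hzρ
    exact absurd (Metric.mem_ball.1 hzρ) (not_lt.2 hρ.2.le)
  filter_upwards [eventually_all.2 h] with ρ hρ
  refine ⟨hz.1, fun hmem => ?_⟩
  obtain ⟨j, hj⟩ := mem_iUnion.1 hmem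
  exact hρ j hj

lemma tendsto_integral_perforated {n : ℕ} {Ω : Set ℂ} (hΩ : IsOpen Ω) (x : Fin n → ℂ) {f : ℂ → ℝ}
    (hf : IntegrableOn f Ω) :
    Tendsto (fun ρ => ∫ z in perforated Ω x ρ, f z) (𝓝[>] 0) (𝓝 (∫ z in Ω, f z)) := by
  have e : ∀ ρ, ∫ z in perforated Ω x ρ, f z = ∫ z in Ω, (perforated Ω x ρ).indicator f z :=
    fun ρ => by
    have hsub : perforated Ω x ρ ⊆ Ω := sdiff_subset
    rw [setIntegral_indicator (isMeasurable_perforated hΩ x ρ), inter_eq_right.2 hsub]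
  simp_rw [e]
  refine tendsto_integral_filter_of_dominated_convergence (fun z => ‖f z‖)
    (Eventually.of_forall fun ρ => hf.aestronglyMeasurable.indicator
      (isMeasurable_perforated hΩ x ρ))
    (Eventually.of_forall fun ρ => Eventually.of_forall fun z => norm_indicator_le_norm_self _ _)
    hf.norm ?_
  filter_upwards [ae_mem_diff hΩ.measurableSet x] with z hz
  refine tendsto_const_nhds.congr' ?_
  filter_upwards [eventually_mem_perforated hz] with ρ hρ using (indicator_of_mem hρ _).symm

lemma perforated_subset_of_le {n : ℕ} {Ω : Set ℂ} {x : Fin n → ℂ} {ρ R : ℝ} (h : ρ ≤ R) :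
    perforated Ω x R ⊆ perforated Ω x ρ :=
  sdiff_subset_sdiff_right (iUnion_mono fun _ => Metric.ball_subset_ball h)

namespace IsSingularWith

variable {n : ℕ} {Ω : Set ℂ} {x : Fin n → ℂ} {d : Fin n → ℤ} {u v : ℂ → ℂ}
  (h : IsSingularWith Ω x d u v) (hΩ : IsOpen Ω)

include h hΩ

lemma ae_norm_grad_sq_eq (ρ : ℝ) : ∀ᵐ z ∂(volume.restrict (perforated Ω x ρ)),
    ‖grad u z‖ ^ 2 = gdot (current u z) (current u z) := by
  filter_upwards [ae_restrict_of_ae_restrict_of_subset (sdiff_subset : perforated Ω x ρ ⊆ Ω)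
    (ae_mem_diff hΩ.measurableSet x)] with z hz
  exact norm_grad_sq (h.differentiableAt hΩ hz) (h.eventually_norm hΩ hz)

/-- Near a singularity, the energy density is that of the pure vortex up to an integrable error. -/
lemma abs_gdot_current_sub_le {l : Fin n} {R : ℝ} (hR : 0 < R)
    (hRΩ : Metric.closedBall (x l) R ⊆ Ω) (hRd : ∀ j ≠ l, 2 * R ≤ dist (x l) (x j)) :
    ∃ C, ∀ z ∈ Metric.ball (x l) R, z ≠ x l →
      |gdot (current u z) (current u z) - (d l : ℝ) ^ 2 * (‖z - x l‖ ^ 2)⁻¹|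
        ≤ C * ‖z - x l‖⁻¹ + C := by
  have hcv : ContinuousOn (current v) (Metric.closedBall (x l) R) := fun z hz => by
    have h3 := h.harmonic.contDiffAt hΩ (hRΩ hz)
    have h4 : ContinuousAt (fun z => (v z)⁻¹ • fderiv ℝ v z) z :=
      (h3.continuousAt.inv₀ (h.harmonic.ne_zero (hRΩ hz))).smul
        (h3.fderiv_right (m := 1) (by norm_num)).continuousAt
    exact ((ContinuousLinearMap.compL ℝ ℂ ℂ ℝ Complex.imCLM).continuous.continuousAt.comp
      h4).continuousWithinAt
  obtain ⟨C₀, hC₀⟩ := (isCompact_closedBall (x l) R).exists_bound_of_continuousOn hcv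
  have hC₀0 : 0 ≤ C₀ := (norm_nonneg _).trans (hC₀ (x l) (Metric.mem_closedBall_self hR.le))
  set C₁ : ℝ := ∑ j ∈ Finset.univ.erase l, |(d j : ℝ)| * R⁻¹ + C₀ with hC₁
  have hC₁0 : 0 ≤ C₁ := add_nonneg (Finset.sum_nonneg fun j _ => by positivity) hC₀0
  refine ⟨4 * |(d l : ℝ)| * C₁ + 2 * C₁ ^ 2, fun z hz hzl => ?_⟩
  have hfar : ∀ j ≠ l, R ≤ ‖z - x j‖ := fun j hj => by
    have h1 := hRd j hj
    have h2 := dist_triangle_left (x l) (x j) z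
    rw [Metric.mem_ball] at hz
    rw [← dist_eq_norm]
    linarith
  have hzΩ : z ∈ Ω \ range x := ⟨hRΩ (Metric.ball_subset_closedBall hz), by
    rintro ⟨j, hj⟩
    by_cases hjl : j = l
    · exact hzl (by rw [← hj, hjl])
    · have := hfar j hjl
      rw [hj, sub_self, norm_zero] at this
      linarith⟩
  set c := ∑ j ∈ Finset.univ.erase l, (d j : ℝ) • rot (x j) z + current v z with hc
  have hcn : ‖c‖ ≤ C₁ := by
    refine (norm_add_le _ _).trans (add_le_add ((norm_sum_le _ _).trans
      (Finset.sum_le_sum fun j hj => ?_)) (hC₀ z (Metric.ball_subset_closedBall hz)))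
    rw [norm_smul, Real.norm_eq_abs]
    refine mul_le_mul_of_nonneg_left ((norm_rot_le _ _).trans ?_) (abs_nonneg _)
    exact inv_anti₀ hR (hfar j (Finset.ne_of_mem_erase hj))
  have e : current u z = (d l : ℝ) • rot (x l) z + c := by
    rw [h.current_eq hΩ hzΩ, ← Finset.add_sum_erase _ _ (Finset.mem_univ l), hc, add_assoc]
  have e2 : gdot (current u z) (current u z) - (d l : ℝ) ^ 2 * (‖z - x l‖ ^ 2)⁻¹
      = 2 * (d l : ℝ) * gdot (rot (x l) z) c + gdot c c := by
    rw [e]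
    generalize c = γ
    rw [gdot_add_left, gdot_add_right, gdot_add_right, gdot_smul_left, gdot_smul_left,
      gdot_smul_right, gdot_smul_right, gdot_rot_self, gdot_comm γ (rot (x l) z)]
    ring
  rw [e2]
  refine (abs_add_le _ _).trans ?_
  have f1 := abs_gdot_le (rot (x l) z) c
  have f2 := abs_gdot_le c c
  have f3 := norm_rot_le (x l) z
  have f4 : |2 * (d l : ℝ) * gdot (rot (x l) z) c| ≤ 4 * |(d l : ℝ)| * C₁ * ‖z - x l‖⁻¹ := by
    rw [abs_mul, abs_mul, abs_two]
    calc 2 * |(d l : ℝ)| * |gdot (rot (x l) z) c|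
        ≤ 2 * |(d l : ℝ)| * (2 * ‖z - x l‖⁻¹ * C₁) := by
          refine mul_le_mul_of_nonneg_left (f1.trans ?_) (by positivity)
          gcongr
      _ = _ := by ring
  have f5 : |gdot c c| ≤ 2 * C₁ ^ 2 := f2.trans (by
    have := mul_le_mul hcn hcn (norm_nonneg _) hC₁0
    nlinarith)
  have f6 : 0 ≤ 2 * C₁ ^ 2 * ‖z - x l‖⁻¹ := by positivity
  have f7 : 0 ≤ 4 * |(d l : ℝ)| * C₁ := by positivity
  linarith

/-- Subtracting the densities of the pure vortices makes the energy density integrable; the energy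
of a vortex in an annulus is explicit. -/
lemma exists_hasRenormalisedEnergy (hx : x ∈ Config n Ω)
    (hfin : ∀ ρ > 0, IntegrableOn (fun z => ‖grad u z‖ ^ 2) (perforated Ω x ρ)) :
    ∃ w, HasRenormalisedEnergy Ω x d u w := by
  have h1 : ∀ j, ∀ᶠ R in 𝓝[>] (0 : ℝ), Metric.closedBall (x j) R ⊆ Ω := fun j => by
    obtain ⟨ε, hε, hb⟩ := Metric.isOpen_iff.1 hΩ (x j) (hx.1 j)
    filter_upwards [Ioo_mem_nhdsGT hε] with r hr
    exact (Metric.closedBall_subset_ball hr.2).trans hb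
  have h2 : ∀ l j, ∀ᶠ R in 𝓝[>] (0 : ℝ), j ≠ l → 2 * R ≤ dist (x l) (x j) := fun l j => by
    by_cases hjl : j = l
    · exact Eventually.of_forall fun R h => (h hjl).elim
    · have hd : 0 < dist (x l) (x j) := dist_pos.2 fun he => hjl (hx.2 he).symm
      filter_upwards [Ioo_mem_nhdsGT (half_pos hd)] with R hR _
      linarith [hR.2]
  -- the balls of radius `R` around the singularities are disjoint and contained in `Ω`
  obtain ⟨R, ⟨hRΩ, hRd⟩, hR⟩ := (((eventually_all.2 h1).and
    (eventually_all.2 fun l => eventually_all.2 (h2 l))).and self_mem_nhdsWithin).exists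
  have hR : 0 < R := hR
  set g : ℂ → ℝ := fun z => gdot (current u z) (current u z) with hg
  set s : Fin n → ℂ → ℝ := fun j => (Metric.ball (x j) R).indicator fun z => (‖z - x j‖ ^ 2)⁻¹
    with hs
  set H : ℂ → ℝ := fun z => g z - ∑ j, (d j : ℝ) ^ 2 * s j z with hH
  have hgi : ∀ ρ > 0, IntegrableOn g (perforated Ω x ρ) := fun ρ hρ =>
    (hfin ρ hρ).congr (h.ae_norm_grad_sq_eq hΩ ρ)
  have hdisj : ∀ l j, j ≠ l → ∀ z ∈ Metric.ball (x l) R, z ∉ Metric.ball (x j) R :=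
    fun l j hjl z hz hz' => by
    have h3 := hRd l j hjl
    have h4 := dist_triangle_left (x l) (x j) z
    rw [Metric.mem_ball] at hz hz'
    linarith
  have hsm : ∀ j, Measurable (s j) := fun j =>
    Measurable.indicator (by fun_prop) measurableSet_ball
  have hgm : AEStronglyMeasurable g (volume.restrict Ω) :=
    aestronglyMeasurable_gdot hΩ (h.continuousOn_current hΩ) (h.continuousOn_current hΩ)
  have hHm : AEStronglyMeasurable H (volume.restrict Ω) :=
    hgm.sub (Finset.measurable_sum _ fun j _ => (hsm j).const_mul _).aestronglyMeasurable
  -- away from the singularities the energy density is integrable, and near each of them `H` is of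
  -- the order of the inverse of the distance
  have hHi : IntegrableOn H Ω := by
    have hsub : Ω ⊆ perforated Ω x R ∪ ⋃ j, Metric.ball (x j) R := fun z hz => by
      by_cases hzb : z ∈ ⋃ j, Metric.ball (x j) R
      · exact Or.inr hzb
      · exact Or.inl ⟨hz, hzb⟩
    refine IntegrableOn.mono_set (integrableOn_union.2 ⟨?_, ?_⟩) hsub
    · refine (hgi R hR).congr_fun (fun z hz => ?_) (isMeasurable_perforated hΩ x R)
      have : ∀ j, s j z = 0 := fun j =>
        indicator_of_notMem (fun hzj => hz.2 (mem_iUnion.2 ⟨j, hzj⟩)) _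
      simp [hH, this]
    · refine integrableOn_finite_iUnion.2 fun l => ?_
      have hbΩ : Metric.ball (x l) R ⊆ Ω := Metric.ball_subset_closedBall.trans (hRΩ l)
      obtain ⟨C, hC⟩ := h.abs_gdot_current_sub_le hΩ hR (hRΩ l) (hRd l)
      refine (((integrableOn_inv_norm (x l) R).const_mul C).add
        (integrableOn_const (C := C) measure_ball_lt_top.ne)).mono'
        (hHm.mono_measure (Measure.restrict_mono hbΩ le_rfl)) ?_
      filter_upwards [ae_restrict_mem measurableSet_ball,
        ae_restrict_of_ae (IsSingularWith.ae_notMem_range (x := x))] with z hz hz'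
      have e : ∑ j, (d j : ℝ) ^ 2 * s j z = (d l : ℝ) ^ 2 * (‖z - x l‖ ^ 2)⁻¹ := by
        rw [Finset.sum_eq_single l, hs]
        · simp only [indicator_of_mem hz]
        · intro j _ hj
          simp only [hs, indicator_of_notMem (hdisj l j hj z hz), mul_zero]
        · simp
      simp only [hH, e, Pi.add_apply]
      exact hC z hz (ne_of_notMem_range hz' l)
  have hann : ∀ j ρ, 0 < ρ → ρ ≤ R → perforated Ω x ρ ∩ Metric.ball (x j) R
      = Metric.ball (x j) R \ Metric.ball (x j) ρ := fun j ρ hρ hρR => by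
    ext z
    constructor
    · rintro ⟨hz, hz'⟩
      exact ⟨hz', fun hzρ => hz.2 (mem_iUnion.2 ⟨j, hzρ⟩)⟩
    · rintro ⟨hz, hz'⟩
      refine ⟨⟨hRΩ j (Metric.ball_subset_closedBall hz), fun hmem => ?_⟩, hz⟩
      obtain ⟨i, hi⟩ := mem_iUnion.1 hmem
      by_cases hij : i = j
      · exact hz' (hij ▸ hi)
      · exact hdisj j i hij z hz (Metric.ball_subset_ball hρR hi)
  have hsi : ∀ j ρ, 0 < ρ → IntegrableOn (s j) (perforated Ω x ρ) := fun j ρ hρ => by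
    have hb : IntegrableOn (fun _ => (ρ ^ 2)⁻¹) (Metric.ball (x j) R) :=
      integrableOn_const (measure_ball_lt_top (μ := volume)).ne
    refine ((integrable_indicator_iff measurableSet_ball).2 hb).integrableOn.mono'
      (hsm j).aestronglyMeasurable ((ae_restrict_iff' (isMeasurable_perforated hΩ x ρ)).2
        (Eventually.of_forall fun z hz => ?_))
    by_cases hzR : z ∈ Metric.ball (x j) R
    · simp only [hs, indicator_of_mem hzR]
      rw [Real.norm_of_nonneg (by positivity)]
      have : ρ ≤ ‖z - x j‖ := by
        rw [← dist_eq_norm]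
        exact not_lt.1 fun hlt => hz.2 (mem_iUnion.2 ⟨j, hlt⟩)
      exact inv_anti₀ (by positivity) (by gcongr)
    · simp only [hs, indicator_of_notMem hzR, norm_zero, le_refl]
  have hse : ∀ j ρ, 0 < ρ → ρ ≤ R → ∫ z in perforated Ω x ρ, s j z
      = 2 * Real.pi * (Real.log R - Real.log ρ) := fun j ρ hρ hρR => by
    simp only [hs]
    rw [setIntegral_indicator measurableSet_ball, hann j ρ hρ hρR, integral_annulus (x j) hρ hρR]
  have hE : ∀ ρ, 0 < ρ → ρ ≤ R → ∫ z in perforated Ω x ρ, ‖grad u z‖ ^ 2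
      = (∫ z in perforated Ω x ρ, H z)
        + ∑ j, (d j : ℝ) ^ 2 * (2 * Real.pi * (Real.log R - Real.log ρ)) := fun ρ hρ hρR => by
    have hsub : perforated Ω x ρ ⊆ Ω := sdiff_subset
    have i1 : ∀ j, Integrable (fun z => (d j : ℝ) ^ 2 * s j z)
      (volume.restrict (perforated Ω x ρ)) := fun j => (hsi j ρ hρ).const_mul _
    rw [integral_congr_ae (h.ae_norm_grad_sq_eq hΩ ρ)]
    have e : ∀ z, gdot (current u z) (current u z) = H z + ∑ j, (d j : ℝ) ^ 2 * s j z :=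
      fun z => by simp only [hH, hg]; ring
    simp_rw [e]
    rw [integral_add (hHi.mono_set hsub) (integrable_finsetSum _ fun j _ => i1 j),
      integral_finsetSum _ fun j _ => i1 j]
    congr 1
    refine Finset.sum_congr rfl fun j _ => ?_
    rw [integral_const_mul, hse j ρ hρ hρR]
  refine ⟨(∫ z in Ω, H z) + ∑ j, (d j : ℝ) ^ 2 * (2 * Real.pi * Real.log R), hfin, ?_⟩
  refine ((tendsto_integral_perforated hΩ x hHi).add_const _).congr' ?_
  filter_upwards [Ioo_mem_nhdsGT hR] with ρ hρ
  rw [hE ρ hρ.1 hρ.2.le, Finset.mul_sum, add_sub_assoc, ← Finset.sum_sub_distrib]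
  congr 1
  refine Finset.sum_congr rfl fun j _ => ?_
  rw [one_div, Real.log_inv]
  ring

end IsSingularWith


/-! ### The renormalised energy of the displaced maps -/

section

variable {n : ℕ} {Ω : Set ℂ} {x y : Fin n → ℂ} {d : Fin n → ℤ} {r : ℝ} {χ : Fin n → ℂ → ℝ}
  {u v U V : ℂ → ℂ} {φ : ℂ → ℂ} {ψ : ℂ → ℝ} (hΩ : IsOpen Ω) (h : IsSingularWith Ω x d u v)
  (hU : IsSingularWith Ω y d U V) (hχ : IsCutoffFamily Ω x r χ)
  (hD : IsCompactDiffeo Ω (fun z => z + shift χ (y - x) z) φ) (hψ : IsPhase Ω x y χ u U ψ)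

include hD hψ hχ in
/-- The Dirichlet form in moved coordinates evaluated on the current of `u` plus the gradient of the
phase is, up to the Jacobian, the Dirichlet form of the current of the displaced map. -/
lemma IsPhase.pullGdot_eq {z : ℂ} (hz : z ∈ Ω \ range x) (γ : ℂ →L[ℝ] ℝ) :
    pullGdot (ContinuousLinearMap.id ℝ ℂ + fderiv ℝ (shift χ (y - x)) z)
      (current u z + fderiv ℝ ψ z) (γ.comp (fderiv ℝ (fun z => z + shift χ (y - x) z) z))
      = jac (fderiv ℝ (fun z => z + shift χ (y - x) z) z)
        * gdot (current U (z + shift χ (y - x) z)) γ := by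
  rw [← fderiv_id_add ((hχ.contDiff_shift (y - x)).differentiable (by simp)) z,
    ← hψ.current_comp_eq z hz, pullGdot_comp (hD.jac_pos z).ne']

include hΩ hU hχ hD hψ in
/-- The Euler equation of the displaced map, in the original coordinates. -/
lemma IsPhase.integral_pullGdot {η : ℂ → ℝ} (hη : ContDiff ℝ 1 η) (hc : HasCompactSupport η)
    (hs : tsupport η ⊆ Ω) :
    ∫ z in Ω, pullGdot (ContinuousLinearMap.id ℝ ℂ + fderiv ℝ (shift χ (y - x)) z)
      (current u z + fderiv ℝ ψ z) (fderiv ℝ η z) = 0 := by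
  set ζ : ℂ → ℝ := fun w => η (φ w) with hζ
  have hζd : ContDiff ℝ 1 ζ := hη.comp (hD.smooth_inv.of_le (by exact ENat.LEInfty.out))
  have hζs : tsupport ζ ⊆ Ω := hD.symm.tsupport_comp_subset hs
  have hζc : HasCompactSupport ζ := hD.symm.hasCompactSupport_comp hc
  have h1 := hU.integral_gdot hΩ hζd hζc hζs
  rw [← setIntegral_eq_integral_of_forall_compl_eq_zero (s := Ω) fun z hz => ?_,
    hD.integral_comp hΩ.measurableSet] at h1
  · rw [← h1]
    refine integral_congr_ae ?_
    filter_upwards [ae_mem_diff hΩ.measurableSet x] with z hz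
    have e : fderiv ℝ η z = (fderiv ℝ ζ (z + shift χ (y - x) z)).comp
        (fderiv ℝ (fun z => z + shift χ (y - x) z) z) := by
      have h2 : η = ζ ∘ fun z => z + shift χ (y - x) z :=
        funext fun w => congrArg η (hD.left w).symm
      conv_lhs => rw [h2]
      exact (((hζd.differentiable (by simp)) _).hasFDerivAt.comp z (hD.hasFDerivAt z)).fderiv
    rw [e, hψ.pullGdot_eq hχ hD hz, smul_eq_mul]
  · rw [image_eq_zero_of_notMem_tsupport fun h' => hz (hζs (tsupport_fderiv_subset ℝ h')),
      gdot_zero_right]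

include hΩ h hU hχ hD hψ in
/-- Displacing the singularities changes the renormalised energy to second order only. -/
lemma IsPhase.exists_hasRenormalisedEnergy (hΩb : Bornology.IsBounded Ω) (hx : ∀ j, x j ∈ Ω)
    {w : ℝ} (hw : HasRenormalisedEnergy Ω x d u w) {m : ℝ}
    (hMm : ∀ z, ‖fderiv ℝ (shift χ (y - x)) z‖ ≤ m) (hm : m ≤ 1 / 44)
    (hs0 : ∫ z, stress (fderiv ℝ (shift χ (y - x)) z) (current u z) = 0) :
    ∃ w', HasRenormalisedEnergy Ω y d U w' ∧
      |w' - w| ≤ 50000 * m ^ 2 * ∫ z in perforated Ω x r, ‖current u z‖ ^ 2 := by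
  obtain ⟨hfin, hlim⟩ := hw
  have hXs := hχ.contDiff_shift (y - x)
  have hMc : Continuous (fderiv ℝ (shift χ (y - x))) := hXs.continuous_fderiv (by simp)
  have hs1 : ∫ z in Ω, stress (fderiv ℝ (shift χ (y - x)) z) (current u z) = 0 := by
    rw [setIntegral_eq_integral_of_forall_compl_eq_zero fun z hz => ?_, hs0]
    rw [image_eq_zero_of_notMem_tsupport fun h' =>
      hz (hχ.tsupport_shift_subset (y - x) (tsupport_fderiv_subset ℝ h')), stress_zero]
  have hsq : ∀ ρ > 0, IntegrableOn (fun z => ‖current u z‖ ^ 2) (perforated Ω x ρ) := fun ρ hρ =>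
    (h.memLp_current hΩ (hfin ρ hρ)).integrable_norm_pow (by norm_num)
  have ha0 : ∀ η : ℂ → ℝ, ContDiff ℝ 1 η → HasCompactSupport η → tsupport η ⊆ Ω →
      ∫ z in Ω, gdot (current u z) (fderiv ℝ η z) = 0 := fun η hη hc hs => by
    rw [setIntegral_eq_integral_of_forall_compl_eq_zero fun z hz => ?_,
      h.integral_gdot hΩ hη hc hs]
    rw [image_eq_zero_of_notMem_tsupport fun h' => hz (hs (tsupport_fderiv_subset ℝ h')),
      gdot_zero_right]
  obtain ⟨iF, hF⟩ := abs_integral_energy_sub_le hΩ hΩb hMc hMm hm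
    (fun l z hz => hχ.fderiv_shift_eq_zero (y - x) hz) (h.continuousOn_current hΩ)
    (h.integrableOn_current hΩ hΩb hx hfin) hψ.continuous hψ.eq_zero hψ.contDiffAt hx hsq ha0
    hχ.pos (fun η hη hc hs => hψ.integral_pullGdot hΩ hU hχ hD hη hc hs) hs1
  set F : ℂ → ℝ := fun z => pullGdot (ContinuousLinearMap.id ℝ ℂ + fderiv ℝ (shift χ (y - x)) z)
    (current u z + fderiv ℝ ψ z) (current u z + fderiv ℝ ψ z) - gdot (current u z) (current u z)
    with hFd
  have hgi : ∀ ρ > 0, IntegrableOn (fun z => gdot (current u z) (current u z))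
      (perforated Ω x ρ) := fun ρ hρ => (hfin ρ hρ).congr (h.ae_norm_grad_sq_eq hΩ ρ)
  have hsub : ∀ ρ, perforated Ω x ρ ⊆ Ω := fun ρ => sdiff_subset
  -- the energy density of the displaced map in the original coordinates
  have hae : ∀ ρ, (fun z => F z + gdot (current u z) (current u z))
      =ᵐ[volume.restrict (perforated Ω x ρ)]
      fun z => jac (fderiv ℝ (fun z => z + shift χ (y - x) z) z) •
        gdot (current U (z + shift χ (y - x) z)) (current U (z + shift χ (y - x) z)) := fun ρ => by
    filter_upwards [ae_restrict_of_ae_restrict_of_subset (hsub ρ)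
      (ae_mem_diff hΩ.measurableSet x)] with z hz
    rw [smul_eq_mul, ← hψ.pullGdot_eq hχ hD hz, hψ.current_comp_eq z hz]
    exact sub_add_cancel _ _
  have hUi : ∀ ρ, 0 < ρ → ρ ≤ r → IntegrableOn (fun z => ‖grad U z‖ ^ 2) (perforated Ω y ρ) :=
    fun ρ hρ hρr => by
    refine Integrable.congr (f := fun z => gdot (current U z) (current U z))
      (IntegrableOn.integrable ?_)
      ((hU.ae_norm_grad_sq_eq hΩ ρ).mono fun z hz => hz.symm)
    rw [← hχ.image_perforated hD hρr, hD.integrableOn_image (isMeasurable_perforated hΩ x ρ)]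
    exact ((iF.mono_set (hsub ρ)).add (hgi ρ hρ)).congr (hae ρ)
  -- the diffeomorphism maps the perforated domain of `x` onto that of `y`
  have hUe : ∀ ρ, 0 < ρ → ρ ≤ r → ∫ z in perforated Ω y ρ, ‖grad U z‖ ^ 2
      = (∫ z in perforated Ω x ρ, F z) + ∫ z in perforated Ω x ρ, ‖grad u z‖ ^ 2 :=
    fun ρ hρ hρr => by
    rw [integral_congr_ae (hU.ae_norm_grad_sq_eq hΩ ρ),
      integral_congr_ae (h.ae_norm_grad_sq_eq hΩ ρ), ← hχ.image_perforated hD hρr,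
      hD.integral_image (isMeasurable_perforated hΩ x ρ), ← integral_congr_ae (hae ρ),
      integral_add (iF.mono_set (hsub ρ)) (hgi ρ hρ)]
  refine ⟨(∫ z in Ω, F z) + w, ⟨fun ρ hρ => ?_, ?_⟩, by rwa [add_sub_cancel_right]⟩
  · rcases le_total ρ r with hρr | hρr
    · exact hUi ρ hρ hρr
    · exact (hUi r hχ.pos le_rfl).mono_set (perforated_subset_of_le hρr)
  · refine ((tendsto_integral_perforated hΩ x iF).add hlim).congr' ?_
    filter_upwards [Ioc_mem_nhdsGT hχ.pos] with ρ hρ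
    rw [hUe ρ hρ.1 hρ.2]
    ring

end

end CircleMaps

theorem mainTheorem2 (Ω : Set ℂ) (hΩ : IsSmoothBoundedDomain Ω)
    (n : ℕ) (xs : Fin n → ℂ) (hxs : xs ∈ Config n Ω) (d : Fin n → ℤ)
    -- the limiting singular harmonic map, continuous up to the boundary, of finite energy away
    -- from its singularities
    (us : ℂ → ℂ) (hus : IsSingularHarmonicMap Ω xs d us)
    (hus_cont : ContinuousOn us (closure Ω \ range xs))
    (hus_fin : ∀ ρ > 0, IntegrableOn (fun z => ‖grad us z‖ ^ 2) (perforated Ω xs ρ))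
    -- the continuous family of singular harmonic maps which defines the renormalised energy
    (q : ℝ≥0∞) (hq1 : 1 ≤ q) (hq2 : q < 2) (N : Set (Fin n → ℂ)) (uf : (Fin n → ℂ) → ℂ → ℂ)
    (huf : IsSingularHarmonicFamily Ω q xs d us N uf)
    -- the stationary maps, with their weak gradients
    (p : ℕ → ℝ) (hp1 : ∀ k, 1 < p k) (hp : Tendsto p atTop (𝓝 2))
    (u : ℕ → ℂ → ℂ) (G : ℕ → ℂ → Grad) (hu : ∀ k, IsStationaryPHarmonic Ω (p k) (u k) (G k))
    (hae : ∀ᵐ z ∂(volume.restrict Ω), Tendsto (fun k => u k z) atTop (𝓝 (us z)))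
    (hconv : ∀ K : Set ℂ, IsCompact K → K ⊆ Ω \ range xs →
      Tendsto (fun k => eLpNorm (fun z => (‖G k z‖ ^ (p k - 2))⁻¹ • G k z - grad us z) 2
        (volume.restrict K)) atTop (𝓝 0)) :
    ∃ W : (Fin n → ℂ) → ℝ,
      (∀ᶠ x in 𝓝 xs, HasRenormalisedEnergy Ω x d (uf x) (W x)) ∧
      HasFDerivAt W (0 : (Fin n → ℂ) →L[ℝ] ℝ) xs := by
  have hΩo := hΩ.isOpen
  obtain ⟨v, hv1, hv2⟩ := hus
  have h : IsSingularWith Ω xs d us v := ⟨hv1, hv2⟩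
  obtain ⟨r, χ, hχ⟩ := exists_isCutoffFamily hΩo hxs
  obtain ⟨B, hB, hb⟩ := hχ.exists_norm_fderiv_shift_le
  obtain ⟨w, hw⟩ := h.exists_hasRenormalisedEnergy hΩo hxs hus_fin
  set A : ℝ := ∫ z in perforated Ω xs r, ‖current us z‖ ^ 2 with hA
  -- the smallness required of the differential of the displacing diffeomorphism
  have hsmall : ∀ᶠ y in 𝓝 xs, B * ‖y - xs‖ ≤ 1 / 44 := by
    have hc : Continuous fun y : Fin n → ℂ => B * ‖y - xs‖ := by fun_prop
    filter_upwards [(hc.tendsto' xs 0 (by simp)).eventually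
      (gt_mem_nhds (by norm_num : (0 : ℝ) < 1 / 44))] with y hy using hy.le
  -- for nearby configurations the energy exists and differs from `w` to second order only
  have key : ∀ᶠ y in 𝓝 xs, ∃ w', HasRenormalisedEnergy Ω y d (uf y) w' ∧
      |w' - w| ≤ 50000 * B ^ 2 * A * ‖y - xs‖ ^ 2 := by
    filter_upwards [hsmall, hχ.eventually_isCompactDiffeo, huf.isOpen.mem_nhds huf.mem,
      eventually_exists_isPhase hΩ hxs h hus_cont hus_fin hq1 huf hχ]
      with y hy ⟨_, φ, hφ⟩ hyN ⟨ψ, hψ⟩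
    obtain ⟨V, hV1, hV2⟩ := huf.singularHarmonic y hyN
    obtain ⟨w', h1, h2⟩ := hψ.exists_hasRenormalisedEnergy hΩo h ⟨hV1, hV2⟩ hχ hφ hΩ.isBounded
      hxs.1 hw (hb (y - xs)) hy
      (integral_stress_eq_zero hΩo hΩ.isBounded hxs h hp1 hp hu hae hconv
        (hχ.contDiff_shift _) (hχ.hasCompactSupport_shift _) (hχ.tsupport_shift_subset _)
        hχ.pos fun l z hz => hχ.fderiv_shift_eq_zero _ hz)
    refine ⟨w', h1, h2.trans (le_of_eq ?_)⟩
    rw [← hA]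
    ring
  obtain ⟨W, hW⟩ : ∃ W : (Fin n → ℂ) → ℝ, ∀ y, (∃ w', HasRenormalisedEnergy Ω y d (uf y) w' ∧
      |w' - w| ≤ 50000 * B ^ 2 * A * ‖y - xs‖ ^ 2) → HasRenormalisedEnergy Ω y d (uf y) (W y) ∧
      |W y - w| ≤ 50000 * B ^ 2 * A * ‖y - xs‖ ^ 2 := by
    choose! W hW using fun y (hy : ∃ w', HasRenormalisedEnergy Ω y d (uf y) w' ∧
      |w' - w| ≤ 50000 * B ^ 2 * A * ‖y - xs‖ ^ 2) => hy
    exact ⟨W, hW⟩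
  refine ⟨W, key.mono fun y hy => (hW y hy).1, ?_⟩
  have hWx : W xs = w := by
    have := (hW xs key.self_of_nhds).2
    rw [sub_self, norm_zero] at this
    simpa [sub_eq_zero] using this
  -- a quadratic bound makes `W` differentiable with vanishing differential
  have hO : (fun y => W y - W xs) =O[𝓝 xs] fun y => ‖y - xs‖ ^ 2 := by
    refine Asymptotics.IsBigO.of_bound (50000 * B ^ 2 * A) ?_
    filter_upwards [key] with y hy
    rw [hWx, Real.norm_eq_abs, Real.norm_of_nonneg (by positivity)]
    exact (hW y hy).2
  refine .of_isLittleO ?_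
  simp only [zero_apply, sub_zero]
  exact hO.trans_isLittleO (Asymptotics.isLittleO_pow_sub_sub xs one_lt_two)
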